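/- Let $s,r\ge 0$ be integers with $s+r>0$. Let $C\ell_c$ be the Weyl algebra over $\mathbb C$ on generators $b_i$, $i\in\frac12+\mathbb Z$, with $b_ib_j-b_jb_i=(-1)^{i-\frac12}\delta_{i,-j}$, and let $F_c$ be the Weyl module: the left $C\ell_c$-module generated by a vector $|0\rangle$ subject to $b_j|0\rangle=0$ for $j>0$. Then $F_c$ is irreducible, and $C\ell_c$ admits an $(s,r)$-component relabeling, i.e. elements $b^{\pm a}_i$ ($1\le a\le s$) and $b^{c}_i$ ($s<c\le s+r$), $i\in\frac12+\mathbb Z$, that span the same space as the $b_i$, satisfy $$[b^{+a}_i,b^{-d}_j]=\delta_{ad}\delta_{i,-j},\quad [b^{\pm a}_i,b^{\pm d}_j]=0,\quad [b^c_i,b^e_j]=(-1)^{i-\frac12}\delta_{ce}\delta_{i,-j},\quad [b^{\pm a}_i,b^c_j]=0,$$ and annihilate $|0\rangle$ when the index $i$ is positive. For every such relabeling put $b^{\pm a}(z)=\sum_i b^{\pm a}_iz^{-i-\frac12}$, $b^{c}(z)=\sum_i b^{c}_iz^{-i-\frac12}$, and, with $:\ :$ the normal ordering that puts positive modes on the right,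 $$\sum_{k\in\mathbb Z}\alpha^a_kz^{-k-1}=\,:b^{+a}(z)b^{-a}(z):\ (a\le s),\qquad \sum_{k\ \mathrm{odd}}\alpha^c_kz^{-k-1}=\tfrac12:b^c(z)b^c(-z):\ (c>s),$$ $$E^a_\mp(z)=\exp\Big(-\sum_{\pm k<0}\frac{\alpha^a_k}{k}z^{-k}\Big),\qquad V^c_\mp(z)=\exp\Big(-2\sum_{\pm k<0,\ k\ \mathrm{odd}}\frac{\alpha^c_k}{k}z^{-k}\Big),$$ $$\Theta^{\pm a}(z)=\sum_{k\in\mathbb Z}\Theta^{\pm a}_kz^{-k-1}=E^a_-(z)^{\mp1}b^{\pm a}(z)z^{\mp\alpha^a_0}E^a_+(z)^{\mp1},\qquad \Theta^{c}(z)=\sum_{k\in\frac12+\mathbb Z}\theta^c_kz^{-k-\frac12}=V^c_-(z)^{-1}b^c(z)V^c_+(z)^{-1}.$$ On $F_c$ all these modes are locally finite sums of operators, and each $\alpha^a_0$ is diagonalizable with integral eigenvalues. Moreover the following holds. (1) For $a\le s<j$, $$b^{\pm a}(z)=E_-^a(z)^{\pm1}\Theta^{\pm a}(z)E_+^a(z)^{\pm1}z^{\pm\alpha_0^a},\qquad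 b^j(z)=V_-^j(z)\Theta^j(z)V_+^j(z),$$ $[\alpha^i_k,\Theta^{\pm a}(z)]=\mp\delta_{ia}\delta_{k0}\Theta^{\pm a}(z)$ and $[\alpha^i_k,\Theta^{j}(z)]=0$ for all $1\le i\le s+r$ ($k$ odd if $i>s$). (2) For $a,d\le s<i,j$, $$\Theta^{\pm a}_k\Theta^{\pm d}_\ell-(-1)^{\delta_{ad}}\Theta^{\pm d}_\ell\Theta^{\pm a}_k=0,\qquad \Theta^{+a}_k\Theta^{-d}_\ell-(-1)^{\delta_{ad}}\Theta^{-d}_\ell\Theta^{+a}_k=\delta_{ad}\delta_{k,-\ell}k,$$ $$\Theta^{\pm a}_k\theta^j_\ell-\theta^j_\ell\Theta^{\pm a}_k=0,\qquad \theta^i_k\theta^j_\ell-(-1)^{\delta_{ij}}\theta^j_\ell\theta^i_k=(-1)^{k-\frac12}\delta_{ij}\delta_{k,-\ell}2k.$$ (3) Let $\widehat F=F_c\otimes\mathbb C[q_1^{\pm1},\dots,q_s^{\pm1}]$ carry the operators $Q_a=q_a$, $\widehat\alpha^a_0=q_a\partial_{q_a}$, $\widehat\alpha^a_k=\alpha^a_k\otimes1$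 ($k\ne0$) and $\theta^{\pm a}(z)=\Theta^{\pm a}(z)\otimes1$. Then each $\widehat\alpha^a_0$ is diagonalizable with integral eigenvalues, $[\widehat\alpha^a_0,Q_d]=\delta_{ad}Q_d$, $[\widehat\alpha^a_k,\theta^{\pm d}(z)]=0$, and the modes of $\theta^{\pm a}(z)$ (together with $\theta^j_\ell\otimes 1$) satisfy the relations (2) involving $\Theta^{\pm a}$. There is an injective linear map $\iota:F_c\to\widehat F$ sending each $v$ with $\alpha^a_0v=m_av$ for all $a$ to $v\otimes q^m$; it intertwines $\alpha^a_k$ with $\widehat\alpha^a_k$, $\Theta^{\pm a}(z)$ with $Q_a^{\mp1}\theta^{\pm a}(z)$, and $b^{\pm a}(z)$ with $Q_a^{\mp1}z^{\pm\widehat\alpha_0^a}\widehat E_-^a(z)^{\pm1}\theta^{\pm a}(z)\widehat E_+^a(z)^{\pm1}$, where $\widehat E^a_\pm$ are formed from $\widehat\alpha^a_k$. (4) Let $C_{s,r}=\mathbb C[t^{(a)}_i,t^{(c)}_j,\xi^a_k,\xi^c_\ell\mid 1\le a\le s<c\le s+r,\ i\in\mathbb Z_{>0},\ j\in\mathbb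 Z_{odd>0},\ k\in\mathbb Z_{\ne0},\ \ell\in\frac12+\mathbb Z_{\ge0}]$, with commuting $t$'s and anticommuting $\xi$'s. For $1\le a\le s+r$ let $S_a$ be the algebra automorphism fixing the $t$'s with $S_a\xi^d=-\xi^d$ for $d<a$ and $S_a\xi^d=\xi^d$ for $d\ge a$. Let $T_a=-\sum_{k>0}\xi^a_k\partial_{\xi^a_k}+\sum_{k>0}\xi^a_{-k}\partial_{\xi^a_{-k}}$, a locally finite sum, diagonalizable with integral eigenvalues, and let $$\Xi^{\pm a}(z)=\mp\sum_{k\ge1}k\,\xi^a_{\pm k}z^{k-1}+\sum_{k\ge1}\partial_{\xi^a_{\mp k}}z^{-k-1},\qquad \Xi^c(z)=\sum_{i\in\frac12+\mathbb Z_{\ge0}}\Big((-1)^{i-\frac12}2i\,\xi^c_iz^{i-\frac12}+\partial_{\xi^c_i}z^{-i-\frac12}\Big).$$ There is a unique linear isomorphism $\sigma:F_c\to C_{s,r}$ with $\sigma|0\rangle=1$ and, for $a\le s<c$, $$\sigma\alpha^a_{-i}\sigma^{-1}=it^{(a)}_i,\quad \sigma\alpha^a_i\sigma^{-1}=-\partial_{t^{(a)}_i}\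 (i>0),\quad \sigma\alpha_0^a\sigma^{-1}=T_a,\quad \sigma\alpha^c_{-j}\sigma^{-1}=\tfrac12jt^{(c)}_j,\quad \sigma\alpha^c_j\sigma^{-1}=-\partial_{t^{(c)}_j}\ (j>0\text{ odd}),$$ $$\sigma\Theta^{\pm a}(z)\sigma^{-1}=\Xi^{\pm a}(z)S_a,\qquad \sigma\Theta^c(z)\sigma^{-1}=\Xi^c(z)S_c.$$ (5) Write $z\cdot t=\sum_{j\ge1}z^jt_j$, $z^{-1}\cdot\tilde\partial_t=\sum_{j\ge1}\frac{z^{-j}}j\partial_{t_j}$, and $z\circ t$, $z^{-1}\circ\tilde\partial_t$ for the same sums over odd $j$. Then for $a\le s<c$ $$\sigma b^{\pm a}(z)\sigma^{-1}=e^{\pm z\cdot t^{(a)}}\,\Xi^{\pm a}(z)\,z^{\pm T_a}\,e^{\pm z^{-1}\cdot\tilde\partial_{t^{(a)}}}S_a,\qquad \sigma b^c(z)\sigma^{-1}=e^{z\circ t^{(c)}}\,\Xi^c(z)\,e^{2z^{-1}\circ\tilde\partial_{t^{(c)}}}S_c.$$ (6) The generating fields of $c_\infty$ (normally ordered products of two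 fields) are as follows, where $i_{z,w}$ denotes expansion in the domain $|z|>|w|$. For $a\le d\le s$ and signs $\varepsilon,\eta=\pm1$, $$\sigma:b^{\varepsilon a}(z)b^{\eta d}(w):\sigma^{-1}=i_{z,w}(z-w)^{-\varepsilon\eta\delta_{ad}}e^{\varepsilon z\cdot t^{(a)}+\eta w\cdot t^{(d)}}\Xi^{\varepsilon a}(z)\Xi^{\eta d}(w)z^{\varepsilon T_a}w^{\eta T_d}e^{\varepsilon z^{-1}\cdot\tilde\partial_{t^{(a)}}+\eta w^{-1}\cdot\tilde\partial_{t^{(d)}}}S_aS_d-\varepsilon\,\delta_{ad}\delta_{\eta,-\varepsilon}\,i_{z,w}\frac1{z-w};$$ for $s<a\le c\le s+r$, $$\sigma:b^{a}(z)b^{c}(w):\sigma^{-1}=i_{z,w}\Big(\frac{z+w}{z-w}\Big)^{\delta_{ac}}e^{z\circ t^{(a)}+w\circ t^{(c)}}\,\Xi^{a}(z)\Xi^{c}(w)\,e^{2(z^{-1}\circ\tilde\partial_{t^{(a)}}+w^{-1}\circ\tilde\partial_{t^{(c)}})}S_aS_c-i_{z,w}\frac{\delta_{ac}}{z+w};$$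 and for $a\le s<c\le s+r$, $$\sigma:b^{\pm a}(z)b^{c}(w):\sigma^{-1}=e^{\pm z\cdot t^{(a)}+w\circ t^{(c)}}\,\Xi^{\pm a}(z)\Xi^{c}(w)\,z^{\pm T_a}\,e^{\pm z^{-1}\cdot\tilde\partial_{t^{(a)}}+2w^{-1}\circ\tilde\partial_{t^{(c)}}}S_aS_c.$$ All products of fields in (1), (3), (5), (6) are well defined: each coefficient is a locally finite sum of operators. -/

import Mathlib

open scoped TensorProduct

namespace SympBoson

noncomputable section

/-! ### Formal fields

A field on `M` is a formal series of operators.  `FDist ℤ M` holds the fields `∑ A n z ^ n` in one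
variable and `FDist (ℤ × ℤ) M` the fields `∑ A (m, n) z ^ m w ^ n` in two variables. -/

abbrev FDist (G M : Type*) [AddCommGroup M] [Module ℂ M] := G → Module.End ℂ M

section Fields

variable {M : Type*} [AddCommGroup M] [Module ℂ M]

/-- A family of operators is locally finite if on each vector all but finitely many vanish. -/
def LocFin {ι : Type*} (f : ι → Module.End ℂ M) : Prop :=
  ∀ v, (Function.support fun i => f i v).Finite

open Classical in
/-- The sum of a locally finite family of operators (zero if the family is not locally finite). -/
def locSum {ι : Type*} (f : ι → Module.End ℂ M) : Module.End ℂ M :=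
  if h : LocFin f then
    { toFun := fun v => ∑ᶠ i, f i v
      map_add' := fun v w => by
        simp only [map_add]
        exact finsum_add_distrib (h v) (h w)
      map_smul' := fun c v => by
        simp only [map_smul, RingHom.id_apply]
        exact (smul_finsum' c (h v)).symm }
  else 0

variable {G : Type*} [AddCommGroup G] [DecidableEq G]

/-- The field which is constant in the formal variables. -/
def constF (T : Module.End ℂ M) : FDist G M := fun n => if n = 0 then T else 0

/-- The product of two fields (Cauchy product). -/
def fmul (A B : FDist G M) : FDist G M := fun n => locSum fun i => A i * B (n - i)

/-- The product of a list of fields, evaluated from the right. -/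
def prodF : List (FDist G M) → FDist G M
  | [] => constF 1
  | A :: L => fmul A (prodF L)

/-- All the sums that occur in `prodF` are locally finite. -/
def ProdOK : List (FDist G M) → Prop
  | [] => True
  | A :: L => (∀ n, LocFin fun i => A i * prodF L (n - i)) ∧ ProdOK L

/-- The product of the list `L` is well defined and equals `B`. -/
def IsFieldProd (L : List (FDist G M)) (B : FDist G M) : Prop := ProdOK L ∧ prodF L = B

/-- A field in one variable as a field in the first of two variables. -/
def inZ (A : FDist ℤ M) : FDist (ℤ × ℤ) M := fun p => if p.2 = 0 then A p.1 else 0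

/-- A field in one variable as a field in the second of two variables. -/
def inW (A : FDist ℤ M) : FDist (ℤ × ℤ) M := fun p => if p.1 = 0 then A p.2 else 0

/-- A scalar formal series as a field. -/
def scalF (R : ℤ × ℤ → ℂ) : FDist (ℤ × ℤ) M := fun p => R p • 1

/-- The coefficient of `x ^ n` in `exp (∑_{j ≥ 1} A j x ^ j)`. -/
def expCoeff (A : ℕ → Module.End ℂ M) (n : ℕ) : Module.End ℂ M :=
  ∑ k ∈ Finset.range (n + 1), ((k.factorial : ℂ)⁻¹) •
    PowerSeries.coeff n ((PowerSeries.mk fun j => if j = 0 then 0 else A j) ^ k)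

/-- `exp (∑_{j ≥ 1} A j z ^ j)`. -/
def expUp (A : ℕ → Module.End ℂ M) : FDist ℤ M :=
  fun n => if 0 ≤ n then expCoeff A n.toNat else 0

/-- `exp (∑_{j ≥ 1} A j z ^ (-j))`. -/
def expDown (A : ℕ → Module.End ℂ M) : FDist ℤ M :=
  fun n => if n ≤ 0 then expCoeff A (-n).toNat else 0

/-- `P n` is the projection onto the eigenspace of `T` of eigenvalue `n`, and `M` is the direct sum
of these eigenspaces; that is, `∑ P n z ^ n` is the field `z ^ T`. -/
def IsZPow (T : Module.End ℂ M) (P : FDist ℤ M) : Prop :=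
  LocFin P ∧ locSum P = 1 ∧ ∀ n : ℤ, T * P n = (n : ℂ) • P n

open Classical in
/-- The field `z ^ T`, for an operator `T` that is diagonalizable with integral eigenvalues. -/
def zPow (T : Module.End ℂ M) : FDist ℤ M := if h : ∃ P, IsZPow T P then h.choose else 0

/-- `exp (- δ ∑_{k < 0} (α k / k) z ^ (-k))`. -/
def EMinus (α : ℤ → Module.End ℂ M) (δ : ℂ) : FDist ℤ M :=
  expUp fun j => -(δ / (-(j : ℂ))) • α (-(j : ℤ))

/-- `exp (- δ ∑_{k > 0} (α k / k) z ^ (-k))`. -/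
def EPlus (α : ℤ → Module.End ℂ M) (δ : ℂ) : FDist ℤ M :=
  expDown fun j => -(δ / (j : ℂ)) • α (j : ℤ)

/-- `exp (- 2 δ ∑_{k < 0, k odd} (α k / k) z ^ (-k))`. -/
def VMinus (α : ℤ → Module.End ℂ M) (δ : ℂ) : FDist ℤ M :=
  expUp fun j => if Odd j then -(2 * δ / (-(j : ℂ))) • α (-(j : ℤ)) else 0

/-- `exp (- 2 δ ∑_{k > 0, k odd} (α k / k) z ^ (-k))`. -/
def VPlus (α : ℤ → Module.End ℂ M) (δ : ℂ) : FDist ℤ M :=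
  expDown fun j => if Odd j then -(2 * δ / (j : ℂ)) • α (j : ℤ) else 0

end Fields

/-! ### Expansions of rational functions in the domain `|z| > |w|` -/

/-- `(z - w) ^ e = ∑_{n ≥ 0} (-1) ^ n (e choose n) z ^ (e - n) w ^ n`. -/
def zSubW (e : ℤ) : ℤ × ℤ → ℂ := fun p =>
  if 0 ≤ p.2 ∧ p.1 = e - p.2 then (-1) ^ p.2.toNat * ((Ring.choose e p.2.toNat : ℤ) : ℂ) else 0

/-- `1 / (z + w) = ∑_{n ≥ 0} (-1) ^ n z ^ (-1 - n) w ^ n`. -/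
def invZAddW : ℤ × ℤ → ℂ := fun p =>
  if 0 ≤ p.2 ∧ p.1 = -1 - p.2 then (-1) ^ p.2.toNat else 0

/-- `(z + w) / (z - w) = 1 + 2 ∑_{n ≥ 1} z ^ (-n) w ^ n`. -/
def zAddWDivZSubW : ℤ × ℤ → ℂ := fun p =>
  if p.1 = -p.2 then (if p.2 = 0 then 1 else if 0 < p.2 then 2 else 0) else 0

/-! ### The Weyl algebra and the Weyl module

Half-integers are indexed by integers: `n` stands for `n + 1/2`.  So `-n - 1` stands for the
negative of the half-integer of `n`, and a field `∑ b_i z ^ (-i - 1/2)`, `i ∈ 1/2 + ℤ`, has the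
coefficient `b (-n - 1)` at `z ^ n`. -/

/-- The relations `b_i b_j - b_j b_i = (-1) ^ (i - 1/2) δ_{i, -j}`, `i, j ∈ 1/2 + ℤ`. -/
inductive WeylRel : FreeAlgebra ℂ ℤ → FreeAlgebra ℂ ℤ → Prop
  | comm (i j : ℤ) : WeylRel
      (FreeAlgebra.ι ℂ i * FreeAlgebra.ι ℂ j - FreeAlgebra.ι ℂ j * FreeAlgebra.ι ℂ i)
      (algebraMap ℂ _ (if i + j + 1 = 0 then (-1) ^ i else 0))

/-- The Weyl algebra on the generators `b_i`, `i ∈ 1/2 + ℤ`. -/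
abbrev ClC : Type := RingQuot WeylRel

/-- The generators of the Weyl algebra. -/
def bGen (i : ℤ) : ClC := RingQuot.mkAlgHom ℂ WeylRel (FreeAlgebra.ι ℂ i)

/-- The Weyl module: it is generated by the vacuum subject to `b_j |0⟩ = 0`, `j > 0`. -/
abbrev Fc : Type := ClC ⧸ (Submodule.span ClC {x : ClC | ∃ j : ℤ, 0 ≤ j ∧ x = bGen j})

/-- The vacuum vector `|0⟩`. -/
def vac : Fc := Submodule.Quotient.mk 1

/-! ### Multicomponent generators -/

/-- The labels of the fields: `s` pairs of charged fields and `r` neutral fields. -/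
inductive FieldIdx (s r : ℕ)
  | ch (a : Fin s) (ε : ℤˣ) : FieldIdx s r
  | ne (c : Fin r) : FieldIdx s r

/-- The sign `±1` as a complex number. -/
def sg (ε : ℤˣ) : ℂ := ((ε : ℤ) : ℂ)

/-- The commutator of the modes `i` and `j` (half-integers) of two fields. -/
def commForm {s r : ℕ} : FieldIdx s r → FieldIdx s r → ℤ → ℤ → ℂ
  | .ch a ε, .ch c η, i, j => if a = c ∧ η = -ε ∧ i + j + 1 = 0 then sg ε else 0
  | .ne d, .ne e, i, j => if d = e ∧ i + j + 1 = 0 then (-1) ^ i else 0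
  | .ch _ _, .ne _, _, _ => 0
  | .ne _, .ch _ _, _, _ => 0

/-- An `(s, r)`-component relabeling of the Weyl algebra: a choice of new generators, spanning the
same space as the `b_i`, which satisfy the commutation relations of `s` pairs of charged and `r`
neutral symplectic bosons and whose positive modes annihilate the vacuum. -/
structure IsMulticomponent (s r : ℕ) (B : FieldIdx s r → ℤ → ClC) : Prop where
  span_eq : Submodule.span ℂ (Set.range fun p : FieldIdx s r × ℤ => B p.1 p.2) =
    Submodule.span ℂ (Set.range bGen)
  comm : ∀ x y i j, B x i * B y j - B y j * B x i = algebraMap ℂ ClC (commForm x y i j)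
  vac : ∀ x i, 0 ≤ i → B x i • vac = 0

section Multi

variable {s r : ℕ} (B : FieldIdx s r → ℤ → ClC)

/-- The action of the modes on the Weyl module. -/
def op (x : FieldIdx s r) (i : ℤ) : Module.End ℂ Fc := Algebra.lsmul ℂ ℂ Fc (B x i)

/-- The fields `b^{±a}(z)` and `b^c(z)`. -/
def bField (x : FieldIdx s r) : FDist ℤ Fc := fun n => op B x (-n - 1)

/-- The normally ordered product of two modes. -/
def normalOp (x : FieldIdx s r) (i : ℤ) (y : FieldIdx s r) (j : ℤ) : Module.End ℂ Fc :=
  if 0 ≤ i then op B y j * op B x i else op B x i * op B y j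

/-- The summands of `α^a_k`, the coefficient of `z ^ (-k - 1)` in `:b^{+a}(z) b^{-a}(z):`. -/
def alphaChTerm (a : Fin s) (k i : ℤ) : Module.End ℂ Fc :=
  normalOp B (.ch a 1) i (.ch a (-1)) (k - 1 - i)

def alphaCh (a : Fin s) (k : ℤ) : Module.End ℂ Fc := locSum (alphaChTerm B a k)

/-- The summands of `α^c_k`, the coefficient of `z ^ (-k - 1)` in `1/2 :b^c(z) b^c(-z):`. -/
def alphaNeTerm (c : Fin r) (k i : ℤ) : Module.End ℂ Fc :=
  ((1 / 2 : ℂ) * (-1) ^ (-(k - 1 - i) - 1)) • normalOp B (.ne c) i (.ne c) (k - 1 - i)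

def alphaNe (c : Fin r) (k : ℤ) : Module.End ℂ Fc := locSum (alphaNeTerm B c k)

/-- The factors of `Θ^{±a}(z) = E_-^a(z)^{∓1} b^{±a}(z) z^{∓α_0^a} E_+^a(z)^{∓1}`. -/
def thetaChFactors (a : Fin s) (ε : ℤˣ) : List (FDist ℤ Fc) :=
  [EMinus (alphaCh B a) (-sg ε), bField B (.ch a ε), zPow (-sg ε • alphaCh B a 0),
    EPlus (alphaCh B a) (-sg ε)]

def thetaCh (a : Fin s) (ε : ℤˣ) : FDist ℤ Fc := prodF (thetaChFactors B a ε)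

/-- The factors of `Θ^c(z) = V_-^c(z)^{-1} b^c(z) V_+^c(z)^{-1}`. -/
def thetaNeFactors (c : Fin r) : List (FDist ℤ Fc) :=
  [VMinus (alphaNe B c) (-1), bField B (.ne c), VPlus (alphaNe B c) (-1)]

def thetaNe (c : Fin r) : FDist ℤ Fc := prodF (thetaNeFactors B c)

end Multi

/-- The mode of index `k` of a field, that is, the coefficient of `z ^ (-k - 1)`; for a field with
half-integral modes this is the mode of index `k + 1/2`, the coefficient of
`z ^ (-(k + 1/2) - 1/2)`. -/
def mode {M : Type*} [AddCommGroup M] [Module ℂ M] (A : FDist ℤ M) (k : ℤ) : Module.End ℂ M :=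
  A (-k - 1)

/-! ### The extension of the Weyl module by the operators `Q_a`

The space `Fhat s` is `Fc ⊗ ℂ[q_1^{±1}, …, q_s^{±1}]`, with `v ⊗ q^m` written `single m v`. -/

abbrev Fhat (s : ℕ) : Type := (Fin s → ℤ) →₀ Fc

/-- The operator `f ⊗ 1`. -/
def ext {s : ℕ} (f : Module.End ℂ Fc) : Module.End ℂ (Fhat s) := Finsupp.mapRange.linearMap f

/-- The operator `Q_a ^ n`, multiplication by `q_a ^ n`. -/
def QPow {s : ℕ} (a : Fin s) (n : ℤ) : Module.End ℂ (Fhat s) :=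
  Finsupp.lmapDomain Fc ℂ fun m => m + Pi.single a n

/-- The Heisenberg operators on `Fhat s`: `α^a_0` is `q_a ∂ / ∂ q_a` and `α^a_k` is `α^a_k ⊗ 1` for
`k ≠ 0`. -/
def alphaHat {s r : ℕ} (B : FieldIdx s r → ℤ → ClC) (a : Fin s) (k : ℤ) :
    Module.End ℂ (Fhat s) :=
  if k = 0 then Finsupp.lsum ℂ fun m : Fin s → ℤ => ((m a : ℤ) : ℂ) • Finsupp.lsingle m
  else ext (alphaCh B a k)

/-- The field `θ^{±a}(z) = Q_a^{±1} Θ^{±a}(z)` on `Fhat s`. -/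
def thetaHat {s r : ℕ} (B : FieldIdx s r → ℤ → ClC) (a : Fin s) (ε : ℤˣ) : FDist ℤ (Fhat s) :=
  fun n => ext (thetaCh B a ε n)

/-- The embedding of `Fc` in `Fhat s`: a vector `v` with charges `α^a_0 v = m_a v` goes to
`v ⊗ q^m`. -/
def IsChargeEmbedding {s r : ℕ} (B : FieldIdx s r → ℤ → ClC) (ι : Fc →ₗ[ℂ] Fhat s) : Prop :=
  ∀ (m : Fin s → ℤ) (v : Fc), (∀ a, alphaCh B a 0 v = ((m a : ℤ) : ℂ) • v) →
    ι v = Finsupp.single m v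

/-! ### The space `C_{s,r}` -/

/-- The times `t^{(a)}_j`, `j > 0`, and `t^{(c)}_j`, `j > 0` odd. -/
abbrev TIdx (s r : ℕ) : Type := (Fin s × {j : ℕ // 0 < j}) ⊕ (Fin r × {j : ℕ // Odd j})

/-- The Grassmann variables `ξ^a_k`, `k ∈ ℤ`, `k ≠ 0`, and `ξ^c_{n + 1/2}`, `n ∈ ℕ`. -/
abbrev XiIdx (s r : ℕ) : Type := (Fin s × {k : ℤ // k ≠ 0}) ⊕ (Fin r × ℕ)

/-- The Grassmann algebra on the anticommuting variables. -/
abbrev Grass (s r : ℕ) : Type := ExteriorAlgebra ℂ (XiIdx s r →₀ ℂ)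

/-- The polynomial algebra in the commuting times and the anticommuting variables. -/
abbrev CSpace (s r : ℕ) : Type := MvPolynomial (TIdx s r) ℂ ⊗[ℂ] Grass s r

section Boson

variable {s r : ℕ}

/-- Multiplication by a time. -/
def mulT (i : TIdx s r) : Module.End ℂ (CSpace s r) :=
  LinearMap.rTensor _ (LinearMap.mulLeft ℂ (MvPolynomial.X i))

/-- Differentiation by a time. -/
def dT (i : TIdx s r) : Module.End ℂ (CSpace s r) :=
  LinearMap.rTensor _ (MvPolynomial.pderiv i).toLinearMap

/-- Left multiplication by a Grassmann variable. -/
def mulXi (i : XiIdx s r) : Module.End ℂ (CSpace s r) :=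
  LinearMap.lTensor _ (LinearMap.mulLeft ℂ (ExteriorAlgebra.ι ℂ (Finsupp.single i 1)))

/-- Left differentiation by a Grassmann variable. -/
def dXi (i : XiIdx s r) : Module.End ℂ (CSpace s r) :=
  LinearMap.lTensor _
    (CliffordAlgebra.contractLeft (Q := (0 : QuadraticForm ℂ (XiIdx s r →₀ ℂ))) (Finsupp.lapply i))

/-- `t^{(a)}_j` for a charged field, `j > 0`. -/
def mulTCh (a : Fin s) (j : ℕ) : Module.End ℂ (CSpace s r) :=
  if h : 0 < j then mulT (.inl (a, ⟨j, h⟩)) else 0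

def dTCh (a : Fin s) (j : ℕ) : Module.End ℂ (CSpace s r) :=
  if h : 0 < j then dT (.inl (a, ⟨j, h⟩)) else 0

open Classical in
/-- `t^{(c)}_j` for a neutral field, `j` odd. -/
def mulTNe (c : Fin r) (j : ℕ) : Module.End ℂ (CSpace s r) :=
  if h : Odd j then mulT (.inr (c, ⟨j, h⟩)) else 0

open Classical in
def dTNe (c : Fin r) (j : ℕ) : Module.End ℂ (CSpace s r) :=
  if h : Odd j then dT (.inr (c, ⟨j, h⟩)) else 0

/-- `ξ^a_k` for `k ≠ 0`. -/
def mulXiCh (a : Fin s) (k : ℤ) : Module.End ℂ (CSpace s r) :=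
  if h : k ≠ 0 then mulXi (.inl (a, ⟨k, h⟩)) else 0

/-- `∂ / ∂ ξ^a_k`; it is zero for `k = 0`, as there is no variable `ξ^a_0` in `C_{s,r}`. -/
def dXiCh (a : Fin s) (k : ℤ) : Module.End ℂ (CSpace s r) :=
  if h : k ≠ 0 then dXi (.inl (a, ⟨k, h⟩)) else 0

/-- The position of the component of a Grassmann variable in the order `1, …, s, s + 1, …, s + r`
(counted from zero). -/
def compXi : XiIdx s r → ℕ
  | .inl p => p.1
  | .inr p => s + p.1

/-- The operator `S_a` for the component in position `p`: the algebra automorphism with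
`ξ^b ↦ -ξ^b` for `b < a` and `ξ^b ↦ ξ^b` for `b ≥ a`. -/
def SOp (p : ℕ) : Module.End ℂ (CSpace s r) :=
  LinearMap.lTensor _ (ExteriorAlgebra.map (Finsupp.lsum ℂ fun i : XiIdx s r =>
    (if compXi i < p then (-1 : ℂ) else 1) • Finsupp.lsingle i)).toLinearMap

/-- The field `Ξ^{±a}(z)`. With `k = n + 1`, the coefficient at `z ^ n` is `∓ k ξ^a_{±k}` for `k > 0`
and `∂ / ∂ ξ^a_{±k}` for `k < 0`. -/
def XiCh (a : Fin s) (ε : ℤˣ) : FDist ℤ (CSpace s r) := fun n =>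
  if 0 < n + 1 then (-sg ε * ((n + 1 : ℤ) : ℂ)) • mulXiCh a (ε * (n + 1))
  else if n + 1 = 0 then sg ε • dXiCh a 0
  else dXiCh a (ε * (n + 1))

/-- The field `Ξ^c(z) = ∑_{i ∈ 1/2 + ℕ} ((-1) ^ (i - 1/2) 2 i ξ^c_i z ^ (i - 1/2) +
(∂ / ∂ ξ^c_i) z ^ (-i - 1/2))`. -/
def XiNe (c : Fin r) : FDist ℤ (CSpace s r) := fun n =>
  if 0 ≤ n then ((-1) ^ n * (2 * (n : ℂ) + 1)) • mulXi (.inr (c, n.toNat))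
  else dXi (.inr (c, (-n - 1).toNat))

/-- The summands `∓ ξ^a_k ∂ / ∂ ξ^a_k` of the operator `T_a`, with the sign `-` for `k > 0`. -/
def TTerm (a : Fin s) (k : ℤ) : Module.End ℂ (CSpace s r) :=
  (if 0 < k then (-1 : ℂ) else 1) • (mulXiCh a k * dXiCh a k)

def TOp (a : Fin s) : Module.End ℂ (CSpace s r) := locSum (TTerm a)

/-- `exp (± z · t^{(a)})`, respectively `exp (z ∘ t^{(c)})`. -/
def expT : FieldIdx s r → FDist ℤ (CSpace s r)
  | .ch a ε => expUp fun j => sg ε • mulTCh a j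
  | .ne c => expUp fun j => mulTNe c j

/-- `exp (± ∑_{j > 0} z ^ (-j) / j ∂ / ∂ t^{(a)}_j)`, respectively
`exp (2 ∑_{j > 0, j odd} z ^ (-j) / j ∂ / ∂ t^{(c)}_j)`. -/
def expD : FieldIdx s r → FDist ℤ (CSpace s r)
  | .ch a ε => expDown fun j => (sg ε / (j : ℂ)) • dTCh a j
  | .ne c => expDown fun j => (2 / (j : ℂ)) • dTNe c j

/-- The defining properties of the bosonization `σ : F_c → C_{s,r}`. -/
structure IsBosonization (B : FieldIdx s r → ℤ → ClC) (σ : Fc ≃ₗ[ℂ] CSpace s r) : Prop where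
  vac : σ vac = 1 ⊗ₜ 1
  alphaCh_neg : ∀ (a : Fin s) (j : ℕ), 0 < j →
    σ.conj (alphaCh B a (-(j : ℤ))) = (j : ℂ) • mulTCh a j
  alphaCh_pos : ∀ (a : Fin s) (j : ℕ), 0 < j → σ.conj (alphaCh B a (j : ℤ)) = -dTCh a j
  alphaCh_zero : ∀ a : Fin s, σ.conj (alphaCh B a 0) = TOp a
  alphaNe_neg : ∀ (c : Fin r) (j : ℕ), Odd j →
    σ.conj (alphaNe B c (-(j : ℤ))) = ((j : ℂ) / 2) • mulTNe c j
  alphaNe_pos : ∀ (c : Fin r) (j : ℕ), Odd j → σ.conj (alphaNe B c (j : ℤ)) = -dTNe c j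
  thetaCh : ∀ (a : Fin s) (ε : ℤˣ) (n : ℤ),
    σ.conj (thetaCh B a ε n) = XiCh a ε n * SOp (a : ℕ)
  thetaNe : ∀ (c : Fin r) (n : ℤ), σ.conj (thetaNe B c n) = XiNe c n * SOp (s + (c : ℕ))

/-- The field `:b^x(z) b^y(w):`, carried to `C_{s,r}` by `σ`. -/
def cField (B : FieldIdx s r → ℤ → ClC) (σ : Fc ≃ₗ[ℂ] CSpace s r) (x y : FieldIdx s r) :
    FDist (ℤ × ℤ) (CSpace s r) :=
  fun p => σ.conj (normalOp B x (-p.1 - 1) y (-p.2 - 1))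

end Boson

end

end SympBoson

open SympBoson

/-! The isomorphism `σ` is built in reverse: the vertex operators expected for the fields `b` are
written down on `C_{s,r}`, and `σ` is derived from them. The operator `vF x` is the product of a
raising exponential in the times, of `Ξ S z^T`, and of a lowering exponential in the derivatives.
Once its modes satisfy the relations of the symplectic bosons (`vF_comm`) and the positive ones kill
`1` (`vF_one`), the universal properties of the Weyl algebra and of the Weyl module give a linear
map `φ` from `F_c` that sends the vacuum to `1` and `b^x(z)` to the vertex operator of `x`
(`exists_fc_map`). It is injective because `F_c` is irreducible (`fc_simple`): an invariant
subspace, pulled back to polynomials in the creation operators, is closed under partial derivatives,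
hence is zero or contains `1` (`one_mem_of_pderiv_closed`).

Commutation relations: fields of different components commute factor by factor, the signs `S`
turning anticommuting `Ξ` into commuting ones. Within a component, the bracket of a time, or of a
derivative by a time, with the defect of a relation (`vDefect`) is a combination of other defects.
Multiplication by times reduces the claim to time-free vectors. On such a vector the values of the
defects span a space closed under derivatives, which is zero as soon as all its elements vanish at
time zero. At time zero the outer exponentials disappear, and moving the lowering exponential of one
field past the raising one of the other leaves a scalar kernel: the expansion of `(1 - x)^(-εη)` for
charged fields and of `(1 + x)/(1 - x)` for neutral ones. The remaining identity concerns only the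
anticommuting modes of `Ξ S`. It follows from antisymmetry for a field and itself
(`anticomm_relation_self`), and by regrouping four products for opposite charges
(`anticomm_relation_opposite`).

Currents: a mode `α_k` and the Heisenberg operator `heis` have the same brackets with the fields, so
they correspond as soon as they do on the vacuum. For negative `k` the difference of the two vectors
is killed by all nonnegative Heisenberg modes and by all positive modes of the fields. This makes it
a multiple of `1` (`eq_smul_one_of_vF`), and its constant term is zero. The range of `φ` is then
stable under the Heisenberg operators, under their exponentials and `z^T`, and, solving the vertex
operator for its middle factor (`isFieldProd_psi`), under `Ξ S`. These generate `C_{s,r}` from `1`,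
so `φ` is onto.

The rest is transport. The fields `Θ` correspond to `Ξ S`, whose relations are those of derivatives
and Grassmann variables; `σ` is unique because times and `Ξ S` generate. A normally ordered product
differs from the product of the fields by a scalar contraction, and the product of two vertex
operators is put in order by moving the first lowering exponential past the second raising one and
`z^T` past the second `Ξ`; the two resulting scalars combine to `(z - w)^(-εη)` or `(z + w)/(z -
w)`. The statement with the operators `Q_a` is checked on vectors of definite charge, which span
`F_c`. -/

namespace SympBoson

noncomputable section

open Finset.HasAntidiagonal

/-! ### Locally finite families of operators -/

section LocallyFinite

variable {M : Type*} [AddCommGroup M] [Module ℂ M] {ι κ : Type*}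

theorem locSum_apply {f : ι → Module.End ℂ M} (h : LocFin f) (v : M) :
    locSum f v = ∑ᶠ i, f i v := by
  simp [locSum, h]

theorem LocFin.mono {f : ι → Module.End ℂ M} {g : ι → Module.End ℂ M} (h : LocFin f)
    (hfg : ∀ v i, f i v = 0 → g i v = 0) : LocFin g := fun v =>
  (h v).subset fun i hi h0 => hi (hfg v i h0)

theorem locFin_comp_equiv (e : ι ≃ κ) {f : κ → Module.End ℂ M} :
    LocFin (fun i => f (e i)) ↔ LocFin f := by
  refine forall_congr' fun v => ?_
  have : Function.support (fun i => f (e i) v) = e ⁻¹' Function.support fun k => f k v := rfl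
  rw [this]
  exact ⟨fun h => by simpa using h.image e, fun h => h.preimage e.injective.injOn⟩

/-- Reindexing preserves local finiteness, and a family that is not locally finite has the default
sum `0` on both sides; so no finiteness assumption is needed. -/
theorem locSum_comp_equiv (e : ι ≃ κ) (f : κ → Module.End ℂ M) :
    locSum (fun i => f (e i)) = locSum f := by
  by_cases h : LocFin f
  · ext v
    rw [locSum_apply h, locSum_apply ((locFin_comp_equiv e).2 h)]
    exact finsum_comp_equiv e (f := fun k => f k v)
  · rw [locSum, dif_neg (fun h' => h ((locFin_comp_equiv e).1 h')), locSum, dif_neg h]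

/-- Local finiteness only has to be checked on a spanning set. -/
theorem locFin_of_span {f : ι → Module.End ℂ M} {s : Set M} (hs : Submodule.span ℂ s = ⊤)
    (h : ∀ v ∈ s, (Function.support fun i => f i v).Finite) : LocFin f := fun v => by
  have hv : v ∈ Submodule.span ℂ s := hs ▸ Submodule.mem_top
  induction hv using Submodule.span_induction with
  | mem x hx => exact h x hx
  | zero => simp
  | add x y _ _ hx hy =>
    refine (hx.union hy).subset fun i hi => ?_
    by_contra hc
    simp only [Set.mem_union, Function.mem_support, not_or, not_not] at hc
    exact hi (by simp [hc.1, hc.2])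
  | smul c x _ hx =>
    refine hx.subset fun i hi h0 => hi ?_
    simp [h0]

theorem locFin_single [DecidableEq ι] (i : ι) (T : ι → Module.End ℂ M)
    (h : ∀ j, j ≠ i → T j = 0) : LocFin T := fun v =>
  (Set.finite_singleton i).subset fun j hj => by
    by_contra hne
    exact hj (by simp [h j hne])

theorem locSum_single (i : ι) (T : ι → Module.End ℂ M)
    (h : ∀ j, j ≠ i → T j = 0) : locSum T = T i := by
  classical
  ext v
  rw [locSum_apply (locFin_single i T h)]
  exact finsum_eq_single _ i fun j hj => by simp [h j hj]

/-- A locally finite sum of operators preserving a subspace preserves it. -/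
theorem locSum_mem {f : ι → Module.End ℂ M} {W : Submodule ℂ M} {v : M}
    (h : ∀ i, f i v ∈ W) : locSum f v ∈ W := by
  by_cases hf : LocFin f
  · rw [locSum_apply hf]
    exact finsum_induction (· ∈ W) W.zero_mem (fun _ _ hx hy => W.add_mem hx hy) h
  · simp [locSum, hf]

end LocallyFinite

/-! ### Products of fields: well-definedness and associativity -/

section Products

variable {M : Type*} [AddCommGroup M] [Module ℂ M]
variable {G : Type*} [AddCommGroup G]

/-- The product of the fields `A` and `B` is well defined. -/
def MulOK (A B : FDist G M) : Prop := ∀ n, LocFin fun i => A i * B (n - i)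

theorem fmul_apply {A B : FDist G M} (h : MulOK A B) (n : G) (v : M) :
    fmul A B n v = ∑ᶠ i, A i (B (n - i) v) := by
  rw [fmul, locSum_apply (h n)]; rfl

theorem fmul_mem {A B : FDist G M} {W : Submodule ℂ M} (hA : ∀ n, ∀ v ∈ W, A n v ∈ W)
    (hB : ∀ n, ∀ v ∈ W, B n v ∈ W) (n : G) (v : M) (hv : v ∈ W) : fmul A B n v ∈ W :=
  locSum_mem fun i => hA _ _ (hB _ _ hv)

/-- On a vector only finitely many coefficients of the right factor survive, whatever the left
factor is. This covers `z^T`, lowering exponentials and constants as right factors. -/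
theorem mulOK_of_locFin (A : FDist G M) {B : FDist G M} (hB : LocFin B) : MulOK A B := fun n =>
  ((locFin_comp_equiv (Equiv.subLeft n)).2 hB).mono fun v i hi => by
    simp only [Equiv.subLeft_apply] at hi
    simp [hi]

/-- The reflection `i ↦ n - i` exchanges the two Cauchy sums; default values agree, so the products
need not be well defined. -/
theorem fmul_comm_of {A B : FDist G M} (h : ∀ i j, A i * B j = B j * A i) :
    fmul A B = fmul B A := by
  funext n
  rw [fmul, fmul, ← locSum_comp_equiv (Equiv.subLeft n)]
  congr 1
  funext i
  simp [h]

/-- Associativity of the product of fields. -/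
theorem fmul_assoc_of {A B C : FDist G M} (hAB : MulOK A B) (hBC : MulOK B C)
    (hJ : ∀ v n, (Function.support fun p : G × G =>
      A p.1 (B p.2 (C (n - p.1 - p.2) v))).Finite) :
    MulOK (fmul A B) C ∧ MulOK A (fmul B C) ∧
      fmul (fmul A B) C = fmul A (fmul B C) := by
  have key1 : ∀ n i v, A i (fmul B C (n - i) v) = ∑ᶠ j, A i (B j (C (n - i - j) v)) := by
    intro n i v
    rw [fmul_apply hBC, map_finsum]
    exact hBC (n - i) v
  have key2 : ∀ n k v, fmul A B k (C (n - k) v) = ∑ᶠ i, A i (B (k - i) (C (n - k) v)) := by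
    intro n k v
    rw [fmul_apply hAB]
  -- The pair (total exponent of `A B`, exponent of `A`), by which the left bracketing sums, is
  -- matched with (exponent of `A`, exponent of `B`), by which the right bracketing sums.
  let e : G × G ≃ G × G :=
    { toFun := fun p => (p.2, p.1 - p.2)
      invFun := fun q => (q.1 + q.2, q.1)
      left_inv := fun p => by simp
      right_inv := fun q => by simp }
  have hJ' : ∀ v n, (Function.support fun p : G × G =>
      A p.2 (B (p.1 - p.2) (C (n - p.1) v))).Finite := by
    intro v n
    have := (hJ v n).preimage (e.injective.injOn)
    refine this.subset fun p hp => ?_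
    simp only [Function.mem_support, Set.mem_preimage, e, Equiv.coe_fn_mk] at hp ⊢
    rwa [show n - p.2 - (p.1 - p.2) = n - p.1 by abel]
  have h1 : MulOK (fmul A B) C := by
    intro n v
    refine ((hJ' v n).image Prod.fst).subset fun k hk => ?_
    by_contra hc
    refine hk ?_
    simp only [Module.End.mul_apply]
    rw [key2]
    refine finsum_eq_zero_of_forall_eq_zero fun i => ?_
    by_contra h0
    exact hc ⟨(k, i), h0, rfl⟩
  have h2 : MulOK A (fmul B C) := by
    intro n v
    refine ((hJ v n).image Prod.fst).subset fun k hk => ?_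
    by_contra hc
    refine hk ?_
    simp only [Module.End.mul_apply]
    rw [key1]
    refine finsum_eq_zero_of_forall_eq_zero fun i => ?_
    by_contra h0
    exact hc ⟨(k, i), h0, rfl⟩
  refine ⟨h1, h2, ?_⟩
  funext n
  ext v
  rw [fmul_apply h1, fmul_apply h2]
  simp only [key1, key2]
  rw [← finsum_curry _ (hJ v n), ← finsum_curry _ (hJ' v n),
    ← finsum_comp_equiv e (f := fun p : G × G => A p.1 (B p.2 (C (n - p.1 - p.2) v)))]
  refine finsum_congr fun p => ?_
  simp only [e, Equiv.coe_fn_mk]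
  rw [show n - p.2 - (p.1 - p.2) = n - p.1 by abel]

/-- The exponents that can occur on `v` are sums `i + j`, with `j` among the finitely many exponents
of `B` on `v` and `i` among those of `A` on `B j v`. -/
theorem locFin_fmul {A B : FDist G M} (hA : LocFin A) (hB : LocFin B) : LocFin (fmul A B) := by
  classical
  intro v
  have hB' := hB v
  have : (⋃ j ∈ Function.support (fun j => B j v),
      (fun i => i + j) '' Function.support fun i => A i (B j v)).Finite :=
    hB'.biUnion fun j _ => (hA _).image _
  refine this.subset fun n hn => ?_
  by_contra hc
  refine hn ?_
  simp only
  rw [fmul_apply (mulOK_of_locFin A hB)]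
  refine finsum_eq_zero_of_forall_eq_zero fun i => ?_
  by_contra h0
  refine hc ?_
  simp only [Set.mem_iUnion]
  refine ⟨n - i, fun h => h0 (by simp only at h; simp [h]), i, h0, by simp⟩

/-- Associativity when the two factors on the right are locally finite. -/
theorem fmul_assoc_locFin (A : FDist G M) {B C : FDist G M} (hB : LocFin B) (hC : LocFin C) :
    fmul (fmul A B) C = fmul A (fmul B C) := by
  refine (fmul_assoc_of (mulOK_of_locFin A hB) (mulOK_of_locFin B hC) fun v n => ?_).2.2
  have : (⋃ j ∈ Function.support (fun j => C j v),
      (fun i => (n - i - j, i)) '' Function.support fun i => B i (C j v)).Finite :=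
    (hC v).biUnion fun j _ => (hB _).image _
  refine this.subset fun p hp => ?_
  simp only [Set.mem_iUnion]
  refine ⟨n - p.1 - p.2, fun h => hp (by simp only at h; simp [h]), p.2,
    fun h => hp (by simp only at h; simp [h]), ?_⟩
  ext <;> simp

variable [DecidableEq G]

theorem mulOK_constF_left (T : Module.End ℂ M) (A : FDist G M) : MulOK (constF T) A := fun n =>
  locFin_single 0 _ fun j hj => by simp [constF, hj]

theorem fmul_constF_left (T : Module.End ℂ M) (A : FDist G M) (n : G) :
    fmul (constF T) A n = T * A n := by
  rw [fmul, locSum_single 0 _ fun j hj => by simp [constF, hj]]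
  simp [constF]

theorem fmul_constF_one (A : FDist G M) : fmul (constF 1) A = A := by
  funext n; simp [fmul_constF_left]

theorem mulOK_constF_right (T : Module.End ℂ M) (A : FDist G M) : MulOK A (constF T) := fun n =>
  locFin_single n _ fun j hj => by simp [constF, sub_eq_zero, Ne.symm hj]

theorem fmul_constF_right (T : Module.End ℂ M) (A : FDist G M) (n : G) :
    fmul A (constF T) n = A n * T := by
  rw [fmul, locSum_single n _ fun j hj => by simp [constF, sub_eq_zero, Ne.symm hj]]
  simp [constF]

theorem locFin_constF (T : Module.End ℂ M) : LocFin (constF T : FDist G M) :=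
  locFin_single 0 _ fun j hj => by simp [constF, hj]

theorem prodF_cons (A : FDist G M) (L : List (FDist G M)) : prodF (A :: L) = fmul A (prodF L) := rfl

theorem prodF_singleton (A : FDist G M) : prodF [A] = A := by
  funext n; simp [prodF, fmul_constF_right]

theorem prodOK_cons {A : FDist G M} {L : List (FDist G M)} :
    ProdOK (A :: L) ↔ MulOK A (prodF L) ∧ ProdOK L := Iff.rfl

theorem prodOK_singleton (A : FDist G M) : ProdOK [A] :=
  prodOK_cons.2 ⟨mulOK_constF_right 1 A, trivial⟩

theorem IsFieldProd.singleton (A : FDist G M) : IsFieldProd [A] A :=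
  ⟨prodOK_singleton A, prodF_singleton A⟩

theorem IsFieldProd.cons {A B C : FDist G M} {L : List (FDist G M)} (hL : IsFieldProd L B)
    (hA : MulOK A B) (h : fmul A B = C) : IsFieldProd (A :: L) C :=
  ⟨prodOK_cons.2 ⟨by rw [hL.2]; exact hA, hL.1⟩, by rw [prodF_cons, hL.2, h]⟩

theorem prodF_mem {W : Submodule ℂ M} {L : List (FDist G M)}
    (hL : ∀ A ∈ L, ∀ n, ∀ v ∈ W, A n v ∈ W) : ∀ n, ∀ v ∈ W, prodF L n v ∈ W := by
  induction L with
  | nil =>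
    intro n v hv
    by_cases h : n = 0 <;> simp [prodF, constF, h, hv]
  | cons A L ih =>
    exact fmul_mem (hL A (by simp)) (ih fun B hB => hL B (by simp [hB]))

end Products

/-! ### Transport of fields along a linear isomorphism -/

section Conj

variable {M N : Type*} [AddCommGroup M] [Module ℂ M] [AddCommGroup N] [Module ℂ N] (e : M ≃ₗ[ℂ] N)

theorem conj_mul' (f g : Module.End ℂ M) : e.conj (f * g) = e.conj f * e.conj g := by
  ext v; simp [LinearEquiv.conj_apply]

theorem conj_one' : e.conj (1 : Module.End ℂ M) = 1 := by
  ext v; simp [LinearEquiv.conj_apply]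

theorem locFin_conj {ι : Type*} {f : ι → Module.End ℂ M} :
    LocFin (fun i => e.conj (f i)) ↔ LocFin f := by
  constructor
  · intro h v
    refine (h (e v)).subset fun i hi h0 => hi ?_
    simpa [LinearEquiv.conj_apply] using h0
  · intro h v
    refine (h (e.symm v)).subset fun i hi h0 => hi ?_
    simpa [LinearEquiv.conj_apply] using h0

theorem locSum_conj {ι : Type*} (f : ι → Module.End ℂ M) :
    locSum (fun i => e.conj (f i)) = e.conj (locSum f) := by
  by_cases h : LocFin f
  · ext v
    rw [locSum_apply ((locFin_conj e).2 h)]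
    simp only [LinearEquiv.conj_apply_apply, locSum_apply h]
    exact (map_finsum e (h (e.symm v))).symm
  · rw [locSum, dif_neg fun h' => h ((locFin_conj e).1 h'), locSum, dif_neg h, map_zero]

/-- A field transported along a linear equivalence. -/
def conjF {G : Type*} (A : FDist G M) : FDist G N := fun n => e.conj (A n)

variable {G : Type*} [AddCommGroup G]

theorem mulOK_conjF {A B : FDist G M} : MulOK (conjF e A) (conjF e B) ↔ MulOK A B := by
  refine forall_congr' fun n => ?_
  simp only [conjF, ← conj_mul']
  exact locFin_conj e

theorem fmul_conjF (A B : FDist G M) : fmul (conjF e A) (conjF e B) = conjF e (fmul A B) := by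
  funext n
  simp only [fmul, conjF, ← conj_mul']
  exact locSum_conj e _

variable [DecidableEq G]

theorem prodF_conjF (L : List (FDist G M)) : prodF (L.map (conjF e)) = conjF e (prodF L) := by
  induction L with
  | nil =>
    funext n
    by_cases h : n = 0 <;> simp [prodF, conjF, constF, h, conj_one']
  | cons A L ih => rw [List.map_cons, prodF_cons, ih, fmul_conjF, prodF_cons]

theorem prodOK_conjF {L : List (FDist G M)} : ProdOK (L.map (conjF e)) ↔ ProdOK L := by
  induction L with
  | nil => simp [ProdOK]
  | cons A L ih => rw [List.map_cons, prodOK_cons, prodOK_cons, ih, prodF_conjF, mulOK_conjF]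

theorem conjF_injective : Function.Injective (conjF (G := G) e) := fun A B h => by
  funext n
  exact e.conj.injective (congrFun h n)

/-- Both well-definedness and value are invariant under conjugation, so an identity of fields on the
Weyl module may be checked on `C_{s,r}`. -/
theorem isFieldProd_conjF {L : List (FDist G M)} {B : FDist G M} :
    IsFieldProd (L.map (conjF e)) (conjF e B) ↔ IsFieldProd L B := by
  rw [IsFieldProd, IsFieldProd, prodOK_conjF, prodF_conjF, (conjF_injective e).eq_iff]

end Conj

/-! ### Fields with exponents bounded below -/

section Laurent

variable {M : Type*} [AddCommGroup M] [Module ℂ M]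

/-- The field has no negative powers of `z`. -/
def UpF (A : FDist ℤ M) : Prop := ∀ n < 0, A n = 0

/-- On each vector the powers of `z` are bounded below. -/
def LaurF (A : FDist ℤ M) : Prop := ∀ v, ∃ N : ℤ, ∀ n < N, A n v = 0

/-- The exponent of `A` is bounded below by zero and, because that of `B` is bounded below on `v`,
also bounded above. -/
theorem mulOK_up_laur {A B : FDist ℤ M} (hA : UpF A) (hB : LaurF B) : MulOK A B := fun n v => by
  obtain ⟨N, hN⟩ := hB v
  refine (Set.finite_Icc 0 (n - N)).subset fun i hi => ?_
  by_contra hc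
  refine hi ?_
  simp only [Module.End.mul_apply]
  by_cases h : i < 0
  · simp [hA i h]
  · rw [hN (n - i) (by simp only [Set.mem_Icc] at hc; omega), map_zero]

theorem laurF_fmul_up {A B : FDist ℤ M} (hA : UpF A) (hB : LaurF B) : LaurF (fmul A B) := by
  intro v
  obtain ⟨N, hN⟩ := hB v
  refine ⟨N, fun n hn => ?_⟩
  rw [fmul_apply (mulOK_up_laur hA hB)]
  refine finsum_eq_zero_of_forall_eq_zero fun i => ?_
  by_cases h : i < 0
  · simp [hA i h]
  · rw [hN (n - i) (by omega), map_zero]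

/-- Only finitely many vectors `B j v` are nonzero, so the lower bounds of `A` on them, shifted by
`j`, have a minimum. -/
theorem laurF_fmul_locFin {A B : FDist ℤ M} (hA : LaurF A) (hB : LocFin B) : LaurF (fmul A B) := by
  intro v
  choose N hN using hA
  have hs := hB v
  obtain ⟨m, hm⟩ := (hs.image fun j => N (B j v) + j).bddBelow
  refine ⟨m, fun n hn => ?_⟩
  rw [fmul_apply (mulOK_of_locFin A hB)]
  refine finsum_eq_zero_of_forall_eq_zero fun i => ?_
  by_cases h : B (n - i) v = 0
  · simp [h]
  · refine hN _ _ ?_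
    have := hm ⟨n - i, h, rfl⟩
    simp only at this
    omega

theorem upF_fmul {A B : FDist ℤ M} (hA : UpF A) (hB : UpF B) : UpF (fmul A B) := by
  intro n hn
  have : (fun i => A i * B (n - i)) = fun _ => 0 := by
    funext i
    by_cases h : i < 0
    · simp [hA i h]
    · rw [hB (n - i) (by omega), mul_zero]
  rw [fmul, this, locSum_single (0 : ℤ) _ fun _ _ => rfl]

theorem UpF.laurF {A : FDist ℤ M} (hA : UpF A) : LaurF A := fun v => ⟨0, fun n hn => by simp [hA n hn]⟩

/-- Associativity when the left factor has no negative powers and the right one is locally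
finite. -/
theorem fmul_assoc_up_locFin {A B C : FDist ℤ M} (hA : UpF A) (hB : LaurF B) (hC : LocFin C) :
    fmul (fmul A B) C = fmul A (fmul B C) := by
  refine (fmul_assoc_of (mulOK_up_laur hA hB) (mulOK_of_locFin B hC) fun v n => ?_).2.2
  have : (⋃ j ∈ Function.support (fun j => C j v),
      (fun i => (i, n - i - j)) '' Function.support fun i => A i (B (n - j - i) (C j v))).Finite :=
    (hC v).biUnion fun j _ => (mulOK_up_laur hA hB (n - j) (C j v)).image _
  refine this.subset fun p hp => ?_
  simp only [Set.mem_iUnion]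
  refine ⟨n - p.1 - p.2, fun h => hp (by simp only at h; simp [h]), p.1, fun h => hp ?_, ?_⟩
  · simp only at h ⊢
    rwa [show n - (n - p.1 - p.2) - p.1 = p.2 by ring] at h
  · ext <;> simp

/-- Associativity when the two factors on the left have no negative powers. -/
theorem fmul_assoc_up_up {A B C : FDist ℤ M} (hA : UpF A) (hB : UpF B) (hC : LaurF C) :
    fmul (fmul A B) C = fmul A (fmul B C) := by
  refine (fmul_assoc_of (mulOK_up_laur hA hB.laurF) (mulOK_up_laur hB hC) fun v n => ?_).2.2
  obtain ⟨N, hN⟩ := hC v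
  refine ((Set.finite_Icc (0 : ℤ) (n - N)).prod (Set.finite_Icc (0 : ℤ) (n - N))).subset
    fun p hp => ?_
  by_contra hc
  refine hp ?_
  by_cases h1 : p.1 < 0
  · simp [hA _ h1]
  by_cases h2 : p.2 < 0
  · simp [hB _ h2]
  have h3 : n - p.1 - p.2 < N := by
    by_contra h3
    exact hc ⟨⟨by omega, by omega⟩, by omega, by omega⟩
  simp [hN _ h3]

end Laurent

/-! ### The field `z ^ T` of an operator with integral eigenvalues -/

section ZPowers

variable {M : Type*} [AddCommGroup M] [Module ℂ M] {T : Module.End ℂ M}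

theorem aeval_apply_eigen {μ : ℂ} {v : M} (h : T v = μ • v) (p : Polynomial ℂ) :
    Polynomial.aeval T p v = p.eval μ • v := by
  rcases eq_or_ne v 0 with rfl | hv
  · simp
  · exact Module.End.aeval_apply_of_hasEigenvector
      (Module.End.hasEigenvector_iff.2 ⟨Module.End.mem_eigenspace_iff.2 h, hv⟩)

theorem exists_poly_select (s : Finset ℤ) (n : ℤ) : ∃ p : Polynomial ℂ, p.eval (n : ℂ) = 1 ∧
    ∀ m ∈ s, m ≠ n → p.eval (m : ℂ) = 0 := by
  classical
  refine ⟨Polynomial.C (∏ k ∈ s.erase n, ((n : ℂ) - k))⁻¹ *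
    ∏ k ∈ s.erase n, (Polynomial.X - Polynomial.C (k : ℂ)), ?_, ?_⟩
  · rw [Polynomial.eval_mul, Polynomial.eval_C, Polynomial.eval_prod]
    simp only [Polynomial.eval_sub, Polynomial.eval_X, Polynomial.eval_C]
    refine inv_mul_cancel₀ (Finset.prod_ne_zero_iff.2 fun k hk => sub_ne_zero.2 ?_)
    exact_mod_cast (Finset.ne_of_mem_erase hk).symm
  · intro m hm hmn
    rw [Polynomial.eval_mul, Polynomial.eval_prod]
    refine mul_eq_zero_of_right _ (Finset.prod_eq_zero (Finset.mem_erase.2 ⟨hmn, hm⟩) ?_)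
    simp

/-- On a single vector a spectral projection is a polynomial in `T`, by Lagrange interpolation at
the finitely many eigenvalues involved. The set `s` allows further eigenvalues to be excluded. Hence
the projections are determined by `T` and preserve every `T`-stable subspace. -/
theorem IsZPow.exists_poly {P : FDist ℤ M} (h : IsZPow T P) (v : M) (n : ℤ) (s : Finset ℤ) :
    ∃ p : Polynomial ℂ, p.eval (n : ℂ) = 1 ∧ (∀ m ∈ s, m ≠ n → p.eval (m : ℂ) = 0) ∧
      Polynomial.aeval T p v = P n v := by
  classical
  set s' := s ∪ (h.1 v).toFinset ∪ {n}
  obtain ⟨p, hp1, hp2⟩ := exists_poly_select s' n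
  refine ⟨p, hp1, fun m hm => hp2 m (by simp [s', hm]), ?_⟩
  have hv : v = ∑ k ∈ s', P k v := by
    conv_lhs => rw [← Module.End.one_apply (R := ℂ) v, ← h.2.1, locSum_apply h.1]
    refine finsum_eq_sum_of_support_subset _ fun k hk => ?_
    simp only [s', Finset.coe_union, Set.Finite.coe_toFinset]
    exact Or.inl (Or.inr hk)
  have hk : ∀ k, Polynomial.aeval T p (P k v) = p.eval (k : ℂ) • P k v := fun k =>
    aeval_apply_eigen (by simpa using LinearMap.congr_fun (h.2.2 k) v) p
  conv_lhs => rw [hv]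
  rw [map_sum, Finset.sum_eq_single n]
  · rw [hk, hp1, one_smul]
  · intro m hm hmn
    rw [hk, hp2 m hm hmn, zero_smul]
  · intro hn
    exact absurd (by simp [s']) hn

theorem IsZPow.apply_eigen {P : FDist ℤ M} (h : IsZPow T P) {v : M} {m : ℤ}
    (hv : T v = (m : ℂ) • v) (n : ℤ) : P n v = if n = m then v else 0 := by
  obtain ⟨p, hp1, hp2, hp⟩ := h.exists_poly v n {m}
  rw [← hp, aeval_apply_eigen hv]
  split_ifs with hnm
  · rw [← hnm, hp1, one_smul]
  · rw [hp2 m (by simp) (Ne.symm hnm), zero_smul]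

theorem aeval_mem {W : Submodule ℂ M} (hW : ∀ v ∈ W, T v ∈ W) (p : Polynomial ℂ) {v : M}
    (hv : v ∈ W) : Polynomial.aeval T p v ∈ W := by
  induction p using Polynomial.induction_on' with
  | add p q hp hq => simpa using W.add_mem hp hq
  | monomial n c =>
    rw [Polynomial.aeval_monomial, Module.End.mul_apply, Module.algebraMap_end_apply]
    refine W.smul_mem _ ?_
    induction n with
    | zero => simpa using hv
    | succ n ih => rw [pow_succ', Module.End.mul_apply]; exact hW _ ih

theorem IsZPow.mem {P : FDist ℤ M} (h : IsZPow T P) {W : Submodule ℂ M} (hW : ∀ v ∈ W, T v ∈ W)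
    (n : ℤ) (v : M) (hv : v ∈ W) : P n v ∈ W := by
  obtain ⟨p, -, -, hp⟩ := h.exists_poly v n ∅
  rw [← hp]
  exact aeval_mem hW p hv

/-- `zPow` is defined by a choice; uniqueness identifies it with any explicit family of projections.
-/
theorem IsZPow.unique {P P' : FDist ℤ M} (h : IsZPow T P) (h' : IsZPow T P') : P = P' := by
  funext n
  ext v
  conv_lhs => rw [← Module.End.one_apply (R := ℂ) v, ← h'.2.1, locSum_apply h'.1]
  rw [map_finsum _ (h'.1 v), finsum_eq_single _ n]
  · rw [h.apply_eigen (by simpa using LinearMap.congr_fun (h'.2.2 n) v), if_pos rfl]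
  · intro m hm
    rw [h.apply_eigen (by simpa using LinearMap.congr_fun (h'.2.2 m) v), if_neg hm.symm]

theorem zPow_spec (h : ∃ P, IsZPow T P) : IsZPow T (zPow T) := by
  rw [zPow, dif_pos h]
  exact h.choose_spec

theorem zPow_eq {P : FDist ℤ M} (h : IsZPow T P) : zPow T = P := (zPow_spec ⟨P, h⟩).unique h

/-- An operator with a spanning set of integral eigenvectors is diagonalizable. -/
theorem exists_isZPow_of_span {s : Set M} (hs : Submodule.span ℂ s = ⊤)
    (h : ∀ v ∈ s, ∃ m : ℤ, T v = (m : ℂ) • v) : ∃ P, IsZPow T P := by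
  classical
  -- A basis extracted from the spanning set consists of eigenvectors, and the projections can be
  -- prescribed on it.
  let b := Module.Basis.ofSpan hs.ge
  have hb : ∀ i, ∃ m : ℤ, T (b i) = (m : ℂ) • b i := fun i =>
    h _ (Module.Basis.ofSpan_subset hs.ge ⟨i, rfl⟩)
  choose m hm using hb
  let P : FDist ℤ M := fun n => b.constr ℂ fun i => if m i = n then b i else 0
  have hP : ∀ n i, P n (b i) = if m i = n then b i else 0 := fun n i => b.constr_basis ℂ _ i
  have hfin : LocFin P := by
    refine locFin_of_span b.span_eq ?_
    rintro _ ⟨i, rfl⟩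
    refine (Set.finite_singleton (m i)).subset fun n hn => ?_
    by_contra hc
    refine hn ?_
    simp only
    rw [hP, if_neg fun h => hc h.symm]
  refine ⟨P, hfin, b.ext fun i => ?_, fun n => b.ext fun i => ?_⟩
  · rw [locSum_apply hfin, finsum_eq_single _ (m i)]
    · simp [hP]
    · intro n hn
      rw [hP, if_neg hn.symm]
  · simp only [Module.End.mul_apply, LinearMap.smul_apply, hP]
    split_ifs with hn
    · rw [hm, hn]
    · simp

theorem IsZPow.conj {N : Type*} [AddCommGroup N] [Module ℂ N] (e : M ≃ₗ[ℂ] N) {P : FDist ℤ M}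
    (h : IsZPow T P) : IsZPow (e.conj T) (conjF e P) := by
  refine ⟨(locFin_conj e).2 h.1, ?_, fun n => ?_⟩
  · have := locSum_conj e P
    rw [h.2.1, conj_one'] at this
    exact this
  · rw [conjF, ← conj_mul', h.2.2, map_smul]

theorem zPow_conj {N : Type*} [AddCommGroup N] [Module ℂ N] (e : M ≃ₗ[ℂ] N)
    (h : ∃ P, IsZPow T P) : zPow (e.conj T) = conjF e (zPow T) :=
  zPow_eq ((zPow_spec h).conj e)

/-- An operator that shifts the eigenvalues of `T` by `d` shifts the coefficients of `z ^ T`. -/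
theorem IsZPow.shift {P : FDist ℤ M} (h : IsZPow T P) {A : Module.End ℂ M} {d : ℤ}
    (hA : T * A = A * T + (d : ℂ) • A) (n : ℤ) : P n * A = A * P (n - d) := by
  ext v
  have hfin := h.1 v
  have hv : v = ∑ᶠ m, P m v := by
    conv_lhs => rw [← Module.End.one_apply (R := ℂ) v, ← h.2.1, locSum_apply h.1]
  -- `A` raises the eigenvalue by `d`, so of the components of `v` only the one of eigenvalue `n -
  -- d` can reach eigenvalue `n`.
  have hAP : ∀ m, T (A (P m v)) = ((m + d : ℤ) : ℂ) • A (P m v) := fun m => by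
    have h1 := LinearMap.congr_fun hA (P m v)
    have h2 : T (P m v) = (m : ℂ) • P m v := by simpa using LinearMap.congr_fun (h.2.2 m) v
    simp only [Module.End.mul_apply, LinearMap.add_apply, LinearMap.smul_apply, h2, map_smul] at h1
    rw [h1, Int.cast_add, add_smul]
  simp only [Module.End.mul_apply]
  conv_lhs => rw [hv, map_finsum _ hfin, map_finsum _ (hfin.subset fun i hi h0 => hi (by
    simp only at h0
    simp [h0]))]
  rw [finsum_eq_single _ (n - d)]
  · rw [h.apply_eigen (hAP _), if_pos (by ring)]
  · intro m hm
    rw [h.apply_eigen (hAP _), if_neg (by omega)]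

theorem IsZPow.neg {P : FDist ℤ M} (h : IsZPow T P) : IsZPow (-T) fun n => P (-n) := by
  refine ⟨(locFin_comp_equiv (Equiv.neg ℤ)).2 h.1, ?_, fun n => ?_⟩
  · exact (locSum_comp_equiv (Equiv.neg ℤ) P).trans h.2.1
  · rw [neg_mul, h.2.2, ← neg_smul]
    simp

end ZPowers

/-! ### The Euler derivation on power series with noncommuting coefficients -/

section EulerDerivation

variable {S : Type*} [Ring S] [Algebra ℂ S]

/-- The derivation `x d/dx` of formal power series. -/
def eulerD (f : PowerSeries S) : PowerSeries S :=
  PowerSeries.mk fun n => (n : ℂ) • PowerSeries.coeff n f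

theorem eulerD_mul (f g : PowerSeries S) : eulerD (f * g) = eulerD f * g + f * eulerD g := by
  ext n
  simp only [eulerD, PowerSeries.coeff_mk, PowerSeries.coeff_mul, map_add, Finset.smul_sum,
    ← Finset.sum_add_distrib]
  refine Finset.sum_congr rfl fun p hp => ?_
  rw [← mem_antidiagonal.1 hp, Nat.cast_add, add_smul, smul_mul_assoc, mul_smul_comm]

theorem eulerD_one : eulerD (1 : PowerSeries S) = 0 := by
  ext n
  rcases n with _ | n <;> simp [eulerD, PowerSeries.coeff_one]

/-- The usual power rule needs `f` to commute with its own derivative, as the coefficients are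
operators. -/
theorem eulerD_pow_succ {f : PowerSeries S} (h : Commute f (eulerD f)) (k : ℕ) :
    eulerD (f ^ (k + 1)) = ((k + 1 : ℕ) : ℂ) • (eulerD f * f ^ k) := by
  induction k with
  | zero => simp
  | succ k ih =>
    rw [pow_succ', eulerD_mul, ih, mul_smul_comm, ← mul_assoc, h.eq, mul_assoc, ← pow_succ']
    rw [Nat.cast_add (k + 1) 1, add_smul, Nat.cast_one, one_smul, add_comm]

/-- In degree `n` the equation reads `n y_n = ∑ k a_k y_(n-k)`, and the term `k = 0` is absent; so
it determines `y_n` from lower coefficients. The identities between exponentials below are proved by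
showing that both sides solve the same equation. -/
theorem eulerD_ode_unique {a y z : PowerSeries S} (hy : eulerD y = eulerD a * y)
    (hz : eulerD z = eulerD a * z) (h0 : PowerSeries.coeff 0 y = PowerSeries.coeff 0 z) :
    y = z := by
  ext n
  induction n using Nat.strong_induction_on with
  | _ n ih =>
    rcases Nat.eq_zero_or_pos n with rfl | hn
    · exact h0
    have h1 := congrArg (PowerSeries.coeff n) hy
    have h2 := congrArg (PowerSeries.coeff n) hz
    simp only [eulerD, PowerSeries.coeff_mk, PowerSeries.coeff_mul] at h1 h2
    have h3 : (n : ℂ) • PowerSeries.coeff n y = (n : ℂ) • PowerSeries.coeff n z := by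
      rw [h1, h2]
      refine Finset.sum_congr rfl fun p hp => ?_
      have hp := mem_antidiagonal.1 hp
      rcases Nat.eq_zero_or_pos p.1 with h | h
      · simp [h]
      · rw [ih p.2 (by omega)]
    have hn' : (n : ℂ) ≠ 0 := by exact_mod_cast hn.ne'
    exact smul_right_injective _ hn' h3

/-- A scalar power series as a power series over a `ℂ`-algebra. -/
def scalarPS (c : ℕ → ℂ) : PowerSeries S := PowerSeries.mk fun k => algebraMap ℂ S (c k)

theorem commute_of_coeff {f g : PowerSeries S}
    (h : ∀ i j, Commute (PowerSeries.coeff i f) (PowerSeries.coeff j g)) : Commute f g := by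
  ext n
  rw [PowerSeries.coeff_mul, PowerSeries.coeff_mul, ← Finset.Nat.sum_antidiagonal_swap]
  exact Finset.sum_congr rfl fun p _ => h _ _

theorem scalarPS_commute (c : ℕ → ℂ) (f : PowerSeries S) : Commute (scalarPS c) f :=
  commute_of_coeff fun i j => by
    rw [scalarPS, PowerSeries.coeff_mk]
    exact Algebra.commutes (c i) (PowerSeries.coeff j f)

end EulerDerivation

/-! ### Exponentials of operator-valued series -/

section ExpCoeff

variable {M : Type*} [AddCommGroup M] [Module ℂ M]

/-- The power series `∑_{j ≥ 1} A j x ^ j`. -/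
def expArg (A : ℕ → Module.End ℂ M) : PowerSeries (Module.End ℂ M) :=
  PowerSeries.mk fun j => if j = 0 then 0 else A j

/-- The power series `exp (∑_{j ≥ 1} A j x ^ j)`. -/
def expSeries (A : ℕ → Module.End ℂ M) : PowerSeries (Module.End ℂ M) :=
  PowerSeries.mk (expCoeff A)

/-- The series has no constant term. Hence the truncation in `expCoeff` loses nothing, and
truncations at different places agree. -/
theorem coeff_expArg_pow_eq_zero (A : ℕ → Module.End ℂ M) {n k : ℕ} (h : n < k) :
    PowerSeries.coeff n (expArg A ^ k) = 0 := by
  induction k generalizing n with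
  | zero => omega
  | succ k ih =>
    rw [pow_succ', PowerSeries.coeff_mul]
    refine Finset.sum_eq_zero fun p hp => ?_
    have hp := mem_antidiagonal.1 hp
    rcases Nat.eq_zero_or_pos p.1 with h0 | h0
    · simp [expArg, h0]
    · rw [ih (by omega), mul_zero]

theorem expCoeff_eq_sum (A : ℕ → Module.End ℂ M) {n N : ℕ} (h : n < N) :
    expCoeff A n = ∑ k ∈ Finset.range N, ((k.factorial : ℂ)⁻¹) •
      PowerSeries.coeff n (expArg A ^ k) := by
  rw [expCoeff]
  refine Finset.sum_subset (fun k hk => ?_) fun k _ hk => ?_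
  · simp only [Finset.mem_range] at hk ⊢; omega
  · simp only [Finset.mem_range] at hk
    change _ • PowerSeries.coeff n (expArg A ^ k) = 0
    rw [coeff_expArg_pow_eq_zero A (by omega), smul_zero]

theorem expCoeff_zero (A : ℕ → Module.End ℂ M) : expCoeff A 0 = 1 := by
  simp [expCoeff]

/-- The entry of index zero is discarded, so meaningless values there, such as a coefficient divided
by zero, never matter. -/
theorem expCoeff_congr {A A' : ℕ → Module.End ℂ M} (h : ∀ j, j ≠ 0 → A j = A' j) :
    expCoeff A = expCoeff A' := by
  have : expArg A = expArg A' := by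
    ext n
    rcases eq_or_ne n 0 with h0 | h0 <;> simp [expArg, h0, h]
  funext n
  rw [expCoeff_eq_sum A n.lt_succ_self, expCoeff_eq_sum A' n.lt_succ_self, this]

theorem expArg_commute_eulerD {A : ℕ → Module.End ℂ M} (hA : ∀ i j, Commute (A i) (A j)) :
    Commute (expArg A) (eulerD (expArg A)) := by
  refine commute_of_coeff fun i j => ?_
  simp only [expArg, eulerD, PowerSeries.coeff_mk]
  refine Commute.smul_right ?_ _
  split_ifs <;> simp [hA]

/-- Termwise differentiation: the factor `k + 1` from the power rule turns `1/(k+1)!` into `1/k!`.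
Commuting exponents are essential. -/
theorem eulerD_expSeries {A : ℕ → Module.End ℂ M} (hA : ∀ i j, Commute (A i) (A j)) :
    eulerD (expSeries A) = eulerD (expArg A) * expSeries A := by
  have hc := expArg_commute_eulerD hA
  ext1 n
  simp only [eulerD, expSeries, PowerSeries.coeff_mk, PowerSeries.coeff_mul]
  rw [expCoeff_eq_sum A n.lt_succ_self, Finset.sum_range_succ', smul_add, Finset.smul_sum]
  have h0 : (n : ℂ) • ((Nat.factorial 0 : ℂ)⁻¹ • PowerSeries.coeff n (expArg A ^ 0)) = 0 := by
    rcases n with _ | n <;> simp [PowerSeries.coeff_one]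
  rw [h0, add_zero]
  have h1 : ∀ k ∈ Finset.range n, (n : ℂ) • (((k + 1).factorial : ℂ)⁻¹ •
      PowerSeries.coeff n (expArg A ^ (k + 1))) = ∑ p ∈ antidiagonal n,
        ((p.1 : ℂ) • PowerSeries.coeff p.1 (expArg A)) *
          (((k.factorial : ℂ)⁻¹) • PowerSeries.coeff p.2 (expArg A ^ k)) := by
    intro k _
    have h2 := congrArg (PowerSeries.coeff n) (eulerD_pow_succ hc k)
    rw [PowerSeries.coeff_smul, PowerSeries.coeff_mul] at h2
    simp only [eulerD, PowerSeries.coeff_mk] at h2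
    rw [smul_comm, h2, smul_smul]
    have h3 : ((k + 1).factorial : ℂ)⁻¹ * ((k + 1 : ℕ) : ℂ) = (k.factorial : ℂ)⁻¹ := by
      rw [Nat.factorial_succ, Nat.cast_mul, mul_inv, mul_comm, ← mul_assoc,
        mul_inv_cancel₀ (by exact_mod_cast k.succ_ne_zero), one_mul]
    rw [h3, Finset.smul_sum]
    exact Finset.sum_congr rfl fun p _ => (mul_smul_comm _ _ _).symm
  rw [Finset.sum_congr rfl h1, Finset.sum_comm]
  refine Finset.sum_congr rfl fun p hp => ?_
  have hp := mem_antidiagonal.1 hp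
  rcases Nat.eq_zero_or_pos p.1 with h0 | h0
  · simp [h0]
  · rw [← Finset.mul_sum, expCoeff_eq_sum A (show p.2 < n by omega)]

theorem coeff_eulerD_mul_expSeries (A : ℕ → Module.End ℂ M) (n : ℕ) :
    PowerSeries.coeff n (eulerD (expArg A) * expSeries A) =
      ∑ p ∈ antidiagonal n, (p.1 : ℂ) • (A p.1 * expCoeff A p.2) := by
  rw [PowerSeries.coeff_mul]
  refine Finset.sum_congr rfl fun p _ => ?_
  rcases eq_or_ne p.1 0 with h | h <;> simp [eulerD, expArg, expSeries, h]

/-- The differential equation of the exponential in coefficients; it allows induction on the degree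
without returning to powers of the exponent. -/
theorem expCoeff_rec {A : ℕ → Module.End ℂ M} (hA : ∀ i j, Commute (A i) (A j)) (n : ℕ) :
    (n : ℂ) • expCoeff A n =
      ∑ p ∈ antidiagonal n, (p.1 : ℂ) • (A p.1 * expCoeff A p.2) := by
  rw [← coeff_eulerD_mul_expSeries, ← eulerD_expSeries hA]
  simp [eulerD, expSeries]

theorem commute_expCoeff {A : ℕ → Module.End ℂ M} {B : Module.End ℂ M}
    (h : ∀ j, Commute B (A j)) (n : ℕ) : Commute B (expCoeff A n) := by
  rw [expCoeff_eq_sum A n.lt_succ_self]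
  refine Commute.sum_right _ _ _ fun k _ => Commute.smul_right ?_ _
  have hpow : Commute (PowerSeries.C B) (expArg A ^ k) := by
    refine Commute.pow_right (commute_of_coeff fun i j => ?_) k
    simp only [expArg, PowerSeries.coeff_C, PowerSeries.coeff_mk]
    split_ifs <;> simp [h]
  have := congrArg (PowerSeries.coeff n) hpow.eq
  rwa [PowerSeries.coeff_C_mul, PowerSeries.coeff_mul_C] at this

theorem expCoeff_apply_of_killed {A : ℕ → Module.End ℂ M} (hA : ∀ i j, Commute (A i) (A j)) {v : M}
    (h : ∀ j, j ≠ 0 → A j v = 0) {n : ℕ} (hn : n ≠ 0) : expCoeff A n v = 0 := by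
  have h1 := LinearMap.congr_fun (expCoeff_rec hA n) v
  have hn' : (n : ℂ) ≠ 0 := by exact_mod_cast hn
  refine (smul_eq_zero.1 (h1.trans ?_)).resolve_left hn'
  rw [LinearMap.sum_apply]
  refine Finset.sum_eq_zero fun p _ => ?_
  rcases eq_or_ne p.1 0 with h0 | h0
  · simp [h0]
  · rw [(commute_expCoeff (fun j => hA p.1 j) p.2).eq]
    simp [h _ h0]

/-- The commutator of an exponential with an operator whose commutators with the exponent are
scalars. -/
theorem expSeries_bracket {A : ℕ → Module.End ℂ M} (hA : ∀ i j, Commute (A i) (A j))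
    {B : Module.End ℂ M} {c : ℕ → ℂ} (hc0 : c 0 = 0)
    (h : ∀ j, j ≠ 0 → B * A j = A j * B + c j • 1) :
    PowerSeries.C B * expSeries A = expSeries A * PowerSeries.C B + scalarPS c * expSeries A := by
  have hB : PowerSeries.C B * eulerD (expArg A) =
      eulerD (expArg A) * PowerSeries.C B + eulerD (scalarPS c) := by
    ext1 n
    rw [map_add, PowerSeries.coeff_C_mul, PowerSeries.coeff_mul_C]
    rcases eq_or_ne n 0 with h0 | h0
    · simp [eulerD, h0]
    · simp only [eulerD, expArg, scalarPS, PowerSeries.coeff_mk, h0, if_false, mul_smul_comm,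
        smul_mul_assoc, h n h0, smul_add, Algebra.algebraMap_eq_smul_one]
  have hE := eulerD_expSeries hA
  have hCB : eulerD (PowerSeries.C B) = 0 := by
    ext1 n
    rcases n with _ | n <;> simp [eulerD, PowerSeries.coeff_C]
  have key : PowerSeries.C B * expSeries A - expSeries A * PowerSeries.C B =
      scalarPS c * expSeries A := by
    have hsub : ∀ f g : PowerSeries (Module.End ℂ M), eulerD (f - g) = eulerD f - eulerD g := by
      intro f g; ext1 n; simp [eulerD, smul_sub]
    -- The difference of the two sides solves the homogeneous equation of the exponential and has
    -- constant term zero, because `c 0 = 0`.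
    refine sub_eq_zero.1 (eulerD_ode_unique (a := expArg A) (z := 0) ?_ ?_ ?_)
    · rw [hsub, hsub, eulerD_mul, eulerD_mul, eulerD_mul, hCB, hE, ← mul_assoc, hB]
      have h1 := (scalarPS_commute c (eulerD (expArg A))).eq
      rw [← mul_assoc (scalarPS c), h1]
      noncomm_ring
    · ext1 n; simp [eulerD]
    · simp [PowerSeries.coeff_mul, expSeries, expCoeff_zero, scalarPS, hc0]
  rw [← key]; abel

/-- The derivative of the product vanishes since everything commutes, so the product equals its
constant term; this is uniqueness for the equation with `a = 0`. -/
theorem expSeries_mul_neg {A : ℕ → Module.End ℂ M} (hA : ∀ i j, Commute (A i) (A j)) :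
    expSeries A * expSeries (fun j => -A j) = 1 := by
  have hA' : ∀ i j, Commute (-A i) (-A j) := fun i j => ((hA i j).neg_left).neg_right
  have hn : eulerD (expArg fun j => -A j) = -eulerD (expArg A) := by
    ext1 n
    rcases eq_or_ne n 0 with h | h <;> simp [eulerD, expArg, h]
  have hcomm : Commute (eulerD (expArg A)) (expSeries A) := by
    refine commute_of_coeff fun i j => ?_
    simp only [eulerD, expArg, expSeries, PowerSeries.coeff_mk]
    refine Commute.smul_left ?_ _
    split_ifs
    · simp
    · exact commute_expCoeff (hA i) j
  refine eulerD_ode_unique (a := 0) ?_ ?_ ?_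
  · rw [eulerD_mul, eulerD_expSeries hA, eulerD_expSeries hA', hn, hcomm.eq]
    have : eulerD (0 : PowerSeries (Module.End ℂ M)) = 0 := by ext1 n; simp [eulerD]
    rw [this]
    noncomm_ring
  · rw [eulerD_one]
    have : eulerD (0 : PowerSeries (Module.End ℂ M)) = 0 := by ext1 n; simp [eulerD]
    rw [this, zero_mul]
  · simp [PowerSeries.coeff_mul, expSeries, expCoeff_zero]

theorem expUp_of_nonneg (A : ℕ → Module.End ℂ M) (n : ℕ) : expUp A (n : ℤ) = expCoeff A n := by
  simp [expUp]

theorem upF_expUp (A : ℕ → Module.End ℂ M) : UpF (expUp A) := fun n hn => by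
  simp [expUp, not_le.2 hn]

theorem expDown_eq (A : ℕ → Module.End ℂ M) (n : ℤ) : expDown A n = expUp A (-n) := by
  simp [expDown, expUp]

theorem expUp_zero (A : ℕ → Module.End ℂ M) : expUp A 0 = 1 := by
  simp [expUp, expCoeff_zero]

/-- The situation of a Heisenberg mode: `B` fails to commute with the single coefficient `A d`, so
its bracket with the exponential is the exponential multiplied by `c x^d`, a shift of exponents. -/
theorem expUp_bracket {A : ℕ → Module.End ℂ M} (hA : ∀ i j, Commute (A i) (A j))
    {B : Module.End ℂ M} {c : ℂ} {d : ℕ} (hd : d ≠ 0)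
    (h : ∀ j, j ≠ 0 → B * A j = A j * B + (if j = d then c else 0) • 1) (n : ℤ) :
    B * expUp A n = expUp A n * B + c • expUp A (n - d) := by
  rcases lt_or_ge n 0 with hn | hn
  · rw [upF_expUp A n hn, upF_expUp A _ (by omega)]; simp
  obtain ⟨n, rfl⟩ := Int.eq_ofNat_of_zero_le hn
  have := congrArg (PowerSeries.coeff n) (expSeries_bracket hA
    (c := fun j => if j = d then c else 0) (if_neg hd.symm) h)
  rw [map_add, PowerSeries.coeff_C_mul, PowerSeries.coeff_mul_C, PowerSeries.coeff_mul] at this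
  simp only [expSeries, scalarPS, PowerSeries.coeff_mk] at this
  rw [expUp_of_nonneg, this]
  congr 1
  by_cases hdn : d ≤ n
  · rw [Finset.sum_eq_single (d, n - d)]
    · rw [← Nat.cast_sub hdn, expUp_of_nonneg]
      simp [Algebra.algebraMap_eq_smul_one]
    · intro p hp hne
      have hp := mem_antidiagonal.1 hp
      rw [if_neg, map_zero, zero_mul]
      rintro rfl
      exact hne (Prod.ext rfl (by simp only; omega))
    · intro h0
      exact absurd (mem_antidiagonal.2 (by simp only; omega)) h0
  · rw [upF_expUp A _ (by omega), smul_zero]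
    refine Finset.sum_eq_zero fun p hp => ?_
    have hp := mem_antidiagonal.1 hp
    rw [if_neg (by omega), map_zero, zero_mul]

theorem commute_expUp {A : ℕ → Module.End ℂ M} {B : Module.End ℂ M}
    (h : ∀ j, Commute B (A j)) (n : ℤ) : Commute B (expUp A n) := by
  rw [expUp]
  split_ifs
  · exact commute_expCoeff h _
  · exact Commute.zero_right B

theorem expUp_apply_of_killed {A : ℕ → Module.End ℂ M} (hA : ∀ i j, Commute (A i) (A j)) {v : M}
    (h : ∀ j, j ≠ 0 → A j v = 0) (n : ℤ) : expUp A n v = if n = 0 then v else 0 := by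
  rcases lt_trichotomy n 0 with hn | rfl | hn
  · simp [upF_expUp A n hn, hn.ne]
  · simp [expUp_zero]
  · obtain ⟨n, rfl⟩ := Int.eq_ofNat_of_zero_le hn.le
    rw [expUp_of_nonneg, expCoeff_apply_of_killed hA h (by omega), if_neg hn.ne']

theorem fmul_up_up {A B : FDist ℤ M} (hA : UpF A) (hB : UpF B) (n : ℕ) :
    fmul A B n = ∑ p ∈ antidiagonal n, A (p.1 : ℤ) * B (p.2 : ℤ) := by
  ext v
  rw [fmul_apply (mulOK_up_laur hA hB.laurF), LinearMap.sum_apply,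
    Finset.Nat.sum_antidiagonal_eq_sum_range_succ fun i j => (A (i : ℤ) * B (j : ℤ)) v]
  have hinj : Set.InjOn (fun i : ℕ => (i : ℤ)) (Finset.range n.succ) := fun i _ j _ h => by
    simpa using h
  rw [finsum_eq_sum_of_support_subset (s := (Finset.range n.succ).image fun i : ℕ => (i : ℤ)),
    Finset.sum_image hinj]
  · refine Finset.sum_congr rfl fun i hi => ?_
    rw [← Nat.cast_sub (by simpa [Nat.lt_succ_iff] using hi)]; rfl
  · intro i hi
    by_cases h1 : i < 0
    · exact absurd (by simp [hA i h1]) hi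
    by_cases h2 : (n : ℤ) - i < 0
    · exact absurd (by simp [hB _ h2]) hi
    simp only [Finset.coe_image, Set.mem_image, Finset.mem_coe, Finset.mem_range]
    exact ⟨i.toNat, by omega, by omega⟩

theorem fmul_expUp_neg {A : ℕ → Module.End ℂ M} (hA : ∀ i j, Commute (A i) (A j)) :
    fmul (expUp A) (expUp fun j => -A j) = constF 1 := by
  funext n
  rcases lt_or_ge n 0 with hn | hn
  · rw [upF_fmul (upF_expUp _) (upF_expUp _) n hn, constF, if_neg hn.ne]
  obtain ⟨n, rfl⟩ := Int.eq_ofNat_of_zero_le hn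
  rw [fmul_up_up (upF_expUp _) (upF_expUp _)]
  have := congrArg (PowerSeries.coeff n) (expSeries_mul_neg hA)
  rw [PowerSeries.coeff_mul] at this
  simp only [expSeries, PowerSeries.coeff_mk] at this
  simp only [expUp_of_nonneg, this, PowerSeries.coeff_one, constF, Nat.cast_eq_zero]

theorem fmul_reflect (A B : FDist ℤ M) (n : ℤ) :
    fmul (fun n => A (-n)) (fun n => B (-n)) n = fmul A B (-n) := by
  rw [fmul, fmul, ← locSum_comp_equiv (Equiv.neg ℤ)]
  congr 1
  funext i
  simp [sub_eq_add_neg, add_comm]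

theorem fmul_expDown_neg {A : ℕ → Module.End ℂ M} (hA : ∀ i j, Commute (A i) (A j)) :
    fmul (expDown A) (expDown fun j => -A j) = constF 1 := by
  funext n
  have h1 : ∀ A : ℕ → Module.End ℂ M, expDown A = fun n => expUp A (-n) := fun A =>
    funext (expDown_eq A)
  rw [h1, h1, fmul_reflect, fmul_expUp_neg hA]
  simp [constF]

/-- Stated for linear maps that preserve products and the identity, so as to cover both conjugation
and `f ↦ f ⊗ 1`. -/
theorem expCoeff_map {N : Type*} [AddCommGroup N] [Module ℂ N]
    (f : Module.End ℂ M →ₗ[ℂ] Module.End ℂ N) (h1 : f 1 = 1) (hmul : ∀ A B, f (A * B) = f A * f B)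
    (A : ℕ → Module.End ℂ M) (n : ℕ) : f (expCoeff A n) = expCoeff (fun j => f (A j)) n := by
  have hpow : ∀ k n, f (PowerSeries.coeff n (expArg A ^ k)) =
      PowerSeries.coeff n (expArg (fun j => f (A j)) ^ k) := by
    intro k
    induction k with
    | zero =>
      intro n
      rcases n with _ | n <;> simp [PowerSeries.coeff_one, h1]
    | succ k ih =>
      intro n
      rw [pow_succ', pow_succ', PowerSeries.coeff_mul, PowerSeries.coeff_mul, map_sum]
      refine Finset.sum_congr rfl fun p _ => ?_
      rw [hmul, ih]
      congr 1
      rcases eq_or_ne p.1 0 with h | h <;> simp [expArg, h]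
  rw [expCoeff_eq_sum A n.lt_succ_self, expCoeff_eq_sum _ n.lt_succ_self, map_sum]
  exact Finset.sum_congr rfl fun k _ => by rw [map_smul, hpow]

theorem expUp_map {N : Type*} [AddCommGroup N] [Module ℂ N]
    (f : Module.End ℂ M →ₗ[ℂ] Module.End ℂ N) (h1 : f 1 = 1) (hmul : ∀ A B, f (A * B) = f A * f B)
    (A : ℕ → Module.End ℂ M) (n : ℤ) : f (expUp A n) = expUp (fun j => f (A j)) n := by
  rw [expUp, expUp]
  split_ifs
  · exact expCoeff_map f h1 hmul A _
  · exact map_zero f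

theorem conjF_expUp {N : Type*} [AddCommGroup N] [Module ℂ N] (e : M ≃ₗ[ℂ] N)
    (A : ℕ → Module.End ℂ M) : conjF e (expUp A) = expUp fun j => e.conj (A j) :=
  funext (expUp_map e.conj.toLinearMap (conj_one' e) (conj_mul' e) A)

theorem conjF_expDown {N : Type*} [AddCommGroup N] [Module ℂ N] (e : M ≃ₗ[ℂ] N)
    (A : ℕ → Module.End ℂ M) : conjF e (expDown A) = expDown fun j => e.conj (A j) := by
  funext n
  have := congrFun (conjF_expUp e A) (-n)
  rw [conjF, expDown_eq, expDown_eq]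
  exact this

theorem expUp_congr {A A' : ℕ → Module.End ℂ M} (h : ∀ j, j ≠ 0 → A j = A' j) :
    expUp A = expUp A' := by
  funext n
  simp only [expUp, expCoeff_congr h]

theorem expDown_congr {A A' : ℕ → Module.End ℂ M} (h : ∀ j, j ≠ 0 → A j = A' j) :
    expDown A = expDown A' := by
  funext n
  simp only [expDown, expCoeff_congr h]

/-- Reordering of two exponentials whose exponents have scalar commutators. -/
theorem expCoeff_mul_expUp {A B : ℕ → Module.End ℂ M} (hA : ∀ i j, Commute (A i) (A j))
    (hB : ∀ i j, Commute (B i) (B j)) {γ r : ℕ → ℂ}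
    (hAB : ∀ i j, i ≠ 0 → j ≠ 0 → A i * B j = B j * A i + (if j = i then γ i else 0) • 1)
    (hr0 : r 0 = 1)
    (hr : ∀ n : ℕ, (n : ℂ) * r n = ∑ p ∈ antidiagonal n, (p.1 : ℂ) * γ p.1 * r p.2)
    (n : ℕ) (l : ℤ) :
    expCoeff A n * expUp B l =
      ∑ p ∈ antidiagonal n, r p.1 • (expUp B (l - p.1) * expCoeff A p.2) := by
  have hbr : ∀ i, i ≠ 0 → ∀ l, A i * expUp B l = expUp B l * A i + γ i • expUp B (l - i) :=
    fun i hi l => expUp_bracket hB hi (fun j hj => hAB i j hi hj) l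
  induction n using Nat.strong_induction_on generalizing l with
  | _ n ih =>
    rcases Nat.eq_zero_or_pos n with rfl | hn
    · simp [expCoeff_zero, hr0]
    have hn' : (n : ℂ) ≠ 0 := by exact_mod_cast hn.ne'
    refine smul_right_injective _ hn' ?_
    simp only
    rw [← smul_mul_assoc, expCoeff_rec hA, Finset.sum_mul]
    -- By `hr`, the numbers `r n` are the coefficients of `exp (∑ γ k x^k)`. The factor `A p.1` is
    -- now moved past the exponential of `B`, giving a reordered term and a scalar correction.
    have step : ∀ p ∈ antidiagonal n,
        ((p.1 : ℂ) • (A p.1 * expCoeff A p.2)) * expUp B l =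
        ∑ q ∈ antidiagonal p.2,
          (r q.1 • (expUp B (l - q.1) * ((p.1 : ℂ) • (A p.1 * expCoeff A q.2))) +
            ((p.1 : ℂ) * γ p.1 * r q.1) • (expUp B (l - (p.1 + q.1 : ℕ)) * expCoeff A q.2)) := by
      intro p hp
      have hp := mem_antidiagonal.1 hp
      rcases eq_or_ne p.1 0 with h0 | h0
      · simp [h0]
      rw [smul_mul_assoc, mul_assoc, ih p.2 (by omega), Finset.mul_sum, Finset.smul_sum]
      refine Finset.sum_congr rfl fun q _ => ?_
      rw [mul_smul_comm, ← mul_assoc, hbr _ h0, add_mul, smul_add, smul_add, smul_mul_assoc,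
        mul_smul_comm, mul_assoc, smul_smul, smul_smul, smul_smul, smul_smul]
      congr 1
      · rw [mul_comm]
      · push_cast
        rw [sub_sub, add_comm (q.1 : ℤ)]
        congr 1
        ring
    rw [Finset.sum_congr rfl step]
    simp only [Finset.sum_add_distrib]
    -- The reordered terms resum by the recursion for `expCoeff A` and carry the weight `p.2`.
    have t1 : ∑ p ∈ antidiagonal n, ∑ q ∈ antidiagonal p.2,
        r q.1 • (expUp B (l - q.1) * ((p.1 : ℂ) • (A p.1 * expCoeff A q.2))) =
        ∑ p ∈ antidiagonal n, (p.2 : ℂ) • (r p.1 • (expUp B (l - p.1) * expCoeff A p.2)) := by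
      rw [Finset.sum_sigma', ← Finset.sum_congr rfl (g := fun p : ℕ × ℕ => (p.2 : ℂ) • (r p.1 • (expUp B (l - p.1) * expCoeff A p.2))) (f := fun p : ℕ × ℕ => ∑ q ∈ antidiagonal p.2, r p.1 • (expUp B (l - p.1) * ((q.1 : ℂ) • (A q.1 * expCoeff A q.2)))), Finset.sum_sigma']
      · refine Finset.sum_bij' (fun x _ => ⟨(x.2.1, x.1.1 + x.2.2), (x.1.1, x.2.2)⟩)
          (fun x _ => ⟨(x.2.1, x.1.1 + x.2.2), (x.1.1, x.2.2)⟩) ?_ ?_ ?_ ?_ ?_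
        · rintro ⟨⟨a, b⟩, ⟨c, d⟩⟩ h
          simp only [Finset.mem_sigma, mem_antidiagonal] at h ⊢
          refine ⟨by omega, ?_⟩
          trivial
        · rintro ⟨⟨a, b⟩, ⟨c, d⟩⟩ h
          simp only [Finset.mem_sigma, mem_antidiagonal] at h ⊢
          refine ⟨by omega, ?_⟩
          trivial
        · rintro ⟨⟨a, b⟩, ⟨c, d⟩⟩ h
          simp only [Finset.mem_sigma, mem_antidiagonal] at h
          simp [h.2]
        · rintro ⟨⟨a, b⟩, ⟨c, d⟩⟩ h
          simp only [Finset.mem_sigma, mem_antidiagonal] at h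
          simp [h.2]
        · rintro ⟨⟨a, b⟩, ⟨c, d⟩⟩ h
          rfl
      · intro p _
        rw [← Finset.smul_sum, ← Finset.mul_sum, ← expCoeff_rec hA, mul_smul_comm, smul_comm]
    -- The corrections resum by the recursion `hr` and carry the weight `p.1`; the two weights add
    -- up to `n`.
    have t2 : ∑ p ∈ antidiagonal n, ∑ q ∈ antidiagonal p.2,
        ((p.1 : ℂ) * γ p.1 * r q.1) • (expUp B (l - (p.1 + q.1 : ℕ)) * expCoeff A q.2) =
        ∑ p ∈ antidiagonal n, (p.1 : ℂ) • (r p.1 • (expUp B (l - p.1) * expCoeff A p.2)) := by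
      rw [Finset.sum_sigma', ← Finset.sum_congr rfl (g := fun p : ℕ × ℕ => (p.1 : ℂ) • (r p.1 • (expUp B (l - p.1) * expCoeff A p.2))) (f := fun p : ℕ × ℕ => ∑ q ∈ antidiagonal p.1, ((q.1 : ℂ) * γ q.1 * r q.2) • (expUp B (l - p.1) * expCoeff A p.2)), Finset.sum_sigma']
      · refine Finset.sum_bij' (fun x _ => ⟨(x.1.1 + x.2.1, x.2.2), (x.1.1, x.2.1)⟩)
          (fun x _ => ⟨(x.2.1, x.2.2 + x.1.2), (x.2.2, x.1.2)⟩) ?_ ?_ ?_ ?_ ?_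
        · rintro ⟨⟨a, b⟩, ⟨c, d⟩⟩ h
          simp only [Finset.mem_sigma, mem_antidiagonal] at h ⊢
          refine ⟨by omega, ?_⟩
          trivial
        · rintro ⟨⟨a, b⟩, ⟨c, d⟩⟩ h
          simp only [Finset.mem_sigma, mem_antidiagonal] at h ⊢
          refine ⟨by omega, ?_⟩
          trivial
        · rintro ⟨⟨a, b⟩, ⟨c, d⟩⟩ h
          simp only [Finset.mem_sigma, mem_antidiagonal] at h
          simp [h.2]
        · rintro ⟨⟨a, b⟩, ⟨c, d⟩⟩ h
          simp only [Finset.mem_sigma, mem_antidiagonal] at h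
          simp [h.2]
        · rintro ⟨⟨a, b⟩, ⟨c, d⟩⟩ h
          rfl
      · intro p _
        rw [← Finset.sum_smul, ← hr, smul_smul]
    rw [t1, t2, ← Finset.sum_add_distrib, Finset.smul_sum]
    refine Finset.sum_congr rfl fun p hp => ?_
    rw [← add_smul, ← Nat.cast_add, add_comm, mem_antidiagonal.1 hp]

end ExpCoeff

/-! ### Subspaces of polynomials closed under derivatives -/

section PolynomialDerivatives

variable {τ : Type*}

/-- A nonzero space of polynomials closed under differentiation contains the constants. -/
theorem one_mem_of_pderiv_closed {W : Submodule ℂ (MvPolynomial τ ℂ)}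
    (hW : ∀ i, ∀ f ∈ W, MvPolynomial.pderiv i f ∈ W) {f : MvPolynomial τ ℂ} (hf : f ∈ W)
    (hf0 : f ≠ 0) : (1 : MvPolynomial τ ℂ) ∈ W := by
  classical
  -- Induction on the total degree: differentiating by a variable of a monomial of top degree lowers
  -- the degree by one without killing the polynomial.
  have key : ∀ n : ℕ, ∀ f ∈ W, ∀ α : τ →₀ ℕ, α.degree = n → f.coeff α ≠ 0 →
      (∀ β : τ →₀ ℕ, n < β.degree → f.coeff β = 0) → (1 : MvPolynomial τ ℂ) ∈ W := by
    intro n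
    induction n with
    | zero =>
      intro f hf α hα hne hbd
      have h0 : α = 0 := (Finsupp.degree_eq_zero_iff α).1 hα
      have hfc : f = MvPolynomial.C (f.coeff 0) := by
        ext β
        rw [MvPolynomial.coeff_C]
        split_ifs with h
        · rw [h]
        · refine hbd β (Nat.pos_of_ne_zero fun h' => h ?_)
          exact ((Finsupp.degree_eq_zero_iff β).1 h').symm
      have h1 : (1 : MvPolynomial τ ℂ) = (f.coeff 0)⁻¹ • f := by
        rw [hfc, MvPolynomial.coeff_C, if_pos rfl, MvPolynomial.smul_eq_C_mul, ← map_mul,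
          inv_mul_cancel₀ (h0 ▸ hne), map_one]
      rw [h1]
      exact W.smul_mem _ hf
    | succ n ih =>
      intro f hf α hα hne hbd
      have hex : ∃ i, α i ≠ 0 := by
        by_contra hc
        push Not at hc
        have : α = 0 := Finsupp.ext hc
        rw [this, map_zero] at hα
        omega
      obtain ⟨i, hi⟩ := hex
      have hle : Finsupp.single i 1 ≤ α := by
        rw [Finsupp.single_le_iff]; omega
      have hsub : α - Finsupp.single i 1 + Finsupp.single i 1 = α := tsub_add_cancel_of_le hle
      refine ih _ (hW i f hf) (α - Finsupp.single i 1) ?_ ?_ ?_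
      · have := congrArg Finsupp.degree hsub
        rw [map_add, Finsupp.degree_single, hα] at this
        omega
      -- The coefficient is multiplied by the exponent of the variable, which is nonzero in
      -- characteristic zero.
      · rw [MvPolynomial.coeff_pderiv, hsub]
        refine mul_ne_zero hne ?_
        exact Nat.cast_add_one_ne_zero _
      · intro β hβ
        rw [MvPolynomial.coeff_pderiv, hbd, zero_mul]
        rw [map_add, Finsupp.degree_single]
        omega
  obtain ⟨α, hα, hmax⟩ := f.support.exists_max_image Finsupp.degree
    (MvPolynomial.support_nonempty.2 hf0)
  refine key _ f hf α rfl (MvPolynomial.mem_support_iff.1 hα) fun β hβ => ?_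
  by_contra hne
  exact absurd (hmax β (MvPolynomial.mem_support_iff.2 hne)) (by omega)

end PolynomialDerivatives

/-! ### The Weyl algebra and the irreducibility of the Weyl module -/

section WeylAlgebra

theorem bGen_comm (i j : ℤ) : bGen i * bGen j - bGen j * bGen i =
    algebraMap ℂ ClC (if i + j + 1 = 0 then (-1) ^ i else 0) := by
  have := RingQuot.mkAlgHom_rel ℂ (WeylRel.comm i j)
  simpa [bGen] using this

/-- The universal property of the Weyl algebra. -/
theorem exists_algHom_of_weyl {A : Type*} [Ring A] [Algebra ℂ A] (X : ℤ → A)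
    (h : ∀ i j, X i * X j - X j * X i = algebraMap ℂ A (if i + j + 1 = 0 then (-1) ^ i else 0)) :
    ∃ ρ : ClC →ₐ[ℂ] A, ∀ i, ρ (bGen i) = X i := by
  refine ⟨RingQuot.liftAlgHom ℂ ⟨FreeAlgebra.lift ℂ X, ?_⟩, fun i => ?_⟩
  · rintro _ _ ⟨i, j⟩
    rw [map_sub, map_mul, map_mul, FreeAlgebra.lift_ι_apply, FreeAlgebra.lift_ι_apply, h,
      AlgHom.commutes]
  · rw [bGen, RingQuot.liftAlgHom_mkAlgHom_apply, FreeAlgebra.lift_ι_apply]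

theorem clC_induction {p : ClC → Prop} (halg : ∀ c, p (algebraMap ℂ ClC c)) (hgen : ∀ i, p (bGen i))
    (hmul : ∀ a b, p a → p b → p (a * b)) (hadd : ∀ a b, p a → p b → p (a + b)) (x : ClC) : p x := by
  obtain ⟨y, rfl⟩ := RingQuot.mkAlgHom_surjective ℂ WeylRel x
  induction y using FreeAlgebra.induction with
  | grade0 c => rw [AlgHom.commutes]; exact halg c
  | grade1 i => exact hgen i
  | mul a b ha hb => rw [map_mul]; exact hmul _ _ ha hb
  | add a b ha hb => rw [map_add]; exact hadd _ _ ha hb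

theorem fc_eq_smul_vac (v : Fc) : ∃ x : ClC, v = x • vac := by
  obtain ⟨x, rfl⟩ := Submodule.Quotient.mk_surjective _ v
  exact ⟨x, by rw [vac, ← Submodule.Quotient.mk_smul, smul_eq_mul, mul_one]⟩

theorem bGen_smul_vac {j : ℤ} (hj : 0 ≤ j) : bGen j • vac = 0 := by
  rw [vac, ← Submodule.Quotient.mk_smul, smul_eq_mul, mul_one, Submodule.Quotient.mk_eq_zero]
  exact Submodule.subset_span ⟨j, hj, rfl⟩

/-- The universal property of the Weyl module. -/
theorem exists_fc_hom {N : Type*} [AddCommGroup N] [Module ℂ N] (ρ : ClC →ₐ[ℂ] Module.End ℂ N)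
    (n : N) (h : ∀ j, 0 ≤ j → ρ (bGen j) n = 0) :
    ∃ φ : Fc →ₗ[ℂ] N, φ vac = n ∧ ∀ x v, φ (x • v) = ρ x (φ v) := by
  set p : Submodule ClC ClC := Submodule.span ClC {x : ClC | ∃ j : ℤ, 0 ≤ j ∧ x = bGen j} with hp
  let L : ClC →ₗ[ℂ] N := (LinearMap.applyₗ n).comp ρ.toLinearMap
  have hL : ∀ x, L x = ρ x n := fun _ => rfl
  have hker : p.restrictScalars ℂ ≤ LinearMap.ker L := by
    intro x hx
    rw [Submodule.restrictScalars_mem, hp] at hx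
    rw [LinearMap.mem_ker]
    induction hx using Submodule.span_induction with
    | mem x hx => obtain ⟨j, hj, rfl⟩ := hx; exact h j hj
    | zero => exact map_zero L
    | add x y _ _ hx hy => rw [map_add, hx, hy, add_zero]
    | smul a x _ hx =>
      rw [hL] at hx
      rw [hL, smul_eq_mul, map_mul, Module.End.mul_apply, hx, map_zero]
  let φ : Fc →ₗ[ℂ] N := ((p.restrictScalars ℂ).liftQ L hker).comp
    (Submodule.Quotient.restrictScalarsEquiv ℂ p).symm.toLinearMap
  have hφ : ∀ x : ClC, φ (Submodule.Quotient.mk x) = ρ x n := fun x => by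
    change (p.restrictScalars ℂ).liftQ L hker
      ((Submodule.Quotient.restrictScalarsEquiv ℂ p).symm (Submodule.Quotient.mk x)) = _
    rw [Submodule.Quotient.restrictScalarsEquiv_symm_mk, Submodule.liftQ_apply, hL]
  refine ⟨φ, ?_, fun x v => ?_⟩
  · rw [vac, hφ, map_one, Module.End.one_apply]
  · obtain ⟨y, rfl⟩ := Submodule.Quotient.mk_surjective _ v
    rw [← Submodule.Quotient.mk_smul, hφ, hφ, smul_eq_mul, map_mul, Module.End.mul_apply]

/-- The generators of the Weyl algebra acting on polynomials in the creation operators. -/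
def polyOp (i : ℤ) : Module.End ℂ (MvPolynomial ℕ ℂ) :=
  if 0 ≤ i then ((-1 : ℂ) ^ i) • (MvPolynomial.pderiv i.toNat).toLinearMap
  else LinearMap.mulLeft ℂ (MvPolynomial.X (-i - 1).toNat)

theorem polyOp_comm_pos_neg {i j : ℤ} (hi : 0 ≤ i) (hj : j < 0) :
    polyOp i * polyOp j - polyOp j * polyOp i =
      algebraMap ℂ _ (if i + j + 1 = 0 then (-1) ^ i else 0) := by
  refine LinearMap.ext fun f => ?_
  simp only [polyOp, hi, if_true, not_le.2 hj, if_false, LinearMap.sub_apply, Module.End.mul_apply,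
    LinearMap.smul_apply, LinearMap.mulLeft_apply, Derivation.coeFn_coe, Derivation.leibniz,
    Module.algebraMap_end_apply, smul_eq_mul]
  split_ifs with h
  · rw [show (-j - 1).toNat = i.toNat by omega, MvPolynomial.pderiv_X_self]
    rw [mul_one, smul_add, mul_smul_comm, add_sub_cancel_left]
  · rw [MvPolynomial.pderiv_X_of_ne (by omega)]
    rw [mul_zero, add_zero, mul_smul_comm, sub_self, zero_smul]

theorem polyOp_comm (i j : ℤ) : polyOp i * polyOp j - polyOp j * polyOp i =
    algebraMap ℂ _ (if i + j + 1 = 0 then (-1) ^ i else 0) := by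
  rcases lt_or_ge i 0 with hi | hi <;> rcases lt_or_ge j 0 with hj | hj
  · rw [if_neg (by omega), map_zero, sub_eq_zero]
    refine LinearMap.ext fun f => ?_
    simp only [polyOp, not_le.2 hi, not_le.2 hj, if_false, Module.End.mul_apply,
      LinearMap.mulLeft_apply]
    ring
  · rw [← neg_sub, polyOp_comm_pos_neg hj hi, ← map_neg, add_comm j i]
    congr 1
    split_ifs with h
    · rw [show i = -1 - j by omega, zpow_sub₀ (by norm_num), zpow_neg_one]
      rcases Int.even_or_odd j with hj | hj
      · simp [hj.neg_one_zpow]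
      · simp [hj.neg_one_zpow]
    · simp
  · exact polyOp_comm_pos_neg hi hj
  · rw [if_neg (by omega), map_zero, sub_eq_zero]
    simp only [polyOp, hi, hj, if_true, smul_mul_assoc, mul_smul_comm]
    rw [smul_comm]
    have hc : ⁅MvPolynomial.pderiv (R := ℂ) i.toNat, MvPolynomial.pderiv (R := ℂ) j.toNat⁆ = 0 := by
      refine MvPolynomial.derivation_ext fun k => ?_
      rw [Derivation.commutator_apply]
      classical
      simp only [MvPolynomial.pderiv_X, Pi.single_apply, Derivation.coe_zero, Pi.zero_apply]
      split_ifs <;> simp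
    refine congrArg _ (congrArg _ (LinearMap.ext fun f => ?_))
    have h1 := Derivation.commutator_apply (D1 := MvPolynomial.pderiv (R := ℂ) i.toNat)
      (D2 := MvPolynomial.pderiv (R := ℂ) j.toNat) f
    rw [hc] at h1
    exact sub_eq_zero.1 h1.symm

/-- The polynomial representation serves only to show that the vacuum is nonzero; irreducibility
does not require it to be an isomorphism. -/
theorem exists_fc_to_poly : ∃ (ρ : ClC →ₐ[ℂ] Module.End ℂ (MvPolynomial ℕ ℂ))
    (φ : Fc →ₗ[ℂ] MvPolynomial ℕ ℂ), (∀ i, ρ (bGen i) = polyOp i) ∧ φ vac = 1 ∧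
      ∀ x v, φ (x • v) = ρ x (φ v) := by
  obtain ⟨ρ, hρ⟩ := exists_algHom_of_weyl polyOp polyOp_comm
  obtain ⟨φ, h1, h2⟩ := exists_fc_hom ρ 1 fun j hj => by
    rw [hρ, polyOp, if_pos hj]; simp
  exact ⟨ρ, φ, hρ, h1, h2⟩

theorem vac_ne_zero : vac ≠ 0 := by
  obtain ⟨ρ, φ, -, h1, -⟩ := exists_fc_to_poly
  intro h
  rw [h, map_zero] at h1
  exact zero_ne_one h1

/-- A subspace of the Weyl module containing the vacuum and stable under the generators is
everything. -/
theorem fc_induction_bGen {W : Submodule ℂ Fc} (h0 : vac ∈ W)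
    (h : ∀ i, ∀ v ∈ W, bGen i • v ∈ W) : W = ⊤ := by
  refine eq_top_iff.2 fun v _ => ?_
  obtain ⟨x, rfl⟩ := fc_eq_smul_vac v
  -- The claim is generalized from the vacuum to all vectors of `W`, as induction over products
  -- demands.
  suffices hW : ∀ v ∈ W, x • v ∈ W from hW _ h0
  · clear * - h
    induction x using clC_induction with
    | halg c => intro v hv; rw [algebraMap_smul]; exact W.smul_mem c hv
    | hgen i => exact h i
    | hmul a b ha hb =>
      intro v hv
      rw [mul_smul]
      exact ha _ (hb v hv)
    | hadd a b ha hb => intro v hv; rw [add_smul]; exact W.add_mem (ha v hv) (hb v hv)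

section Irreducible

variable {M : Type*} [AddCommGroup M] [Module ℂ M] {o : ℤ → Module.End ℂ M} {v₀ : M}

open scoped IsMulCommutative in
/-- Polynomials in the creation operators, applied to the vacuum. -/
theorem exists_poly_to_weyl
    (hcomm : ∀ i j, o i * o j - o j * o i = algebraMap ℂ _ (if i + j + 1 = 0 then (-1) ^ i else 0)) :
    ∃ τ : MvPolynomial ℕ ℂ →ₗ[ℂ] M, τ 1 = v₀ ∧
      ∀ (n : ℕ) f, τ (MvPolynomial.X n * f) = o (-(n : ℤ) - 1) (τ f) := by
  set S := Set.range fun n : ℕ => o (-(n : ℤ) - 1)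
  have hS : ∀ a ∈ S, ∀ b ∈ S, a * b = b * a := by
    rintro _ ⟨m, rfl⟩ _ ⟨n, rfl⟩
    have := hcomm (-m - 1) (-n - 1)
    rwa [if_neg (by omega), map_zero, sub_eq_zero] at this
  have := Algebra.isMulCommutative_adjoin ℂ hS
  let g : ℕ → Algebra.adjoin ℂ S := fun n => ⟨o (-(n : ℤ) - 1), Algebra.subset_adjoin ⟨n, rfl⟩⟩
  let F : MvPolynomial ℕ ℂ →ₐ[ℂ] Algebra.adjoin ℂ S := MvPolynomial.aeval g
  refine ⟨(LinearMap.applyₗ v₀).comp ((Algebra.adjoin ℂ S).val.comp F).toLinearMap, ?_, fun n f => ?_⟩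
  · simp
  · simp [F, g]

/-- Polynomials in the creation operators, applied to the vacuum, exhaust the module, and the
annihilation operators act on them as signed partial derivatives. A nonzero stable subspace pulls
back to a nonzero space of polynomials closed under derivatives, which contains `1`. -/
theorem weyl_irreducible
    (hcomm : ∀ i j, o i * o j - o j * o i = algebraMap ℂ _ (if i + j + 1 = 0 then (-1) ^ i else 0))
    (hkill : ∀ i, 0 ≤ i → o i v₀ = 0)
    (hcyc : ∀ W : Submodule ℂ M, v₀ ∈ W → (∀ i, ∀ v ∈ W, o i v ∈ W) → W = ⊤)
    {W : Submodule ℂ M} (hW : ∀ i, ∀ v ∈ W, o i v ∈ W) (hW0 : W ≠ ⊥) : v₀ ∈ W := by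
  obtain ⟨τ, hτ1, hτ⟩ := exists_poly_to_weyl (v₀ := v₀) hcomm
  have hC : ∀ c : ℂ, τ (MvPolynomial.C c) = c • v₀ := fun c => by
    rw [← mul_one (MvPolynomial.C c), ← MvPolynomial.smul_eq_C_mul, map_smul, hτ1]
  have hcomm' : ∀ i j v, o i (o j v) = o j (o i v) +
      (if i + j + 1 = 0 then (-1) ^ i else 0 : ℂ) • v := fun i j v => by
    have := LinearMap.congr_fun (hcomm i j) v
    rw [LinearMap.sub_apply, Module.algebraMap_end_apply] at this
    rw [← this]; simp
  -- Both sides obey the same commutation rule with multiplication by a variable and vanish on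
  -- constants.
  have hann : ∀ (i : ℕ) f, o i (τ f) = ((-1 : ℂ) ^ (i : ℤ)) • τ (MvPolynomial.pderiv i f) := by
    intro i f
    induction f using MvPolynomial.induction_on with
    | C c => rw [hC, map_smul, hkill _ (by omega)]; simp
    | add f g hf hg => simp only [map_add, smul_add, hf, hg]
    | mul_X f n hf =>
      rw [mul_comm, hτ, hcomm', hf, Derivation.leibniz, map_add, smul_eq_mul, smul_eq_mul, hτ,
        smul_add, map_smul]
      refine congrArg₂ (· + ·) rfl ?_
      by_cases h : n = i
      · subst h
        rw [if_pos (by omega), MvPolynomial.pderiv_X_self, mul_one]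
      · rw [if_neg (by omega), MvPolynomial.pderiv_X_of_ne h, mul_zero]
        simp
  have hsurj : LinearMap.range τ = ⊤ := by
    refine hcyc _ ⟨1, hτ1⟩ ?_
    rintro i _ ⟨f, rfl⟩
    rcases lt_or_ge i 0 with hi | hi
    · refine ⟨MvPolynomial.X (-i - 1).toNat * f, ?_⟩
      rw [hτ]
      congr 2
      omega
    · obtain ⟨i, rfl⟩ := Int.eq_ofNat_of_zero_le hi
      rw [hann]
      exact Submodule.smul_mem _ _ ⟨_, rfl⟩
  obtain ⟨v, hv, hv0⟩ := Submodule.exists_mem_ne_zero_of_ne_bot hW0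
  obtain ⟨f, rfl⟩ : v ∈ LinearMap.range τ := hsurj ▸ Submodule.mem_top
  have h1 := one_mem_of_pderiv_closed (W := W.comap τ) (f := f) (fun i g hg => by
    have h2 : τ (MvPolynomial.pderiv i g) = ((-1 : ℂ) ^ (i : ℤ))⁻¹ • o i (τ g) := by
      rw [hann, smul_smul, inv_mul_cancel₀ (zpow_ne_zero _ (by norm_num)), one_smul]
    rw [Submodule.mem_comap, h2]
    exact W.smul_mem _ (hW _ _ hg)) hv
    (fun h => hv0 (by rw [h, map_zero]))
  rwa [Submodule.mem_comap, hτ1] at h1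

end Irreducible

theorem lsmul_bGen_comm (i j : ℤ) : Algebra.lsmul ℂ ℂ Fc (bGen i) * Algebra.lsmul ℂ ℂ Fc (bGen j) -
    Algebra.lsmul ℂ ℂ Fc (bGen j) * Algebra.lsmul ℂ ℂ Fc (bGen i) =
      algebraMap ℂ _ (if i + j + 1 = 0 then (-1) ^ i else 0) := by
  rw [← map_mul, ← map_mul, ← map_sub, bGen_comm, AlgHom.commutes]

theorem fc_simple : IsSimpleModule ClC Fc := by
  rw [isSimpleModule_iff]
  have : Nontrivial Fc := ⟨⟨vac, 0, vac_ne_zero⟩⟩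
  refine ⟨fun W => or_iff_not_imp_left.2 fun hW => ?_⟩
  have h1 := weyl_irreducible (o := fun i => Algebra.lsmul ℂ ℂ Fc (bGen i)) (v₀ := vac)
    lsmul_bGen_comm (fun i hi => bGen_smul_vac hi) (fun W h0 h => fc_induction_bGen h0 h)
    (W := W.restrictScalars ℂ) (fun i v hv => W.smul_mem _ hv)
    (fun h => hW ((Submodule.restrictScalars_eq_bot_iff ℂ ClC Fc).1 h))
  rw [Submodule.restrictScalars_mem] at h1
  refine eq_top_iff.2 fun w _ => ?_
  obtain ⟨x, rfl⟩ := fc_eq_smul_vac w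
  exact W.smul_mem x h1

end WeylAlgebra

/-! ### Existence of multicomponent generators -/

section Relabeling

variable {s r : ℕ}

/-- The field conjugate to a given one with respect to the commutation relations. -/
def FieldIdx.dual : FieldIdx s r → FieldIdx s r
  | .ch a ε => .ch a (-ε)
  | .ne c => .ne c

theorem FieldIdx.dual_dual (x : FieldIdx s r) : x.dual.dual = x := by
  cases x <;> simp [FieldIdx.dual]

/-- The nonzero values of the commutators. -/
def commVal : FieldIdx s r → ℤ → ℂ
  | .ch _ ε, _ => sg ε
  | .ne _, i => (-1) ^ i

theorem sg_one : sg 1 = 1 := by simp [sg]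

theorem sg_neg (ε : ℤˣ) : sg (-ε) = -sg ε := by simp [sg]

theorem sg_mul_self (ε : ℤˣ) : sg ε * sg ε = 1 := by
  rcases Int.units_eq_one_or ε with rfl | rfl <;> simp [sg]

theorem sg_ne_zero (ε : ℤˣ) : sg ε ≠ 0 := fun h => by simpa [h] using sg_mul_self ε

theorem commVal_ne_zero (x : FieldIdx s r) (i : ℤ) : commVal x i ≠ 0 := by
  cases x
  · exact sg_ne_zero _
  · exact zpow_ne_zero _ (by norm_num)

open Classical in
theorem commForm_eq (x y : FieldIdx s r) (i j : ℤ) :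
    commForm x y i j = if y = x.dual ∧ i + j + 1 = 0 then commVal x i else 0 := by
  cases x <;> cases y <;> simp [commForm, FieldIdx.dual, commVal, eq_comm, and_assoc]

theorem neg_one_zpow_mul_self (i : ℤ) : (-1 : ℂ) ^ i * (-1) ^ i = 1 := by
  rcases Int.even_or_odd i with h | h <;> simp [h.neg_one_zpow]

/-- The integers that stand for opposite half-integers have opposite parity; this makes the neutral
commutator antisymmetric. -/
theorem neg_one_zpow_reflect {i j : ℤ} (h : i + j + 1 = 0) : (-1 : ℂ) ^ j = -(-1) ^ i := by
  rw [show j = -1 - i by omega, zpow_sub₀ (by norm_num), zpow_neg_one]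
  rcases Int.even_or_odd i with hi | hi <;> simp [hi.neg_one_zpow]

theorem commForm_symm (x y : FieldIdx s r) (i j : ℤ) : commForm y x j i = -commForm x y i j := by
  rcases x with ⟨a, ε⟩ | c <;> rcases y with ⟨b, η⟩ | d <;> simp only [commForm, neg_zero]
  · by_cases h : a = b ∧ η = -ε ∧ i + j + 1 = 0
    · rw [if_pos h, if_pos ⟨h.1.symm, by rw [h.2.1, neg_neg], by omega⟩, h.2.1, sg_neg]
    · rw [if_neg h, if_neg, neg_zero]
      rintro ⟨h1, h2, h3⟩
      exact h ⟨h1.symm, by rw [h2, neg_neg], by omega⟩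
  · by_cases h : c = d ∧ i + j + 1 = 0
    · rw [if_pos h, if_pos ⟨h.1.symm, by omega⟩, neg_one_zpow_reflect h.2]
    · rw [if_neg h, if_neg, neg_zero]
      rintro ⟨h1, h3⟩
      exact h ⟨h1.symm, by omega⟩

theorem commForm_dual_ne_zero (x : FieldIdx s r) (i : ℤ) : commForm x x.dual i (-i - 1) ≠ 0 := by
  rw [commForm_eq, if_pos ⟨rfl, by omega⟩]
  exact commVal_ne_zero x i

/-- The annihilation operators of all components together are countably infinite, as are those of
the single field. At least one component is needed. -/
theorem exists_modes_equiv (hsr : 0 < s + r) : Nonempty (FieldIdx s r × ℕ ≃ ℕ) := by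
  let f : FieldIdx s r → (Fin s × ℤˣ) ⊕ Fin r := fun x =>
    match x with
    | .ch a ε => .inl (a, ε)
    | .ne c => .inr c
  have hf : Function.Injective f := by
    rintro (⟨a, ε⟩ | c) (⟨b, η⟩ | d) h <;> simp_all [f]
  have : Countable (FieldIdx s r) := hf.countable
  have : Nonempty (FieldIdx s r) := by
    rcases Nat.eq_zero_or_pos s with h | h
    · exact ⟨.ne ⟨0, by omega⟩⟩
    · exact ⟨.ch ⟨0, h⟩ 1⟩
  exact nonempty_equiv_of_countable

/-- The annihilation operators may be renamed by any bijection. The creation operator paired with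
each of them is then forced up to a scalar, and the scalar is fixed by the prescribed commutator. -/
theorem exists_relabeling (hsr : 0 < s + r) {A : Type*} [Ring A] [Algebra ℂ A] {b : ℤ → A}
    (hb : ∀ i j, b i * b j - b j * b i = algebraMap ℂ A (if i + j + 1 = 0 then (-1) ^ i else 0)) :
    ∃ B : FieldIdx s r → ℤ → A,
      Submodule.span ℂ (Set.range fun p : FieldIdx s r × ℤ => B p.1 p.2) =
        Submodule.span ℂ (Set.range b) ∧
      (∀ x y i j, B x i * B y j - B y j * B x i = algebraMap ℂ A (commForm x y i j)) ∧
      ∀ x i, 0 ≤ i → ∃ j, 0 ≤ j ∧ B x i = b j := by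
  classical
  obtain ⟨e⟩ := exists_modes_equiv hsr
  let p : FieldIdx s r → ℤ → ℤ := fun x i => (e (x, i.toNat) : ℤ)
  -- The sign cancels the commutator of the underlying pair of generators, and the second factor
  -- inserts the required commutator with the annihilator of the dual field.
  let c : FieldIdx s r → ℤ → ℂ := fun x i =>
    (-1) ^ p x.dual (-i - 1) * commForm x.dual x (-i - 1) i
  let B : FieldIdx s r → ℤ → A := fun x i =>
    if 0 ≤ i then b (p x i) else c x i • b (-p x.dual (-i - 1) - 1)
  have hp : ∀ x i, 0 ≤ p x i := fun x i => Int.natCast_nonneg _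
  have hc : ∀ x i, c x i ≠ 0 := fun x i => by
    refine mul_ne_zero (zpow_ne_zero _ (by norm_num)) ?_
    have := commForm_dual_ne_zero x.dual (-i - 1)
    rwa [FieldIdx.dual_dual, show -(-i - 1) - 1 = i by ring] at this
  have hpn : ∀ x y i j, 0 ≤ i → j < 0 → B x i * B y j - B y j * B x i =
      algebraMap ℂ A (commForm x y i j) := by
    intro x y i j hi hj
    simp only [B, hi, if_true, not_le.2 hj, if_false, mul_smul_comm, smul_mul_assoc, ← smul_sub]
    rw [hb, Algebra.smul_def, ← map_mul]
    congr 1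
    by_cases h : y = x.dual ∧ i + j + 1 = 0
    · obtain ⟨rfl, h⟩ := h
      have hji : -j - 1 = i := by omega
      simp only [c, FieldIdx.dual_dual, hji]
      rw [if_pos (by ring), mul_comm, ← mul_assoc, neg_one_zpow_mul_self, one_mul]
    · rw [commForm_eq x y, if_neg h, if_neg, mul_zero]
      intro h0
      -- A nonzero commutator means that the underlying generators form a dual pair; injectivity of
      -- `e` then identifies field and mode.
      have h1 : p x i = p y.dual (-j - 1) := by omega
      have h2 := e.injective (Nat.cast_injective (R := ℤ) h1)
      rw [Prod.mk.injEq] at h2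
      exact h ⟨by rw [h2.1, FieldIdx.dual_dual], by omega⟩
  refine ⟨B, ?_, ?_, ?_⟩
  · apply le_antisymm
    · rw [Submodule.span_le]
      rintro _ ⟨⟨x, i⟩, rfl⟩
      simp only [B]
      split_ifs
      · exact Submodule.subset_span ⟨_, rfl⟩
      · exact Submodule.smul_mem _ _ (Submodule.subset_span ⟨_, rfl⟩)
    · rw [Submodule.span_le]
      rintro _ ⟨n, rfl⟩
      rcases lt_or_ge n 0 with hn | hn
      · obtain ⟨⟨x, k⟩, hk⟩ := e.surjective (-n - 1).toNat
        have h1 : B x.dual (-k - 1) = c x.dual (-k - 1) • b n := by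
          simp only [B, if_neg (show ¬ (0 : ℤ) ≤ -k - 1 by omega), p, FieldIdx.dual_dual]
          rw [show (-(-(k : ℤ) - 1) - 1).toNat = k by omega, hk]
          congr 2
          omega
        have h2 : b n = (c x.dual (-k - 1))⁻¹ • B x.dual (-k - 1) := by
          rw [h1, smul_smul, inv_mul_cancel₀ (hc _ _), one_smul]
        rw [h2]
        exact Submodule.smul_mem _ _ (Submodule.subset_span ⟨(x.dual, -k - 1), rfl⟩)
      · obtain ⟨⟨x, k⟩, hk⟩ := e.surjective n.toNat
        refine Submodule.subset_span ⟨(x, k), ?_⟩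
        simp only [B, if_pos (Int.natCast_nonneg k), p, Int.toNat_natCast, hk]
        congr 1
        omega
  · intro x y i j
    rcases lt_or_ge i 0 with hi | hi <;> rcases lt_or_ge j 0 with hj | hj
    · simp only [B, not_le.2 hi, not_le.2 hj, if_false, mul_smul_comm, smul_mul_assoc]
      rw [smul_comm, ← smul_sub, ← smul_sub, hb, commForm_eq, if_neg (by
        have := hp x.dual (-i - 1)
        have := hp y.dual (-j - 1)
        omega), if_neg (by omega)]
      simp
    · rw [← neg_sub, hpn y x j i hj hi, commForm_symm, map_neg, neg_neg]
    · exact hpn x y i j hi hj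
    · simp only [B, hi, hj, if_true]
      have := hp x i
      have := hp y j
      rw [hb, commForm_eq, if_neg (by omega), if_neg (by omega)]
  · intro x i hi
    simp only [B, hi, if_true]
    exact ⟨_, hp x i, rfl⟩

theorem exists_multicomponent (hsr : 0 < s + r) :
    ∃ B : FieldIdx s r → ℤ → ClC, IsMulticomponent s r B := by
  obtain ⟨B, h1, h2, h3⟩ := exists_relabeling hsr bGen_comm
  refine ⟨B, h1, h2, fun x i hi => ?_⟩
  obtain ⟨j, hj, h⟩ := h3 x i hi
  rw [h]
  exact bGen_smul_vac hj

end Relabeling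

/-! ### Currents on an abstract Fock space of symplectic bosons -/

section BosonFock

variable {s r : ℕ} {M : Type*} [AddCommGroup M] [Module ℂ M]

/-- The operators `o x i` represent the modes of symplectic bosons, with cyclic vacuum `v₀`. -/
structure IsBosonFock (o : FieldIdx s r → ℤ → Module.End ℂ M) (v₀ : M) : Prop where
  comm : ∀ x y i j, o x i * o y j - o y j * o x i = commForm x y i j • 1
  kill : ∀ x i, 0 ≤ i → o x i v₀ = 0
  cyc : ∀ W : Submodule ℂ M, v₀ ∈ W → (∀ x i, ∀ v ∈ W, o x i v ∈ W) → W = ⊤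

/-- The normally ordered product of two modes. -/
def normalMode (o : FieldIdx s r → ℤ → Module.End ℂ M) (x : FieldIdx s r) (i : ℤ)
    (y : FieldIdx s r) (j : ℤ) : Module.End ℂ M :=
  if 0 ≤ i then o y j * o x i else o x i * o y j

/-- The first of the two fields whose normally ordered product is the current of a component. -/
def curX : Fin s ⊕ Fin r → FieldIdx s r
  | .inl a => .ch a 1
  | .inr c => .ne c

/-- The second of the two fields whose normally ordered product is the current of a component. -/
def curY : Fin s ⊕ Fin r → FieldIdx s r
  | .inl a => .ch a (-1)
  | .inr c => .ne c

/-- The coefficients of the current of a component. -/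
def curCoeff : Fin s ⊕ Fin r → ℤ → ℤ → ℂ
  | .inl _, _, _ => 1
  | .inr _, k, i => (1 / 2 : ℂ) * (-1) ^ (-(k - 1 - i) - 1)

/-- The summands of the modes of the current of a component. -/
def curTerm (o : FieldIdx s r → ℤ → Module.End ℂ M) (c : Fin s ⊕ Fin r) (k i : ℤ) :
    Module.End ℂ M :=
  curCoeff c k i • normalMode o (curX c) i (curY c) (k - 1 - i)

/-- The modes of the current of a component. -/
def cur (o : FieldIdx s r → ℤ → Module.End ℂ M) (c : Fin s ⊕ Fin r) (k : ℤ) : Module.End ℂ M :=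
  locSum (curTerm o c k)

/-- The charge of a field with respect to the current of a component, up to sign. -/
def wt : Fin s ⊕ Fin r → FieldIdx s r → ℂ
  | .inl a, .ch b ε => if a = b then sg ε else 0
  | .inr c, .ne d => if c = d then 1 else 0
  | .inl _, .ne _ => 0
  | .inr _, .ch _ _ => 0

/-- The modes that the current of a component has: only odd ones for a neutral field. -/
def curMode : Fin s ⊕ Fin r → ℤ → Prop
  | .inl _, _ => True
  | .inr _, k => Odd k

/-- The level of the Heisenberg algebra of a component. -/
def curLevel : Fin s ⊕ Fin r → ℤ → ℂ
  | .inl _, j => j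
  | .inr _, j => (j : ℂ) / 2

variable {o : FieldIdx s r → ℤ → Module.End ℂ M} {v₀ : M}

namespace IsBosonFock

theorem comm_apply (h : IsBosonFock o v₀) (x y : FieldIdx s r) (i j : ℤ) (v : M) :
    o x i (o y j v) = o y j (o x i v) + commForm x y i j • v := by
  have := LinearMap.congr_fun (h.comm x y i j) v
  simp only [LinearMap.sub_apply, Module.End.mul_apply, LinearMap.smul_apply,
    Module.End.one_apply] at this
  rw [← this, add_sub_cancel]

/-- The vectors killed by all sufficiently high modes form a subspace that contains the vacuum and
is stable under all modes, since modes of large total index commute. -/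
theorem smooth (h : IsBosonFock o v₀) (x : FieldIdx s r) (v : M) :
    ∃ N : ℤ, ∀ i, N ≤ i → o x i v = 0 := by
  let W : Submodule ℂ M :=
    { carrier := {v | ∃ N : ℤ, ∀ i, N ≤ i → o x i v = 0}
      zero_mem' := ⟨0, fun i _ => map_zero _⟩
      add_mem' := by
        rintro v w ⟨N, hN⟩ ⟨N', hN'⟩
        exact ⟨max N N', fun i hi => by
          rw [map_add, hN i (by omega), hN' i (by omega), add_zero]⟩
      smul_mem' := by
        rintro c v ⟨N, hN⟩
        exact ⟨N, fun i hi => by rw [map_smul, hN i hi, smul_zero]⟩ }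
  have hW : W = ⊤ := by
    refine h.cyc W ⟨0, h.kill x⟩ ?_
    rintro y j v ⟨N, hN⟩
    refine ⟨max N (-j), fun i hi => ?_⟩
    rw [h.comm_apply, hN i (by omega), map_zero, commForm_eq, if_neg (by omega), zero_smul, zero_add]
  exact (hW ▸ Submodule.mem_top : v ∈ W)

theorem locFin_normalMode (h : IsBosonFock o v₀) (x y : FieldIdx s r) (k : ℤ) :
    LocFin fun i => normalMode o x i y (k - 1 - i) := fun v => by
  obtain ⟨N, hN⟩ := h.smooth x v
  obtain ⟨N', hN'⟩ := h.smooth y v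
  refine (Set.finite_Icc (min (k - 1 - N') 0) (max N 0)).subset fun i hi => ?_
  by_contra hc
  refine hi ?_
  simp only [normalMode]
  simp only [Set.mem_Icc, not_and_or, not_le] at hc
  rcases lt_or_ge i 0 with h0 | h0
  · rw [if_neg (not_le.2 h0), Module.End.mul_apply, hN' _ (by omega), map_zero]
  · rw [if_pos h0, Module.End.mul_apply, hN _ (by omega), map_zero]

theorem locFin_curTerm (h : IsBosonFock o v₀) (c : Fin s ⊕ Fin r) (k : ℤ) :
    LocFin (curTerm o c k) :=
  (h.locFin_normalMode (curX c) (curY c) k).mono fun v i hi => by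
    simp [curTerm, hi]

theorem cur_apply (h : IsBosonFock o v₀) (c : Fin s ⊕ Fin r) (k : ℤ) (v : M) :
    cur o c k v = ∑ᶠ i, curTerm o c k i v :=
  locSum_apply (h.locFin_curTerm c k) v

/-- The two possible orderings differ by a scalar, so the bracket with a mode is the Leibniz rule in
either case. -/
theorem normalMode_bracket (h : IsBosonFock o v₀) (x y z : FieldIdx s r) (i j l : ℤ) (v : M) :
    normalMode o x i y j (o z l v) = o z l (normalMode o x i y j v) +
      (commForm y z j l • o x i v + commForm x z i l • o y j v) := by
  rw [normalMode]
  split_ifs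
  · simp only [Module.End.mul_apply]
    rw [h.comm_apply x z, map_add, h.comm_apply y z, map_smul]
    abel
  · simp only [Module.End.mul_apply]
    rw [h.comm_apply y z, map_add, h.comm_apply x z, map_smul]
    abel

/-- For a charged current at most one of the two contractions is nonzero. For a neutral one each
contributes `-1/2`, and they add up exactly because `k` is odd; for even `k` they would cancel. -/
theorem curCoeff_bracket (c : Fin s ⊕ Fin r) {k : ℤ} (hk : curMode c k) (z : FieldIdx s r) (l : ℤ)
    (v : ℤ → FieldIdx s r → M) :
    curCoeff c k (k + l) • commForm (curY c) z (-l - 1) l • v (k + l) (curX c) +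
      curCoeff c k (-l - 1) • commForm (curX c) z (-l - 1) l • v (k + l) (curY c) =
      -(wt c z • v (k + l) z) := by
  rcases c with a | c <;> rcases z with ⟨b, ε⟩ | d
  · simp only [curCoeff, curX, curY, commForm, wt, one_smul]
    by_cases hab : a = b
    · subst hab
      rcases Int.units_eq_one_or ε with rfl | rfl <;>
        simp [sg, show (1 : ℤˣ) ≠ -1 by decide, show -l - 1 + l + 1 = 0 by ring]
    · simp [hab]
  · simp [curX, curY, commForm, wt]
  · simp [curX, curY, commForm, wt]
  · simp only [curCoeff, curX, curY, commForm, wt]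
    by_cases hcd : c = d
    · subst hcd
      simp only [true_and, if_true, one_smul, show -l - 1 + l + 1 = 0 by ring]
      rw [smul_smul, smul_smul, ← add_smul, ← neg_one_smul ℂ (v (k + l) _)]
      congr 1
      have h1 : -(k - 1 - (k + l)) - 1 = l := by ring
      have h2 : -(k - 1 - (-l - 1)) - 1 = -k - l - 1 := by ring
      rw [h1, h2]
      have hk' : Odd k := hk
      rcases Int.even_or_odd l with hl | hl
      · have e1 : Odd (-l - 1) := by rcases hl with ⟨m, rfl⟩; exact ⟨-m - 1, by ring⟩
        have e2 : Even (-k - l - 1) := by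
          obtain ⟨m, rfl⟩ := hl; obtain ⟨n, rfl⟩ := hk'; exact ⟨-n - m - 1, by ring⟩
        rw [e1.neg_one_zpow, e2.neg_one_zpow, hl.neg_one_zpow]; norm_num
      · have e1 : Even (-l - 1) := by rcases hl with ⟨m, rfl⟩; exact ⟨-m - 1, by ring⟩
        have e2 : Odd (-k - l - 1) := by
          obtain ⟨m, rfl⟩ := hl; obtain ⟨n, rfl⟩ := hk'; exact ⟨-n - m - 2, by ring⟩
        rw [e1.neg_one_zpow, e2.neg_one_zpow, hl.neg_one_zpow]; norm_num
    · simp [hcd]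

theorem cur_bracket (h : IsBosonFock o v₀) (c : Fin s ⊕ Fin r) {k : ℤ} (hk : curMode c k)
    (z : FieldIdx s r) (l : ℤ) (v : M) :
    cur o c k (o z l v) = o z l (cur o c k v) - wt c z • o z (k + l) v := by
  have hs1 : (Function.support fun i => curCoeff c k i •
      (commForm (curY c) z (k - 1 - i) l • o (curX c) i v)).Finite :=
    (Set.finite_singleton (k + l)).subset fun i hi => by
      by_contra hc
      refine hi ?_
      simp only
      rw [commForm_eq, if_neg (fun h' => hc (by rw [Set.mem_singleton_iff]; omega)), zero_smul,
        smul_zero]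
  have hs2 : (Function.support fun i => curCoeff c k i •
      (commForm (curX c) z i l • o (curY c) (k - 1 - i) v)).Finite :=
    (Set.finite_singleton (-l - 1)).subset fun i hi => by
      by_contra hc
      refine hi ?_
      simp only
      rw [commForm_eq, if_neg (fun h' => hc (by rw [Set.mem_singleton_iff]; omega)), zero_smul,
        smul_zero]
  have hs0 : (Function.support fun i => o z l (curTerm o c k i v)).Finite :=
    (h.locFin_curTerm c k v).subset fun i hi h0 => hi (by simp only at h0; simp [h0])
  rw [h.cur_apply, h.cur_apply, map_finsum _ (h.locFin_curTerm c k v)]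
  have : ∀ i, curTerm o c k i (o z l v) = o z l (curTerm o c k i v) +
      (curCoeff c k i • (commForm (curY c) z (k - 1 - i) l • o (curX c) i v) +
        curCoeff c k i • (commForm (curX c) z i l • o (curY c) (k - 1 - i) v)) := by
    intro i
    rw [curTerm, LinearMap.smul_apply, h.normalMode_bracket, smul_add, smul_add,
      LinearMap.smul_apply, map_smul]
  simp only [this]
  -- In each of the two sums of contractions only the index whose partner is dual to `l` survives:
  -- `i = k + l` here, `i = -l - 1` below.
  have e1 := finsum_eq_single (fun i => curCoeff c k i •
      (commForm (curY c) z (k - 1 - i) l • o (curX c) i v)) (k + l) fun i hi => by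
    rw [commForm_eq, if_neg (fun h' => hi (by omega)), zero_smul, smul_zero]
  have e2 := finsum_eq_single (fun i => curCoeff c k i •
      (commForm (curX c) z i l • o (curY c) (k - 1 - i) v)) (-l - 1) fun i hi => by
    rw [commForm_eq, if_neg (fun h' => hi (by omega)), zero_smul, smul_zero]
  rw [finsum_add_distrib hs0 ((hs1.union hs2).subset (Function.support_add _ _)),
    finsum_add_distrib hs1 hs2, e1, e2, show k - 1 - (k + l) = -l - 1 by ring,
    show k - 1 - (-l - 1) = k + l by ring, curCoeff_bracket c hk z l fun i y => o y i v]
  exact (sub_eq_add_neg _ _).symm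

theorem cur_kill (h : IsBosonFock o v₀) (c : Fin s ⊕ Fin r) {k : ℤ} (hk : 0 ≤ k) :
    cur o c k v₀ = 0 := by
  rw [h.cur_apply]
  refine finsum_eq_zero_of_forall_eq_zero fun i => ?_
  rw [curTerm, LinearMap.smul_apply, normalMode]
  split_ifs with h0
  · rw [Module.End.mul_apply, h.kill _ _ h0, map_zero, smul_zero]
  · rw [Module.End.mul_apply, h.kill _ _ (by omega), map_zero, smul_zero]

/-- On the vacuum only the terms made of two creation operators remain, and these are finitely many.
-/
theorem cur_neg_vac (h : IsBosonFock o v₀) (c : Fin s ⊕ Fin r) (k : ℤ) :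
    cur o c (-k) v₀ = ∑ i ∈ Finset.Ico (-k) 0,
      curCoeff c (-k) i • o (curX c) i (o (curY c) (-k - 1 - i) v₀) := by
  rw [h.cur_apply, finsum_eq_sum_of_support_subset (s := Finset.Ico (-k) 0)]
  · refine Finset.sum_congr rfl fun i hi => ?_
    rw [curTerm, normalMode, if_neg (by simp only [Finset.mem_Ico] at hi; omega)]; rfl
  · intro i hi
    by_contra hc
    simp only [Finset.coe_Ico, Set.mem_Ico, not_and_or, not_le, not_lt] at hc
    refine hi ?_
    simp only
    rw [curTerm, LinearMap.smul_apply, normalMode]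
    split_ifs with h0
    · rw [Module.End.mul_apply, h.kill _ _ h0, map_zero, smul_zero]
    · rw [Module.End.mul_apply, h.kill _ _ (by omega), map_zero, smul_zero]

/-- A telescoping sum: the shifted and the unshifted range overlap up to terms where `F` vanishes,
leaving the `j` terms that were pushed across zero. -/
theorem sum_sub_shift {M : Type*} [AddCommGroup M] {F : ℤ → M} {j k : ℤ} (hj : 0 ≤ j) (hk : 0 ≤ k)
    (hF : ∀ i, i ≤ j - k - 1 → F i = 0) :
    ∑ i ∈ Finset.Ico (-k) 0, (F (i + j) - F i) = ∑ i ∈ Finset.Ico 0 j, F i := by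
  have h1 : ∑ i ∈ Finset.Ico (-k) 0, F (i + j) = ∑ i ∈ Finset.Ico (j - k) j, F i := by
    refine Finset.sum_bij' (fun i _ => i + j) (fun i _ => i - j) ?_ ?_ ?_ ?_ ?_
    · intro i hi; simp only [Finset.mem_Ico] at hi ⊢; omega
    · intro i hi; simp only [Finset.mem_Ico] at hi ⊢; omega
    · intro i _; ring
    · intro i _; ring
    · intro i _; rfl
  have h2 : ∑ i ∈ Finset.Ico (j - k) j, F i = ∑ i ∈ Finset.Ico (-k) j, F i := by
    refine Finset.sum_subset (fun i hi => ?_) fun i hi hi' => hF i ?_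
    · simp only [Finset.mem_Ico] at hi ⊢; omega
    · simp only [Finset.mem_Ico] at hi hi'; omega
  rw [Finset.sum_sub_distrib, h1, h2,
    ← Finset.Ico_union_Ico_eq_Ico (show -k ≤ 0 by omega) hj, Finset.sum_union, add_sub_cancel_left]
  refine Finset.disjoint_left.2 fun i hi hi' => ?_
  simp only [Finset.mem_Ico] at hi hi'
  omega

theorem wt_curX (c : Fin s ⊕ Fin r) : wt c (curX c) = 1 := by
  rcases c with a | c <;> simp [wt, curX, sg]

theorem wt_of_ne {c d : Fin s ⊕ Fin r} (h : c ≠ d) : wt c (curX d) = 0 ∧ wt c (curY d) = 0 := by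
  rcases c with a | c <;> rcases d with b | d <;> simp_all [wt, curX, curY]

/-- With this sign rule the two contributions of the bracket become values of one function at
shifted indices, so that they telescope. -/
theorem curCoeff_shift (c : Fin s ⊕ Fin r) {j : ℤ} (hj : curMode c j) (k i : ℤ) :
    curCoeff c k i = -(wt c (curY c) * curCoeff c k (i + j)) := by
  rcases c with a | c
  · simp [curCoeff, wt, curY, sg]
  · simp only [curCoeff, wt, curY, if_true, one_mul]
    have hj' : Odd j := hj
    rw [show -(k - 1 - (i + j)) - 1 = (-(k - 1 - i) - 1) + j by ring,
      zpow_add₀ (by norm_num), hj'.neg_one_zpow]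
    ring

theorem curCoeff_diag (c : Fin s ⊕ Fin r) {j : ℤ} (hj : curMode c j) (i : ℤ) :
    wt c (curY c) * (curCoeff c (-j) i * commForm (curX c) (curY c) i (-1 - i)) =
      -(curLevel c 1) := by
  rcases c with a | c
  · simp [curCoeff, wt, curY, curX, sg, commForm, curLevel]
  · have hj' : Odd j := hj
    simp only [wt, curCoeff, curX, curY, commForm, curLevel, if_true, true_and, one_mul,
      show i + (-1 - i) + 1 = 0 by ring, show -(-j - 1 - i) - 1 = j + i by ring]
    rw [zpow_add₀ (by norm_num), hj'.neg_one_zpow]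
    have := neg_one_zpow_mul_self i
    linear_combination (-1 / 2 : ℂ) * this

/-- The Heisenberg relations, on the vacuum. -/
theorem cur_cur_vac (h : IsBosonFock o v₀) (c d : Fin s ⊕ Fin r) {j k : ℤ} (hj : 0 ≤ j)
    (hk : 0 ≤ k) (hcj : curMode c j) :
    cur o c j (cur o d (-k) v₀) = (if c = d ∧ j = k then -curLevel c j else 0) • v₀ := by
  classical
  rw [h.cur_neg_vac, map_sum]
  have hterm : ∀ i, cur o c j (curCoeff d (-k) i • o (curX d) i (o (curY d) (-k - 1 - i) v₀)) =
      -((curCoeff d (-k) i * wt c (curX d)) • o (curX d) (i + j) (o (curY d) (-k - 1 - i) v₀) +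
        (curCoeff d (-k) i * wt c (curY d)) •
          o (curX d) i (o (curY d) (j - k - 1 - i) v₀)) := by
    intro i
    rw [map_smul, h.cur_bracket c hcj, h.cur_bracket c hcj, h.cur_kill c hj, map_zero, zero_sub,
      map_neg, map_smul, add_comm j i, show j + (-k - 1 - i) = j - k - 1 - i by ring]
    module
  rw [Finset.sum_congr rfl fun i _ => hterm i]
  by_cases hcd : c = d
  · subst hcd
    set w := wt c (curY c) with hw
    -- Acting on the first or on the second creation operator produces the same family of vectors,
    -- displaced by `j`, with opposite signs.
    set F : ℤ → M := fun i => curCoeff c (-k) i • o (curX c) i (o (curY c) (j - k - 1 - i) v₀)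
      with hF
    have h1 : ∀ i, -((curCoeff c (-k) i * wt c (curX c)) •
        o (curX c) (i + j) (o (curY c) (-k - 1 - i) v₀) + (curCoeff c (-k) i * w) •
          o (curX c) i (o (curY c) (j - k - 1 - i) v₀)) = w • (F (i + j) - F i) := by
      intro i
      simp only [hF]
      rw [wt_curX, mul_one, smul_sub, smul_smul, smul_smul,
        show j - k - 1 - (i + j) = -k - 1 - i by ring, mul_comm _ w, neg_add, ← neg_smul,
        ← sub_eq_add_neg]
      congr 2
      rw [curCoeff_shift c hcj (-k) i, neg_neg]
    rw [Finset.sum_congr rfl fun i _ => h1 i, ← Finset.smul_sum, sum_sub_shift hj hk]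
    · by_cases hjk : j = k
      · subst hjk
        rw [if_pos ⟨rfl, rfl⟩, Finset.smul_sum]
        -- For `j = k` each remaining term is an annihilator in front of its dual creator. It equals
        -- the contraction, independently of `i`, so the `j` terms give the level times `j`.
        have h2 : ∀ i ∈ Finset.Ico 0 j, w • F i = -curLevel c 1 • v₀ := by
          intro i hi
          simp only [Finset.mem_Ico] at hi
          simp only [hF]
          rw [show j - j - 1 - i = -1 - i by ring, h.comm_apply, h.kill _ _ hi.1, map_zero,
            zero_add, smul_smul, smul_smul, mul_assoc, curCoeff_diag c hcj]
        rw [Finset.sum_congr rfl h2, Finset.sum_const, ← Nat.cast_smul_eq_nsmul ℂ, smul_smul,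
          Int.card_Ico]
        congr 1
        have h3 : (((j - 0).toNat : ℕ) : ℂ) = (j : ℂ) := by
          rw [sub_zero, ← Int.cast_natCast, Int.toNat_of_nonneg hj]
        rw [h3]
        rcases c with a | c <;> simp [curLevel]
        ring
      · rw [if_neg (fun h' => hjk h'.2), zero_smul, Finset.sum_eq_zero, smul_zero]
        intro i hi
        simp only [Finset.mem_Ico] at hi
        simp only [hF]
        rw [h.comm_apply, h.kill _ _ hi.1, map_zero, commForm_eq, if_neg (by omega), zero_smul,
          add_zero, smul_zero]
    · intro i hi
      simp only [hF]
      rw [h.kill _ _ (by omega), map_zero, smul_zero]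
  · rw [if_neg (fun h' => hcd h'.1), zero_smul]
    refine Finset.sum_eq_zero fun i _ => ?_
    rw [(wt_of_ne hcd).1, (wt_of_ne hcd).2]
    simp

end IsBosonFock

theorem curTerm_inl (o : FieldIdx s r → ℤ → Module.End ℂ M) (a : Fin s) (k i : ℤ) :
    curTerm o (.inl a) k i = normalMode o (.ch a 1) i (.ch a (-1)) (k - 1 - i) :=
  one_smul ℂ _

end BosonFock

/-! ### The Weyl module as a Fock space -/

section Multicomponent

variable {s r : ℕ} {B : FieldIdx s r → ℤ → ClC}

theorem bGen_mem_span (hB : IsMulticomponent s r B) (i : ℤ) :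
    bGen i ∈ Submodule.span ℂ (Set.range fun p : FieldIdx s r × ℤ => B p.1 p.2) := by
  rw [hB.span_eq]
  exact Submodule.subset_span ⟨i, rfl⟩

theorem isBosonFock_op (hB : IsMulticomponent s r B) : IsBosonFock (op B) vac where
  comm x y i j := by
    have := congrArg (Algebra.lsmul ℂ ℂ Fc) (hB.comm x y i j)
    rw [map_sub, map_mul, map_mul, AlgHom.commutes, Algebra.algebraMap_eq_smul_one] at this
    exact this
  kill x i hi := hB.vac x i hi
  cyc W h0 hW := by
    refine fc_induction_bGen h0 fun i v hv => ?_
    have h1 : Submodule.span ℂ (Set.range fun p : FieldIdx s r × ℤ => B p.1 p.2) ≤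
        W.comap ((LinearMap.applyₗ v).comp (Algebra.lsmul ℂ ℂ Fc).toLinearMap) := by
      rw [Submodule.span_le]
      rintro _ ⟨p, rfl⟩
      exact hW p.1 p.2 v hv
    exact h1 (bGen_mem_span hB i)

theorem alphaCh_eq_cur (a : Fin s) (k : ℤ) : alphaCh B a k = cur (op B) (.inl a) k := by
  rw [alphaCh, cur]
  congr 1
  funext i
  exact (curTerm_inl (op B) a k i).symm

theorem alphaNe_eq_cur (c : Fin r) (k : ℤ) : alphaNe B c k = cur (op B) (.inr c) k := rfl

end Multicomponent

/-! ### Invariant subspaces and brackets of odd operators -/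

section General

variable {M : Type*} [AddCommGroup M] [Module ℂ M]

/-- The vectors on which all but finitely many operators of a family vanish. -/
def finSupp {ι : Type*} (f : ι → Module.End ℂ M) : Submodule ℂ M where
  carrier := {v | (Function.support fun i => f i v).Finite}
  zero_mem' := by simp
  add_mem' hv hw := (hv.union hw).subset fun i hi => by
    by_contra hc
    simp only [Set.mem_union, Function.mem_support, not_or, not_not] at hc
    exact hi (by simp only; rw [map_add, hc.1, hc.2, add_zero])
  smul_mem' c _ hv := hv.subset fun i hi h0 => hi (by simp only at h0 ⊢; rw [map_smul, h0, smul_zero])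

theorem locFin_of_finSupp {ι : Type*} {f : ι → Module.End ℂ M} (h : finSupp f = ⊤) : LocFin f :=
  fun v => (h ▸ Submodule.mem_top : v ∈ finSupp f)

/-- The vectors at which two operators agree. -/
def eqLoc (f g : Module.End ℂ M) : Submodule ℂ M := LinearMap.eqLocus f g

/-- Moving `m` past two odd factors changes the sign twice, so `x d` has an ordinary commutator with
`m`, namely the contraction of `d` with `m`. -/
theorem bracket_mul_of_anticomm {c δ : ℂ} {x d m : Module.End ℂ M} (h1 : d * m + m * d = δ • 1)
    (h2 : x * m + m * x = 0) : (c • (x * d)) * m = m * (c • (x * d)) + (c * δ) • x := by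
  have h3 : x * d * m = m * (x * d) + δ • x := by
    rw [mul_assoc, eq_sub_of_add_eq h1, mul_sub, mul_smul_comm, mul_one, ← mul_assoc,
      eq_neg_of_add_eq_zero_left h2, neg_mul, sub_neg_eq_add, mul_assoc, add_comm]
  rw [smul_mul_assoc, h3, smul_add, mul_smul_comm, smul_smul]

theorem bracket_mul_of_anticomm' {c δ : ℂ} {x d e : Module.End ℂ M} (h1 : e * x + x * e = δ • 1)
    (h2 : d * e + e * d = 0) : (c • (x * d)) * e = e * (c • (x * d)) - (c * δ) • d := by
  have h3 : x * d * e = e * (x * d) - δ • d := by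
    rw [mul_assoc, eq_neg_of_add_eq_zero_left h2, mul_neg, ← mul_assoc,
      eq_sub_of_add_eq' h1, sub_mul, smul_mul_assoc, one_mul, mul_assoc, neg_sub]
  rw [smul_mul_assoc, h3, smul_sub, mul_smul_comm, smul_smul]

theorem smul_sub_of_mul_self {c : ℂ} (h : c * c = 1) (u v : M) :
    (1 : ℂ) • u - c • c • v = c • c • ((1 : ℂ) • u - v) := by
  rw [smul_smul, smul_smul, h]
  module

theorem mem_eqLoc {f g : Module.End ℂ M} {v : M} : v ∈ eqLoc f g ↔ f v = g v := Iff.rfl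

theorem eq_of_eqLoc {f g : Module.End ℂ M} (h : eqLoc f g = ⊤) : f = g :=
  LinearMap.ext fun _ => mem_eqLoc.1 (h ▸ Submodule.mem_top)

end General

/-! ### Operators on `C_{s,r}`: times, Grassmann variables, signs and charges -/

section Boson

variable {s r : ℕ}

theorem one_tmul_mem {W : Submodule ℂ (CSpace s r)} (h1 : (1 ⊗ₜ 1 : CSpace s r) ∈ W)
    (hX : ∀ i, ∀ v ∈ W, mulXi i v ∈ W) (g : Grass s r) : (1 ⊗ₜ g : CSpace s r) ∈ W := by
  induction g using CliffordAlgebra.left_induction with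
  | algebraMap c =>
    rw [Algebra.algebraMap_eq_smul_one, TensorProduct.tmul_smul]
    exact W.smul_mem _ h1
  | add x y hx hy => rw [TensorProduct.tmul_add]; exact W.add_mem hx hy
  | ι_mul x m hx =>
    induction m using Finsupp.induction_linear with
    | zero => rw [map_zero, zero_mul, TensorProduct.tmul_zero]; exact W.zero_mem
    | add a b ha hb => rw [map_add, add_mul, TensorProduct.tmul_add]; exact W.add_mem ha hb
    | single i c =>
      have := W.smul_mem c (hX i _ hx)
      rw [mulXi, LinearMap.lTensor_tmul, LinearMap.mulLeft_apply, ← TensorProduct.tmul_smul,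
        ← smul_mul_assoc, ← map_smul, Finsupp.smul_single, smul_eq_mul, mul_one] at this
      exact this

theorem cSpace_induction_times {W : Submodule ℂ (CSpace s r)}
    (hg : ∀ g : Grass s r, (1 ⊗ₜ g : CSpace s r) ∈ W) (hT : ∀ i, ∀ v ∈ W, mulT i v ∈ W) :
    W = ⊤ := by
  refine eq_top_iff.2 fun v _ => ?_
  induction v using TensorProduct.induction_on with
  | zero => exact W.zero_mem
  | add x y hx hy => exact W.add_mem (hx trivial) (hy trivial)
  | tmul p g =>
    induction p using MvPolynomial.induction_on with
    | C c =>
      rw [← MvPolynomial.algebraMap_eq, Algebra.algebraMap_eq_smul_one]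
      exact W.smul_mem c (hg g)
    | add p q hp hq =>
      rw [TensorProduct.add_tmul]; exact W.add_mem (hp trivial) (hq trivial)
    | mul_X p i hp =>
      have := hT i _ (hp trivial)
      rw [mulT, LinearMap.rTensor_tmul, LinearMap.mulLeft_apply, mul_comm] at this
      exact this

/-- The space is generated from `1` by multiplications by times and Grassmann variables. Operator
identities and finiteness statements are proved by checking `1` and the behaviour under these
multiplications. -/
theorem cSpace_induction {W : Submodule ℂ (CSpace s r)} (h1 : (1 ⊗ₜ 1 : CSpace s r) ∈ W)
    (hT : ∀ i, ∀ v ∈ W, mulT i v ∈ W) (hX : ∀ i, ∀ v ∈ W, mulXi i v ∈ W) : W = ⊤ :=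
  cSpace_induction_times (one_tmul_mem h1 hX) hT

/-! ### Times -/

theorem commute_rTensor_lTensor (f : Module.End ℂ (MvPolynomial (TIdx s r) ℂ))
    (g : Module.End ℂ (Grass s r)) :
    Commute (LinearMap.rTensor (Grass s r) f) (LinearMap.lTensor (MvPolynomial (TIdx s r) ℂ) g) := by
  refine TensorProduct.ext' fun p g => ?_
  simp [Module.End.mul_apply]

theorem mulT_comm (i j : TIdx s r) : Commute (mulT i) (mulT j) := by
  rw [Commute, SemiconjBy, mulT, mulT, ← LinearMap.rTensor_mul, ← LinearMap.rTensor_mul]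
  congr 1
  refine LinearMap.ext fun f => ?_
  simp [Module.End.mul_apply, mul_left_comm]

theorem pderiv_comm {τ : Type*} (i j : τ) (f : MvPolynomial τ ℂ) :
    MvPolynomial.pderiv i (MvPolynomial.pderiv j f) =
      MvPolynomial.pderiv j (MvPolynomial.pderiv i f) := by
  classical
  have h : ⁅MvPolynomial.pderiv (R := ℂ) i, MvPolynomial.pderiv (R := ℂ) j⁆ =
      (0 : Derivation ℂ (MvPolynomial τ ℂ) (MvPolynomial τ ℂ)) := by
    refine MvPolynomial.derivation_ext fun k => ?_
    rw [Derivation.commutator_apply, MvPolynomial.pderiv_X, MvPolynomial.pderiv_X, Pi.single_apply,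
      Pi.single_apply]
    split_ifs <;> simp
  have := congrArg (fun D => D f) h
  simp only [Derivation.commutator_apply, Derivation.coe_zero, Pi.zero_apply] at this
  exact sub_eq_zero.1 this

theorem pderiv_X_mul {τ : Type*} [DecidableEq τ] (i j : τ) (f : MvPolynomial τ ℂ) :
    MvPolynomial.pderiv i (MvPolynomial.X j * f) =
      MvPolynomial.X j * MvPolynomial.pderiv i f + if i = j then f else 0 := by
  rw [Derivation.leibniz, smul_eq_mul, smul_eq_mul]
  by_cases h : i = j
  · subst h
    rw [MvPolynomial.pderiv_X_self, if_pos rfl, mul_one]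
  · rw [MvPolynomial.pderiv_X_of_ne (Ne.symm h), if_neg h, mul_zero]

theorem dT_comm (i j : TIdx s r) : Commute (dT i) (dT j) := by
  rw [Commute, SemiconjBy, dT, dT, ← LinearMap.rTensor_mul, ← LinearMap.rTensor_mul]
  exact congrArg _ (LinearMap.ext fun f => pderiv_comm i j f)

theorem dT_mulT [DecidableEq (TIdx s r)] (i j : TIdx s r) :
    dT i * mulT j = mulT j * dT i + (if i = j then (1 : ℂ) else 0) • 1 := by
  refine TensorProduct.ext' fun p g => ?_
  simp only [dT, mulT, Module.End.mul_apply, LinearMap.add_apply, LinearMap.rTensor_tmul,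
    LinearMap.mulLeft_apply, LinearMap.smul_apply, Module.End.one_apply]
  refine (congrArg (· ⊗ₜ[ℂ] g) (pderiv_X_mul i j p)).trans ?_
  refine (TensorProduct.add_tmul _ _ _).trans (congrArg₂ (· + ·) rfl ?_)
  split_ifs
  · exact (one_smul ℂ _).symm
  · rw [TensorProduct.zero_tmul, zero_smul]

theorem mulT_mulXi (i : TIdx s r) (j : XiIdx s r) : Commute (mulT i) (mulXi j) :=
  commute_rTensor_lTensor _ _
theorem mulT_dXi (i : TIdx s r) (j : XiIdx s r) : Commute (mulT i) (dXi j) :=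
  commute_rTensor_lTensor _ _
theorem mulT_SOp (i : TIdx s r) (p : ℕ) : Commute (mulT i) (SOp p) :=
  commute_rTensor_lTensor _ _
theorem dT_mulXi (i : TIdx s r) (j : XiIdx s r) : Commute (dT i) (mulXi j) :=
  commute_rTensor_lTensor _ _
theorem dT_dXi (i : TIdx s r) (j : XiIdx s r) : Commute (dT i) (dXi j) :=
  commute_rTensor_lTensor _ _
theorem dT_SOp (i : TIdx s r) (p : ℕ) : Commute (dT i) (SOp p) :=
  commute_rTensor_lTensor _ _

theorem dT_one (i : TIdx s r) : dT i (1 ⊗ₜ 1 : CSpace s r) = 0 := by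
  simp [dT]

/-! ### Grassmann variables -/

theorem mulXi_mulXi (i j : XiIdx s r) :
    mulXi i * mulXi j + mulXi j * mulXi i = (0 : Module.End ℂ (CSpace s r)) := by
  rw [mulXi, mulXi, ← LinearMap.lTensor_mul, ← LinearMap.lTensor_mul, ← LinearMap.lTensor_add]
  convert LinearMap.lTensor_zero (M := MvPolynomial (TIdx s r) ℂ) using 1
  refine congrArg _ (LinearMap.ext fun g => ?_)
  simp [Module.End.mul_apply, ← mul_assoc, ← add_mul]

theorem dXi_dXi (i j : XiIdx s r) :
    dXi i * dXi j + dXi j * dXi i = (0 : Module.End ℂ (CSpace s r)) := by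
  rw [dXi, dXi, ← LinearMap.lTensor_mul, ← LinearMap.lTensor_mul, ← LinearMap.lTensor_add]
  convert LinearMap.lTensor_zero (M := MvPolynomial (TIdx s r) ℂ) using 1
  refine congrArg _ (LinearMap.ext fun g => ?_)
  rw [LinearMap.add_apply, Module.End.mul_apply, Module.End.mul_apply,
    CliffordAlgebra.contractLeft_comm, neg_add_cancel]
  rfl

theorem dXi_mulXi [DecidableEq (XiIdx s r)] (i j : XiIdx s r) :
    dXi i * mulXi j + mulXi j * dXi i =
      (if i = j then (1 : ℂ) else 0) • (1 : Module.End ℂ (CSpace s r)) := by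
  refine TensorProduct.ext' fun p g => ?_
  simp only [dXi, mulXi, LinearMap.add_apply, Module.End.mul_apply, LinearMap.lTensor_tmul,
    LinearMap.mulLeft_apply, LinearMap.smul_apply, Module.End.one_apply]
  rw [← TensorProduct.tmul_add, ← TensorProduct.tmul_smul]
  congr 1
  have := CliffordAlgebra.contractLeft_ι_mul (Q := (0 : QuadraticForm ℂ (XiIdx s r →₀ ℂ)))
    (d := Finsupp.lapply i) (Finsupp.single j 1) g
  refine (congrArg₂ (· + ·) this rfl).trans ?_
  rw [sub_add_cancel]
  congr 1
  simp [Finsupp.single_apply, eq_comm]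

theorem dXi_one (i : XiIdx s r) : dXi i (1 ⊗ₜ 1 : CSpace s r) = 0 := by
  rw [dXi, LinearMap.lTensor_tmul, CliffordAlgebra.contractLeft_one, TensorProduct.tmul_zero]

theorem mulXi_mulXi_apply (i j : XiIdx s r) (v : CSpace s r) :
    mulXi i (mulXi j v) = -mulXi j (mulXi i v) :=
  eq_neg_of_add_eq_zero_left (LinearMap.congr_fun (mulXi_mulXi i j) v)

theorem dXi_mulXi_apply [DecidableEq (XiIdx s r)] (i j : XiIdx s r) (v : CSpace s r) :
    dXi i (mulXi j v) = (if i = j then (1 : ℂ) else 0) • v - mulXi j (dXi i v) :=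
  eq_sub_of_add_eq (LinearMap.congr_fun (dXi_mulXi i j) v)

/-- Each vector involves finitely many Grassmann variables: a multiplication by `ξ_i` adds at most
the index `i` to the support. -/
theorem locFin_dXi : LocFin (dXi (s := s) (r := r)) := by
  classical
  refine locFin_of_finSupp (cSpace_induction ?_ ?_ ?_)
  · change Set.Finite _
    simp [dXi_one]
  · intro i v hv
    refine Set.Finite.subset hv fun j hj h0 => hj ?_
    have := LinearMap.congr_fun (mulT_dXi i j).eq v
    simp only [Module.End.mul_apply] at this h0 ⊢
    rw [← this, h0, map_zero]
  · intro i v hv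
    refine (Set.Finite.union hv (Set.finite_singleton i)).subset fun j hj => ?_
    by_contra hc
    simp only [Set.mem_union, Function.mem_support, not_or, not_not, Set.mem_singleton_iff] at hc
    exact hj (by simp only; rw [dXi_mulXi_apply, if_neg hc.2, hc.1, map_zero, zero_smul, sub_zero])

/-! ### The signs `S` -/

/-- The sign of a Grassmann variable of position `q` under `SOp p`. -/
def sSign (p q : ℕ) : ℂ := if q < p then -1 else 1

theorem sSign_mul_self (p q : ℕ) : sSign p q * sSign p q = 1 := by
  rw [sSign]; split_ifs <;> norm_num

theorem SOp_mulXi (p : ℕ) (i : XiIdx s r) :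
    SOp p * mulXi i = sSign p (compXi i) • (mulXi i * SOp p) := by
  refine TensorProduct.ext' fun f g => ?_
  simp only [SOp, mulXi, Module.End.mul_apply, LinearMap.lTensor_tmul, LinearMap.mulLeft_apply,
    LinearMap.smul_apply, AlgHom.toLinearMap_apply, map_mul, ExteriorAlgebra.map_apply_ι]
  rw [← TensorProduct.tmul_smul, ← smul_mul_assoc, ← map_smul, Finsupp.lsum_single,
    LinearMap.smul_apply, Finsupp.lsingle_apply]
  rfl

theorem SOp_one (p : ℕ) : SOp p (1 ⊗ₜ 1 : CSpace s r) = 1 ⊗ₜ 1 := by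
  simp [SOp]

theorem SOp_mulXi_apply (p : ℕ) (i : XiIdx s r) (v : CSpace s r) :
    SOp p (mulXi i v) = sSign p (compXi i) • mulXi i (SOp p v) :=
  LinearMap.congr_fun (SOp_mulXi p i) v

theorem SOp_mulT_apply (p : ℕ) (i : TIdx s r) (v : CSpace s r) :
    SOp p (mulT i v) = mulT i (SOp p v) :=
  (LinearMap.congr_fun (mulT_SOp i p).eq v).symm

theorem SOp_mul_self (p : ℕ) : SOp p * SOp p = (1 : Module.End ℂ (CSpace s r)) := by
  refine eq_of_eqLoc (cSpace_induction ?_ ?_ ?_)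
  · simp [mem_eqLoc, SOp_one]
  · intro i v hv
    simp only [mem_eqLoc, Module.End.mul_apply, Module.End.one_apply] at hv ⊢
    rw [SOp_mulT_apply, SOp_mulT_apply, hv]
  · intro i v hv
    simp only [mem_eqLoc, Module.End.mul_apply, Module.End.one_apply] at hv ⊢
    rw [SOp_mulXi_apply, map_smul, SOp_mulXi_apply, smul_smul, sSign_mul_self, one_smul, hv]

theorem SOp_comm (p q : ℕ) : Commute (SOp p) (SOp q : Module.End ℂ (CSpace s r)) := by
  refine eq_of_eqLoc (cSpace_induction ?_ ?_ ?_)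
  · simp [mem_eqLoc, SOp_one]
  · intro i v hv
    simp only [mem_eqLoc, Module.End.mul_apply] at hv ⊢
    rw [SOp_mulT_apply, SOp_mulT_apply, hv, SOp_mulT_apply, SOp_mulT_apply]
  · intro i v hv
    simp only [mem_eqLoc, Module.End.mul_apply] at hv ⊢
    rw [SOp_mulXi_apply, map_smul, SOp_mulXi_apply, hv, SOp_mulXi_apply, map_smul, SOp_mulXi_apply,
      smul_comm]

/-- A derivative picks up the same sign as its variable, because the sign is its own inverse. -/
theorem SOp_dXi (p : ℕ) (i : XiIdx s r) :
    SOp p * dXi i = sSign p (compXi i) • (dXi i * SOp p) := by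
  classical
  refine eq_of_eqLoc (cSpace_induction ?_ ?_ ?_)
  · simp [mem_eqLoc, SOp_one, dXi_one]
  · intro j v hv
    have h1 := fun w => LinearMap.congr_fun (mulT_dXi j i).eq w
    simp only [mem_eqLoc, Module.End.mul_apply, LinearMap.smul_apply] at hv h1 ⊢
    rw [← h1, SOp_mulT_apply, hv, SOp_mulT_apply, map_smul, h1]
  · intro j v hv
    simp only [mem_eqLoc, Module.End.mul_apply, LinearMap.smul_apply] at hv ⊢
    rw [dXi_mulXi_apply, map_sub, map_smul, SOp_mulXi_apply, hv, SOp_mulXi_apply, map_smul,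
      map_smul, dXi_mulXi_apply]
    split_ifs with h
    · subst h
      exact smul_sub_of_mul_self (sSign_mul_self p (compXi i)) _ _
    · generalize sSign p (compXi i) = c
      generalize sSign p (compXi j) = d
      module

/-! ### The charges `T` -/

theorem mulXiCh_of_ne (a : Fin s) {k : ℤ} (h : k ≠ 0) :
    mulXiCh (r := r) a k = mulXi (.inl (a, ⟨k, h⟩)) := dif_pos h
theorem dXiCh_of_ne (a : Fin s) {k : ℤ} (h : k ≠ 0) :
    dXiCh (r := r) a k = dXi (.inl (a, ⟨k, h⟩)) := dif_pos h
theorem dXiCh_zero (a : Fin s) : dXiCh (r := r) a 0 = 0 := by simp [dXiCh]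
theorem mulXiCh_zero (a : Fin s) : mulXiCh (r := r) a 0 = 0 := by simp [mulXiCh]

/-- The charge of a Grassmann variable. -/
def xiCharge (a : Fin s) : XiIdx s r → ℤ
  | .inl (b, k) => if a = b then (if 0 < (k : ℤ) then -1 else 1) else 0
  | .inr _ => 0

theorem locFin_TTerm (a : Fin s) : LocFin (TTerm (r := r) a) := fun v => by
  refine ((locFin_dXi v).image fun i : XiIdx s r => match i with
    | .inl p => (p.2 : ℤ)
    | .inr _ => 0).subset fun k hk => ?_
  by_cases h : k = 0
  · subst h
    exact absurd (by simp [TTerm, dXiCh_zero]) hk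
  · refine ⟨.inl (a, ⟨k, h⟩), fun h0 => hk ?_, rfl⟩
    simp only [TTerm] at h0 ⊢
    rw [LinearMap.smul_apply, Module.End.mul_apply, dXiCh_of_ne a h, h0, map_zero, smul_zero]

theorem TOp_apply (a : Fin s) (v : CSpace s r) : TOp a v = ∑ᶠ k, TTerm a k v :=
  locSum_apply (locFin_TTerm a) v

/-- `ξ ∂_ξ` is the number operator of one variable, so its bracket with a variable is that variable
or zero; summation over `k` gives the charge. -/
theorem TTerm_mulXi (a : Fin s) (k : ℤ) (i : XiIdx s r) (v : CSpace s r) :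
    TTerm a k (mulXi i v) = mulXi i (TTerm a k v) +
      (if h : k ≠ 0 then (if (.inl (a, ⟨k, h⟩) : XiIdx s r) = i then (xiCharge a i : ℂ) else 0)
        else 0) • mulXi i v := by
  classical
  by_cases h : k = 0
  · subst h; simp [TTerm, dXiCh_zero]
  · rw [dif_pos h, TTerm, mulXiCh_of_ne a h, dXiCh_of_ne a h]
    refine (LinearMap.congr_fun (bracket_mul_of_anticomm (dXi_mulXi _ _) (mulXi_mulXi _ _)) v).trans
      ((LinearMap.add_apply _ _ v).trans (congrArg₂ (· + ·) rfl ?_))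
    by_cases hi : (.inl (a, ⟨k, h⟩) : XiIdx s r) = i
    · subst hi
      rw [if_pos rfl, if_pos rfl, LinearMap.smul_apply, mul_one]
      congr 1
      simp [xiCharge]
    · rw [if_neg hi, if_neg hi, mul_zero, zero_smul, zero_smul, LinearMap.zero_apply]

theorem TTerm_dXi (a : Fin s) (k : ℤ) (i : XiIdx s r) (v : CSpace s r) :
    TTerm a k (dXi i v) = dXi i (TTerm a k v) -
      (if h : k ≠ 0 then (if (.inl (a, ⟨k, h⟩) : XiIdx s r) = i then (xiCharge a i : ℂ) else 0)
        else 0) • dXi i v := by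
  classical
  by_cases h : k = 0
  · subst h; simp [TTerm, dXiCh_zero]
  · rw [dif_pos h, TTerm, mulXiCh_of_ne a h, dXiCh_of_ne a h]
    refine (LinearMap.congr_fun (bracket_mul_of_anticomm' (dXi_mulXi _ _) (dXi_dXi _ _)) v).trans
      ((LinearMap.sub_apply _ _ v).trans (congrArg₂ (· - ·) rfl ?_))
    by_cases hi : (.inl (a, ⟨k, h⟩) : XiIdx s r) = i
    · subst hi
      rw [if_pos rfl, if_pos rfl, LinearMap.smul_apply, mul_one]
      congr 1
      simp [xiCharge]
    · rw [if_neg (Ne.symm hi), if_neg hi, mul_zero, zero_smul, zero_smul, LinearMap.zero_apply]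

theorem finsum_xiCharge (a : Fin s) (i : XiIdx s r) (w : CSpace s r) :
    (Function.support fun k : ℤ => (if h : k ≠ 0 then
      (if (.inl (a, ⟨k, h⟩) : XiIdx s r) = i then (xiCharge a i : ℂ) else 0) else 0) • w).Finite ∧
    ∑ᶠ k : ℤ, (if h : k ≠ 0 then
      (if (.inl (a, ⟨k, h⟩) : XiIdx s r) = i then (xiCharge a i : ℂ) else 0) else 0) • w =
      (xiCharge a i : ℂ) • w := by
  rcases i with ⟨b, k, hk⟩ | p
  · have h0 : ∀ j : ℤ, j ≠ k → (if h : j ≠ 0 then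
      (if (.inl (a, ⟨j, h⟩) : XiIdx s r) = .inl (b, ⟨k, hk⟩) then
        (xiCharge (s := s) (r := r) a (.inl (b, ⟨k, hk⟩)) : ℂ) else 0) else 0) • w = 0 := by
      intro j hj
      split_ifs with h1 h2
      · simp only [Sum.inl.injEq, Prod.mk.injEq, Subtype.mk.injEq] at h2
        exact absurd h2.2 hj
      · simp
      · simp
    refine ⟨(Set.finite_singleton k).subset fun j hj => by
      by_contra hc; exact hj (h0 j hc), ?_⟩
    rw [finsum_eq_single _ k h0, dif_pos hk]
    by_cases hab : a = b
    · simp [hab]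
    · simp [hab, xiCharge]
  · simp [xiCharge]

theorem TOp_mulXi (a : Fin s) (i : XiIdx s r) :
    TOp a * mulXi i = mulXi i * TOp a + (xiCharge a i : ℂ) • mulXi i := by
  refine LinearMap.ext fun v => ?_
  have hs : (Function.support fun k => mulXi i (TTerm a k v)).Finite :=
    (locFin_TTerm a v).subset fun k hk h0 => hk (by simp only at h0; simp [h0])
  simp only [Module.End.mul_apply, LinearMap.add_apply, LinearMap.smul_apply, TOp_apply,
    TTerm_mulXi]
  rw [finsum_add_distrib hs (finsum_xiCharge a i _).1, (finsum_xiCharge a i _).2,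
    map_finsum _ (locFin_TTerm a v)]

theorem TOp_dXi (a : Fin s) (i : XiIdx s r) :
    TOp a * dXi i = dXi i * TOp a + ((-xiCharge a i : ℤ) : ℂ) • dXi i := by
  refine LinearMap.ext fun v => ?_
  have hs : (Function.support fun k => dXi i (TTerm a k v)).Finite :=
    (locFin_TTerm a v).subset fun k hk h0 => hk (by simp only at h0; simp [h0])
  simp only [Module.End.mul_apply, LinearMap.add_apply, LinearMap.smul_apply, TOp_apply,
    TTerm_dXi]
  rw [finsum_sub_distrib hs (finsum_xiCharge a i _).1, (finsum_xiCharge a i _).2,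
    map_finsum _ (locFin_TTerm a v), Int.cast_neg, neg_smul, sub_eq_add_neg]

/-- It suffices to commute with each number operator, since the locally finite sum is taken vector
by vector. -/
theorem TOp_commute {a : Fin s} {A : Module.End ℂ (CSpace s r)}
    (h1 : ∀ i, A * (mulXi i * dXi i) = (mulXi i * dXi i) * A) : Commute (TOp a) A := by
  refine LinearMap.ext fun v => ?_
  simp only [Module.End.mul_apply, TOp_apply]
  rw [map_finsum _ (locFin_TTerm a v)]
  refine finsum_congr fun k => ?_
  by_cases h : k = 0
  · subst h; simp [TTerm, dXiCh_zero]
  · have := LinearMap.congr_fun (h1 (.inl (a, ⟨k, h⟩))) v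
    simp only [Module.End.mul_apply, TTerm, mulXiCh_of_ne a h, dXiCh_of_ne a h,
      LinearMap.smul_apply] at this ⊢
    rw [map_smul, this]

theorem TOp_mulT (a : Fin s) (i : TIdx s r) : Commute (TOp a) (mulT i) :=
  TOp_commute fun j => ((mulT_mulXi i j).mul_right (mulT_dXi i j)).eq

theorem TOp_dT (a : Fin s) (i : TIdx s r) : Commute (TOp a) (dT i) :=
  TOp_commute fun j => ((dT_mulXi i j).mul_right (dT_dXi i j)).eq

theorem TOp_SOp (a : Fin s) (p : ℕ) : Commute (TOp a) (SOp p : Module.End ℂ (CSpace s r)) :=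
  TOp_commute fun j => by
    rw [← mul_assoc, SOp_mulXi, smul_mul_assoc, mul_assoc, SOp_dXi, mul_smul_comm, smul_smul,
      sSign_mul_self, one_smul, mul_assoc]

theorem TOp_one (a : Fin s) : TOp a (1 ⊗ₜ 1 : CSpace s r) = 0 := by
  rw [TOp_apply]
  refine finsum_eq_zero_of_forall_eq_zero fun k => ?_
  by_cases h : k = 0
  · subst h; simp [TTerm, dXiCh_zero]
  · rw [TTerm, LinearMap.smul_apply, Module.End.mul_apply, dXiCh_of_ne a h, dXi_one, map_zero,
      smul_zero]

/-- Monomials are eigenvectors: `1` has charge zero, times are neutral, and each Grassmann variable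
adds an integer. -/
theorem exists_isZPow_TOp (a : Fin s) (ε : ℤˣ) :
    ∃ P, IsZPow (sg ε • TOp a : Module.End ℂ (CSpace s r)) P := by
  have key : Submodule.span ℂ {v : CSpace s r | ∃ m : ℤ, TOp a v = (m : ℂ) • v} = ⊤ := by
    -- An operator of charge `d` maps eigenvectors to eigenvectors, hence preserves their span.
    have step : ∀ (A : Module.End ℂ (CSpace s r)) (d : ℤ), TOp a * A = A * TOp a + (d : ℂ) • A →
        ∀ v ∈ Submodule.span ℂ {v : CSpace s r | ∃ m : ℤ, TOp a v = (m : ℂ) • v},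
          A v ∈ Submodule.span ℂ {v : CSpace s r | ∃ m : ℤ, TOp a v = (m : ℂ) • v} := by
      intro A d hA v hv
      induction hv using Submodule.span_induction with
      | zero => rw [map_zero]; exact Submodule.zero_mem _
      | add x y _ _ hx hy => rw [map_add]; exact Submodule.add_mem _ hx hy
      | smul c x _ hx => rw [map_smul]; exact Submodule.smul_mem _ _ hx
      | mem x hx =>
        obtain ⟨m, hm⟩ := hx
        refine Submodule.subset_span ⟨m + d, ?_⟩
        have := LinearMap.congr_fun hA x
        simp only [Module.End.mul_apply, LinearMap.add_apply, LinearMap.smul_apply] at this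
        rw [this, hm, map_smul, ← add_smul, Int.cast_add]
    refine cSpace_induction (Submodule.subset_span ⟨0, by rw [TOp_one, Int.cast_zero, zero_smul]⟩)
      (fun i => step _ 0 (by rw [Int.cast_zero, zero_smul, add_zero]; exact (TOp_mulT a i).eq))
      fun i => step _ _ (TOp_mulXi a i)
  refine exists_isZPow_of_span key ?_
  rintro v ⟨m, hm⟩
  refine ⟨(ε : ℤ) * m, ?_⟩
  rw [LinearMap.smul_apply, hm, smul_smul, sg, Int.cast_mul]

end Boson

section General

variable {M : Type*} [AddCommGroup M] [Module ℂ M] {A : ℕ → Module.End ℂ M}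

theorem mul_smul_of_bracket {A B : Module.End ℂ M} {γ d e : ℂ} (h : A * B = B * A + γ • 1)
    (he : e = -(d * γ)) : B * (d • A) = d • A * B + e • 1 := by
  rw [mul_smul_comm, smul_mul_assoc, h, smul_add, smul_smul, he, neg_smul, add_neg_cancel_right]

theorem fmul_expUp_smul_neg (hA : ∀ i j, Commute (A i) (A j)) (c : ℕ → ℂ) :
    fmul (expUp fun j => c j • A j) (expUp fun j => -c j • A j) = constF 1 := by
  simp only [neg_smul]
  exact fmul_expUp_neg fun i j => ((hA i j).smul_right _).smul_left _

theorem fmul_expDown_smul_neg (hA : ∀ i j, Commute (A i) (A j)) (c : ℕ → ℂ) :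
    fmul (expDown fun j => c j • A j) (expDown fun j => -c j • A j) = constF 1 := by
  simp only [neg_smul]
  exact fmul_expDown_neg fun i j => ((hA i j).smul_right _).smul_left _

end General

/-! ### Uniform notation for charged and neutral components; their exponentials and Grassmann fields
-/

section Components

variable {s r : ℕ}

/-- The component of a field. -/
def FieldIdx.comp : FieldIdx s r → Fin s ⊕ Fin r
  | .ch a _ => .inl a
  | .ne c => .inr c

/-- The sign of a field. -/
def FieldIdx.sgn : FieldIdx s r → ℂ
  | .ch _ ε => sg ε
  | .ne _ => 1

/-- The position of a component. -/
def compPos : Fin s ⊕ Fin r → ℕ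
  | .inl a => a
  | .inr c => s + c

theorem compPos_injective : Function.Injective (compPos (s := s) (r := r)) := by
  rintro (a | c) (b | d) h <;> simp only [compPos] at h
  · rw [Fin.ext h]
  · have := a.2; omega
  · have := b.2; omega
  · rw [Fin.ext (by omega : (c : ℕ) = d)]

/-- The indices of the times of a component. -/
def timeMode : Fin s ⊕ Fin r → ℕ → Prop
  | .inl _, j => 0 < j
  | .inr _, j => Odd j

/-- Multiplication by the times of a component. -/
def compT : Fin s ⊕ Fin r → ℕ → Module.End ℂ (CSpace s r)
  | .inl a, j => mulTCh a j
  | .inr c, j => mulTNe c j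

/-- Differentiation by the times of a component. -/
def compD : Fin s ⊕ Fin r → ℕ → Module.End ℂ (CSpace s r)
  | .inl a, j => dTCh a j
  | .inr c, j => dTNe c j

/-- The time of a component of a given index. -/
def timeIdx : (c : Fin s ⊕ Fin r) → (j : ℕ) → timeMode c j → TIdx s r
  | .inl a, j, h => .inl (a, ⟨j, h⟩)
  | .inr c, j, h => .inr (c, ⟨j, h⟩)

theorem timeIdx_eq_iff {c d : Fin s ⊕ Fin r} {j k : ℕ} (hj : timeMode c j) (hk : timeMode d k) :
    timeIdx c j hj = timeIdx d k hk ↔ c = d ∧ j = k := by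
  constructor
  · intro h
    rcases c with a | c <;> rcases d with b | d <;>
      simp only [timeIdx, Sum.inl.injEq, Sum.inr.injEq, Prod.mk.injEq, reduceCtorEq] at h ⊢
    · exact ⟨h.1, congrArg Subtype.val h.2⟩
    · exact ⟨h.1, congrArg Subtype.val h.2⟩
  · rintro ⟨rfl, rfl⟩
    rfl

theorem exists_timeIdx (i : TIdx s r) : ∃ c j, ∃ h : timeMode c j, i = timeIdx c j h := by
  rcases i with ⟨a, j, hj⟩ | ⟨c, j, hj⟩
  · exact ⟨.inl a, j, hj, rfl⟩
  · exact ⟨.inr c, j, hj, rfl⟩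

theorem compT_of {c : Fin s ⊕ Fin r} {j : ℕ} (h : timeMode c j) : compT c j = mulT (timeIdx c j h) := by
  rcases c with a | c
  · exact dif_pos h
  · exact dif_pos h

theorem compD_of {c : Fin s ⊕ Fin r} {j : ℕ} (h : timeMode c j) : compD c j = dT (timeIdx c j h) := by
  rcases c with a | c
  · exact dif_pos h
  · exact dif_pos h

theorem compT_of_not {c : Fin s ⊕ Fin r} {j : ℕ} (h : ¬timeMode c j) : compT c j = 0 := by
  rcases c with a | c
  · exact dif_neg h
  · exact dif_neg h

theorem compD_of_not {c : Fin s ⊕ Fin r} {j : ℕ} (h : ¬timeMode c j) : compD c j = 0 := by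
  rcases c with a | c
  · exact dif_neg h
  · exact dif_neg h

/-- An operator commuting with all times commutes with the times of each component. -/
theorem commute_compT {A : Module.End ℂ (CSpace s r)} (h : ∀ i, Commute A (mulT i))
    (c : Fin s ⊕ Fin r) (j : ℕ) : Commute A (compT c j) := by
  by_cases hj : timeMode c j
  · rw [compT_of hj]; exact h _
  · rw [compT_of_not hj]; exact Commute.zero_right _

theorem commute_compD {A : Module.End ℂ (CSpace s r)} (h : ∀ i, Commute A (dT i))
    (c : Fin s ⊕ Fin r) (j : ℕ) : Commute A (compD c j) := by
  by_cases hj : timeMode c j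
  · rw [compD_of hj]; exact h _
  · rw [compD_of_not hj]; exact Commute.zero_right _

theorem compT_comm (c d : Fin s ⊕ Fin r) (j k : ℕ) : Commute (compT c j) (compT d k) :=
  commute_compT (fun i => (commute_compT (fun i' => mulT_comm i i') c j).symm) d k

theorem compD_comm (c d : Fin s ⊕ Fin r) (j k : ℕ) : Commute (compD c j) (compD d k) :=
  commute_compD (fun i => (commute_compD (fun i' => dT_comm i i') c j).symm) d k

open Classical in
theorem compD_compT (c d : Fin s ⊕ Fin r) (j k : ℕ) :
    compD c j * compT d k = compT d k * compD c j +
      (if timeMode c j ∧ c = d ∧ j = k then (1 : ℂ) else 0) • 1 := by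
  by_cases hj : timeMode c j
  · by_cases hk : timeMode d k
    · rw [compD_of hj, compT_of hk, dT_mulT]
      simp only [timeIdx_eq_iff, hj, true_and]
    · rw [compT_of_not hk, if_neg, zero_smul, mul_zero, zero_mul, add_zero]
      rintro ⟨-, rfl, rfl⟩
      exact hk hj
  · rw [compD_of_not hj, if_neg (fun h => hj h.1), zero_smul, mul_zero, zero_mul, add_zero]

theorem compD_one (c : Fin s ⊕ Fin r) (j : ℕ) : compD c j (1 ⊗ₜ 1) = 0 := by
  by_cases hj : timeMode c j
  · rw [compD_of hj, dT_one]
  · rw [compD_of_not hj]; rfl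

/-- The level: `1` for charged and `2` for neutral components. -/
def compLevel : Fin s ⊕ Fin r → ℂ
  | .inl _ => 1
  | .inr _ => 2

/-- `exp (δ ∑ z ^ j t_j)`. -/
def expTs (c : Fin s ⊕ Fin r) (δ : ℂ) : FDist ℤ (CSpace s r) := expUp fun j => δ • compT c j

/-- `exp (δ ∑ z ^ (-j) / j ∂_j)`, with an additional factor two for neutral components. -/
def expDs (c : Fin s ⊕ Fin r) (δ : ℂ) : FDist ℤ (CSpace s r) :=
  expDown fun j => (δ * compLevel c / (j : ℂ)) • compD c j

theorem expT_eq (x : FieldIdx s r) : expT x = expTs x.comp x.sgn := by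
  cases x
  · rfl
  · rw [expT, expTs]
    congr 1
    funext j
    exact (one_smul ℂ _).symm

theorem expD_eq (x : FieldIdx s r) : expD x = expDs x.comp x.sgn := by
  cases x
  · rw [expD, expDs]
    congr 1
    funext j
    simp only [FieldIdx.sgn, FieldIdx.comp, compLevel, mul_one]
    rfl
  · rw [expD, expDs]
    congr 1
    funext j
    simp only [FieldIdx.sgn, FieldIdx.comp, compLevel, one_mul]
    rfl

theorem compT_smul_comm (c : Fin s ⊕ Fin r) (δ : ℂ) (i j : ℕ) :
    Commute (δ • compT c i) (δ • compT c j) :=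
  ((compT_comm c c i j).smul_right δ).smul_left δ

theorem compD_smul_comm (c : Fin s ⊕ Fin r) (δ : ℕ → ℂ) (i j : ℕ) :
    Commute (δ i • compD c i) (δ j • compD c j) :=
  ((compD_comm c c i j).smul_right _).smul_left _

theorem upF_expTs (c : Fin s ⊕ Fin r) (δ : ℂ) : UpF (expTs c δ) := upF_expUp _

theorem expDs_pos (c : Fin s ⊕ Fin r) (δ : ℂ) {n : ℤ} (hn : 0 < n) : expDs c δ n = 0 := by
  rw [expDs, expDown_eq]
  exact upF_expUp _ _ (by omega)

theorem fmul_expTs (c : Fin s ⊕ Fin r) (δ : ℂ) : fmul (expTs c δ) (expTs c (-δ)) = constF 1 :=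
  fmul_expUp_smul_neg (compT_comm c c) fun _ => δ

theorem fmul_expDs (c : Fin s ⊕ Fin r) (δ : ℂ) : fmul (expDs c δ) (expDs c (-δ)) = constF 1 := by
  have := fmul_expDown_smul_neg (compD_comm c c) fun j => δ * compLevel c / (j : ℂ)
  simp only [← neg_div, ← neg_mul] at this
  exact this

theorem commute_expTs {A : Module.End ℂ (CSpace s r)} (h : ∀ i, Commute A (mulT i))
    (c : Fin s ⊕ Fin r) (δ : ℂ) (n : ℤ) : Commute A (expTs c δ n) :=
  commute_expUp (fun j => (commute_compT h c j).smul_right δ) n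

theorem commute_expDs {A : Module.End ℂ (CSpace s r)} (h : ∀ i, Commute A (dT i))
    (c : Fin s ⊕ Fin r) (δ : ℂ) (n : ℤ) : Commute A (expDs c δ n) := by
  rw [expDs, expDown_eq]
  exact commute_expUp (fun j => (commute_compD h c j).smul_right _) _

theorem expTs_comm (c d : Fin s ⊕ Fin r) (δ δ' : ℂ) (m n : ℤ) :
    Commute (expTs c δ m) (expTs d δ' n) :=
  commute_expTs (fun i => (commute_expTs (fun i' => mulT_comm i i') c δ m).symm) d δ' n

theorem expDs_comm (c d : Fin s ⊕ Fin r) (δ δ' : ℂ) (m n : ℤ) :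
    Commute (expDs c δ m) (expDs d δ' n) :=
  commute_expDs (fun i => (commute_expDs (fun i' => dT_comm i i') c δ m).symm) d δ' n

open Classical in
/-- Differentiating an exponential of times. -/
theorem compD_expTs (c d : Fin s ⊕ Fin r) {j : ℕ} (hj : j ≠ 0) (δ : ℂ) (n : ℤ) :
    compD c j * expTs d δ n = expTs d δ n * compD c j +
      (if timeMode c j ∧ c = d then δ else 0) • expTs d δ (n - j) := by
  refine expUp_bracket (compT_smul_comm d δ) hj (fun k _ => ?_) n
  rw [mul_smul_comm, smul_mul_assoc, compD_compT, smul_add, smul_smul]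
  congr 2
  by_cases hjk : k = j
  · subst hjk
    by_cases h : timeMode c k ∧ c = d <;> simp [h]
  · rw [if_neg (fun h => hjk h.2.2.symm), if_neg hjk, mul_zero]

open Classical in
/-- Multiplying by a time after an exponential of derivatives. -/
theorem compT_expDs (c d : Fin s ⊕ Fin r) {j : ℕ} (hj : j ≠ 0) (δ : ℂ) (n : ℤ) :
    compT c j * expDs d δ n = expDs d δ n * compT c j +
      (if timeMode c j ∧ c = d then -(δ * compLevel d / (j : ℂ)) else 0) • expDs d δ (n + j) := by
  rw [expDs, expDown_eq, expDown_eq, neg_add, ← sub_eq_add_neg]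
  refine expUp_bracket (compD_smul_comm d _) hj (fun k _ => ?_) (-n)
  refine mul_smul_of_bracket (compD_compT d c k j) ?_
  by_cases hjk : k = j
  · subst hjk
    by_cases hcd : c = d
    · subst hcd
      by_cases h : timeMode c k <;> simp [h]
    · simp [hcd, Ne.symm hcd]
  · rw [if_neg hjk, if_neg (fun h => hjk h.2.2), mul_zero, neg_zero]

/-- Polynomials are killed by high derivatives. Inductively, multiplying a vector by a time of index
`j` enlarges the set of exponents at most by its translate by `-j`. -/
theorem locFin_expDs (c : Fin s ⊕ Fin r) (δ : ℂ) : LocFin (expDs c δ) := by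
  classical
  refine locFin_of_finSupp (cSpace_induction ?_ ?_ ?_)
  · refine (Set.finite_singleton 0).subset fun n hn => ?_
    by_contra hc
    refine hn ?_
    simp only
    rw [expDs, expDown_eq, expUp_apply_of_killed (compD_smul_comm c _) (fun j _ => by
      rw [LinearMap.smul_apply, compD_one, smul_zero]), if_neg]
    simpa using hc
  · intro i v hv
    obtain ⟨d, j, hj, rfl⟩ := exists_timeIdx i
    have hj0 : j ≠ 0 := by
      rcases d with a | d
      · exact hj.ne'
      · rintro rfl; exact absurd hj (by simp [timeMode])
    rw [← compT_of hj]
    refine (Set.Finite.union hv (Set.Finite.image (fun n => n - (j : ℤ)) hv)).subset fun n hn => ?_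
    by_contra hc
    simp only [Set.mem_union, Set.mem_image, not_or, not_exists, not_and] at hc
    have h1 : expDs c δ n v = 0 := by
      by_contra h; exact hc.1 h
    have h2 : expDs c δ (n + j) v = 0 := by
      by_contra h; exact hc.2 (n + j) h (by ring)
    have := LinearMap.congr_fun (compT_expDs d c hj0 δ n) v
    simp only [Module.End.mul_apply, LinearMap.add_apply, LinearMap.smul_apply] at this
    rw [h1, h2, map_zero, smul_zero, add_zero] at this
    exact hn this.symm
  · intro i v hv
    refine Set.Finite.subset hv fun n hn h0 => hn ?_
    have := LinearMap.congr_fun (commute_expDs (fun k => (dT_mulXi k i).symm) c δ n).eq v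
    simp only [Module.End.mul_apply] at this h0 ⊢
    rw [← this, h0, map_zero]

/-! ### The Grassmann fields -/

/-- The Grassmann field `Ξ` of a field. -/
def xiF : FieldIdx s r → FDist ℤ (CSpace s r)
  | .ch a ε => XiCh a ε
  | .ne c => XiNe c

/-- The operator `S` of a field. -/
def sF (x : FieldIdx s r) : Module.End ℂ (CSpace s r) := SOp (compPos x.comp)

/-- `Ξ S`. -/
def psi (x : FieldIdx s r) : FDist ℤ (CSpace s r) := fun n => xiF x n * sF x

/-- The coefficients of a Grassmann field are multiples of variables and derivatives. -/
theorem xiF_cases (x : FieldIdx s r) (n : ℤ) : xiF x n = 0 ∨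
    (∃ (c : ℂ) (i : XiIdx s r), compXi i = compPos x.comp ∧ (xiF x n = c • mulXi i ∨ xiF x n = dXi i)) := by
  rcases x with ⟨a, ε⟩ | c
  · rcases eq_or_ne (n + 1) 0 with h | h
    · left
      simp [xiF, XiCh, h, dXiCh_zero]
    · right
      have h' : (ε : ℤ) * (n + 1) ≠ 0 := mul_ne_zero (Units.ne_zero ε) h
      refine ⟨-sg ε * ((n + 1 : ℤ) : ℂ), .inl (a, ⟨(ε : ℤ) * (n + 1), h'⟩), rfl, ?_⟩
      rcases lt_or_gt_of_ne h with h0 | h0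
      · right
        simp only [xiF, XiCh]
        rw [if_neg (not_lt.2 h0.le), if_neg h, dXiCh_of_ne a h']
      · left
        simp only [xiF, XiCh]
        rw [if_pos h0, mulXiCh_of_ne a h']
  · right
    rcases lt_or_ge n 0 with h | h
    · refine ⟨0, .inr (c, (-n - 1).toNat), rfl, .inr ?_⟩
      simp only [xiF, XiNe]
      rw [if_neg (not_le.2 h)]
    · refine ⟨(-1) ^ n * (2 * (n : ℂ) + 1), .inr (c, n.toNat), rfl, .inl ?_⟩
      simp only [xiF, XiNe]
      rw [if_pos h]

theorem commute_xiF {A : Module.End ℂ (CSpace s r)} (h1 : ∀ i, Commute A (mulXi i))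
    (h2 : ∀ i, Commute A (dXi i)) (x : FieldIdx s r) (n : ℤ) : Commute A (xiF x n) := by
  rcases xiF_cases x n with h | ⟨c, i, -, h | h⟩ <;> rw [h]
  · exact Commute.zero_right _
  · exact (h1 i).smul_right c
  · exact h2 i

theorem dT_xiF (i : TIdx s r) (x : FieldIdx s r) (n : ℤ) : Commute (dT i) (xiF x n) :=
  commute_xiF (dT_mulXi i) (dT_dXi i) x n

theorem SOp_xiF (p : ℕ) (x : FieldIdx s r) (n : ℤ) :
    SOp p * xiF x n = sSign p (compPos x.comp) • (xiF x n * SOp p) := by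
  rcases xiF_cases x n with h | ⟨c, i, hi, h | h⟩ <;> rw [h]
  · rw [mul_zero, zero_mul, smul_zero]
  · rw [mul_smul_comm, SOp_mulXi, hi, smul_mul_assoc, smul_comm]
  · rw [SOp_dXi, hi]

theorem laurF_xiF (x : FieldIdx s r) : LaurF (xiF x) := fun v => by
  -- The image lists the powers of `z` at which the derivatives acting nontrivially on `v` occur:
  -- `-|k| - 1` for charged and `-n - 1` for neutral variables.
  have hfin := (locFin_dXi v).image fun i : XiIdx s r => match i with
    | .inl p => -|(p.2 : ℤ)| - 1
    | .inr p => -(p.2 : ℤ) - 1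
  obtain ⟨N, hN⟩ := hfin.bddBelow
  refine ⟨min N (-1), fun n hn => ?_⟩
  rcases x with ⟨a, ε⟩ | c
  · simp only [xiF, XiCh]
    rw [if_neg (by omega), if_neg (by omega)]
    have h' : (ε : ℤ) * (n + 1) ≠ 0 := mul_ne_zero (Units.ne_zero ε) (by omega)
    rw [dXiCh_of_ne a h']
    by_contra hc
    have := hN ⟨_, hc, rfl⟩
    simp only [abs_mul, Int.isUnit_iff_abs_eq.1 ε.isUnit, one_mul] at this
    rw [abs_of_neg (by omega)] at this
    omega
  · simp only [xiF, XiNe]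
    rw [if_neg (by omega)]
    by_contra hc
    have := hN ⟨_, hc, rfl⟩
    simp only at this
    omega

/-- The anticommutators of the Grassmann fields. -/
def xiForm : FieldIdx s r → FieldIdx s r → ℤ → ℤ → ℂ
  | .ch a ε, .ch c η, m, n => if a = c ∧ η = -ε ∧ m + n + 2 = 0 then -sg ε * ((m + 1 : ℤ) : ℂ) else 0
  | .ne d, .ne e, m, n => if d = e ∧ m + n + 1 = 0 then (-1) ^ m * (2 * (m : ℂ) + 1) else 0
  | .ch _ _, .ne _, _, _ => 0
  | .ne _, .ch _ _, _, _ => 0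

end Components

/-! ### Brackets and values of products of fields -/

section General

variable {M : Type*} [AddCommGroup M] [Module ℂ M]

/-- Brackets with the coefficients of a product of fields, by the Leibniz rule. -/
theorem fmul_bracket {F G : FDist ℤ M} (hFG : MulOK F G) {A : Module.End ℂ M} {f g : ℂ} {d : ℤ}
    (hF : ∀ n, A * F n = F n * A + f • F (n + d)) (hG : ∀ n, A * G n = G n * A + g • G (n + d))
    (n : ℤ) : A * fmul F G n = fmul F G n * A + (f + g) • fmul F G (n + d) := by
  refine LinearMap.ext fun v => ?_
  simp only [Module.End.mul_apply, LinearMap.add_apply, LinearMap.smul_apply, fmul_apply hFG]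
  have h1 := hFG n (A v)
  have h2 := hFG (n + d) v
  have h3 : (Function.support fun i => F (i + d) (G (n - i) v)).Finite := by
    refine (h2.preimage (f := fun i => i + d) ((add_left_injective d).injOn)).subset fun i hi => ?_
    simp only [Set.mem_preimage, Function.mem_support, Module.End.mul_apply] at hi ⊢
    rwa [show n + d - (i + d) = n - i by ring]
  have e3 : ∑ᶠ i, F (i + d) (G (n - i) v) = ∑ᶠ i, F i (G (n + d - i) v) := by
    refine finsum_eq_of_bijective (fun i => i + d) (Equiv.addRight d).bijective fun i => ?_
    rw [show n + d - (i + d) = n - i by ring]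
  have hs : ∀ i, A (F i (G (n - i) v)) =
      F i (G (n - i) (A v)) + (f • F (i + d) (G (n - i) v) + g • F i (G (n + d - i) v)) := by
    intro i
    have e1 := LinearMap.congr_fun (hF i) (G (n - i) v)
    have e2 := LinearMap.congr_fun (hG (n - i)) v
    simp only [Module.End.mul_apply, LinearMap.add_apply, LinearMap.smul_apply] at e1 e2
    rw [e1, e2, map_add, map_smul, show n - i + d = n + d - i by ring]
    abel
  have h3' : (Function.support fun i => f • F (i + d) (G (n - i) v)).Finite :=
    h3.subset fun i hi h0 => hi (by simp only at h0 ⊢; rw [h0, smul_zero])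
  have h2' : (Function.support fun i => g • F i (G (n + d - i) v)).Finite :=
    h2.subset fun i hi h0 => hi (by
      simp only [Module.End.mul_apply] at h0 ⊢; rw [h0, smul_zero])
  have e0 : A (∑ᶠ i, F i (G (n - i) v)) = ∑ᶠ i, A (F i (G (n - i) v)) := map_finsum A (hFG n v)
  simp only [Module.End.mul_apply] at h1 h2
  rw [e0, finsum_congr hs, finsum_add_distrib h1
    ((h3'.union h2').subset (Function.support_add _ _)), finsum_add_distrib h3' h2',
    ← smul_finsum' f h3, ← smul_finsum' g h2, e3, add_smul]

theorem commute_fmul {F G : FDist ℤ M} (hFG : MulOK F G) {A : Module.End ℂ M}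
    (hF : ∀ n, Commute A (F n)) (hG : ∀ n, Commute A (G n)) (n : ℤ) : Commute A (fmul F G n) := by
  have := fmul_bracket hFG (A := A) (f := 0) (g := 0) (d := 0)
    (fun n => by rw [zero_smul, add_zero]; exact (hF n).eq)
    (fun n => by rw [zero_smul, add_zero]; exact (hG n).eq) n
  rw [add_zero, zero_smul, add_zero] at this
  exact this

/-- If the right factor acts on `v` through one power only, the Cauchy sum collapses. It is used for
`z^T` on weight vectors and for lowering exponentials on time-free vectors. -/
theorem fmul_apply_of_delta {F G : FDist ℤ M} (hFG : MulOK F G) {v w : M} {k : ℤ}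
    (hG : ∀ n, G n v = if n = k then w else 0) (n : ℤ) : fmul F G n v = F (n - k) w := by
  rw [fmul_apply hFG, finsum_eq_single _ (n - k)]
  · rw [hG, if_pos (by omega)]
  · intro i hi
    rw [hG, if_neg (by omega), map_zero]

theorem IsZPow.commute {T : Module.End ℂ M} {P : FDist ℤ M} (h : IsZPow T P) {A : Module.End ℂ M}
    (hA : Commute A T) (n : ℤ) : Commute A (P n) := by
  have := h.shift (A := A) (d := 0) (by rw [Int.cast_zero, zero_smul, add_zero]; exact hA.eq.symm) n
  rw [sub_zero] at this
  exact this.symm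

theorem anticomm_smul {A B : Module.End ℂ M} {e : ℂ} (h : A * B + B * A = e • 1) (c d : ℂ) :
    (c • A) * (d • B) + (d • B) * (c • A) = (c * d * e) • 1 := by
  simp only [smul_mul_smul_comm]
  rw [mul_comm d c, ← smul_add, h, smul_smul]

theorem neg_smul_mul_of_anticomm {A B : Module.End ℂ M} (h : A * B + B * A = 0) (c : ℂ)
    (S : Module.End ℂ M) : (-c) • (A * B * S) = c • (B * A * S) := by
  rw [eq_neg_of_add_eq_zero_left h, neg_mul, smul_neg, neg_smul, neg_neg]

theorem commute_mul_of_charges {T A B : Module.End ℂ M} {n : ℤ} (hA : T * A = A * T + (n : ℂ) • A)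
    (hB : T * B = B * T + ((-n : ℤ) : ℂ) • B) : Commute T (A * B) := by
  rw [Commute, SemiconjBy, ← mul_assoc, hA, add_mul, smul_mul_assoc, mul_assoc, hB, mul_add,
    mul_smul_comm, Int.cast_neg, neg_smul, neg_add_cancel_right, mul_assoc]

end General

/-! ### Relations and charges of the Grassmann fields; the vertex operators -/

section Components

variable {s r : ℕ}

theorem mulXiCh_mulXiCh (a b : Fin s) (k l : ℤ) :
    mulXiCh (r := r) a k * mulXiCh b l + mulXiCh b l * mulXiCh a k = (0 : ℂ) • 1 := by
  rw [zero_smul]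
  by_cases hk : k = 0
  · rw [hk, mulXiCh_zero, zero_mul, mul_zero, add_zero]
  by_cases hl : l = 0
  · rw [hl, mulXiCh_zero, zero_mul, mul_zero, add_zero]
  rw [mulXiCh_of_ne a hk, mulXiCh_of_ne b hl, mulXi_mulXi]

theorem dXiCh_dXiCh (a b : Fin s) (k l : ℤ) :
    dXiCh (r := r) a k * dXiCh b l + dXiCh b l * dXiCh a k = (0 : ℂ) • 1 := by
  rw [zero_smul]
  by_cases hk : k = 0
  · rw [hk, dXiCh_zero, zero_mul, mul_zero, add_zero]
  by_cases hl : l = 0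
  · rw [hl, dXiCh_zero, zero_mul, mul_zero, add_zero]
  rw [dXiCh_of_ne a hk, dXiCh_of_ne b hl, dXi_dXi]

theorem dXiCh_mulXiCh (a b : Fin s) (k l : ℤ) :
    dXiCh (r := r) a k * mulXiCh b l + mulXiCh b l * dXiCh a k =
      (if a = b ∧ k = l ∧ k ≠ 0 then (1 : ℂ) else 0) • 1 := by
  classical
  by_cases hk : k = 0
  · rw [hk, dXiCh_zero, zero_mul, mul_zero, add_zero, if_neg (by simp), zero_smul]
  by_cases hl : l = 0
  · rw [hl, mulXiCh_zero, zero_mul, mul_zero, add_zero, if_neg (by omega), zero_smul]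
  rw [mulXiCh_of_ne b hl, dXiCh_of_ne a hk, dXi_mulXi]
  congr 1
  simp [hk]

/-- The anticommutators of the Grassmann fields. -/
theorem xiForm_symm (x y : FieldIdx s r) (m n : ℤ) : xiForm x y m n = xiForm y x n m := by
  rcases x with ⟨a, ε⟩ | c <;> rcases y with ⟨b, η⟩ | d <;> simp only [xiForm]
  · by_cases h : a = b ∧ η = -ε ∧ m + n + 2 = 0
    · rw [if_pos h, if_pos ⟨h.1.symm, by rw [h.2.1, neg_neg], by omega⟩, h.2.1, sg_neg,
        show n = -m - 2 by omega]
      push_cast; ring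
    · rw [if_neg h, if_neg]
      rintro ⟨h1, h2, h3⟩
      exact h ⟨h1.symm, by rw [h2, neg_neg], by omega⟩
  · by_cases h : c = d ∧ m + n + 1 = 0
    · rw [if_pos h, if_pos ⟨h.1.symm, by omega⟩, neg_one_zpow_reflect h.2, show n = -m - 1 by omega]
      push_cast; ring
    · rw [if_neg h, if_neg]
      rintro ⟨h1, h2⟩
      exact h ⟨h1.symm, by omega⟩

theorem XiCh_of_pos (a : Fin s) (ε : ℤˣ) {n : ℤ} (h : 0 < n + 1) : XiCh (r := r) a ε n =
    (-sg ε * ((n + 1 : ℤ) : ℂ)) • mulXiCh a (ε * (n + 1)) := if_pos h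

/-- The exponent `n = -1` is included: there both sides vanish, as there is no variable of index
zero. -/
theorem XiCh_of_nonpos (a : Fin s) (ε : ℤˣ) {n : ℤ} (h : n + 1 ≤ 0) :
    XiCh (r := r) a ε n = (1 : ℂ) • dXiCh a (ε * (n + 1)) := by
  rw [XiCh, if_neg (not_lt.2 h)]
  split_ifs with h0
  · rw [h0, mul_zero, dXiCh_zero, smul_zero, smul_zero]
  · exact (one_smul ℂ _).symm

theorem XiCh_anticomm (a b : Fin s) (ε η : ℤˣ) (m n : ℤ) :
    XiCh (r := r) a ε m * XiCh b η n + XiCh b η n * XiCh a ε m =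
      xiForm (s := s) (r := r) (.ch a ε) (.ch b η) m n • 1 := by
  -- Only a derivative and a variable can pair nontrivially, and the form is symmetric; so one order
  -- is enough.
  have key : ∀ (a b : Fin s) (ε η : ℤˣ) (m n : ℤ), m + 1 ≤ 0 → 0 < n + 1 →
      XiCh (r := r) a ε m * XiCh b η n + XiCh b η n * XiCh a ε m =
      xiForm (s := s) (r := r) (.ch a ε) (.ch b η) m n • 1 := by
    intro a b ε η m n hm hn
    rw [XiCh_of_nonpos a ε hm, XiCh_of_pos b η hn, anticomm_smul (dXiCh_mulXiCh _ _ _ _)]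
    congr 1
    have h : (a = b ∧ (ε : ℤ) * (m + 1) = η * (n + 1) ∧ (ε : ℤ) * (m + 1) ≠ 0) ↔
        (a = b ∧ η = -ε ∧ m + n + 2 = 0) := by
      refine and_congr_right fun _ => ?_
      rcases Int.units_eq_one_or ε with rfl | rfl <;> rcases Int.units_eq_one_or η with rfl | rfl <;>
        simp [show (1 : ℤˣ) ≠ -1 by decide, show (-1 : ℤˣ) ≠ 1 by decide] <;> omega
    simp only [h, xiForm]
    split_ifs with hc
    · rw [hc.2.1, sg_neg, show n = -m - 2 by omega]
      push_cast; ring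
    · ring
  rcases lt_or_ge 0 (m + 1) with hm | hm <;> rcases lt_or_ge 0 (n + 1) with hn | hn
  · rw [XiCh_of_pos a ε hm, XiCh_of_pos b η hn, anticomm_smul (mulXiCh_mulXiCh _ _ _ _), xiForm,
      if_neg (by omega), mul_zero]
  · rw [add_comm, xiForm_symm]
    exact key b a η ε n m hn hm
  · exact key a b ε η m n hm hn
  · rw [XiCh_of_nonpos a ε hm, XiCh_of_nonpos b η hn, anticomm_smul (dXiCh_dXiCh _ _ _ _), xiForm,
      mul_zero]
    congr 1
    split_ifs with h
    · rw [show m = -1 by omega]; simp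
    · rfl

theorem XiNe_anticomm (c d : Fin r) (m n : ℤ) :
    XiNe (s := s) c m * XiNe d n + XiNe d n * XiNe c m =
      xiForm (s := s) (r := r) (.ne c) (.ne d) m n • 1 := by
  classical
  have h1 : ∀ (c : Fin r) {n : ℤ}, 0 ≤ n → XiNe (s := s) c n =
    ((-1) ^ n * (2 * (n : ℂ) + 1)) • mulXi (.inr (c, n.toNat)) := fun c n h => if_pos h
  have h2 : ∀ (c : Fin r) {n : ℤ}, n < 0 → XiNe (s := s) c n =
    (1 : ℂ) • dXi (.inr (c, (-n - 1).toNat)) := fun c n h =>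
    (if_neg (not_le.2 h)).trans (one_smul ℂ _).symm
  have key : ∀ (c d : Fin r) (m n : ℤ), m < 0 → 0 ≤ n →
      XiNe (s := s) c m * XiNe d n + XiNe d n * XiNe c m =
      xiForm (s := s) (r := r) (.ne c) (.ne d) m n • 1 := by
    intro c d m n hm hn
    rw [h2 c hm, h1 d hn, anticomm_smul (dXi_mulXi _ _)]
    congr 1
    have h : ((.inr (c, (-m - 1).toNat) : XiIdx s r) = .inr (d, n.toNat)) ↔ c = d ∧ m + n + 1 = 0 := by
      simp only [Sum.inr.injEq, Prod.mk.injEq]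
      refine and_congr_right fun _ => ?_
      omega
    simp only [h, xiForm]
    split_ifs with hc
    · rw [neg_one_zpow_reflect hc.2, show n = -m - 1 by omega]
      push_cast; ring
    · ring
  rcases lt_or_ge m 0 with hm | hm <;> rcases lt_or_ge n 0 with hn | hn
  · rw [h2 c hm, h2 d hn, anticomm_smul (e := 0) (by rw [dXi_dXi, zero_smul]), xiForm,
      if_neg (by omega), mul_zero]
  · exact key c d m n hm hn
  · rw [add_comm, xiForm_symm]
    exact key d c n m hn hm
  · rw [h1 c hm, h1 d hn, anticomm_smul (e := 0) (by rw [mulXi_mulXi, zero_smul]), xiForm,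
      if_neg (by omega), mul_zero]

theorem xiF_anticomm_of_comp_ne {x y : FieldIdx s r} (h : x.comp ≠ y.comp) (m n : ℤ) :
    xiF x m * xiF y n + xiF y n * xiF x m = 0 := by
  classical
  have hp : compPos x.comp ≠ compPos y.comp := fun h' => h (compPos_injective h')
  have key : ∀ i j : XiIdx s r, compXi i = compPos x.comp → compXi j = compPos y.comp →
      dXi i * mulXi j + mulXi j * dXi i = (0 : Module.End ℂ (CSpace s r)) ∧
      mulXi i * dXi j + dXi j * mulXi i = (0 : Module.End ℂ (CSpace s r)) := by
    intro i j hi hj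
    have hij : i ≠ j := fun h' => hp (by rw [← hi, ← hj, h'])
    constructor
    · rw [dXi_mulXi, if_neg hij, zero_smul]
    · rw [add_comm, dXi_mulXi, if_neg hij.symm, zero_smul]
  rcases xiF_cases x m with h1 | ⟨c, i, hi, h1 | h1⟩ <;> rw [h1]
  · rw [zero_mul, mul_zero, add_zero]
  · rcases xiF_cases y n with h2 | ⟨d, j, hj, h2 | h2⟩ <;> rw [h2]
    · rw [zero_mul, mul_zero, add_zero]
    · rw [anticomm_smul (e := 0) (by rw [mulXi_mulXi, zero_smul]), mul_zero, zero_smul]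
    · rw [smul_mul_assoc, mul_smul_comm, ← smul_add, (key i j hi hj).2, smul_zero]
  · rcases xiF_cases y n with h2 | ⟨d, j, hj, h2 | h2⟩ <;> rw [h2]
    · rw [zero_mul, mul_zero, add_zero]
    · rw [smul_mul_assoc, mul_smul_comm, ← smul_add, (key i j hi hj).1, smul_zero]
    · exact dXi_dXi i j

theorem xiF_anticomm (x y : FieldIdx s r) (m n : ℤ) :
    xiF x m * xiF y n + xiF y n * xiF x m = xiForm x y m n • 1 := by
  rcases x with ⟨a, ε⟩ | c <;> rcases y with ⟨b, η⟩ | d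
  · exact XiCh_anticomm a b ε η m n
  · rw [xiF_anticomm_of_comp_ne (by simp [FieldIdx.comp]), xiForm, zero_smul]
  · rw [xiF_anticomm_of_comp_ne (by simp [FieldIdx.comp]), xiForm, zero_smul]
  · exact XiNe_anticomm c d m n

theorem sSign_anti {p q : ℕ} (h : p ≠ q) : sSign p q = -sSign q p := by
  rcases lt_or_gt_of_ne h with h | h
  · rw [sSign, sSign, if_neg (by omega), if_pos h]; norm_num
  · rw [sSign, sSign, if_pos h, if_neg (by omega)]

theorem psi_mul_psi (x y : FieldIdx s r) (m n : ℤ) : psi x m * psi y n =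
    sSign (compPos x.comp) (compPos y.comp) • (xiF x m * xiF y n * (sF x * sF y)) := by
  rw [psi, psi, sF, mul_assoc, ← mul_assoc (SOp _), SOp_xiF, smul_mul_assoc, mul_smul_comm]
  rfl

theorem psi_anticomm {x y : FieldIdx s r} (h : x.comp = y.comp) (m n : ℤ) :
    psi x m * psi y n + psi y n * psi x m = xiForm x y m n • 1 := by
  have hS : sF x * sF y = 1 ∧ sF y * sF x = 1 := by
    rw [sF, sF, h, SOp_mul_self]; exact ⟨rfl, rfl⟩
  have h1 : sSign (compPos y.comp) (compPos y.comp) = 1 := by rw [sSign, if_neg (lt_irrefl _)]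
  rw [psi_mul_psi, psi_mul_psi, hS.1, hS.2, h, h1, one_smul, one_smul, mul_one, mul_one,
    xiF_anticomm]

/-- This is the purpose of the signs `S`. Of two distinct components exactly one has an `S` that
changes the sign of the other's variables, and this compensates the minus sign from interchanging
the `Ξ`. -/
theorem psi_comm {x y : FieldIdx s r} (h : x.comp ≠ y.comp) (m n : ℤ) :
    Commute (psi x m) (psi y n) := by
  have hp : compPos x.comp ≠ compPos y.comp := fun h' => h (compPos_injective h')
  rw [Commute, SemiconjBy, psi_mul_psi, psi_mul_psi, sSign_anti hp,
    neg_smul_mul_of_anticomm (xiF_anticomm_of_comp_ne h m n)]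
  congr 2
  exact (SOp_comm _ _).eq

theorem commute_psi {A : Module.End ℂ (CSpace s r)} (h1 : ∀ i, Commute A (mulXi i))
    (h2 : ∀ i, Commute A (dXi i)) (h3 : ∀ p, Commute A (SOp p)) (x : FieldIdx s r) (n : ℤ) :
    Commute A (psi x n) :=
  (commute_xiF h1 h2 x n).mul_right (h3 _)

theorem mulT_psi (i : TIdx s r) (x : FieldIdx s r) (n : ℤ) : Commute (mulT i) (psi x n) :=
  commute_psi (mulT_mulXi i) (mulT_dXi i) (mulT_SOp i) x n

theorem dT_psi (i : TIdx s r) (x : FieldIdx s r) (n : ℤ) : Commute (dT i) (psi x n) :=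
  commute_psi (dT_mulXi i) (dT_dXi i) (dT_SOp i) x n

theorem laurF_psi (x : FieldIdx s r) : LaurF (psi x) := fun v => laurF_xiF x (sF x v)

/-! ### Charges of the Grassmann fields -/

/-- The integral weight of a field with respect to a charge. -/
def wtZ (a : Fin s) : FieldIdx s r → ℤ
  | .ch b ε => if a = b then ε else 0
  | .ne _ => 0

theorem TOp_xiF (a : Fin s) (x : FieldIdx s r) (n : ℤ) :
    TOp a * xiF x n = xiF x n * TOp a + ((-wtZ a x : ℤ) : ℂ) • xiF x n := by
  rcases x with ⟨b, ε⟩ | c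
  · simp only [xiF]
    rcases lt_trichotomy (n + 1) 0 with h | h | h
    · have h' : (ε : ℤ) * (n + 1) ≠ 0 := mul_ne_zero (Units.ne_zero ε) h.ne
      rw [XiCh_of_nonpos b ε h.le, one_smul, dXiCh_of_ne b h', TOp_dXi]
      congr 3
      simp only [xiCharge, wtZ]
      rcases Int.units_eq_one_or ε with rfl | rfl
      · simp; split_ifs <;> omega
      · simp; split_ifs <;> omega
    · rw [XiCh_of_nonpos b ε h.le, h, mul_zero, dXiCh_zero, smul_zero, mul_zero, zero_mul,
        smul_zero, add_zero]
    · have h' : (ε : ℤ) * (n + 1) ≠ 0 := mul_ne_zero (Units.ne_zero ε) h.ne'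
      rw [XiCh_of_pos b ε h, mulXiCh_of_ne b h', mul_smul_comm, TOp_mulXi, smul_add,
        smul_mul_assoc]
      congr 1
      rw [smul_comm]
      congr 2
      simp only [xiCharge, wtZ]
      rcases Int.units_eq_one_or ε with rfl | rfl
      · simp; split_ifs <;> omega
      · simp; split_ifs <;> omega
  · simp only [wtZ, xiF, XiNe, neg_zero, Int.cast_zero, zero_smul, add_zero]
    split_ifs
    · rw [mul_smul_comm, TOp_mulXi, smul_mul_assoc]
      simp [xiCharge]
    · rw [TOp_dXi]
      simp [xiCharge]

theorem TOp_psi (a : Fin s) (x : FieldIdx s r) (n : ℤ) :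
    TOp a * psi x n = psi x n * TOp a + ((-wtZ a x : ℤ) : ℂ) • psi x n := by
  rw [psi, ← mul_assoc, TOp_xiF, add_mul, smul_mul_assoc, mul_assoc, sF, (TOp_SOp a _).eq,
    mul_assoc]

theorem TOp_comm (a b : Fin s) : Commute (TOp (r := r) a) (TOp b) :=
  TOp_commute fun i => (commute_mul_of_charges (TOp_mulXi b i) (TOp_dXi b i)).eq

/-- The field `z ^ T` for charged fields. -/
def zT : FieldIdx s r → FDist ℤ (CSpace s r)
  | .ch a ε => zPow (sg ε • TOp a)
  | .ne _ => constF 1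

/-- The shift of the exponents of `z ^ T` by a Grassmann field. -/
def zShift : FieldIdx s r → FieldIdx s r → ℤ
  | .ch a ε, y => -(ε * wtZ a y)
  | .ne _, _ => 0

theorem isZPow_zT (a : Fin s) (ε : ℤˣ) :
    IsZPow (sg ε • TOp a : Module.End ℂ (CSpace s r)) (zT (.ch a ε)) :=
  zPow_spec (exists_isZPow_TOp a ε)

theorem locFin_zT (x : FieldIdx s r) : LocFin (zT x) := by
  cases x
  · exact (isZPow_zT _ _).1
  · exact locFin_constF 1

theorem commute_zT {A : Module.End ℂ (CSpace s r)} (h : ∀ a, Commute A (TOp a))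
    (x : FieldIdx s r) (n : ℤ) : Commute A (zT x n) := by
  cases x
  · exact (isZPow_zT _ _).commute ((h _).smul_right _) n
  · simp only [zT, constF]
    split_ifs
    · exact Commute.one_right A
    · exact Commute.zero_right A

/-- A Grassmann field changes the charge by an integer, so moving `z^T` across it multiplies by a
power of `z`. -/
theorem zT_psi (x y : FieldIdx s r) (m n : ℤ) :
    zT x m * psi y n = psi y n * zT x (m - zShift x y) := by
  rcases x with ⟨a, ε⟩ | c
  · refine (isZPow_zT a ε).shift ?_ m
    rw [smul_mul_assoc, TOp_psi, smul_add, mul_smul_comm, smul_smul]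
    congr 2
    simp only [zShift, sg]
    push_cast; ring
  · simp only [zT, constF, zShift, sub_zero]
    split_ifs
    · rw [one_mul, mul_one]
    · rw [zero_mul, mul_zero]

theorem zT_xiF (x y : FieldIdx s r) (m n : ℤ) :
    zT x m * xiF y n = xiF y n * zT x (m - zShift x y) := by
  rcases x with ⟨a, ε⟩ | c
  · refine (isZPow_zT a ε).shift ?_ m
    rw [smul_mul_assoc, TOp_xiF, smul_add, mul_smul_comm, smul_smul]
    congr 2
    simp only [zShift, sg]
    push_cast; ring
  · simp only [zT, constF, zShift, sub_zero]
    split_ifs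
    · rw [one_mul, mul_one]
    · rw [zero_mul, mul_zero]

theorem mulT_zT (i : TIdx s r) (x : FieldIdx s r) (n : ℤ) : Commute (mulT i) (zT x n) :=
  commute_zT (fun a => (TOp_mulT a i).symm) x n

theorem dT_zT (i : TIdx s r) (x : FieldIdx s r) (n : ℤ) : Commute (dT i) (zT x n) :=
  commute_zT (fun a => (TOp_dT a i).symm) x n

theorem SOp_zT (p : ℕ) (x : FieldIdx s r) (n : ℤ) : Commute (SOp p) (zT x n) :=
  commute_zT (fun a => (TOp_SOp a p).symm) x n

theorem zT_comm (x y : FieldIdx s r) (m n : ℤ) : Commute (zT x m) (zT y n) :=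
  commute_zT (fun a => (commute_zT (fun b => TOp_comm a b) x m).symm) y n

theorem zT_one (x : FieldIdx s r) (n : ℤ) :
    zT x n (1 ⊗ₜ 1) = if n = 0 then (1 ⊗ₜ 1 : CSpace s r) else 0 := by
  cases x
  · refine (isZPow_zT _ _).apply_eigen (m := 0) ?_ n
    rw [LinearMap.smul_apply, TOp_one, smul_zero, Int.cast_zero, zero_smul]
  · simp only [zT, constF]
    split_ifs <;> rfl

/-! ### Vertex operators -/

/-- `Ξ(z) S z ^ T`, the part of a vertex operator without times. -/
def gF (x : FieldIdx s r) : FDist ℤ (CSpace s r) := fmul (psi x) (zT x)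

/-- The vertex operator of a field. -/
def vF (x : FieldIdx s r) : FDist ℤ (CSpace s r) := fmul (expT x) (fmul (gF x) (expD x))

theorem mulOK_psi_zT (x : FieldIdx s r) : MulOK (psi x) (zT x) := mulOK_of_locFin _ (locFin_zT x)

theorem locFin_expD (x : FieldIdx s r) : LocFin (expD x) := by
  rw [expD_eq]; exact locFin_expDs _ _

theorem mulOK_gF_expD (x : FieldIdx s r) : MulOK (gF x) (expD x) :=
  mulOK_of_locFin _ (locFin_expD x)

theorem laurF_gF (x : FieldIdx s r) : LaurF (gF x) := laurF_fmul_locFin (laurF_psi x) (locFin_zT x)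

theorem upF_expT (x : FieldIdx s r) : UpF (expT x) := by
  rw [expT_eq]; exact upF_expTs _ _

theorem mulOK_expT (x : FieldIdx s r) : MulOK (expT x) (fmul (gF x) (expD x)) :=
  mulOK_up_laur (upF_expT x) (laurF_fmul_locFin (laurF_gF x) (locFin_expD x))

theorem commute_gF {A : Module.End ℂ (CSpace s r)} {x : FieldIdx s r}
    (h1 : ∀ n, Commute A (psi x n)) (h2 : ∀ n, Commute A (zT x n)) (n : ℤ) : Commute A (gF x n) :=
  commute_fmul (mulOK_psi_zT x) h1 h2 n

theorem mulT_gF (i : TIdx s r) (x : FieldIdx s r) (n : ℤ) : Commute (mulT i) (gF x n) :=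
  commute_gF (mulT_psi i x) (mulT_zT i x) n

theorem dT_gF (i : TIdx s r) (x : FieldIdx s r) (n : ℤ) : Commute (dT i) (gF x n) :=
  commute_gF (dT_psi i x) (dT_zT i x) n

theorem commute_vF {A : Module.End ℂ (CSpace s r)} {x : FieldIdx s r}
    (h1 : ∀ n, Commute A (expT x n)) (h2 : ∀ n, Commute A (gF x n))
    (h3 : ∀ n, Commute A (expD x n)) (n : ℤ) : Commute A (vF x n) :=
  commute_fmul (mulOK_expT x) h1 (commute_fmul (mulOK_gF_expD x) h2 h3) n

open Classical in
-- Of the factors of a vertex operator only the raising exponential fails to commute with a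
-- derivative, and its bracket is a power of `z`.
theorem compD_vF (c : Fin s ⊕ Fin r) {j : ℕ} (hj : timeMode c j) (x : FieldIdx s r) (n : ℤ) :
    compD c j * vF x n = vF x n * compD c j +
      (if c = x.comp then x.sgn else 0) • vF x (n - j) := by
  have hj0 : j ≠ 0 := by
    rintro rfl
    rcases c with a | c <;> simp [timeMode] at hj
  have h1 : ∀ n, compD c j * fmul (gF x) (expD x) n = fmul (gF x) (expD x) n * compD c j +
      (0 : ℂ) • fmul (gF x) (expD x) (n + (-(j : ℤ))) := fun n => by
    rw [zero_smul, add_zero]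
    refine (commute_fmul (mulOK_gF_expD x) (fun n => ?_) (fun n => ?_) n).eq
    · exact (commute_compD (fun i => (dT_gF i x n).symm) c j).symm
    · rw [expD_eq]
      exact (commute_compD (fun i => (commute_expDs (dT_comm i) _ _ _).symm) c j).symm
  have := fmul_bracket (mulOK_expT x) (A := compD c j) (g := 0) (d := -(j : ℤ))
    (f := if c = x.comp then x.sgn else 0) (fun n => by
      rw [expT_eq, compD_expTs c _ hj0]
      simp only [hj, true_and]; rfl) h1 n
  rw [add_zero] at this
  exact this

open Classical in
theorem compT_vF (c : Fin s ⊕ Fin r) {j : ℕ} (hj : timeMode c j) (x : FieldIdx s r) (n : ℤ) :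
    compT c j * vF x n = vF x n * compT c j +
      (if c = x.comp then -(x.sgn * compLevel c / (j : ℂ)) else 0) • vF x (n + j) := by
  have hj0 : j ≠ 0 := by
    rintro rfl
    rcases c with a | c <;> simp [timeMode] at hj
  have h1 := fmul_bracket (mulOK_gF_expD x) (A := compT c j) (f := 0) (d := j)
    (g := if c = x.comp then -(x.sgn * compLevel c / (j : ℂ)) else 0) (fun n => by
      rw [zero_smul, add_zero]
      exact ((commute_compT (fun i => (mulT_gF i x n).symm) c j).symm).eq) (fun n => by
      rw [expD_eq, compT_expDs c _ hj0]
      simp only [hj, true_and]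
      congr 2
      split_ifs with h
      · rw [h]
      · rfl)
  have := fmul_bracket (mulOK_expT x) (A := compT c j) (f := 0) (d := (j : ℤ)) (fun n => by
      rw [zero_smul, add_zero, expT_eq]
      exact ((commute_compT (fun i => (commute_expTs (mulT_comm i) _ _ _).symm) c j).symm).eq) h1 n
  rw [zero_add, zero_add] at this
  exact this

theorem TOp_vF (a : Fin s) (x : FieldIdx s r) (n : ℤ) :
    TOp a * vF x n = vF x n * TOp a + ((-wtZ a x : ℤ) : ℂ) • vF x n := by
  have h0 := fmul_bracket (mulOK_psi_zT x) (A := TOp a) (d := 0) (f := ((-wtZ a x : ℤ) : ℂ)) (g := 0)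
    (fun n => by rw [add_zero]; exact TOp_psi a x n) (fun n => by
      rw [zero_smul, add_zero]
      exact (commute_zT (fun b => TOp_comm a b) x n).eq)
  have h1 := fmul_bracket (mulOK_gF_expD x) (A := TOp a) (d := 0) (g := 0) h0 (fun n => by
      rw [zero_smul, add_zero, expD_eq]
      exact (commute_expDs (fun i => TOp_dT a i) _ _ _).eq)
  have := fmul_bracket (mulOK_expT x) (A := TOp a) (f := 0) (d := 0) (fun n => by
      rw [zero_smul, add_zero, expT_eq]
      exact (commute_expTs (fun i => TOp_mulT a i) _ _ _).eq) h1 n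
  rw [zero_add, add_zero, add_zero, add_zero] at this
  exact this

/-- For distinct components every factor of one vertex operator commutes with every factor of the
other. -/
theorem vF_comm_of_comp_ne {x y : FieldIdx s r} (h : x.comp ≠ y.comp) (m n : ℤ) :
    Commute (vF x m) (vF y n) := by
  classical
  have hDT : ∀ {x y : FieldIdx s r}, x.comp ≠ y.comp → ∀ m n, Commute (expD x m) (expT y n) := by
    intro x y h m n
    rw [expT_eq, expD_eq, expDs, expDown_eq]
    refine (commute_expUp (fun j => Commute.smul_right ?_ _) _).symm
    refine (commute_expUp (fun k => Commute.smul_right ?_ _) _).symm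
    have := compD_compT x.comp y.comp j k
    rw [if_neg (fun h' => h h'.2.1), zero_smul, add_zero] at this
    exact this
  have hzs : ∀ {x y : FieldIdx s r}, x.comp ≠ y.comp → zShift x y = 0 := by
    rintro (⟨a, ε⟩ | c) (⟨b, η⟩ | d) h
    · have : a ≠ b := fun h' => h (by rw [h']; rfl)
      simp [zShift, wtZ, this]
    all_goals simp [zShift, wtZ]
  have hzp : ∀ {x y : FieldIdx s r}, x.comp ≠ y.comp → ∀ m n, Commute (zT x m) (psi y n) := by
    intro x y h m n
    have := zT_psi x y m n
    rw [hzs h, sub_zero] at this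
    exact this
  have hTg : ∀ x y : FieldIdx s r, ∀ m n, Commute (expT x m) (gF y n) := fun x y m n => by
    rw [expT_eq]
    exact (commute_expTs (fun i => (mulT_gF i y n).symm) _ _ _).symm
  have hDg : ∀ x y : FieldIdx s r, ∀ m n, Commute (expD x m) (gF y n) := fun x y m n => by
    rw [expD_eq]
    exact (commute_expDs (fun i => (dT_gF i y n).symm) _ _ _).symm
  refine (commute_vF (fun m => ?_) (fun m => ?_) (fun m => ?_) m).symm
  · refine (commute_vF (fun n => ?_) (fun n => hTg x y m n) (fun n => (hDT (Ne.symm h) n m).symm)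
      n).symm
    rw [expT_eq, expT_eq]
    exact expTs_comm ..
  · refine (commute_vF (fun n => (hTg y x n m).symm) (fun n => ?_) (fun n => (hDg y x n m).symm)
      n).symm
    refine (commute_gF (fun m => (commute_gF (fun n => psi_comm h m n) (fun n => ?_) n).symm)
      (fun m => (commute_gF (fun n => hzp h m n) (fun n => zT_comm x y m n) n).symm) m).symm
    exact (hzp (Ne.symm h) n m).symm
  · refine (commute_vF (fun n => hDT h m n) (fun n => hDg x y m n) (fun n => ?_) n).symm
    rw [expD_eq, expD_eq]
    exact expDs_comm ..

end Components

/-! ### Linear forms applied to exponentials and products -/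

section General

variable {M : Type*} [AddCommGroup M] [Module ℂ M]

theorem map_expCoeff_eq_zero {A : ℕ → Module.End ℂ M} (hA : ∀ i j, Commute (A i) (A j))
    {lam : M →ₗ[ℂ] ℂ} (h : ∀ j v, lam (A j v) = 0) {n : ℕ} (hn : n ≠ 0) (v : M) :
    lam (expCoeff A n v) = 0 := by
  have := congrArg (fun T : Module.End ℂ M => lam (T v)) (expCoeff_rec hA n)
  simp only [LinearMap.smul_apply, map_smul, LinearMap.sum_apply, map_sum, Module.End.mul_apply, h,
    smul_zero, Finset.sum_const_zero] at this
  exact (smul_eq_zero.1 this).resolve_left (Nat.cast_ne_zero.2 hn)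

/-- Every term of positive degree has some `A j` on the left by the recursion, and the form kills
its image. -/
theorem map_expUp {A : ℕ → Module.End ℂ M} (hA : ∀ i j, Commute (A i) (A j))
    {lam : M →ₗ[ℂ] ℂ} (h : ∀ j v, lam (A j v) = 0) (n : ℤ) (v : M) :
    lam (expUp A n v) = if n = 0 then lam v else 0 := by
  rcases lt_trichotomy n 0 with hn | rfl | hn
  · rw [upF_expUp A n hn, if_neg hn.ne, LinearMap.zero_apply, map_zero]
  · rw [expUp_zero, if_pos rfl, Module.End.one_apply]
  · obtain ⟨n, rfl⟩ := Int.eq_ofNat_of_zero_le hn.le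
    rw [expUp_of_nonneg, map_expCoeff_eq_zero hA h (by omega), if_neg hn.ne']

theorem map_fmul {F G : FDist ℤ M} (hFG : MulOK F G) {lam : M →ₗ[ℂ] ℂ}
    (h : ∀ n v, lam (F n v) = if n = 0 then lam v else 0) (n : ℤ) (v : M) :
    lam (fmul F G n v) = lam (G n v) := by
  have e0 : lam (∑ᶠ i, F i (G (n - i) v)) = ∑ᶠ i, lam (F i (G (n - i) v)) :=
    map_finsum lam (hFG n v)
  rw [fmul_apply hFG, e0, finsum_eq_single _ 0]
  · rw [h, if_pos rfl, sub_zero]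
  · intro i hi
    rw [h, if_neg hi]

theorem smul_mul_smul_of_bracket {A B : Module.End ℂ M} {e : ℂ} (h : A * B = B * A + e • 1)
    (c d : ℂ) : (c • A) * (d • B) = (d • B) * (c • A) + (c * d * e) • 1 := by
  rw [smul_mul_smul_comm, smul_mul_smul_comm, h, smul_add, smul_smul, mul_comm d]

end General

/-! ### Evaluation at time zero -/

section Functionals

variable {s r : ℕ}

/-- The polynomial which is the coefficient of a vector at a linear form on the Grassmann algebra. -/
def timeCoeff (f : Grass s r →ₗ[ℂ] ℂ) : CSpace s r →ₗ[ℂ] MvPolynomial (TIdx s r) ℂ :=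
  (TensorProduct.rid ℂ _).toLinearMap ∘ₗ LinearMap.lTensor _ f

theorem timeCoeff_tmul (f : Grass s r →ₗ[ℂ] ℂ) (p : MvPolynomial (TIdx s r) ℂ) (g : Grass s r) :
    timeCoeff f (p ⊗ₜ g) = f g • p := by
  simp [timeCoeff]

theorem timeCoeff_mulT (f : Grass s r →ₗ[ℂ] ℂ) (i : TIdx s r) (v : CSpace s r) :
    timeCoeff f (mulT i v) = MvPolynomial.X i * timeCoeff f v := by
  induction v using TensorProduct.induction_on with
  | zero => rw [map_zero, map_zero, mul_zero]
  | add v w hv hw => rw [map_add, map_add, map_add, hv, hw, mul_add]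
  | tmul p g =>
    rw [mulT, LinearMap.rTensor_tmul, LinearMap.mulLeft_apply, timeCoeff_tmul, timeCoeff_tmul,
      mul_smul_comm]

theorem timeCoeff_dT (f : Grass s r →ₗ[ℂ] ℂ) (i : TIdx s r) (v : CSpace s r) :
    timeCoeff f (dT i v) = MvPolynomial.pderiv i (timeCoeff f v) := by
  induction v using TensorProduct.induction_on with
  | zero => rw [map_zero, map_zero, map_zero]
  | add v w hv hw => rw [map_add, map_add, map_add, hv, hw, map_add]
  | tmul p g =>
    rw [dT, LinearMap.rTensor_tmul, timeCoeff_tmul, timeCoeff_tmul, Derivation.map_smul]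
    rfl

/-- The coordinate forms of a basis of the Grassmann algebra already separate vectors. Polynomial
coefficients reduce questions on `C_{s,r}` to ordinary polynomials. -/
theorem eq_zero_of_timeCoeff {v : CSpace s r} (h : ∀ f, timeCoeff f v = 0) : v = 0 := by
  classical
  let b := Module.Basis.ofVectorSpace ℂ (Grass s r)
  let e := TensorProduct.equivFinsuppOfBasisRight (M := MvPolynomial (TIdx s r) ℂ) b
  have h1 : ∀ (v : CSpace s r) i, e v i = timeCoeff (b.coord i) v := by
    intro v i
    induction v using TensorProduct.induction_on with
    | zero => rw [map_zero, map_zero]; rfl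
    | add v w hv hw => rw [map_add, map_add, Finsupp.add_apply, hv, hw]
    | tmul p g =>
      rw [timeCoeff_tmul]
      exact TensorProduct.equivFinsuppOfBasisRight_apply_tmul_apply ..
  refine e.injective ?_
  rw [map_zero]
  ext1 i
  rw [h1, h]
  rfl

/-- A linear form on the Grassmann algebra, extended by setting all times equal to zero. -/
def atZero (f : Grass s r →ₗ[ℂ] ℂ) : CSpace s r →ₗ[ℂ] ℂ :=
  (MvPolynomial.aeval fun _ => (0 : ℂ)).toLinearMap ∘ₗ timeCoeff f

theorem atZero_mulT (f : Grass s r →ₗ[ℂ] ℂ) (i : TIdx s r) (v : CSpace s r) :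
    atZero f (mulT i v) = 0 := by
  rw [atZero, LinearMap.comp_apply, timeCoeff_mulT, AlgHom.toLinearMap_apply, map_mul,
    MvPolynomial.aeval_X, zero_mul]

/-- A space of vectors closed under the derivatives by times is zero if all vectors vanish at time
zero. -/
theorem eq_bot_of_atZero {W : Submodule ℂ (CSpace s r)} (hW : ∀ i, ∀ v ∈ W, dT i v ∈ W)
    (h : ∀ f, ∀ v ∈ W, atZero f v = 0) : W = ⊥ := by
  refine (Submodule.eq_bot_iff W).2 fun v hv => eq_zero_of_timeCoeff fun f => ?_
  by_contra hne
  have h1 := one_mem_of_pderiv_closed (W := W.map (timeCoeff f)) (by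
    rintro i _ ⟨w, hw, rfl⟩
    exact ⟨dT i w, hW i w hw, timeCoeff_dT f i w⟩) ⟨v, hv, rfl⟩ hne
  obtain ⟨w, hw, hw1⟩ := h1
  have := h f w hw
  rw [atZero, LinearMap.comp_apply, hw1, AlgHom.toLinearMap_apply, map_one] at this
  exact one_ne_zero this

end Functionals

/-! ### Reordering exponentials; matrix coefficients at time zero -/

section Reordering

variable {s r : ℕ}

/-- The coefficients of the expansion of the function that arises from reordering two vertex
operators. -/
def reorderCoeff : FieldIdx s r → FieldIdx s r → ℕ → ℂ
  | .ch a ε, .ch b η, n =>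
    if a = b ∧ ε = η then 1 else if n = 0 then 1 else if a = b ∧ n = 1 then -1 else 0
  | .ne c, .ne d, n => if n = 0 then 1 else if c = d then 2 else 0
  | .ch _ _, .ne _, n => if n = 0 then 1 else 0
  | .ne _, .ch _ _, n => if n = 0 then 1 else 0

theorem reorderCoeff_zero (x y : FieldIdx s r) : reorderCoeff x y 0 = 1 := by
  rcases x with ⟨a, ε⟩ | c <;> rcases y with ⟨b, η⟩ | d <;> simp [reorderCoeff]

theorem sum_range_odd (n : ℕ) :
    ∑ k ∈ Finset.range n, (if Odd k then (2 : ℂ) else 0) = 2 * ((n / 2 : ℕ) : ℂ) := by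
  induction n with
  | zero => simp
  | succ n ih =>
    rw [Finset.sum_range_succ, ih]
    rcases Nat.even_or_odd n with h | h
    · rw [if_neg (Nat.not_odd_iff_even.2 h)]
      obtain ⟨m, rfl⟩ := h
      rw [show (m + m + 1) / 2 = (m + m) / 2 by omega, add_zero]
    · rw [if_pos h]
      obtain ⟨m, rfl⟩ := h
      rw [show (2 * m + 1 + 1) / 2 = m + 1 by omega, show (2 * m + 1) / 2 = m by omega]
      push_cast; ring

open Classical in
-- The logarithmic derivative, in coefficients, of the exponential of the contraction. The exponent
-- `εη ∑ x^k/k` is `-εη log (1 - x)`, giving `1/(1 - x)` or `1 - x`; for neutral fields `2 ∑ x^k/k`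
-- over odd `k` gives `(1 + x)/(1 - x)`.
theorem reorderCoeff_rec (x y : FieldIdx s r) (n : ℕ) : (n : ℂ) * reorderCoeff x y n =
    ∑ p ∈ antidiagonal n, (p.1 : ℂ) * (if timeMode x.comp p.1 ∧ x.comp = y.comp then
      x.sgn * compLevel x.comp / (p.1 : ℂ) * y.sgn else 0) * reorderCoeff x y p.2 := by
  by_cases hc : x.comp = y.comp
  · have h1 : ∀ k : ℕ, (k : ℂ) * (if timeMode x.comp k ∧ x.comp = y.comp then
        x.sgn * compLevel x.comp / (k : ℂ) * y.sgn else 0) =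
        if timeMode x.comp k then x.sgn * compLevel x.comp * y.sgn else 0 := by
      intro k
      simp only [hc, and_true]
      split_ifs with h
      · have : (k : ℂ) ≠ 0 := by
          refine Nat.cast_ne_zero.2 ?_
          rintro rfl
          generalize y.comp = c at h
          rcases c with a | c <;> simp [timeMode] at h
        field_simp
      · rw [mul_zero]
    simp only [h1]
    rw [Finset.Nat.sum_antidiagonal_eq_sum_range_succ fun i j =>
      (if timeMode x.comp i then x.sgn * compLevel x.comp * y.sgn else 0) * reorderCoeff x y j]
    rcases x with ⟨a, ε⟩ | c <;> rcases y with ⟨b, η⟩ | d <;>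
      simp only [FieldIdx.comp, Sum.inl.injEq, Sum.inr.injEq, reduceCtorEq] at hc
    · subst hc
      simp only [FieldIdx.comp, FieldIdx.sgn, timeMode, compLevel, mul_one]
      by_cases he : ε = η
      · subst he
        simp only [reorderCoeff, and_self, if_true, mul_one, sg_mul_self]
        rw [Finset.sum_range_succ']
        simp
      · have he' : sg ε * sg η = -1 := by
          rcases Int.units_eq_one_or ε with rfl | rfl <;> rcases Int.units_eq_one_or η with rfl | rfl
          · exact absurd rfl he
          · simp [sg]
          · simp [sg]
          · exact absurd rfl he
        simp only [reorderCoeff, he, and_false, if_false, he', true_and]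
        rcases n with _ | _ | n
        · simp
        · simp [Finset.sum_range_succ]
        · rw [Finset.sum_range_succ, Finset.sum_range_succ, Finset.sum_range_succ,
            Finset.sum_eq_zero]
          · simp [show n + 2 - (n + 1) = 1 by omega, show n + 1 + 1 - n = 2 by omega]
          · intro k hk
            have := Finset.mem_range.1 hk
            rw [if_neg (show ¬n + 1 + 1 - k = 0 by omega), if_neg (show ¬n + 1 + 1 - k = 1 by omega),
              mul_zero]
    · subst hc
      simp only [FieldIdx.comp, FieldIdx.sgn, timeMode, compLevel, mul_one, one_mul, reorderCoeff,
        if_true]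
      rw [Finset.sum_range_succ]
      have : ∀ k ∈ Finset.range n, (if Odd k then (2 : ℂ) else 0) *
          (if n - k = 0 then 1 else 2) = (if Odd k then (2 : ℂ) else 0) * 2 := by
        intro k hk
        have := Finset.mem_range.1 hk
        rw [if_neg (show ¬n - k = 0 by omega)]
      rw [Finset.sum_congr rfl this, ← Finset.sum_mul, sum_range_odd]
      rcases Nat.even_or_odd n with h | h
      · rw [if_neg (Nat.not_odd_iff_even.2 h)]
        obtain ⟨m, rfl⟩ := h
        rcases Nat.eq_zero_or_pos m with rfl | hm
        · simp
        · rw [if_neg (by omega), show (m + m) / 2 = m by omega]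
          push_cast; ring
      · rw [if_pos h]
        obtain ⟨m, rfl⟩ := h
        rw [if_neg (by omega), show (2 * m + 1) / 2 = m by omega]
        simp
        ring
  · have h2 : reorderCoeff x y n = if n = 0 then 1 else 0 := by
      rcases x with ⟨a, ε⟩ | c <;> rcases y with ⟨b, η⟩ | d <;>
        simp only [FieldIdx.comp, Sum.inl.injEq, Sum.inr.injEq] at hc <;>
        simp [reorderCoeff, hc]
    simp only [hc, and_false, if_false, mul_zero, zero_mul, Finset.sum_const_zero, h2]
    split_ifs with h
    · simp [h]
    · simp

/-- Reordering the exponentials of derivatives and of times. -/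
theorem expD_expT (x y : FieldIdx s r) (n : ℕ) (l : ℤ) : expD x (-(n : ℤ)) * expT y l =
    ∑ p ∈ antidiagonal n, reorderCoeff x y p.1 • (expT y (l - p.1) * expD x (-(p.2 : ℤ))) := by
  classical
  have hAB : ∀ i j : ℕ, i ≠ 0 → j ≠ 0 → ((x.sgn * compLevel x.comp / (i : ℂ)) • compD x.comp i) *
      (y.sgn • compT y.comp j) = (y.sgn • compT y.comp j) *
        ((x.sgn * compLevel x.comp / (i : ℂ)) • compD x.comp i) +
      (if j = i then (if timeMode x.comp i ∧ x.comp = y.comp then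
        x.sgn * compLevel x.comp / (i : ℂ) * y.sgn else 0) else 0) • 1 := by
    intro i j _ _
    rw [smul_mul_smul_of_bracket (compD_compT x.comp y.comp i j)]
    congr 2
    by_cases hji : j = i
    · subst hji
      by_cases h : timeMode x.comp j ∧ x.comp = y.comp
      · rw [if_pos rfl, if_pos h, if_pos ⟨h.1, h.2, rfl⟩, mul_one]
      · rw [if_pos rfl, if_neg h, if_neg (fun h' => h ⟨h'.1, h'.2.1⟩), mul_zero]
    · rw [if_neg hji, if_neg (fun h' => hji h'.2.2.symm), mul_zero]
  have key := expCoeff_mul_expUp (compD_smul_comm x.comp fun i => x.sgn * compLevel x.comp / (i : ℂ))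
    (compT_smul_comm y.comp y.sgn) hAB (reorderCoeff_zero x y) (reorderCoeff_rec x y) n l
  simp only [expT_eq, expD_eq, expTs, expDs, expDown_eq, neg_neg, expUp_of_nonneg]
  exact key

/-- The vectors that do not depend on the times. -/
def TimeFree (v : CSpace s r) : Prop := ∀ i, dT i v = 0

theorem TimeFree.map {v : CSpace s r} (h : TimeFree v) {A : Module.End ℂ (CSpace s r)}
    (hA : ∀ i, Commute (dT i) A) : TimeFree (A v) := fun i => by
  have := LinearMap.congr_fun (hA i).eq v
  simp only [Module.End.mul_apply] at this
  rw [this, h i, map_zero]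

theorem TimeFree.compD {v : CSpace s r} (h : TimeFree v) (c : Fin s ⊕ Fin r) (j : ℕ) :
    compD c j v = 0 := by
  by_cases hj : timeMode c j
  · rw [compD_of hj]; exact h _
  · rw [compD_of_not hj]; rfl

theorem TimeFree.expD {v : CSpace s r} (h : TimeFree v) (x : FieldIdx s r) (n : ℤ) :
    expD x n v = if n = 0 then v else 0 := by
  rw [expD_eq, expDs, expDown_eq, expUp_apply_of_killed (compD_smul_comm _ _) (fun j _ => by
    rw [LinearMap.smul_apply, h.compD, smul_zero])]
  simp only [neg_eq_zero]

theorem mulOK_expT_gF (x : FieldIdx s r) : MulOK (expT x) (gF x) :=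
  mulOK_up_laur (upF_expT x) (laurF_gF x)

theorem TimeFree.vF {v : CSpace s r} (h : TimeFree v) (x : FieldIdx s r) (n : ℤ) :
    vF x n v = fmul (expT x) (gF x) n v := by
  rw [SympBoson.vF, fmul_apply (mulOK_expT x), fmul_apply (mulOK_expT_gF x)]
  refine finsum_congr fun i => ?_
  rw [fmul_apply_of_delta (mulOK_gF_expD x) (h.expD x), sub_zero]

/-- A linear form that vanishes on the multiples of the times. -/
def KillsTimes (lam : CSpace s r →ₗ[ℂ] ℂ) : Prop := ∀ i v, lam (mulT i v) = 0

theorem KillsTimes.comp {lam : CSpace s r →ₗ[ℂ] ℂ} (h : KillsTimes lam)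
    {A : Module.End ℂ (CSpace s r)} (hA : ∀ i, Commute (mulT i) A) : KillsTimes (lam ∘ₗ A) :=
  fun i v => by
    have := LinearMap.congr_fun (hA i).eq v
    simp only [Module.End.mul_apply] at this
    rw [LinearMap.comp_apply, ← this, h]

theorem KillsTimes.expT {lam : CSpace s r →ₗ[ℂ] ℂ} (h : KillsTimes lam) (x : FieldIdx s r) (n : ℤ)
    (v : CSpace s r) : lam (expT x n v) = if n = 0 then lam v else 0 := by
  rw [expT_eq]
  refine map_expUp (compT_smul_comm _ _) (fun j v => ?_) n v
  rw [LinearMap.smul_apply, map_smul]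
  by_cases hj : timeMode x.comp j
  · rw [compT_of hj, h, smul_zero]
  · rw [compT_of_not hj, LinearMap.zero_apply, map_zero, smul_zero]

/-- The matrix coefficients of `e ^ (∂) e ^ t` at time zero. -/
theorem KillsTimes.expD_expT {lam : CSpace s r →ₗ[ℂ] ℂ} (h : KillsTimes lam) {v : CSpace s r}
    (hv : TimeFree v) (x y : FieldIdx s r) (n : ℕ) (l : ℤ) :
    lam (SympBoson.expD x (-(n : ℤ)) (SympBoson.expT y l v)) =
      if l = n then reorderCoeff x y n * lam v else 0 := by
  have := congrArg (fun T : Module.End ℂ (CSpace s r) => lam (T v)) (SympBoson.expD_expT x y n l)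
  simp only [LinearMap.sum_apply, map_sum, Module.End.mul_apply, LinearMap.smul_apply,
    map_smul] at this
  rw [this, Finset.sum_eq_single (n, 0)]
  · rw [hv.expD, if_pos (by simp), h.expT, smul_eq_mul]
    simp only [sub_eq_zero]
    split_ifs <;> simp
  · rintro ⟨i, j⟩ hij hne
    have hj : j ≠ 0 := by
      rintro rfl
      rw [mem_antidiagonal, add_zero] at hij
      exact hne (by rw [← hij])
    rw [hv.expD, if_neg (by simpa using hj), map_zero, map_zero, smul_zero]
  · intro h0
    exact absurd (mem_antidiagonal.2 (add_zero n)) h0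

/-- `reorderCoeff`, extended by zero. -/
def reorderZ (x y : FieldIdx s r) (p : ℤ) : ℂ := if 0 ≤ p then reorderCoeff x y p.toNat else 0

/-- The matrix coefficients of a product of two vertex operators at time zero. -/
theorem KillsTimes.vF_vF {lam : CSpace s r →ₗ[ℂ] ℂ} (h : KillsTimes lam) {u : CSpace s r}
    (hu : TimeFree u) (x y : FieldIdx s r) (m n : ℤ) :
    lam (vF x m (vF y n u)) =
      ∑ᶠ p : ℤ, reorderZ x y p * lam (gF x (m + p) (gF y (n - p) u)) := by
  -- The leftmost raising exponential is invisible to a form that kills the times.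
  rw [SympBoson.vF, map_fmul (lam := lam) (mulOK_expT x) (h.expT x), fmul_apply (mulOK_gF_expD x)]
  set w := SympBoson.vF y n u with hw
  have e0 : lam (∑ᶠ i, gF x i (SympBoson.expD x (m - i) w)) =
      ∑ᶠ i, lam (gF x i (SympBoson.expD x (m - i) w)) := map_finsum lam (mulOK_gF_expD x m w)
  rw [e0]
  symm
  refine finsum_eq_of_bijective (fun p => m + p) (Equiv.addLeft m).bijective fun p => ?_
  rw [show m - (m + p) = -p by ring]
  rcases lt_or_ge p 0 with hp | hp
  · rw [reorderZ, if_neg (not_le.2 hp), zero_mul, expD_eq, expDs_pos _ _ (by omega),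
      LinearMap.zero_apply, map_zero, map_zero]
  · obtain ⟨p, rfl⟩ := Int.eq_ofNat_of_zero_le hp
    have h' := h.comp (fun i => mulT_gF i x (m + p))
    have e1 : (lam ∘ₗ gF x (m + p)) (SympBoson.expD x (-(p : ℤ)) w) = ∑ᶠ j,
        (lam ∘ₗ gF x (m + p)) (SympBoson.expD x (-(p : ℤ)) (SympBoson.expT y j (gF y (n - j) u))) := by
      rw [hw, hu.vF, fmul_apply (mulOK_expT_gF y)]
      exact map_finsum ((lam ∘ₗ gF x (m + p)) ∘ₗ SympBoson.expD x (-(p : ℤ)))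
        (mulOK_expT_gF y n u)
    -- The rightmost lowering exponential acts trivially on a time-free vector. What remains is the
    -- lowering exponential of `x` against the raising one of `y`, which contributes the scalar
    -- kernel.
    have e2 : ∀ j, (lam ∘ₗ gF x (m + p))
        (SympBoson.expD x (-(p : ℤ)) (SympBoson.expT y j (gF y (n - j) u))) =
        if j = p then reorderCoeff x y p * (lam ∘ₗ gF x (m + p)) (gF y (n - j) u) else 0 :=
      fun j => h'.expD_expT (hu.map fun i => dT_gF i y _) x y p j
    simp only [e2] at e1
    rw [finsum_eq_single _ (p : ℤ) (fun j hj => if_neg hj), if_pos rfl] at e1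
    rw [reorderZ, if_pos hp, Int.toNat_natCast]
    exact e1.symm

end Reordering

/-! ### Summation of antisymmetric families -/

section General

variable {M : Type*} [AddCommGroup M] [Module ℂ M]

theorem finsum_reorder_shift (R : ℤ → ℂ) (h : ℤ → M) (m : ℤ) :
    ∑ᶠ p, R p • h (m + p) = ∑ᶠ a, R (a - m) • h a :=
  finsum_eq_of_bijective (fun p => m + p) (Equiv.addLeft m).bijective fun p => by
    rw [add_sub_cancel_left]

/-- Summation against a kernel whose symmetrization is constant annihilates antisymmetric families. -/
theorem finsum_antisymm {h : ℤ → M} (hf : (Function.support h).Finite) {σ m n : ℤ} {R : ℤ → ℂ} {C : ℂ}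
    (hR : ∀ a, R (a - m) + R (σ - n - a) = C) (hh : ∀ a, h (σ - a) = -h a) :
    ∑ᶠ a, R (a - m) • h a = ∑ᶠ a, R (a - n) • h a := by
  have hs : ∀ c : ℤ → ℂ, (Function.support fun a => c a • h a).Finite := fun c =>
    hf.subset fun a ha h0 => ha (by simp only; rw [h0, smul_zero])
  -- The sum of `h` equals its own negative by reflection. Below, reflecting one of the two weighted
  -- sums turns their difference into the constant `C` times this sum.
  have h0 : ∑ᶠ a, h a = 0 := by
    have e : ∑ᶠ a, h a = ∑ᶠ a, -h a :=
      finsum_eq_of_bijective (fun a => σ - a) (Equiv.subLeft σ).bijective fun a => by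
        rw [hh, neg_neg]
    rw [finsum_neg_distrib] at e
    have h2 : (2 : ℂ) • ∑ᶠ a, h a = 0 := by
      rw [two_smul]
      nth_rewrite 1 [e]
      exact neg_add_cancel _
    exact (smul_eq_zero.1 h2).resolve_left two_ne_zero
  have e2 : ∑ᶠ a, R (a - n) • h a = ∑ᶠ a, -(R (σ - n - a) • h a) :=
    finsum_eq_of_bijective (fun a => σ - a) (Equiv.subLeft σ).bijective fun a => by
      rw [hh, smul_neg, neg_neg, show σ - n - (σ - a) = a - n by ring]
  rw [e2, finsum_neg_distrib, eq_neg_iff_add_eq_zero, ← finsum_add_distrib (hs _) (hs _)]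
  simp only [← add_smul, hR]
  rw [← smul_finsum' C hf, h0, smul_zero]

/-- The anticommutators of a neutral field are alternating odd numbers, and their partial sums
evaluate the central term of the commutator. -/
theorem sum_neg_one_pow_odd (K : ℕ) :
    ∑ j ∈ Finset.range K, (-1 : ℂ) ^ j * (2 * (j : ℂ) + 1) = -(-1) ^ K * K := by
  induction K with
  | zero => simp
  | succ K ih =>
    rw [Finset.sum_range_succ, ih]
    push_cast
    ring

end General

/-! ### The commutation relations at time zero -/

section Relations

variable {s r : ℕ}

/-- A vector on which each `z ^ T` is the power given by `κ`. -/
def IsWeight (κ : FieldIdx s r → ℤ) (u : CSpace s r) : Prop :=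
  ∀ x k, zT x k u = if k = κ x then u else 0

theorem IsWeight.psi {κ : FieldIdx s r → ℤ} {u : CSpace s r} (h : IsWeight κ u) (y : FieldIdx s r)
    (n : ℤ) : IsWeight (fun x => κ x + zShift x y) (psi y n u) := fun x k => by
  have := LinearMap.congr_fun (zT_psi x y k n) u
  simp only [Module.End.mul_apply] at this
  rw [this, h x, apply_ite (SympBoson.psi y n), map_zero]
  simp only [sub_eq_iff_eq_add]

theorem IsWeight.gF {κ : FieldIdx s r → ℤ} {u : CSpace s r} (h : IsWeight κ u) (y : FieldIdx s r)
    (n : ℤ) : gF y n u = SympBoson.psi y (n - κ y) u :=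
  fmul_apply_of_delta (mulOK_psi_zT y) (h y) n

theorem IsWeight.gF_gF {κ : FieldIdx s r → ℤ} {u : CSpace s r} (h : IsWeight κ u)
    (x y : FieldIdx s r) (m n : ℤ) : SympBoson.gF x m (SympBoson.gF y n u) =
      SympBoson.psi x (m - κ x - zShift x y) (SympBoson.psi y (n - κ y) u) := by
  rw [h.gF, (h.psi y _).gF, sub_sub]

/-- The charge of a weight vector. -/
theorem exists_weight {u : CSpace s r} (h : ∀ a, ∃ m : ℤ, TOp a u = (m : ℂ) • u) :
    ∃ κ : FieldIdx s r → ℤ, IsWeight κ u ∧ (∀ a ε, κ (.ch a (-ε)) = -κ (.ch a ε)) ∧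
      ∀ c, κ (.ne c) = 0 := by
  choose m hm using h
  refine ⟨fun x => match x with
    | .ch a ε => (ε : ℤ) * m a
    | .ne _ => 0, ?_, fun a ε => ?_, fun c => rfl⟩
  · rintro (⟨a, ε⟩ | c) k
    · refine (isZPow_zT a ε).apply_eigen (m := (ε : ℤ) * m a) ?_ k
      rw [LinearMap.smul_apply, hm, smul_smul, sg, Int.cast_mul]
    · simp only [zT, constF]
      split_ifs <;> rfl
  · simp

theorem psi_anticomm_apply {x y : FieldIdx s r} (h : x.comp = y.comp) (m n : ℤ) (u : CSpace s r) :
    psi x m (psi y n u) + psi y n (psi x m u) = xiForm x y m n • u :=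
  LinearMap.congr_fun (psi_anticomm h m n) u

/-- The relation between the two orders of the parts without times, for a field and itself. -/
theorem anticomm_relation_self {M : Type*} [AddCommGroup M] [Module ℂ M] (x : FieldIdx s r)
    {ψ : FDist ℤ M} (hψ : LaurF ψ) (hanti : ∀ m n u, ψ m (ψ n u) + ψ n (ψ m u) = xiForm x x m n • u)
    {k z : ℤ} (hz : z = zShift x x) (hk : ∀ c, x = .ne c → k = 0) (m n : ℤ) (u : M) :
    ∑ᶠ p : ℤ, reorderZ x x p • ψ (m + p - k - z) (ψ (n - p - k) u) -
      ∑ᶠ p : ℤ, reorderZ x x p • ψ (n + p - k - z) (ψ (m - p - k) u) =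
      commForm x x (-m - 1) (-n - 1) • u := by
  -- Both sums run over the same family `H`, against the kernel centred at `m` and at `n`
  -- respectively. The reflection `a ↦ m + n + z - a` interchanges the two factors `ψ`.
  let H : ℤ → M := fun a => ψ (a - k - z) (ψ (m + n - a - k) u)
  have e1 : ∀ m' n' p : ℤ, m' + n' = m + n → ψ (m' + p - k - z) (ψ (n' - p - k) u) = H (m' + p) := by
    intro m' n' p hmn
    simp only [H]
    rw [show n' - p = m + n - (m' + p) by omega]
  simp only [e1 m n _ rfl, e1 n m _ (add_comm n m)]
  rw [finsum_reorder_shift, finsum_reorder_shift]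
  have hbd : ∃ N, ∀ a, N < a → H a = 0 := by
    obtain ⟨N, hN⟩ := hψ u
    exact ⟨m + n - k - N, fun a ha => by simp only [H]; rw [hN _ (by omega), map_zero]⟩
  obtain ⟨N, hN⟩ := hbd
  -- Vanishing on one side comes from the bound for `ψ` on `u`, and antisymmetry carries it to the
  -- other side.
  have hfin : ∀ {h' : ℤ → M} {N' σ : ℤ}, (∀ a, N' < a → h' a = 0) →
      (∀ a, h' (σ - a) = -h' a) → (Function.support h').Finite := by
    intro h' N' σ hN' hh
    refine (Set.finite_Icc (σ - N') N').subset fun a ha => ?_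
    by_contra hc
    simp only [Set.mem_Icc, not_and_or, not_le] at hc
    refine ha ?_
    rcases hc with hc | hc
    · rw [← neg_eq_zero, ← hh, hN' _ (by omega)]
    · exact hN' a hc
  have hsum : ∀ a, H (m + n + z - a) + H a = xiForm x x (a - k - z) (m + n - a - k) • u := by
    intro a
    simp only [H]
    rw [show m + n + z - a - k - z = m + n - a - k by ring,
      show m + n - (m + n + z - a) - k = a - k - z by ring, add_comm, hanti]
  -- The kernel is a step function: the values `0` and `1` in the charged case, `0`, `1` at the
  -- jump, then `2` in the neutral case. With its reflection it adds up to a constant, the shift `z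
  -- = -1` of the charged case closing the gap.
  have hR : ∃ C, ∀ a, reorderZ x x (a - m) + reorderZ x x (m + n + z - n - a) = C := by
    rcases x with ⟨b, ε⟩ | c
    · refine ⟨1, fun a => ?_⟩
      have hz1 : z = -1 := by
        simp only [hz, zShift, wtZ, if_true, ← Units.val_mul, Int.units_mul_self]; rfl
      simp only [reorderZ, reorderCoeff, and_self, if_true]
      by_cases ha : m ≤ a
      · rw [if_pos (by omega), if_neg (by omega), add_zero]
      · rw [if_neg (by omega), if_pos (by omega), zero_add]
    · refine ⟨2, fun a => ?_⟩
      have hz1 : z = 0 := hz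
      simp only [reorderZ, reorderCoeff, if_true]
      rcases lt_trichotomy a m with ha | ha | ha
      · rw [if_neg (by omega), if_pos (by omega), if_neg (by omega), zero_add]
      · rw [if_pos (by omega), if_pos (by omega), if_pos (by omega), if_pos (by omega)]
        norm_num
      · rw [if_pos (by omega), if_neg (by omega), if_neg (by omega), add_zero]
  obtain ⟨C, hC⟩ := hR
  -- If no anticommutator is nonzero, `H` is antisymmetric and both sums agree. The other case
  -- occurs only for a neutral field with dual modes.
  by_cases hzero : ∀ a, xiForm x x (a - k - z) (m + n - a - k) = 0
  · have hanti : ∀ a, H (m + n + z - a) = -H a := fun a =>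
      eq_neg_of_add_eq_zero_left (by rw [hsum, hzero, zero_smul])
    rw [finsum_antisymm (hfin hN hanti) hC hanti, sub_self, commForm_eq, if_neg, zero_smul]
    rintro ⟨h1, h2⟩
    rcases x with ⟨b, ε⟩ | c
    · simp only [FieldIdx.dual, FieldIdx.ch.injEq, true_and] at h1
      rcases Int.units_eq_one_or ε with rfl | rfl <;> simp at h1
    · have hk0 : k = 0 := hk c rfl
      have hz0 : z = 0 := hz
      have := hzero 0
      rw [xiForm, if_pos ⟨rfl, by omega⟩, hk0, hz0] at this
      simp at this
  · rcases x with ⟨b, ε⟩ | c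
    · exfalso
      refine hzero fun a => ?_
      rw [xiForm, if_neg]
      rintro ⟨-, h1, -⟩
      rcases Int.units_eq_one_or ε with rfl | rfl <;> simp at h1
    · have hk0 : k = 0 := hk c rfl
      have hz0 : z = 0 := hz
      have hmn : m + n + 1 = 0 := by
        by_contra hne
        refine hzero fun a => ?_
        rw [xiForm, if_neg]
        rintro ⟨-, h1⟩
        omega
      let cf : ℤ → ℂ := fun a => (-1) ^ a * (2 * (a : ℂ) + 1)
      have hsum' : ∀ a, H (m + n + z - a) + H a = cf a • u := by
        intro a
        rw [hsum, xiForm, if_pos ⟨rfl, by omega⟩, hk0, hz0, sub_zero, sub_zero]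
      -- Here `H` is antisymmetric only up to the scalars `cf a`. Subtracting them on the negative
      -- half-line, which the reflection exchanges with the other half, restores antisymmetry.
      let H' : ℤ → M := fun a => H a - if a < 0 then cf a • u else 0
      have hcf : ∀ a, cf (m + n + z - a) = cf a := by
        intro a
        simp only [cf]
        rw [neg_one_zpow_reflect (show a + (m + n + z - a) + 1 = 0 by omega),
          show m + n + z - a = -a - 1 by omega]
        push_cast; ring
      have hanti : ∀ a, H' (m + n + z - a) = -H' a := by
        intro a
        simp only [H']
        rw [eq_sub_of_add_eq (hsum' a), hcf]
        by_cases ha : a < 0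
        · rw [if_neg (by omega), if_pos ha]; abel
        · rw [if_pos (by omega), if_neg ha]; abel
      have hN' : ∀ a, max N 0 < a → H' a = 0 := fun a ha => by
        simp only [H']
        rw [hN a (by omega), if_neg (by omega), sub_zero]
      have hf' := hfin hN' hanti
      have hkey := finsum_antisymm hf' hC hanti
      let R : ℤ → ℂ := reorderZ (s := s) (r := r) (.ne c) (.ne c)
      have hR0 : ∀ p, p < 0 → R p = 0 := fun p hp => if_neg (not_le.2 hp)
      -- The correction is a finite sum, because the kernel vanishes below `m'` and the correction
      -- from zero on.
      have hsplit : ∀ m' : ℤ, ∑ᶠ a, R (a - m') • H a =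
          ∑ᶠ a, R (a - m') • H' a + (∑ a ∈ Finset.Ico m' 0, R (a - m') * cf a) • u := by
        intro m'
        have e2 : ∑ᶠ a, R (a - m') • (if a < 0 then cf a • u else 0) =
            (∑ a ∈ Finset.Ico m' 0, R (a - m') * cf a) • u := by
          rw [finsum_eq_sum_of_support_subset (s := Finset.Ico m' 0), Finset.sum_smul]
          · refine Finset.sum_congr rfl fun a ha => ?_
            rw [if_pos (Finset.mem_Ico.1 ha).2, smul_smul]
          · intro a ha
            by_contra hc
            simp only [Finset.coe_Ico, Set.mem_Ico, not_and_or, not_le, not_lt] at hc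
            refine ha ?_
            simp only
            rcases hc with hc | hc
            · rw [hR0 _ (by omega), zero_smul]
            · rw [if_neg (by omega), smul_zero]
        rw [← e2, ← finsum_add_distrib]
        · refine finsum_congr fun a => ?_
          rw [← smul_add]
          simp only [H', sub_add_cancel]
        · exact hf'.subset fun a ha h0 => ha (by simp only; rw [h0, smul_zero])
        · refine (Set.finite_Ico m' 0).subset fun a ha => ?_
          by_contra hc
          simp only [Set.mem_Ico, not_and_or, not_le, not_lt] at hc
          refine ha ?_
          simp only
          rcases hc with hc | hc
          · rw [hR0 _ (by omega), zero_smul]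
          · rw [if_neg (by omega), smul_zero]
      -- With `a = -j - 1` this is twice the alternating sum of the odd numbers for `j < K` plus the
      -- term `j = K` with weight one. Exactly one of `m`, `n` is negative, so one such sum survives
      -- and gives the commutator.
      have hval : ∀ K : ℕ, ∑ a ∈ Finset.Ico (-(K : ℤ) - 1) 0, R (a - (-(K : ℤ) - 1)) * cf a =
          (-1) ^ K := by
        intro K
        have e3 : ∑ a ∈ Finset.Ico (-(K : ℤ) - 1) 0, R (a - (-(K : ℤ) - 1)) * cf a =
            ∑ j ∈ Finset.range (K + 1), (if j = K then (1 : ℂ) else 2) *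
              ((-1) ^ j * (2 * (j : ℂ) + 1)) := by
          symm
          refine Finset.sum_bij' (fun j _ => -(j : ℤ) - 1) (fun a _ => (-a - 1).toNat) ?_ ?_ ?_ ?_ ?_
          · intro j hj; simp only [Finset.mem_range, Finset.mem_Ico] at hj ⊢; omega
          · intro j hj; simp only [Finset.mem_range, Finset.mem_Ico] at hj ⊢; omega
          · intro j hj; omega
          · intro j hj; simp only [Finset.mem_Ico] at hj ⊢; omega
          · intro j hj
            simp only [Finset.mem_range] at hj
            simp only [R, reorderZ, reorderCoeff, cf, if_true]
            rw [if_pos (show (0 : ℤ) ≤ -(j : ℤ) - 1 - (-(K : ℤ) - 1) by omega),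
              neg_one_zpow_reflect (show (j : ℤ) + (-(j : ℤ) - 1) + 1 = 0 by ring),
              zpow_natCast]
            have : (-(j : ℤ) - 1 - (-(K : ℤ) - 1)).toNat = 0 ↔ j = K := by omega
            simp only [this]
            push_cast; ring
        rw [e3, Finset.sum_range_succ, if_pos rfl]
        have : ∀ j ∈ Finset.range K, (if j = K then (1 : ℂ) else 2) *
            ((-1) ^ j * (2 * (j : ℂ) + 1)) = 2 * ((-1) ^ j * (2 * (j : ℂ) + 1)) := by
          intro j hj
          rw [if_neg (by have := Finset.mem_range.1 hj; omega)]
        rw [Finset.sum_congr rfl this, ← Finset.mul_sum, sum_neg_one_pow_odd]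
        ring
      have hempty : ∀ m' : ℤ, 0 ≤ m' → ∑ a ∈ Finset.Ico m' 0, R (a - m') * cf a = 0 := fun m' hm' => by
        rw [Finset.Ico_eq_empty (by omega), Finset.sum_empty]
      have hR' : R = reorderZ (s := s) (r := r) (.ne c) (.ne c) := rfl
      rw [← hR'] at hkey ⊢
      rw [hsplit m, hsplit n, hkey, add_sub_add_left_eq_sub, ← sub_smul]
      congr 1
      rw [commForm, if_pos ⟨rfl, by omega⟩]
      rcases lt_or_ge m 0 with hm | hm
      · obtain ⟨K, hK⟩ := Int.eq_ofNat_of_zero_le (show 0 ≤ n by omega)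
        have hm' : m = -(K : ℤ) - 1 := by omega
        rw [hempty n (by omega), hm', hval K, sub_zero, show -(-(K : ℤ) - 1) - 1 = K by ring,
          zpow_natCast]
      · obtain ⟨K, hK⟩ := Int.eq_ofNat_of_zero_le hm
        have hn' : n = -(K : ℤ) - 1 := by omega
        rw [hempty m hm, hn', hval K, hK, zero_sub,
          neg_one_zpow_reflect (show (K : ℤ) + (-(K : ℤ) - 1) + 1 = 0 by ring), zpow_natCast]

/-- The relation between the two orders of the parts without times, for opposite charges. -/
theorem anticomm_relation_opposite {M : Type*} [AddCommGroup M] [Module ℂ M] (b : Fin s) (ε : ℤˣ)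
    {ψ φ : FDist ℤ M} (hanti : ∀ m n u, ψ m (φ n u) + φ n (ψ m u) =
      xiForm (.ch b ε : FieldIdx s r) (.ch b (-ε)) m n • u) (k m n : ℤ) (u : M) :
    ∑ᶠ p : ℤ, reorderZ (.ch b ε : FieldIdx s r) (.ch b (-ε)) p •
        ψ (m + p - k - 1) (φ (n - p - -k) u) -
      ∑ᶠ p : ℤ, reorderZ (.ch b (-ε) : FieldIdx s r) (.ch b ε) p •
        φ (n + p - -k - 1) (ψ (m - p - k) u) =
      commForm (.ch b ε : FieldIdx s r) (.ch b (-ε)) (-m - 1) (-n - 1) • u := by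
  have hne : ε ≠ -ε := by
    rcases Int.units_eq_one_or ε with rfl | rfl <;> simp
  -- For opposite charges the kernel is `1 - x`, so each sum has just two terms.
  have hR : ∀ ε η : ℤˣ, ε ≠ η → ∀ f : ℤ → M,
      ∑ᶠ p : ℤ, reorderZ (s := s) (r := r) (.ch b ε) (.ch b η) p • f p = f 0 - f 1 := by
    intro ε η hεη f
    rw [finsum_eq_sum_of_support_subset (s := {0, 1}), Finset.sum_pair (by norm_num)]
    · simp only [reorderZ, reorderCoeff, hεη, and_false]
      simp
      abel
    · intro p hp
      by_contra hc
      simp only [Finset.coe_insert, Finset.coe_singleton, Set.mem_insert_iff,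
        Set.mem_singleton_iff, not_or] at hc
      refine hp ?_
      simp only [reorderZ, reorderCoeff, hεη, and_false, if_false, true_and]
      split_ifs with h1 h2 h3
      · omega
      · omega
      · rw [zero_smul]
      · rw [zero_smul]
  rw [hR _ _ hne, hR _ _ hne.symm]
  have h1 := hanti (m - k - 1) (n + k) u
  have h2 := hanti (m - k) (n + k - 1) u
  -- The four products form two anticommutators whose values are consecutive multiples; the
  -- difference of these multiples is the commutator.
  have e : commForm (.ch b ε : FieldIdx s r) (.ch b (-ε)) (-m - 1) (-n - 1) • u =
      xiForm (.ch b ε : FieldIdx s r) (.ch b (-ε)) (m - k - 1) (n + k) • u -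
      xiForm (.ch b ε : FieldIdx s r) (.ch b (-ε)) (m - k) (n + k - 1) • u := by
    rw [← sub_smul]
    congr 1
    simp only [commForm, xiForm, true_and]
    by_cases hmn : m + n + 1 = 0
    · rw [if_pos (by omega), if_pos (by omega), if_pos (by omega)]
      push_cast; ring
    · rw [if_neg (by omega), if_neg (by omega), if_neg (by omega), sub_zero]
  rw [e, ← h1, ← h2, show m + 0 - k - 1 = m - k - 1 by ring, show n - 0 - -k = n + k by ring,
    show m + 1 - k - 1 = m - k by ring, show n - 1 - -k = n + k - 1 by ring,
    show n + 0 - -k - 1 = n + k - 1 by ring, show m - 0 - k = m - k by ring,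
    show n + 1 - -k - 1 = n + k by ring, show m - 1 - k = m - k - 1 by ring]
  abel

/-- On a weight vector each `z^T` is a power of `z`, so the identity becomes one about `Ξ S` alone
with shifted exponents. -/
theorem gF_relation {κ : FieldIdx s r → ℤ} {u : CSpace s r} (h : IsWeight κ u)
    (hκ : ∀ a ε, κ (.ch a (-ε)) = -κ (.ch a ε)) (hκ' : ∀ c, κ (.ne c) = 0)
    {x y : FieldIdx s r} (hxy : x.comp = y.comp) (m n : ℤ) :
    ∑ᶠ p : ℤ, reorderZ x y p • gF x (m + p) (gF y (n - p) u) -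
      ∑ᶠ p : ℤ, reorderZ y x p • gF y (n + p) (gF x (m - p) u) =
      commForm x y (-m - 1) (-n - 1) • u := by
  simp only [h.gF_gF]
  by_cases he : x = y
  · subst he
    exact anticomm_relation_self x (laurF_psi x) (psi_anticomm_apply rfl) rfl
      (fun c hc => by rw [hc, hκ']) m n u
  · rcases x with ⟨a, ε⟩ | c <;> rcases y with ⟨b, η⟩ | d <;>
      simp only [FieldIdx.comp, Sum.inl.injEq, Sum.inr.injEq, reduceCtorEq] at hxy
    · subst hxy
      have : η = -ε := by
        rcases Int.units_eq_one_or ε with rfl | rfl <;> rcases Int.units_eq_one_or η with rfl | rfl <;>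
          simp_all
      subst this
      have hz : zShift (.ch a ε : FieldIdx s r) (.ch a (-ε)) = 1 := by
        rcases Int.units_eq_one_or ε with rfl | rfl <;> simp [zShift, wtZ]
      have hz' : zShift (.ch a (-ε) : FieldIdx s r) (.ch a ε) = 1 := by
        rcases Int.units_eq_one_or ε with rfl | rfl <;> simp [zShift, wtZ]
      simp only [hz, hz', hκ]
      exact anticomm_relation_opposite a ε (psi_anticomm_apply rfl) _ m n u
    · exact absurd (by rw [hxy]) he

/-! ### The commutation relations of the vertex operators -/

theorem finsum_mul_map {lam : CSpace s r →ₗ[ℂ] ℂ} {R : ℤ → ℂ} {f : ℤ → CSpace s r}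
    (hf : (Function.support fun p => R p • f p).Finite) :
    ∑ᶠ p, R p * lam (f p) = lam (∑ᶠ p, R p • f p) := by
  have := map_finsum lam hf
  rw [this]
  exact finsum_congr fun p => (map_smul lam _ _).symm

theorem finite_support_reorder (x y : FieldIdx s r) (m n : ℤ) (u : CSpace s r) :
    (Function.support fun p : ℤ => reorderZ x y p • gF x (m + p) (gF y (n - p) u)).Finite := by
  obtain ⟨N, hN⟩ := laurF_gF y u
  refine (Set.finite_Icc 0 (n - N)).subset fun p hp => ?_
  by_contra hc
  simp only [Set.mem_Icc, not_and_or, not_le] at hc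
  refine hp ?_
  simp only
  rcases hc with hc | hc
  · rw [reorderZ, if_neg (not_le.2 hc), zero_smul]
  · rw [hN _ (by omega), map_zero, smul_zero]

/-- The defect of the commutation relation of two vertex operators. -/
def vDefect (x y : FieldIdx s r) (m n : ℤ) : Module.End ℂ (CSpace s r) :=
  vF x m * vF y n - vF y n * vF x m - commForm x y (-m - 1) (-n - 1) • 1

theorem atZero_vDefect {x y : FieldIdx s r} (hxy : x.comp = y.comp) {u : CSpace s r}
    (hu : TimeFree u) (hT : ∀ a, ∃ m : ℤ, TOp a u = (m : ℂ) • u) (f : Grass s r →ₗ[ℂ] ℂ) (m n : ℤ) :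
    atZero f (vDefect x y m n u) = 0 := by
  obtain ⟨κ, hκ, h1, h2⟩ := exists_weight hT
  have hk : KillsTimes (atZero f) := atZero_mulT f
  have hrel := congrArg (atZero f) (gF_relation hκ h1 h2 hxy m n)
  have e : atZero f (vDefect x y m n u) = atZero f (vF x m (vF y n u)) -
      atZero f (vF y n (vF x m u)) - atZero f (commForm x y (-m - 1) (-n - 1) • u) := by
    rw [← map_sub, ← map_sub]; rfl
  rw [e, hk.vF_vF hu, hk.vF_vF hu, finsum_mul_map (finite_support_reorder x y m n u),
    finsum_mul_map (finite_support_reorder y x n m u), ← hrel, ← map_sub, sub_self]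

end Relations

/-! ### The Leibniz rule for defects of commutation relations -/

section General

variable {M : Type*} [AddCommGroup M] [Module ℂ M]

/-- Brackets with the defect of a commutation relation. -/
theorem bracket_defect_ring {R : Type*} [Ring R] [Algebra ℂ R] {A X Y X' Y' : R}
    {e e' e'' a b : ℂ}
    (hX : A * X = X * A + a • X') (hY : A * Y = Y * A + b • Y') (he : a * e' + b * e'' = 0) :
    A * (X * Y - Y * X - e • 1) = (X * Y - Y * X - e • 1) * A +
      (a • (X' * Y - Y * X' - e' • 1) + b • (X * Y' - Y' * X - e'' • 1)) := by
  have h1 : A * (X * Y) = X * Y * A + (a • (X' * Y) + b • (X * Y')) := by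
    rw [← mul_assoc, hX, add_mul, mul_assoc, hY, mul_add, smul_mul_assoc, mul_smul_comm, mul_assoc]
    abel
  have h2 : A * (Y * X) = Y * X * A + (a • (Y * X') + b • (Y' * X)) := by
    rw [← mul_assoc, hY, add_mul, mul_assoc, hX, mul_add, smul_mul_assoc, mul_smul_comm, mul_assoc]
    abel
  have h3 : a • e' • (1 : R) + b • e'' • 1 = 0 := by
    rw [smul_smul, smul_smul, ← add_smul, he, zero_smul]
  rw [mul_sub, mul_sub, sub_mul, sub_mul, h1, h2, mul_smul_comm, smul_mul_assoc, mul_one, one_mul]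
  rw [smul_sub, smul_sub, smul_sub, smul_sub]
  rw [← sub_eq_zero]
  refine Eq.trans ?_ h3
  abel

theorem bracket_defect {A X Y X' Y' : Module.End ℂ M} {e e' e'' a b : ℂ}
    (hX : A * X = X * A + a • X') (hY : A * Y = Y * A + b • Y') (he : a * e' + b * e'' = 0) :
    A * (X * Y - Y * X - e • 1) = (X * Y - Y * X - e • 1) * A +
      (a • (X' * Y - Y * X' - e' • 1) + b • (X * Y' - Y' * X - e'' • 1)) :=
  bracket_defect_ring hX hY he

theorem comm_of_defect {X Y : Module.End ℂ M} {e : ℂ} (h : ∀ v, (X * Y - Y * X - e • 1) v = 0) :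
    X * Y - Y * X = e • 1 :=
  sub_eq_zero.1 (LinearMap.ext h)

theorem comm_of_commute {X Y : Module.End ℂ M} (h : Commute X Y) : X * Y - Y * X = (0 : ℂ) • 1 := by
  rw [h.eq, sub_self, zero_smul]

end General

/-! ### From time zero to all vectors: the commutation relations of the vertex operators -/

section Relations

variable {s r : ℕ}

/-- Dual charged fields have opposite weights, and a neutral commutator changes sign under odd
shifts. This cancels the scalar terms when a time, or a derivative by a time, is bracketed with a
commutation relation. -/
theorem commForm_balance (x y : FieldIdx s r) (c : Fin s ⊕ Fin r) {d : ℤ}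
    (hd : ∀ c', c = .inr c' → Odd d) (i j : ℤ) :
    wt c x * commForm x y (i + d) j + wt c y * commForm x y i (j + d) = 0 := by
  rcases x with ⟨a, ε⟩ | e <;> rcases y with ⟨b, η⟩ | f <;> simp only [commForm, mul_zero, add_zero]
  · by_cases h : a = b ∧ η = -ε ∧ i + d + j + 1 = 0
    · rw [if_pos h, if_pos ⟨h.1, h.2.1, by omega⟩, h.1, h.2.1]
      rcases c with a' | c
      · simp only [wt]
        split_ifs
        · rw [sg_neg]; ring
        · ring
      · simp [wt]
    · rw [if_neg h, if_neg (fun h' => h ⟨h'.1, h'.2.1, by omega⟩)]; ring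
  · by_cases h : e = f ∧ i + d + j + 1 = 0
    · rw [if_pos h, if_pos ⟨h.1, by omega⟩, h.1]
      rcases c with a' | c
      · simp [wt]
      · rw [zpow_add₀ (by norm_num), (hd c rfl).neg_one_zpow]; ring
    · rw [if_neg h, if_neg (fun h' => h ⟨h'.1, by omega⟩)]; ring

theorem wt_eq (c : Fin s ⊕ Fin r) (x : FieldIdx s r) [Decidable (c = x.comp)] :
    wt c x = if c = x.comp then x.sgn else 0 := by
  rcases c with a | c <;> rcases x with ⟨b, ε⟩ | d <;> simp [wt, FieldIdx.comp, FieldIdx.sgn]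

theorem timeMode_odd {c : Fin s ⊕ Fin r} {j : ℕ} (hj : timeMode c j) (c' : Fin r) (h : c = .inr c') :
    Odd (j : ℤ) := by
  subst h
  exact_mod_cast (hj : Odd j)

theorem compD_vF' (c : Fin s ⊕ Fin r) {j : ℕ} (hj : timeMode c j) (x : FieldIdx s r) (n : ℤ) :
    compD c j * vF x n = vF x n * compD c j + wt c x • vF x (n - j) := by
  classical
  rw [compD_vF c hj, wt_eq]

theorem compT_vF' (c : Fin s ⊕ Fin r) {j : ℕ} (hj : timeMode c j) (x : FieldIdx s r) (n : ℤ) :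
    compT c j * vF x n = vF x n * compT c j + (-(compLevel c / (j : ℂ)) * wt c x) • vF x (n + j) := by
  classical
  rw [compT_vF c hj, wt_eq]
  congr 2
  split_ifs <;> ring

/-- The defects are closed under brackets with derivatives, and below with times. This is what
permits reduction to time-free vectors at time zero. -/
theorem compD_vDefect (c : Fin s ⊕ Fin r) {j : ℕ} (hj : timeMode c j) (x y : FieldIdx s r) (m n : ℤ) :
    compD c j * vDefect x y m n = vDefect x y m n * compD c j +
      (wt c x • vDefect x y (m - j) n + wt c y • vDefect x y m (n - j)) := by
  refine bracket_defect (compD_vF' c hj x m) (compD_vF' c hj y n) ?_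
  have := commForm_balance x y c (timeMode_odd hj) (-m - 1) (-n - 1)
  rw [show -(m - (j : ℤ)) - 1 = -m - 1 + j by ring, show -(n - (j : ℤ)) - 1 = -n - 1 + j by ring]
  exact this

theorem compT_vDefect (c : Fin s ⊕ Fin r) {j : ℕ} (hj : timeMode c j) (x y : FieldIdx s r) (m n : ℤ) :
    compT c j * vDefect x y m n = vDefect x y m n * compT c j +
      ((-(compLevel c / (j : ℂ)) * wt c x) • vDefect x y (m + j) n +
        (-(compLevel c / (j : ℂ)) * wt c y) • vDefect x y m (n + j)) := by
  refine bracket_defect (compT_vF' c hj x m) (compT_vF' c hj y n) ?_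
  have := commForm_balance x y c (d := -(j : ℤ)) (fun c' h => (timeMode_odd hj c' h).neg) (-m - 1)
    (-n - 1)
  rw [show -(m + (j : ℤ)) - 1 = -m - 1 + -j by ring, show -(n + (j : ℤ)) - 1 = -n - 1 + -j by ring]
  linear_combination (-(compLevel c / (j : ℂ))) * this

/-- The span of all values on `u` of defects of the pair `x, y` is closed under derivatives, and it
vanishes at time zero; so it is zero. All modes must be treated together, as brackets change them.
-/
theorem vDefect_timeFree {x y : FieldIdx s r} (hxy : x.comp = y.comp) {u : CSpace s r}
    (hu : TimeFree u) (hT : ∀ a, ∃ m : ℤ, TOp a u = (m : ℂ) • u) (m n : ℤ) :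
    vDefect x y m n u = 0 := by
  let W := Submodule.span ℂ (Set.range fun p : ℤ × ℤ => vDefect x y p.1 p.2 u)
  have hmem : ∀ m n, vDefect x y m n u ∈ W := fun m n => Submodule.subset_span ⟨(m, n), rfl⟩
  have hW : W = ⊥ := by
    refine eq_bot_of_atZero (fun i v hv => ?_) fun f v hv => ?_
    · obtain ⟨c, j, hj, rfl⟩ := exists_timeIdx i
      rw [← compD_of hj]
      induction hv using Submodule.span_induction with
      | zero => rw [map_zero]; exact W.zero_mem
      | add v w _ _ hv hw => rw [map_add]; exact W.add_mem hv hw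
      | smul a v _ hv => rw [map_smul]; exact W.smul_mem _ hv
      | mem v hv =>
        obtain ⟨p, rfl⟩ := hv
        have := LinearMap.congr_fun (compD_vDefect c hj x y p.1 p.2) u
        simp only [Module.End.mul_apply, LinearMap.add_apply, LinearMap.smul_apply] at this
        rw [hu.compD, map_zero, zero_add] at this
        simp only
        rw [this]
        exact W.add_mem (W.smul_mem _ (hmem _ _)) (W.smul_mem _ (hmem _ _))
    · induction hv using Submodule.span_induction with
      | zero => rw [map_zero]
      | add v w _ _ hv hw => rw [map_add, hv, hw, add_zero]
      | smul a v _ hv => rw [map_smul, hv, smul_zero]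
      | mem v hv =>
        obtain ⟨p, rfl⟩ := hv
        exact atZero_vDefect hxy hu hT f p.1 p.2
  exact (Submodule.eq_bot_iff W).1 hW _ (hmem m n)

/-- The vectors without times are spanned by weight vectors. -/
theorem one_tmul_mem_span (g : Grass s r) : (1 ⊗ₜ g : CSpace s r) ∈
    Submodule.span ℂ {u : CSpace s r | TimeFree u ∧ ∀ a, ∃ m : ℤ, TOp a u = (m : ℂ) • u} := by
  have h1 : TimeFree (1 ⊗ₜ 1 : CSpace s r) ∧
      ∀ a, ∃ m : ℤ, TOp a (1 ⊗ₜ 1 : CSpace s r) = (m : ℂ) • (1 ⊗ₜ 1) :=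
    ⟨dT_one, fun a => ⟨0, by rw [TOp_one, Int.cast_zero, zero_smul]⟩⟩
  refine one_tmul_mem (Submodule.subset_span h1) (fun i v hv => ?_) g
  induction hv using Submodule.span_induction with
  | zero => rw [map_zero]; exact Submodule.zero_mem _
  | add v w _ _ hv hw => rw [map_add]; exact Submodule.add_mem _ hv hw
  | smul a v _ hv => rw [map_smul]; exact Submodule.smul_mem _ _ hv
  | mem v hv =>
    refine Submodule.subset_span ⟨hv.1.map fun j => dT_mulXi j i, fun a => ?_⟩
    obtain ⟨m, hm⟩ := hv.2 a
    refine ⟨m + xiCharge a i, ?_⟩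
    have := LinearMap.congr_fun (TOp_mulXi a i) v
    simp only [Module.End.mul_apply, LinearMap.add_apply, LinearMap.smul_apply] at this
    rw [this, hm, map_smul, ← add_smul, Int.cast_add]

/-- The common kernel of all defects of the pair contains the time-free vectors, which weight
vectors span, and is closed under multiplication by times. -/
theorem vDefect_eq_zero {x y : FieldIdx s r} (hxy : x.comp = y.comp) (m n : ℤ) (v : CSpace s r) :
    vDefect x y m n v = 0 := by
  let K : Submodule ℂ (CSpace s r) := ⨅ p : ℤ × ℤ, LinearMap.ker (vDefect x y p.1 p.2)
  have hK : ∀ v, v ∈ K ↔ ∀ m n, vDefect x y m n v = 0 := fun v => by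
    simp only [K, Submodule.mem_iInf, LinearMap.mem_ker, Prod.forall]
  have : K = ⊤ := by
    refine cSpace_induction_times (fun g => ?_) fun i v hv => ?_
    · have hle : Submodule.span ℂ {u : CSpace s r | TimeFree u ∧
          ∀ a, ∃ m : ℤ, TOp a u = (m : ℂ) • u} ≤ K :=
        Submodule.span_le.2 fun u hu => (hK u).2 (vDefect_timeFree hxy hu.1 hu.2)
      exact hle (one_tmul_mem_span g)
    · rw [hK] at hv ⊢
      intro m n
      obtain ⟨c, j, hj, rfl⟩ := exists_timeIdx i
      rw [← compT_of hj]
      have := LinearMap.congr_fun (compT_vDefect c hj x y m n) v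
      simp only [Module.End.mul_apply, LinearMap.add_apply, LinearMap.smul_apply] at this
      rw [hv, hv, hv, map_zero, smul_zero, smul_zero, add_zero, add_zero] at this
      exact this.symm
  exact (hK v).1 (this ▸ Submodule.mem_top) m n

/-- The vertex operators satisfy the commutation relations of the symplectic bosons. -/
theorem vF_comm (x y : FieldIdx s r) (m n : ℤ) :
    vF x m * vF y n - vF y n * vF x m = commForm x y (-m - 1) (-n - 1) • 1 := by
  by_cases hxy : x.comp = y.comp
  · exact comm_of_defect (vDefect_eq_zero hxy m n)
  · rw [commForm_eq, if_neg]
    · exact comm_of_commute (vF_comm_of_comp_ne hxy m n)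
    · rintro ⟨h1, -⟩
      exact hxy (by rw [h1]; cases x <;> rfl)

theorem sF_one (x : FieldIdx s r) : sF x (1 ⊗ₜ 1 : CSpace s r) = 1 ⊗ₜ 1 := SOp_one _

theorem xiF_one (x : FieldIdx s r) {n : ℤ} (hn : n < 0) : xiF x n (1 ⊗ₜ 1 : CSpace s r) = 0 := by
  rcases x with ⟨a, ε⟩ | c
  · simp only [xiF]
    rw [XiCh_of_nonpos a ε (by omega), LinearMap.smul_apply]
    by_cases h : (ε : ℤ) * (n + 1) = 0
    · rw [h, dXiCh_zero, LinearMap.zero_apply, smul_zero]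
    · rw [dXiCh_of_ne a h, dXi_one, smul_zero]
  · simp only [xiF, XiNe]
    rw [if_neg (not_le.2 hn), dXi_one]

theorem gF_one (x : FieldIdx s r) (n : ℤ) :
    gF x n (1 ⊗ₜ 1 : CSpace s r) = xiF x n (1 ⊗ₜ 1) := by
  rw [gF, fmul_apply_of_delta (mulOK_psi_zT x) (zT_one x), sub_zero, psi, Module.End.mul_apply, sF_one]

/-- On `1` the lowering exponential and `z^T` are trivial, and `Ξ` and the raising exponential
contribute nonnegative powers only. -/
theorem vF_one (x : FieldIdx s r) {n : ℤ} (hn : n < 0) : vF x n (1 ⊗ₜ 1 : CSpace s r) = 0 := by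
  rw [TimeFree.vF dT_one, fmul_apply (mulOK_expT_gF x)]
  refine finsum_eq_zero_of_forall_eq_zero fun i => ?_
  rcases lt_or_ge i 0 with hi | hi
  · rw [upF_expT x i hi, LinearMap.zero_apply]
  · rw [gF_one, xiF_one x (by omega), map_zero]

end Relations

/-! ### Ordered products of fields in two variables -/

section General

variable {M : Type*} [AddCommGroup M] [Module ℂ M]

/-- Antidiagonals up to `2 K` cover the square of side `K`, outside of which the summand vanishes.
-/
theorem sum_antidiagonal_range {N : Type*} [AddCommGroup N]
    {f : ℕ × ℕ → N} {K : ℕ} (h : ∀ a b, K ≤ a ∨ K ≤ b → f (a, b) = 0) :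
    ∑ n ∈ Finset.range (2 * K), ∑ p ∈ antidiagonal n, f p =
      ∑ a ∈ Finset.range K, ∑ b ∈ Finset.range K, f (a, b) := by
  rw [← Finset.sum_product',
    ← Finset.sum_fiberwise_of_maps_to (s := Finset.range K ×ˢ Finset.range K)
      (t := Finset.range (2 * K)) (g := fun p => p.1 + p.2)]
  · refine Finset.sum_congr rfl fun n _ => ?_
    symm
    refine Finset.sum_subset (fun p hp => mem_antidiagonal.2 (Finset.mem_filter.1 hp).2)
      fun p hp hp' => h p.1 p.2 ?_
    by_contra hc
    rw [not_or, not_le, not_le] at hc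
    exact hp' (Finset.mem_filter.2 ⟨Finset.mem_product.2
      ⟨Finset.mem_range.2 hc.1, Finset.mem_range.2 hc.2⟩, mem_antidiagonal.1 hp⟩)
  · intro p hp
    simp only [Finset.mem_product, Finset.mem_range] at hp ⊢
    omega

theorem finsum_int_eq_sum_range {N : Type*} [AddCommGroup N]
    {f : ℤ → N} {K : ℕ} (h : ∀ i, i < 0 ∨ (K : ℤ) ≤ i → f i = 0) :
    ∑ᶠ i, f i = ∑ k ∈ Finset.range K, f k := by
  rw [finsum_eq_sum_of_support_subset (s := (Finset.range K).map Nat.castEmbedding),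
    Finset.sum_map]
  · rfl
  · intro i hi
    simp only [Finset.coe_map, Finset.coe_range, Set.mem_image, Set.mem_Iio]
    by_contra hc
    refine hi (h i ?_)
    by_contra h'
    rw [not_or, not_lt, not_le] at h'
    exact hc ⟨i.toNat, by omega, Int.toNat_of_nonneg h'.1⟩

theorem finsum_nat_eq_sum_range {N : Type*} [AddCommGroup N]
    {f : ℕ → N} {K : ℕ} (h : ∀ i, K ≤ i → f i = 0) :
    ∑ᶠ i, f i = ∑ k ∈ Finset.range K, f k :=
  finsum_eq_sum_of_support_subset _ fun i hi => by
    by_contra hc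
    exact hi (h i (by simpa using hc))

theorem LocFin.exists_bound {D : FDist ℤ M} (h : LocFin D) (v : M) :
    ∃ K : ℕ, ∀ n : ℤ, n ≤ -(K : ℤ) → D n v = 0 := by
  obtain ⟨N, hN⟩ := (h v).bddBelow
  refine ⟨(1 - N).toNat, fun n hn => ?_⟩
  by_contra hc
  have := hN hc
  omega

/-- The rule for moving a lowering exponential past a raising one. -/
structure Reorders (r : ℕ → ℂ) (D E : FDist ℤ M) : Prop where
  locFin : LocFin D
  down : ∀ n > 0, D n = 0
  up : UpF E
  reorder : ∀ (n : ℕ) (l : ℤ), D (-(n : ℤ)) * E l =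
    ∑ p ∈ antidiagonal n, r p.1 • (E (l - p.1) * D (-(p.2 : ℤ)))

/-- The reordering rule is a relation between coefficients; here it is applied to a vector, where
all sums become finite and can be interchanged. -/
theorem Reorders.fmul_apply {r : ℕ → ℂ} {D E G : FDist ℤ M} (h : Reorders r D E)
    (hG : ∀ m n, Commute (G m) (E n)) (l j : ℤ) (v : M) {J : ℕ} (hJ : j < J) :
    fmul G D l (E j v) = ∑ a ∈ Finset.range J, r a • E (j - a) (fmul G D (l + a) v) := by
  obtain ⟨K₁, h1⟩ := h.locFin.exists_bound v
  obtain ⟨K₂, h2⟩ := h.locFin.exists_bound (E j v)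
  have hGD : MulOK G D := mulOK_of_locFin _ h.locFin
  have key : ∀ (w : M) (K : ℕ), (∀ n : ℤ, n ≤ -(K : ℤ) → D n w = 0) → ∀ l,
      fmul G D l w = ∑ b ∈ Finset.range K, G (l + b) (D (-(b : ℤ)) w) := by
    intro w K hK l
    rw [SympBoson.fmul_apply hGD, ← finsum_int_eq_sum_range (f := fun b => G (l + b) (D (-b) w))]
    · symm
      refine finsum_eq_of_bijective (fun b => l + b) (Equiv.addLeft l).bijective fun b => ?_
      rw [show l - (l + b) = -b by ring]
    · rintro i (hi | hi)
      · rw [h.down _ (by omega), LinearMap.zero_apply, map_zero]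
      · rw [hK _ (by omega), map_zero]
  -- Beyond `K` the raising factor has a negative exponent and the lowering coefficients kill both
  -- `v` and `E j v`.
  let K := max J (max K₁ K₂)
  let f : ℕ × ℕ → M := fun p => r p.1 • E (j - p.1) (G (l + p.1 + p.2) (D (-(p.2 : ℤ)) v))
  have hJK : J ≤ K := le_max_left _ _
  have hK1 : K₁ ≤ K := (le_max_left _ _).trans (le_max_right _ _)
  have hK2 : K₂ ≤ K := (le_max_right _ _).trans (le_max_right _ _)
  have hf : ∀ a b, K ≤ a ∨ K ≤ b → f (a, b) = 0 := by
    rintro a b (hab | hab)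
    · simp only [f]
      rw [h.up _ (by omega), LinearMap.zero_apply, smul_zero]
    · simp only [f]
      rw [h1 _ (by omega), map_zero, map_zero, smul_zero]
  have e1 : fmul G D l (E j v) = ∑ n ∈ Finset.range (2 * K), ∑ p ∈ antidiagonal n, f p := by
    rw [key _ (2 * K) (fun n hn => h2 n (by omega))]
    refine Finset.sum_congr rfl fun n _ => ?_
    have := congrArg (fun T : Module.End ℂ M => G (l + n) (T v)) (h.reorder n j)
    simp only [Module.End.mul_apply, LinearMap.sum_apply, LinearMap.smul_apply, map_sum,
      map_smul] at this
    rw [this]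
    refine Finset.sum_congr rfl fun p hp => ?_
    have hc := LinearMap.congr_fun (hG (l + n) (j - p.1)).eq (D (-(p.2 : ℤ)) v)
    simp only [Module.End.mul_apply] at hc
    rw [hc, ← mem_antidiagonal.1 hp]
    simp only [f]
    rw [Nat.cast_add, add_assoc]
  rw [e1, sum_antidiagonal_range hf, ← Finset.sum_subset (Finset.range_subset_range.2 hJK)]
  · refine Finset.sum_congr rfl fun a _ => ?_
    rw [key v K (fun n hn => h1 n (by omega)), map_sum, Finset.smul_sum]
  · intro a _ ha
    refine Finset.sum_eq_zero fun b _ => ?_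
    simp only [f]
    have : J ≤ a := by simpa using ha
    rw [h.up _ (by omega), LinearMap.zero_apply, smul_zero]

/-! ### Fields in two variables -/

/-- The product of a field in `z` and a field in `w`. -/
def sepF (A B : FDist ℤ M) : FDist (ℤ × ℤ) M := fun p => A p.1 * B p.2

/-- A field in only one of the variables, or a scalar series in `w / z`, is supported on a line of
exponents. Its products are therefore sums over one index. -/
theorem finsum_of_embedding {N : Type*} [AddCommGroup N]
    {ι κ : Type*} {e : ι → κ} (he : Function.Injective e) {f : κ → N}
    (h : ∀ q, q ∉ Set.range e → f q = 0) : ∑ᶠ q, f q = ∑ᶠ i, f (e i) := by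
  rw [← finsum_mem_range he, ← finsum_mem_univ]
  refine finsum_mem_inter_support_eq f _ _ ?_
  ext q
  simp only [Set.univ_inter, Set.mem_inter_iff]
  exact ⟨fun hq => ⟨by_contra fun hn => hq (h q hn), hq⟩, fun hq => hq.2⟩

theorem finite_support_embedding {N : Type*} [AddCommGroup N]
    {ι κ : Type*} {e : ι → κ} (he : Function.Injective e) {f : κ → N}
    (h : ∀ q, q ∉ Set.range e → f q = 0) :
    (Function.support f).Finite ↔ (Function.support fun i => f (e i)).Finite := by
  have : Function.support f = e '' Function.support fun i => f (e i) := by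
    ext q
    constructor
    · intro hq
      obtain ⟨i, rfl⟩ : q ∈ Set.range e := by_contra fun hn => hq (h q hn)
      exact ⟨i, hq, rfl⟩
    · rintro ⟨i, hi, rfl⟩
      exact hi
  rw [this, Set.finite_image_iff he.injOn]

theorem inZ_eq_zero {C : FDist ℤ M} {q : ℤ × ℤ} (hq : q ∉ Set.range fun i : ℤ => (i, (0 : ℤ))) :
    inZ C q = 0 := if_neg fun h => hq ⟨q.1, Prod.ext rfl h.symm⟩

theorem inW_eq_zero {C : FDist ℤ M} {q : ℤ × ℤ} (hq : q ∉ Set.range fun j : ℤ => ((0 : ℤ), j)) :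
    inW C q = 0 := if_neg fun h => hq ⟨q.2, Prod.ext h.symm rfl⟩

theorem mulOK_inZ {C : FDist ℤ M} {G : FDist (ℤ × ℤ) M}
    (h : ∀ m n v, (Function.support fun i => C i (G (m - i, n) v)).Finite) : MulOK (inZ C) G := by
  intro p v
  refine (finite_support_embedding (e := fun i : ℤ => (i, (0 : ℤ)))
    (fun a b h => congrArg Prod.fst h) fun q hq => ?_).2 ?_
  · show (inZ C q * G (p - q)) v = 0
    rw [inZ_eq_zero hq, zero_mul, LinearMap.zero_apply]
  · simpa [inZ, Prod.sub_def] using h p.1 p.2 v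

theorem fmul_inZ {C : FDist ℤ M} {G : FDist (ℤ × ℤ) M} (h : MulOK (inZ C) G) (m n : ℤ) (v : M) :
    fmul (inZ C) G (m, n) v = ∑ᶠ i, C i (G (m - i, n) v) := by
  rw [SympBoson.fmul_apply h]
  refine (finsum_of_embedding (e := fun i : ℤ => (i, (0 : ℤ)))
    (fun a b h => congrArg Prod.fst h) fun q hq => ?_).trans ?_
  · rw [inZ_eq_zero hq, LinearMap.zero_apply]
  · simp [inZ, Prod.sub_def]

theorem mulOK_inW {C : FDist ℤ M} {G : FDist (ℤ × ℤ) M}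
    (h : ∀ m n v, (Function.support fun j => C j (G (m, n - j) v)).Finite) : MulOK (inW C) G := by
  intro p v
  refine (finite_support_embedding (e := fun j : ℤ => ((0 : ℤ), j))
    (fun a b h => congrArg Prod.snd h) fun q hq => ?_).2 ?_
  · show (inW C q * G (p - q)) v = 0
    rw [inW_eq_zero hq, zero_mul, LinearMap.zero_apply]
  · simpa [inW, Prod.sub_def] using h p.1 p.2 v

theorem fmul_inW {C : FDist ℤ M} {G : FDist (ℤ × ℤ) M} (h : MulOK (inW C) G) (m n : ℤ) (v : M) :
    fmul (inW C) G (m, n) v = ∑ᶠ j, C j (G (m, n - j) v) := by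
  rw [SympBoson.fmul_apply h]
  refine (finsum_of_embedding (e := fun j : ℤ => ((0 : ℤ), j))
    (fun a b h => congrArg Prod.snd h) fun q hq => ?_).trans ?_
  · rw [inW_eq_zero hq, LinearMap.zero_apply]
  · simp [inW, Prod.sub_def]

/-- The series `∑ r k z ^ (e - k) w ^ k`. -/
def lineCoeff (e : ℤ) (r : ℕ → ℂ) : ℤ × ℤ → ℂ := fun p =>
  if 0 ≤ p.2 ∧ p.1 = e - p.2 then r p.2.toNat else 0

theorem lineCoeff_eq_zero {e : ℤ} {r : ℕ → ℂ} {q : ℤ × ℤ}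
    (hq : q ∉ Set.range fun k : ℕ => (e - (k : ℤ), (k : ℤ))) : lineCoeff e r q = 0 :=
  if_neg fun h => hq ⟨q.2.toNat, by ext <;> simp <;> omega⟩

theorem lineCoeff_apply (e : ℤ) (r : ℕ → ℂ) (k : ℕ) : lineCoeff e r (e - (k : ℤ), (k : ℤ)) = r k := by
  rw [lineCoeff, if_pos ⟨by simp, rfl⟩, Int.toNat_natCast]

theorem mulOK_line {e : ℤ} {r : ℕ → ℂ} {G : FDist (ℤ × ℤ) M}
    (h : ∀ m n v, (Function.support fun k : ℕ => r k • G (m - e + k, n - k) v).Finite) :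
    MulOK (scalF (lineCoeff e r)) G := by
  intro p v
  refine (finite_support_embedding (e := fun k : ℕ => (e - (k : ℤ), (k : ℤ)))
    (fun a b h => Int.natCast_inj.1 (congrArg Prod.snd h)) fun q hq => ?_).2 ?_
  · show (lineCoeff e r q • 1 * G (p - q)) v = 0
    rw [lineCoeff_eq_zero hq, zero_smul, zero_mul, LinearMap.zero_apply]
  · refine (h p.1 p.2 v).subset fun k hk => ?_
    simpa [scalF, lineCoeff_apply, Prod.sub_def, sub_sub_eq_add_sub, sub_add_eq_add_sub] using hk

theorem fmul_line {e : ℤ} {r : ℕ → ℂ} {G : FDist (ℤ × ℤ) M} (h : MulOK (scalF (lineCoeff e r)) G)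
    (m n : ℤ) (v : M) :
    fmul (scalF (lineCoeff e r)) G (m, n) v = ∑ᶠ k : ℕ, r k • G (m - e + k, n - k) v := by
  rw [SympBoson.fmul_apply h]
  refine (finsum_of_embedding (e := fun k : ℕ => (e - (k : ℤ), (k : ℤ)))
    (fun a b h => Int.natCast_inj.1 (congrArg Prod.snd h)) fun q hq => ?_).trans ?_
  · rw [scalF, lineCoeff_eq_zero hq, zero_smul, LinearMap.zero_apply]
  · refine finsum_congr fun k => ?_
    simp [scalF, lineCoeff_apply, Prod.sub_def, sub_sub_eq_add_sub, sub_add_eq_add_sub]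

theorem isFieldProd_inZ_sepF {L : List (FDist (ℤ × ℤ) M)} {A B C : FDist ℤ M}
    (hL : IsFieldProd L (sepF A B)) (h : MulOK C A) :
    IsFieldProd (inZ C :: L) (sepF (fmul C A) B) := by
  have hOK : MulOK (inZ C) (sepF A B) := mulOK_inZ fun m n v => h m (B n v)
  refine hL.cons hOK (funext fun p => LinearMap.ext fun v => ?_)
  rw [fmul_inZ hOK, sepF, Module.End.mul_apply, SympBoson.fmul_apply h]
  rfl

/-- A new factor in `w` has to pass the part in `z`, which may change to `A'` on the way; typically
`A'` is `A` times a power of `z`. -/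
theorem isFieldProd_inW_sepF {L : List (FDist (ℤ × ℤ) M)} {A A' B C : FDist ℤ M}
    (hL : IsFieldProd L (sepF A B)) (h : MulOK C B) (hCA : ∀ k m, C k * A m = A' m * C k) :
    IsFieldProd (inW C :: L) (sepF A' (fmul C B)) := by
  have e : ∀ m n j v, C j (sepF A B (m, n - j) v) = A' m (C j (B (n - j) v)) := fun m n j v =>
    LinearMap.congr_fun (hCA j m) (B (n - j) v)
  have hOK : MulOK (inW C) (sepF A B) := mulOK_inW fun m n v => by
    simp only [e]
    exact (h n v).subset fun j hj h0 => hj (by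
      simp only [Module.End.mul_apply] at h0
      simp only [h0, map_zero])
  refine hL.cons hOK (funext fun p => LinearMap.ext fun v => ?_)
  rw [fmul_inW hOK, sepF, Module.End.mul_apply, SympBoson.fmul_apply h]
  have := map_finsum (A' p.1) (h p.2 v)
  simp only [e]
  exact this.symm

theorem fmul_shift_commute {A B : FDist ℤ M} (h : MulOK A B) {C : Module.End ℂ M} {e : ℤ}
    (hA : ∀ i, C * A i = A (i + e) * C) (hB : ∀ j, Commute C (B j)) (m : ℤ) :
    C * fmul A B m = fmul A B (m + e) * C := by
  refine LinearMap.ext fun v => ?_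
  rw [Module.End.mul_apply, Module.End.mul_apply, SympBoson.fmul_apply h, SympBoson.fmul_apply h]
  have := map_finsum C (h m v)
  refine this.trans (finsum_eq_of_bijective (fun i => i + e) (Equiv.addRight e).bijective fun i => ?_)
  rw [add_sub_add_right_eq_sub]
  have h1 := LinearMap.congr_fun (hA i) (B (m - i) v)
  have h2 := LinearMap.congr_fun (hB (m - i)).eq v
  simp only [Module.End.mul_apply] at h1 h2 ⊢
  rw [h1, h2]

theorem fmul_shift_right (C A : FDist ℤ M) (e : ℤ) :
    (fmul C fun m => A (m + e)) = fun m => fmul C A (m + e) := by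
  funext m
  simp only [fmul, sub_add_eq_add_sub]

theorem mulOK_shift_right {C A : FDist ℤ M} (h : MulOK C A) (e : ℤ) : MulOK C fun m => A (m + e) :=
  fun m => by simpa only [sub_add_eq_add_sub] using h (m + e)

/-- Two factors `F` and `H` with their exponentials in front, reordered. -/
theorem Reorders.isFieldProd {r : ℕ → ℂ} {D E E' G H : FDist ℤ M} (h : Reorders r D E)
    (hG : ∀ m n, Commute (G m) (E n)) (hE' : UpF E') (hGD : LaurF (fmul G D)) (hH : LaurF H) (e : ℤ)
    {L : List (FDist (ℤ × ℤ) M)}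
    (hL : IsFieldProd L (sepF (fun m => fmul G D (m + e)) H)) :
    IsFieldProd (scalF (lineCoeff e r) :: inZ E' :: inW E :: L)
      (sepF (fmul E' (fmul G D)) (fmul E H)) := by
  set F := fmul G D with hF
  have hOK1 : MulOK (inW E) (sepF (fun m => F (m + e)) H) := mulOK_inW fun m n v => by
    obtain ⟨N, hN⟩ := hH v
    refine (Set.finite_Icc 0 (n - N)).subset fun j hj => ?_
    by_contra hc
    simp only [Set.mem_Icc, not_and_or, not_le] at hc
    refine hj ?_
    simp only
    rcases hc with hc | hc
    · rw [h.up _ hc, LinearMap.zero_apply]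
    · rw [sepF, Module.End.mul_apply, hN _ (by simp only; omega), map_zero, map_zero]
  set Y := fmul (inW E) (sepF (fun m => F (m + e)) H) with hY
  -- On a vector the exponent of `w` is bounded below, so that of the raising exponential in `w` is
  -- bounded above. The finiteness statements that follow rest on this.
  have hYv : ∀ v, ∀ N : ℤ, (∀ n < N, H n v = 0) → ∀ (K : ℕ) m n, n - N < K →
      Y (m, n) v = ∑ b ∈ Finset.range K, E b (F (m + e) (H (n - b) v)) := by
    intro v N hN K m n hK
    rw [hY, fmul_inW hOK1, finsum_int_eq_sum_range (K := K)]
    · rfl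
    · rintro i (hi | hi)
      · rw [h.up _ hi, LinearMap.zero_apply]
      · rw [sepF, Module.End.mul_apply, hN _ (by simp only; omega), map_zero, map_zero]
  have hsupp : ∀ m n v, (Function.support fun i => E' i (Y (m - i, n) v)).Finite := by
    intro m n v
    obtain ⟨N, hN⟩ := hH v
    have : ∀ b : ℕ, ∃ N' : ℤ, ∀ m < N', F m (H (n - b) v) = 0 := fun b => hGD _
    choose N' hN' using this
    refine ((Finset.range (n - N + 1).toNat).finite_toSet.biUnion fun b _ =>
      Set.finite_Icc 0 (m + e - N' b)).subset fun i hi => ?_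
    by_contra hc
    simp only [Set.mem_iUnion, not_exists, Set.mem_Icc, not_and_or, not_le, Finset.mem_coe] at hc
    refine hi ?_
    simp only
    rcases lt_or_ge i 0 with hi0 | hi0
    · rw [hE' _ hi0, LinearMap.zero_apply]
    · rw [hYv v N hN (n - N + 1).toNat _ _ (by omega), Finset.sum_eq_zero, map_zero]
      intro b hb
      have := hc b hb
      rw [hN' b _ (by omega), map_zero]
  have hOK2 : MulOK (inZ E') Y := mulOK_inZ hsupp
  set Z := fmul (inZ E') Y with hZ
  have hZv : ∀ v, ∀ N : ℤ, (∀ n < N, H n v = 0) → ∀ m, ∀ n < N, Z (m, n) v = 0 := by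
    intro v N hN m n hn
    rw [hZ, fmul_inZ hOK2]
    refine finsum_eq_zero_of_forall_eq_zero fun i => ?_
    rw [hYv v N hN 0 _ _ (by push_cast; omega), Finset.range_zero, Finset.sum_empty, map_zero]
  have hOK3 : MulOK (scalF (lineCoeff e r)) Z := mulOK_line fun m n v => by
    obtain ⟨N, hN⟩ := hH v
    refine (Finset.range (n - N + 1).toNat).finite_toSet.subset fun k hk => ?_
    by_contra hc
    simp only [Finset.mem_coe, Finset.mem_range] at hc
    refine hk ?_
    simp only
    rw [hZv v N hN _ _ (by omega), smul_zero]
  refine ((hL.cons hOK1 rfl).cons hOK2 rfl).cons hOK3 (funext fun ⟨m, n⟩ => LinearMap.ext fun v => ?_)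
  obtain ⟨N, hN⟩ := hH v
  obtain ⟨K, hK⟩ : ∃ K : ℕ, n - N < K := ⟨(n - N + 1).toNat, by omega⟩
  have hEF : MulOK E' F := mulOK_up_laur hE' hGD
  have hEH : MulOK E H := mulOK_up_laur h.up hH
  have e1 : ∀ k : ℕ, r k • Z (m - e + k, n - k) v =
      ∑ᶠ i, r k • E' i (Y (m - e + k - i, n - k) v) := fun k => by
    rw [hZ, fmul_inZ hOK2]
    exact smul_finsum' _ (hsupp _ _ v)
  -- The part `F` in `z` is moved past the raising exponential in `w`; the scalars `r k` carry
  -- `z^(-k) w^k`, and `e` corrects the power of `z`.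
  have e2 : ∀ l, F l (fmul E H n v) =
      ∑ k ∈ Finset.range K, r k • Y (l - e + k, n - k) v := by
    intro l
    rw [SympBoson.fmul_apply hEH, finsum_int_eq_sum_range (K := K), map_sum]
    · have e3 : ∀ j ∈ Finset.range K, F l (E j (H (n - j) v)) =
          ∑ a ∈ Finset.range K, r a • E (j - a) (F (l + a) (H (n - j) v)) := fun j hj =>
        h.fmul_apply hG l j _ (Int.ofNat_lt.2 (Finset.mem_range.1 hj))
      rw [Finset.sum_congr rfl e3, Finset.sum_comm]
      refine Finset.sum_congr rfl fun a _ => ?_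
      rw [hYv v N hN K _ _ (by omega), ← Finset.smul_sum, show l - e + a + e = l + a by ring]
      congr 1
      rw [← finsum_int_eq_sum_range (f := fun j => E (j - a) (F (l + a) (H (n - j) v))),
        ← finsum_int_eq_sum_range (f := fun b => E b (F (l + a) (H (n - a - b) v)))]
      · refine finsum_eq_of_bijective (fun j => j - (a : ℤ)) (Equiv.subRight (a : ℤ)).bijective
          fun j => ?_
        rw [show n - a - (j - a) = n - j by ring]
      · rintro i (hi | hi)
        · rw [h.up _ hi, LinearMap.zero_apply]
        · rw [hN _ (by omega), map_zero, map_zero]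
      · rintro i (hi | hi)
        · rw [h.up _ (by omega), LinearMap.zero_apply]
        · rw [hN _ (by omega), map_zero, map_zero]
    · rintro i (hi | hi)
      · rw [h.up _ hi, LinearMap.zero_apply]
      · rw [hN _ (by omega), map_zero]
  rw [fmul_line hOK3, sepF, Module.End.mul_apply, SympBoson.fmul_apply hEF,
    finsum_nat_eq_sum_range (K := K)]
  · rw [Finset.sum_congr rfl fun k _ => e1 k, ← finsum_sum_comm]
    · refine finsum_congr fun i => ?_
      rw [e2, map_sum]
      refine Finset.sum_congr rfl fun k _ => ?_
      rw [map_smul, show m - i - e + k = m - e + k - i by ring]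
    · intro k _
      exact (hsupp (m - e + k) (n - k) v).subset fun i hi
        (h0 : E' i (Y (m - e + k - i, n - k) v) = 0) => hi (by simp only; rw [h0, smul_zero])
  · intro k hk
    rw [hZv v N hN _ _ (by omega), smul_zero]

theorem prodF_insert_constF_one {G : Type*} [AddCommGroup G] [DecidableEq G]
    (L L' : List (FDist G M)) : prodF (L ++ constF 1 :: L') = prodF (L ++ L') := by
  induction L with
  | nil => exact fmul_constF_one _
  | cons A L ih => rw [List.cons_append, List.cons_append, prodF_cons, prodF_cons, ih]

/-- Factors `1` can be dropped. -/
theorem IsFieldProd.drop_one {G : Type*} [AddCommGroup G] [DecidableEq G] (L : List (FDist G M))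
    {L' : List (FDist G M)} {B : FDist G M} (h : IsFieldProd (L ++ constF 1 :: L') B) :
    IsFieldProd (L ++ L') B := by
  refine ⟨?_, by rw [← prodF_insert_constF_one, h.2]⟩
  have h1 := h.1
  clear h
  induction L with
  | nil => exact h1.2
  | cons A L ih =>
    refine ⟨fun n => ?_, ih h1.2⟩
    have := h1.1 n
    change LocFin fun i => A i * prodF (L ++ constF 1 :: L') (n - i) at this
    rwa [prodF_insert_constF_one] at this

theorem inZ_constF (T : Module.End ℂ M) : inZ (constF T) = constF T := by
  funext ⟨m, n⟩
  by_cases hm : m = 0 <;> by_cases hn : n = 0 <;> simp [inZ, constF, hm, hn]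

theorem inW_constF (T : Module.End ℂ M) : inW (constF T) = constF T := by
  funext ⟨m, n⟩
  by_cases hm : m = 0 <;> by_cases hn : n = 0 <;> simp [inW, constF, hm, hn]

theorem constF_one_eq_line : (constF 1 : FDist (ℤ × ℤ) M) =
    scalF (lineCoeff 0 fun k => if k = 0 then 1 else 0) := by
  funext ⟨m, n⟩
  simp only [constF, scalF, lineCoeff, Prod.mk_eq_zero]
  by_cases h : m = 0 ∧ n = 0
  · rw [if_pos h, if_pos (by omega), if_pos (by omega), one_smul]
  · rw [if_neg h]
    split_ifs
    · omega
    · rw [zero_smul]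
    · rw [zero_smul]

end General

/-! ### Products of two vertex operators -/

section Vertex

variable {s r : ℕ}

/-- The product `Ξ z ^ T e ^ ∂ S` without its first factor. -/
def tailF (x : FieldIdx s r) : FDist ℤ (CSpace s r) := fmul (expD x) (constF (sF x))

theorem locFin_tailF (x : FieldIdx s r) : LocFin (tailF x) :=
  locFin_fmul (locFin_expD x) (locFin_constF _)

theorem tailF_eq (x : FieldIdx s r) (n : ℤ) : tailF x n = expD x n * sF x := fmul_constF_right _ _ _

theorem SOp_expD (p : ℕ) (x : FieldIdx s r) (n : ℤ) : Commute (SOp p) (expD x n) := by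
  rw [expD_eq]
  exact commute_expDs (fun i => (dT_SOp i p).symm) _ _ n

theorem zT_expD (x y : FieldIdx s r) (m n : ℤ) : Commute (zT x m) (expD y n) := by
  rw [expD_eq]
  exact commute_expDs (fun i => (dT_zT i x m).symm) _ _ n

theorem xiF_expD (x y : FieldIdx s r) (m n : ℤ) : Commute (xiF x m) (expD y n) := by
  rw [expD_eq]
  exact commute_expDs (fun i => (dT_xiF i x m).symm) _ _ n

/-- `S` commutes with `z^T` and with the lowering exponential, so it may stand at the far right or
next to `Ξ`. -/
theorem fmul_xiF_tail (x : FieldIdx s r) :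
    fmul (xiF x) (fmul (zT x) (tailF x)) = fmul (gF x) (expD x) := by
  have h1 : tailF x = fmul (constF (sF x)) (expD x) :=
    fmul_comm_of fun i j => by
      rw [constF]
      split_ifs
      · exact (SOp_expD _ x i).symm.eq
      · rw [mul_zero, zero_mul]
  have h2 : fmul (zT x) (constF (sF x)) = fmul (constF (sF x)) (zT x) :=
    fmul_comm_of fun i j => by
      rw [constF]
      split_ifs
      · exact (SOp_zT _ x i).symm.eq
      · rw [mul_zero, zero_mul]
  have h3 : fmul (xiF x) (constF (sF x)) = psi x := funext fun n => fmul_constF_right _ _ _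
  rw [h1, ← fmul_assoc_locFin _ (locFin_constF _) (locFin_expD x), h2,
    fmul_assoc_locFin _ (locFin_zT x) (locFin_expD x),
    ← fmul_assoc_locFin _ (locFin_constF _) (locFin_fmul (locFin_zT x) (locFin_expD x)), h3,
    ← fmul_assoc_locFin _ (locFin_zT x) (locFin_expD x), gF]

/-- The factors of a vertex operator. -/
theorem isFieldProd_vF (x : FieldIdx s r) :
    IsFieldProd [expT x, xiF x, zT x, expD x, constF (sF x)] (vF x) := by
  have h1 : IsFieldProd [expD x, constF (sF x)] (tailF x) :=
    (IsFieldProd.singleton _).cons (mulOK_of_locFin _ (locFin_constF _)) rfl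
  have h2 := h1.cons (A := zT x) (mulOK_of_locFin _ (locFin_tailF x)) rfl
  have h3 := h2.cons (A := xiF x)
    (mulOK_of_locFin _ (locFin_fmul (locFin_zT x) (locFin_tailF x))) (fmul_xiF_tail x)
  exact h3.cons (mulOK_expT x) rfl

theorem reorders_expD_expT (x y : FieldIdx s r) :
    Reorders (reorderCoeff x y) (expD x) (expT y) where
  locFin := locFin_expD x
  down n hn := by rw [expD_eq, expDs_pos _ _ hn]
  up := upF_expT y
  reorder := expD_expT x y

/-- `S` reverses only variables of earlier components; this is why ordered products are stated for
the first component not after the second. -/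
theorem SOp_xiF_of_le {x y : FieldIdx s r} (h : compPos x.comp ≤ compPos y.comp) (n : ℤ) :
    Commute (sF x) (xiF y n) := by
  have := SOp_xiF (compPos x.comp) y n
  rw [sSign, if_neg (not_lt.2 h), one_smul] at this
  exact this

/-- The factors of a product of two vertex operators. -/
theorem isFieldProd_vF_vF {x y : FieldIdx s r} (h : compPos x.comp ≤ compPos y.comp) :
    IsFieldProd [scalF (lineCoeff (zShift x y) (reorderCoeff x y)),
      inZ (expT x), inW (expT y), inZ (xiF x), inW (xiF y), inZ (zT x), inW (zT y),
      inZ (expD x), inW (expD y), constF (sF x), constF (sF y)]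
      (sepF (vF x) (vF y)) := by
  have h1 : IsFieldProd [constF (sF x), constF (sF y)]
      (sepF (constF (sF x)) (constF (sF y)) : FDist (ℤ × ℤ) (CSpace s r)) := by
    refine (IsFieldProd.singleton _).cons (mulOK_of_locFin _ (locFin_constF _))
      (funext fun ⟨m, n⟩ => ?_)
    rw [fmul_constF_left, sepF]
    by_cases hm : m = 0 <;> by_cases hn : n = 0 <;> simp [constF, hm, hn]
  have hS : ∀ {T S : Module.End ℂ (CSpace s r)}, Commute T S → ∀ m : ℤ,
      T * (constF S : FDist ℤ _) m = (constF S : FDist ℤ _) m * T := fun {T S} h m => by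
    rw [constF]
    split_ifs
    · exact h.eq
    · rw [mul_zero, zero_mul]
  have h2 := isFieldProd_inW_sepF h1 (C := expD y) (mulOK_of_locFin _ (locFin_constF _))
    fun k m => hS (SOp_expD _ y k).symm m
  have h3 := isFieldProd_inZ_sepF h2 (C := expD x) (mulOK_of_locFin _ (locFin_constF _))
  have h4 := isFieldProd_inW_sepF h3 (C := zT y) (mulOK_of_locFin _ (locFin_tailF y)) fun k m => by
    show zT y k * tailF x m = tailF x m * zT y k
    rw [tailF_eq]
    exact ((zT_expD y x k m).mul_right (SOp_zT _ y k).symm).eq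
  have h5 := isFieldProd_inZ_sepF h4 (C := zT x) (mulOK_of_locFin _ (locFin_tailF x))
  -- Passing `z^T` costs a power of `z`, passing the exponential and `S` costs nothing. This power,
  -- with the kernel from the exponentials, makes up the rational function in front.
  have hz : ∀ k m, xiF y k * fmul (zT x) (tailF x) m =
      fmul (zT x) (tailF x) (m + zShift x y) * xiF y k := fun k m => by
    refine fmul_shift_commute (mulOK_of_locFin _ (locFin_tailF x)) (fun i => ?_) (fun j => ?_) m
    · rw [zT_xiF, add_sub_cancel_right]
    · rw [tailF_eq]
      exact (xiF_expD y x k j).mul_right (SOp_xiF_of_le h k).symm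
  have h6 := isFieldProd_inW_sepF h5 (C := xiF y)
    (A' := fun m => fmul (zT x) (tailF x) (m + zShift x y))
    (mulOK_of_locFin _ (locFin_fmul (locFin_zT y) (locFin_tailF y))) hz
  have h7 := isFieldProd_inZ_sepF h6 (C := xiF x)
    (mulOK_shift_right (mulOK_of_locFin _ (locFin_fmul (locFin_zT x) (locFin_tailF x))) _)
  have h8 : fmul (xiF y) (fmul (zT y) (fmul (expD y) (constF (sF y)))) = fmul (gF y) (expD y) :=
    fmul_xiF_tail y
  rw [fmul_shift_right, fmul_xiF_tail, h8] at h7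
  refine (reorders_expD_expT x y).isFieldProd (fun m n => ?_) (upF_expT x) ?_ ?_ (zShift x y) h7
  · rw [expT_eq]
    exact commute_expTs (fun i => (mulT_gF i x m).symm) _ _ n
  · exact laurF_fmul_locFin (laurF_gF x) (locFin_expD x)
  · exact laurF_fmul_locFin (laurF_gF y) (locFin_expD y)

theorem neg_one_pow_mul_choose (k : ℕ) : (-1 : ℂ) ^ k * ((Ring.choose (-1 : ℤ) k : ℤ) : ℂ) = 1 := by
  have : Ring.choose (-1 : ℤ) k = (-1) ^ k := by
    rw [Ring.choose_neg]
    simp [Int.negOnePow, Ring.choose_natCast, Units.smul_def]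
  rw [this]
  push_cast
  rw [← mul_pow]
  simp

/-- `(z - w)^e = z^e (1 - w/z)^e`: the power of `z` comes from the charges, the binomial series from
the exponentials. Only `e = 0, 1, -1` occur. -/
theorem zSubW_eq_line (a d : Fin s) (ε η : ℤˣ) :
    zSubW (if a = d then -((ε : ℤ) * (η : ℤ)) else 0) =
      lineCoeff (zShift (.ch a ε : FieldIdx s r) (.ch d η))
        (reorderCoeff (.ch a ε : FieldIdx s r) (.ch d η)) := by
  have key : ∀ e : ℤ, ∀ c : ℕ → ℂ, (∀ k : ℕ, (-1) ^ k * ((Ring.choose e k : ℤ) : ℂ) = c k) →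
      zSubW e = lineCoeff e c := fun e c h => funext fun p => by
    rw [zSubW, lineCoeff, h]
  have hc0 : ∀ k : ℕ, (-1 : ℂ) ^ k * ((Ring.choose (0 : ℤ) k : ℤ) : ℂ) = if k = 0 then 1 else 0 := by
    intro k
    rcases k with _ | k
    · simp
    · simp [Ring.choose_zero_succ]
  have hc1 : ∀ k : ℕ, (-1 : ℂ) ^ k * ((Ring.choose (1 : ℤ) k : ℤ) : ℂ) =
      if k = 0 then 1 else if k = 1 then -1 else 0 := by
    intro k
    have : Ring.choose (1 : ℤ) k = ((Nat.choose 1 k : ℕ) : ℤ) := by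
      simpa using Ring.choose_natCast (R := ℤ) 1 k
    rw [this]
    rcases k with _ | _ | k
    · simp
    · simp
    · simp [Nat.choose_eq_zero_of_lt (show 1 < k + 1 + 1 by omega)]
  by_cases had : a = d
  · subst had
    simp only [if_true, zShift, wtZ]
    by_cases hε : ε = η
    · subst hε
      have h1 : -((ε : ℤ) * (ε : ℤ)) = -1 := by
        rcases Int.units_eq_one_or ε with rfl | rfl <;> simp
      rw [h1]
      refine key _ _ fun k => ?_
      rw [neg_one_pow_mul_choose]
      simp [reorderCoeff]
    · have h1 : -((ε : ℤ) * (η : ℤ)) = 1 := by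
        rcases Int.units_eq_one_or ε with rfl | rfl <;> rcases Int.units_eq_one_or η with rfl | rfl
        · exact absurd rfl hε
        · simp
        · simp
        · exact absurd rfl hε
      rw [h1]
      refine key _ _ fun k => ?_
      rw [hc1]
      simp [reorderCoeff, hε]
  · simp only [if_neg had, zShift, wtZ, mul_zero, neg_zero]
    refine key _ _ fun k => ?_
    rw [hc0]
    simp [reorderCoeff, had]

theorem zAddWDivZSubW_eq_line (c : Fin r) : zAddWDivZSubW =
    lineCoeff (zShift (.ne c : FieldIdx s r) (.ne c)) (reorderCoeff (.ne c : FieldIdx s r) (.ne c)) := by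
  funext p
  simp only [zAddWDivZSubW, lineCoeff, zShift, reorderCoeff, if_true]
  split_ifs <;> first | rfl | omega

theorem isFieldProd_ch_ch {a d : Fin s} (h : a ≤ d) (ε η : ℤˣ) : IsFieldProd
    [scalF (zSubW (if a = d then -((ε : ℤ) * (η : ℤ)) else 0)),
      inZ (expT (r := r) (.ch a ε)), inW (expT (.ch d η)), inZ (XiCh a ε), inW (XiCh d η),
      inZ (zPow (sg ε • TOp a)), inW (zPow (sg η • TOp d)),
      inZ (expD (.ch a ε)), inW (expD (.ch d η)),
      constF (SOp (a : ℕ)), constF (SOp (d : ℕ))] (sepF (vF (.ch a ε)) (vF (.ch d η))) := by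
  rw [zSubW_eq_line (r := r)]
  exact isFieldProd_vF_vF (x := .ch a ε) (y := .ch d η) h

theorem isFieldProd_ne_ne {c d : Fin r} (h : c ≤ d) : IsFieldProd
    [(if c = d then scalF zAddWDivZSubW else constF 1),
      inZ (expT (s := s) (.ne c)), inW (expT (.ne d)), inZ (XiNe c), inW (XiNe d),
      inZ (expD (.ne c)), inW (expD (.ne d)),
      constF (SOp (s + (c : ℕ))), constF (SOp (s + (d : ℕ)))] (sepF (vF (.ne c)) (vF (.ne d))) := by
  have h1 := isFieldProd_vF_vF (s := s) (x := .ne c) (y := .ne d)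
    (by simp only [compPos, FieldIdx.comp]; exact Nat.add_le_add_left h s)
  have e : (if c = d then scalF zAddWDivZSubW else constF 1 : FDist (ℤ × ℤ) (CSpace s r)) =
      scalF (lineCoeff (zShift (.ne c : FieldIdx s r) (.ne d))
        (reorderCoeff (.ne c : FieldIdx s r) (.ne d))) := by
    by_cases hcd : c = d
    · subst hcd
      rw [if_pos rfl, zAddWDivZSubW_eq_line (s := s) c]
    · rw [if_neg hcd, constF_one_eq_line]
      have e1 : (fun k => if k = 0 then 1 else 0) =
          reorderCoeff (.ne c : FieldIdx s r) (.ne d) := funext fun k => by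
        simp [reorderCoeff, hcd]
      rw [e1]
      rfl
  rw [e]
  simp only [zT, inZ_constF, inW_constF] at h1
  exact (h1.drop_one [_, _, _, _, _]).drop_one [_, _, _, _, _]

theorem isFieldProd_ch_ne (a : Fin s) (ε : ℤˣ) (c : Fin r) : IsFieldProd
    [inZ (expT (.ch a ε)), inW (expT (.ne c)), inZ (XiCh a ε), inW (XiNe c),
      inZ (zPow (sg ε • TOp a)), inZ (expD (.ch a ε)), inW (expD (.ne c)),
      constF (SOp (a : ℕ)), constF (SOp (s + (c : ℕ)))] (sepF (vF (.ch a ε)) (vF (.ne c))) := by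
  have h1 := isFieldProd_vF_vF (x := (.ch a ε : FieldIdx s r)) (y := .ne c)
    (by simp only [compPos, FieldIdx.comp]; have := a.2; omega)
  have e : scalF (lineCoeff (zShift (.ch a ε : FieldIdx s r) (.ne c))
      (reorderCoeff (.ch a ε : FieldIdx s r) (.ne c))) =
      (constF 1 : FDist (ℤ × ℤ) (CSpace s r)) := by
    rw [constF_one_eq_line]
    have e1 : (fun k => if k = 0 then 1 else 0) =
        reorderCoeff (.ch a ε : FieldIdx s r) (.ne c) := funext fun k => rfl
    rw [e1]
    simp only [zShift, wtZ, mul_zero, neg_zero]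
  rw [e] at h1
  have e2 : inW (zT (.ne c : FieldIdx s r)) = (constF 1 : FDist (ℤ × ℤ) (CSpace s r)) :=
    inW_constF 1
  rw [e2] at h1
  exact (h1.drop_one []).drop_one [_, _, _, _, _]

end Vertex

/-! ### Maps from the Weyl module defined by multicomponent generators -/

section Transfer

variable {s r : ℕ}

/-- The commutator form on combinations of modes. -/
def commOmega (f g : FieldIdx s r × ℤ →₀ ℂ) : ℂ :=
  f.sum fun p a => g.sum fun q b => a * b * commForm p.1 q.1 p.2 q.2

/-- The combination of modes with given coefficients. -/
def combine {A : Type*} [AddCommGroup A] [Module ℂ A] (o : FieldIdx s r → ℤ → A) :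
    (FieldIdx s r × ℤ →₀ ℂ) →ₗ[ℂ] A := Finsupp.linearCombination ℂ fun p => o p.1 p.2

theorem combine_comm {A : Type*} [Ring A] [Algebra ℂ A] {o : FieldIdx s r → ℤ → A}
    (ho : ∀ x y i j, o x i * o y j - o y j * o x i = algebraMap ℂ A (commForm x y i j))
    (f g : FieldIdx s r × ℤ →₀ ℂ) :
    combine o f * combine o g - combine o g * combine o f = algebraMap ℂ A (commOmega f g) := by
  simp only [combine, Finsupp.linearCombination_apply, Finsupp.sum, commOmega, Finset.sum_mul_sum,
    map_sum]
  rw [Finset.sum_comm (s := g.support), ← Finset.sum_sub_distrib]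
  refine Finset.sum_congr rfl fun p _ => ?_
  rw [← Finset.sum_sub_distrib]
  refine Finset.sum_congr rfl fun q _ => ?_
  rw [smul_mul_smul_comm, smul_mul_smul_comm, mul_comm (g q), ← smul_sub, ho, Algebra.smul_def,
    ← map_mul]

theorem FieldIdx.dual_injective : Function.Injective (FieldIdx.dual (s := s) (r := r)) :=
  Function.Involutive.injective FieldIdx.dual_dual

/-- Pairing with the dual mode isolates one coefficient, so the commutator form is nondegenerate and
the modes of a relabeling are linearly independent. -/
theorem commOmega_single (f : FieldIdx s r × ℤ →₀ ℂ) (x : FieldIdx s r) (i : ℤ) :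
    commOmega f (Finsupp.single (x.dual, -i - 1) 1) =
      f (x, i) * commForm x x.dual i (-i - 1) := by
  rw [commOmega]
  have : ∀ (p : FieldIdx s r × ℤ) (a : ℂ), ((Finsupp.single (x.dual, -i - 1) (1 : ℂ)).sum fun q b =>
      a * b * commForm (s := s) (r := r) p.1 q.1 p.2 q.2) = a * commForm p.1 x.dual p.2 (-i - 1) := by
    intro p a
    rw [Finsupp.sum_single_index] <;> simp
  simp only [this]
  rw [Finsupp.sum, Finset.sum_eq_single (x, i)]
  · rintro ⟨y, j⟩ _ hne
    rw [commForm_eq, if_neg, mul_zero]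
    rintro ⟨h1, h2⟩
    exact hne (Prod.ext (FieldIdx.dual_injective h1).symm (by simp only at h2 ⊢; omega))
  · intro h
    rw [Finsupp.notMem_support_iff.1 h, zero_mul]

theorem eq_zero_of_commOmega {f : FieldIdx s r × ℤ →₀ ℂ} (h : ∀ g, commOmega f g = 0) : f = 0 := by
  ext ⟨x, i⟩
  have := h (Finsupp.single (x.dual, -i - 1) 1)
  rw [commOmega_single] at this
  exact (mul_eq_zero.1 this).resolve_right (commForm_dual_ne_zero x i)

theorem clC_nontrivial : Nontrivial ClC :=
  ⟨1, 0, fun h => vac_ne_zero (by rw [← one_smul ClC vac, h, zero_smul])⟩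

theorem commOmega_eq_zero_of_combine {B : FieldIdx s r → ℤ → ClC} (hB : IsMulticomponent s r B)
    {f : FieldIdx s r × ℤ →₀ ℂ} (h : combine B f = 0) : f = 0 :=
  eq_zero_of_commOmega fun g => by
    have := combine_comm hB.comm f g
    rw [h, zero_mul, mul_zero, sub_zero] at this
    have hne := clC_nontrivial
    exact (FaithfulSMul.algebraMap_injective ℂ ClC (this.symm.trans (map_zero _).symm))

theorem exists_combine {B : FieldIdx s r → ℤ → ClC} (hB : IsMulticomponent s r B) (i : ℤ) :
    ∃ f, combine B f = bGen i := by
  have := bGen_mem_span hB i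
  rwa [Finsupp.mem_span_range_iff_exists_finsupp] at this

/-- The Weyl algebra acts on a space with operators that satisfy the relations of the symplectic
bosons. -/
theorem exists_hom_of_modes {B : FieldIdx s r → ℤ → ClC} (hB : IsMulticomponent s r B)
    {A : Type*} [Ring A] [Algebra ℂ A] {o : FieldIdx s r → ℤ → A}
    (ho : ∀ x y i j, o x i * o y j - o y j * o x i = algebraMap ℂ A (commForm x y i j)) :
    ∃ ρ : ClC →ₐ[ℂ] A, ∀ f, ρ (combine B f) = combine o f := by
  choose f hf using exists_combine hB
  have := clC_nontrivial
  -- The commutators of combinations depend only on their coefficients. They can be compared with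
  -- the original relations inside the Weyl algebra, where scalars embed.
  obtain ⟨ρ, hρ⟩ := exists_algHom_of_weyl (fun i => combine o (f i)) fun i j => by
    rw [combine_comm ho]
    congr 1
    refine FaithfulSMul.algebraMap_injective ℂ ClC ?_
    rw [← combine_comm hB.comm, hf, hf, bGen_comm]
  refine ⟨ρ, fun g => ?_⟩
  have hmem : combine B g ∈ Submodule.span ℂ (Set.range bGen) := by
    rw [← hB.span_eq, Finsupp.mem_span_range_iff_exists_finsupp]
    exact ⟨g, rfl⟩
  rw [Finsupp.mem_span_range_iff_exists_finsupp] at hmem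
  obtain ⟨c, hc⟩ := hmem
  -- By independence of the modes, expanding through the original generators returns the
  -- coefficients of `g` themselves.
  have h1 : combine B (c.sum fun i a => a • f i) = combine B g := by
    rw [← hc, Finsupp.sum, map_sum]
    refine Finset.sum_congr rfl fun i _ => ?_
    rw [map_smul, hf]
  have h2 : (c.sum fun i a => a • f i) = g := by
    rw [← sub_eq_zero]
    refine commOmega_eq_zero_of_combine hB ?_
    rw [map_sub, h1, sub_self]
  rw [← hc, ← h2, Finsupp.sum, Finsupp.sum, map_sum, map_sum]
  refine Finset.sum_congr rfl fun i _ => ?_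
  rw [map_smul, map_smul, hρ]

/-- A creation mode in the combination would be detected by commuting with its dual annihilator on
the vacuum. Thus the original annihilators are combinations of new annihilators, as the universal
property of the Weyl module requires. -/
theorem apply_eq_zero_of_combine {B : FieldIdx s r → ℤ → ClC} (hB : IsMulticomponent s r B)
    {f : FieldIdx s r × ℤ →₀ ℂ} (hf : combine B f • vac = 0) (x : FieldIdx s r) {k : ℤ}
    (hk : k < 0) : f (x, k) = 0 := by
  have h1 := combine_comm hB.comm f (Finsupp.single (x.dual, -k - 1) 1)
  have h2 : combine B (Finsupp.single (x.dual, -k - 1) 1) = B x.dual (-k - 1) := by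
    rw [combine, Finsupp.linearCombination_single, one_smul]
  have h3 : (_ : ClC) • vac = (_ : ClC) • vac := congrArg (fun T : ClC => T • vac) h1
  rw [h2, sub_smul, mul_smul, mul_smul, hf, hB.vac _ _ (by omega), smul_zero, smul_zero, sub_zero,
    commOmega_single, algebraMap_smul] at h3
  exact (mul_eq_zero.1 ((smul_eq_zero.1 h3.symm).resolve_right vac_ne_zero)).resolve_right
    (commForm_dual_ne_zero x k)

/-- The Weyl module maps to each space with a vacuum vector and operators that satisfy the relations
of the symplectic bosons. -/
theorem exists_fc_map {B : FieldIdx s r → ℤ → ClC} (hB : IsMulticomponent s r B)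
    {N : Type*} [AddCommGroup N] [Module ℂ N] {o : FieldIdx s r → ℤ → Module.End ℂ N} {n₀ : N}
    (hn : n₀ ≠ 0) (ho : ∀ x y i j, o x i * o y j - o y j * o x i = commForm x y i j • 1)
    (hk : ∀ x i, 0 ≤ i → o x i n₀ = 0) :
    ∃ φ : Fc →ₗ[ℂ] N, φ vac = n₀ ∧ (∀ x i v, φ (op B x i v) = o x i (φ v)) ∧
      Function.Injective φ := by
  obtain ⟨ρ, hρ⟩ := exists_hom_of_modes hB (o := o) fun x y i j =>
    (ho x y i j).trans (Algebra.algebraMap_eq_smul_one _).symm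
  obtain ⟨φ, h1, h2⟩ := exists_fc_hom ρ n₀ fun j hj => by
    obtain ⟨f, hf⟩ := exists_combine hB j
    have hf0 := apply_eq_zero_of_combine hB (f := f) (by rw [hf, bGen_smul_vac hj])
    rw [← hf, hρ, combine, Finsupp.linearCombination_apply, Finsupp.sum, LinearMap.sum_apply]
    refine Finset.sum_eq_zero fun p _ => ?_
    rw [LinearMap.smul_apply]
    rcases lt_or_ge p.2 0 with hp | hp
    · rw [hf0 p.1 hp, zero_smul]
    · rw [hk _ _ hp, smul_zero]
  refine ⟨φ, h1, fun x i v => ?_, ?_⟩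
  · have h3 := hρ (Finsupp.single (x, i) 1)
    simp only [combine, Finsupp.linearCombination_single, one_smul] at h3
    rw [← h3]
    exact h2 _ _
  -- The kernel is a submodule of an irreducible module and does not contain the vacuum.
  · let W : Submodule ClC Fc :=
      { carrier := {v | φ v = 0}
        add_mem' := fun {a b} (ha : φ a = 0) (hb : φ b = 0) =>
          show φ (a + b) = 0 by rw [map_add, ha, hb, add_zero]
        zero_mem' := map_zero φ
        smul_mem' := fun x v (hv : φ v = 0) => show φ (x • v) = 0 by rw [h2, hv, map_zero] }
    have hW : ∀ v, v ∈ W ↔ φ v = 0 := fun v => Iff.rfl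
    have := fc_simple
    rcases eq_bot_or_eq_top W with h | h
    · refine (injective_iff_map_eq_zero φ).2 fun v hv => ?_
      rw [← hW, h] at hv
      exact (Submodule.mem_bot ClC).1 hv
    · refine absurd ?_ hn
      rw [← h1, ← hW, h]
      exact Submodule.mem_top

end Transfer

/-! ### Inverting `z ^ T`; invariant subspaces of exponentials -/

section General

variable {M : Type*} [AddCommGroup M] [Module ℂ M]

theorem IsZPow.mul_apply {T : Module.End ℂ M} {P : FDist ℤ M} (h : IsZPow T P) (m n : ℤ) (v : M) :
    P m (P n v) = if m = n then P n v else 0 :=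
  h.apply_eigen (LinearMap.congr_fun (h.2.2 n) v) m

theorem IsZPow.fmul_neg {T : Module.End ℂ M} {P : FDist ℤ M} (h : IsZPow T P) :
    fmul P (fun n => P (-n)) = constF 1 := by
  have hOK : MulOK P fun n => P (-n) := mulOK_of_locFin _ h.neg.1
  funext n
  refine LinearMap.ext fun v => ?_
  rw [fmul_apply hOK, constF]
  simp only [h.mul_apply]
  by_cases hn : n = 0
  · subst hn
    rw [if_pos rfl, ← h.2.1, locSum_apply h.1]
    refine finsum_congr fun i => ?_
    rw [if_pos (by ring), zero_sub, neg_neg]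
  · rw [if_neg hn, LinearMap.zero_apply]
    exact finsum_eq_zero_of_forall_eq_zero fun i => if_neg (by omega)

theorem IsZPow.zPow_neg_smul {T : Module.End ℂ M} {c : ℂ} {P : FDist ℤ M} (h : IsZPow (c • T) P) :
    zPow (-c • T) = fun n => P (-n) := by
  rw [neg_smul]
  exact zPow_eq h.neg

/-- Induction through the recursion: the leading coefficient is a combination of products of
exponent coefficients with lower ones. -/
theorem expCoeff_mem {A : ℕ → Module.End ℂ M} (hA : ∀ i j, Commute (A i) (A j)) {W : Submodule ℂ M}
    (h : ∀ j, ∀ v ∈ W, A j v ∈ W) (n : ℕ) : ∀ v ∈ W, expCoeff A n v ∈ W := by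
  induction n using Nat.strong_induction_on with
  | _ n ih =>
    intro v hv
    rcases Nat.eq_zero_or_pos n with rfl | hn
    · rw [expCoeff_zero]; exact hv
    · have h1 := LinearMap.congr_fun (expCoeff_rec hA n) v
      rw [LinearMap.smul_apply, LinearMap.sum_apply] at h1
      have hn0 : (n : ℂ) ≠ 0 := Nat.cast_ne_zero.2 hn.ne'
      rw [← inv_smul_smul₀ hn0 (expCoeff A n v), h1]
      refine W.smul_mem _ (W.sum_mem fun p hp => ?_)
      rw [LinearMap.smul_apply, Module.End.mul_apply]
      rcases Nat.eq_zero_or_pos p.1 with h0 | h0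
      · rw [h0, Nat.cast_zero, zero_smul]
        exact W.zero_mem
      · exact W.smul_mem _ (h _ _ (ih _ (by have := mem_antidiagonal.1 hp; omega) v hv))

theorem expUp_mem {A : ℕ → Module.End ℂ M} (hA : ∀ i j, Commute (A i) (A j)) {W : Submodule ℂ M}
    (h : ∀ j, ∀ v ∈ W, A j v ∈ W) (n : ℤ) (v : M) (hv : v ∈ W) : expUp A n v ∈ W := by
  rw [expUp]
  split_ifs
  · exact expCoeff_mem hA h _ v hv
  · exact W.zero_mem

end General

/-! ### Recovering the Grassmann fields; generation and vacuum of `C_{s,r}` -/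

section Vertex

variable {s r : ℕ}

theorem zT_dual_ch (a : Fin s) (ε : ℤˣ) :
    zT (.ch a ε : FieldIdx s r).dual = zPow (-sg ε • TOp a) := by
  rw [← sg_neg]; rfl

theorem fmul_zT_dual (x : FieldIdx s r) : fmul (zT x) (zT x.dual) = constF 1 := by
  rcases x with ⟨a, ε⟩ | c
  · have h := isZPow_zT (r := r) a ε
    have h2 : zT (.ch a ε : FieldIdx s r).dual = fun n => zT (.ch a ε) (-n) := by
      rw [zT_dual_ch]
      exact h.zPow_neg_smul
    rw [h2, h.fmul_neg]
  · exact fmul_constF_one _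

theorem fmul_expD_zT (x y : FieldIdx s r) : fmul (expD x) (zT y) = fmul (zT y) (expD x) :=
  fmul_comm_of fun i j => (zT_expD y x j i).symm.eq

/-- The vertex operator in terms of `Ξ S`. -/
theorem isFieldProd_vF_psi (x : FieldIdx s r) :
    IsFieldProd [expT x, psi x, expD x, zT x] (vF x) := by
  have h1 : IsFieldProd [expD x, zT x] (fmul (expD x) (zT x)) :=
    (IsFieldProd.singleton _).cons (mulOK_of_locFin _ (locFin_zT x)) rfl
  rw [fmul_expD_zT] at h1
  have h2 : IsFieldProd [psi x, expD x, zT x] (fmul (gF x) (expD x)) :=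
    h1.cons (mulOK_of_locFin _ (locFin_fmul (locFin_zT x) (locFin_expD x)))
      (fmul_assoc_locFin _ (locFin_zT x) (locFin_expD x)).symm
  exact h2.cons (mulOK_expT x) rfl

/-- `Ξ S` in terms of the vertex operator. -/
theorem isFieldProd_psi (x : FieldIdx s r) :
    IsFieldProd [expTs x.comp (-x.sgn), vF x, zT x.dual, expDs x.comp (-x.sgn)] (psi x) := by
  have hD := locFin_expDs x.comp (-x.sgn)
  have hZ := locFin_zT x.dual
  have hC := locFin_fmul hZ hD
  have h1 : IsFieldProd [zT x.dual, expDs x.comp (-x.sgn)] _ :=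
    (IsFieldProd.singleton _).cons (mulOK_of_locFin _ hD) rfl
  have hL := laurF_fmul_locFin (laurF_gF x) (locFin_expD x)
  -- The lowering exponential commutes with `z^T` and cancels against its inverse.
  have e1 : fmul (expD x) (fmul (zT x.dual) (expDs x.comp (-x.sgn))) = zT x.dual := by
    rw [← fmul_assoc_locFin _ hZ hD, fmul_expD_zT, fmul_assoc_locFin _ (locFin_expD x) hD, expD_eq,
      fmul_expDs]
    exact funext fun n => by rw [fmul_constF_right, mul_one]
  have e2 : fmul (gF x) (zT x.dual) = psi x := by
    rw [gF, fmul_assoc_locFin _ (locFin_zT x) hZ, fmul_zT_dual]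
    exact funext fun n => by rw [fmul_constF_right, mul_one]
  have h2 : IsFieldProd [vF x, zT x.dual, expDs x.comp (-x.sgn)] (fmul (expT x) (psi x)) := by
    refine h1.cons (mulOK_of_locFin _ hC) ?_
    rw [vF, fmul_assoc_up_locFin (upF_expT x) hL hC, fmul_assoc_locFin _ (locFin_expD x) hC, e1, e2]
  have h3 : fmul (expTs x.comp (-x.sgn)) (expT x) = constF 1 := by
    have := fmul_expTs x.comp (-x.sgn)
    rwa [neg_neg, ← expT_eq] at this
  refine h2.cons (mulOK_up_laur (upF_expTs _ _) (laurF_fmul_up (upF_expT x) (laurF_psi x))) ?_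
  rw [← fmul_assoc_up_up (upF_expTs _ _) (upF_expT x) (laurF_psi x), h3, fmul_constF_one]

/-- Each Grassmann variable occurs in a field with nonzero coefficient, but only together with an
operator `S`. -/
theorem mulXi_eq_psi (i : XiIdx s r) : ∃ (x : FieldIdx s r) (n : ℤ) (c : ℂ), c ≠ 0 ∧
    psi x n = c • (mulXi i * SOp (compXi i)) := by
  rcases i with ⟨a, k, hk⟩ | ⟨c, m⟩
  · obtain ⟨ε, n, hn, hε⟩ : ∃ (ε : ℤˣ) (n : ℤ), 0 < n + 1 ∧ (ε : ℤ) * (n + 1) = k := by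
      rcases lt_or_gt_of_ne hk with h | h
      · exact ⟨-1, -k - 1, by omega, by simp⟩
      · exact ⟨1, k - 1, by omega, by simp⟩
    refine ⟨.ch a ε, n, -sg ε * ((n + 1 : ℤ) : ℂ), mul_ne_zero (neg_ne_zero.2 (sg_ne_zero ε))
      (Int.cast_ne_zero.2 hn.ne'), ?_⟩
    rw [psi, xiF, XiCh_of_pos a ε hn, hε, mulXiCh_of_ne a hk, smul_mul_assoc]
    rfl
  · refine ⟨.ne c, m, (-1) ^ (m : ℤ) * (2 * ((m : ℤ) : ℂ) + 1), mul_ne_zero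
      (zpow_ne_zero _ (by norm_num)) ?_, ?_⟩
    · have : (2 * ((m : ℤ) : ℂ) + 1) = ((2 * m + 1 : ℕ) : ℂ) := by push_cast; ring
      rw [this]
      exact Nat.cast_ne_zero.2 (by omega)
    · rw [psi, xiF, XiNe, if_pos (Int.natCast_nonneg m), Int.toNat_natCast, smul_mul_assoc]
      rfl

theorem dXi_eq_xiF (i : XiIdx s r) : ∃ (x : FieldIdx s r) (n : ℤ), n < 0 ∧ xiF x n = dXi i := by
  rcases i with ⟨a, k, hk⟩ | ⟨c, m⟩
  · obtain ⟨ε, n, hn, hε⟩ : ∃ (ε : ℤˣ) (n : ℤ), n + 1 < 0 ∧ (ε : ℤ) * (n + 1) = k := by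
      rcases lt_or_gt_of_ne hk with h | h
      · exact ⟨1, k - 1, by omega, by simp⟩
      · exact ⟨-1, -k - 1, by omega, by simp⟩
    refine ⟨.ch a ε, n, by omega, ?_⟩
    rw [xiF, XiCh_of_nonpos a ε hn.le, hε, dXiCh_of_ne a hk, one_smul]
  · refine ⟨.ne c, -m - 1, by omega, ?_⟩
    rw [xiF, XiNe, if_neg (by omega), show (-(-(m : ℤ) - 1) - 1).toNat = m by omega]

/-- The products of operators `S`. -/
theorem prod_SOp_mulXi (l : List ℕ) (i : XiIdx s r) : ∃ c : ℂ, ∀ v : CSpace s r,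
    (l.map SOp).prod (mulXi i v) = c • mulXi i ((l.map SOp).prod v) := by
  induction l with
  | nil => exact ⟨1, fun v => (one_smul ℂ _).symm⟩
  | cons p l ih =>
    obtain ⟨c, hc⟩ := ih
    refine ⟨c * sSign p (compXi i), fun v => ?_⟩
    rw [List.map_cons, List.prod_cons, Module.End.mul_apply, Module.End.mul_apply, hc, map_smul,
      SOp_mulXi_apply, smul_smul]

theorem prod_SOp_mulT (l : List ℕ) (i : TIdx s r) (v : CSpace s r) :
    (l.map SOp).prod (mulT i v) = mulT i ((l.map SOp).prod v) := by
  induction l with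
  | nil => rfl
  | cons p l ih =>
    rw [List.map_cons, List.prod_cons, Module.End.mul_apply, Module.End.mul_apply, ih,
      SOp_mulT_apply]

theorem prod_SOp_one (l : List ℕ) :
    (l.map SOp).prod (1 ⊗ₜ 1 : CSpace s r) = 1 ⊗ₜ 1 := by
  induction l with
  | nil => rfl
  | cons p l ih => rw [List.map_cons, List.prod_cons, Module.End.mul_apply, ih, SOp_one]

/-- The space is generated from `1` by the times and the fields `Ξ S`. -/
theorem eq_top_of_psi {W : Submodule ℂ (CSpace s r)} (h1 : (1 ⊗ₜ 1 : CSpace s r) ∈ W)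
    (hT : ∀ i, ∀ v ∈ W, mulT i v ∈ W) (hX : ∀ x n, ∀ v ∈ W, psi x n v ∈ W) : W = ⊤ := by
  -- `W` need not be stable under `S` a priori. The vectors all of whose images under products of
  -- `S` lie in `W` are stable under the variables, since `S` is an involution that can be supplied
  -- in advance.
  let K : Submodule ℂ (CSpace s r) := ⨅ l : List ℕ, W.comap (l.map SOp).prod
  have hK : ∀ v, v ∈ K ↔ ∀ l : List ℕ, (l.map SOp).prod v ∈ W := fun v => by
    simp only [K, Submodule.mem_iInf, Submodule.mem_comap]
  have : K = ⊤ := by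
    refine cSpace_induction ?_ (fun i v hv => ?_) fun i v hv => ?_
    · rw [hK]
      intro l
      rw [prod_SOp_one]
      exact h1
    · rw [hK] at hv ⊢
      intro l
      rw [prod_SOp_mulT]
      exact hT i _ (hv l)
    · rw [hK] at hv ⊢
      intro l
      obtain ⟨c, hc⟩ := prod_SOp_mulXi l i
      rw [hc]
      refine W.smul_mem _ ?_
      obtain ⟨x, n, d, hd, hx⟩ := mulXi_eq_psi i
      have h2 := hX x n _ (hv (compXi i :: l))
      rw [hx, List.map_cons, List.prod_cons, LinearMap.smul_apply, Module.End.mul_apply,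
        Module.End.mul_apply] at h2
      have h3 := LinearMap.congr_fun (SOp_mul_self (compXi i)) ((l.map SOp).prod v)
      rw [Module.End.mul_apply, Module.End.one_apply] at h3
      rw [h3] at h2
      have h4 := W.smul_mem d⁻¹ h2
      rwa [inv_smul_smul₀ hd] at h4
  refine (Submodule.eq_top_iff'.2 fun v => ?_)
  exact (hK v).1 (this ▸ Submodule.mem_top) []

/-! ### The vacuum vector of `C_{s,r}` -/

/-- The projection to the vectors that do not depend on a Grassmann variable. -/
def xiProj (i : XiIdx s r) : Module.End ℂ (CSpace s r) := dXi i * mulXi i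

theorem xiProj_apply (i : XiIdx s r) (v : CSpace s r) : xiProj i v = dXi i (mulXi i v) := rfl

theorem mulXi_self (i : XiIdx s r) (v : CSpace s r) : mulXi i (mulXi i v) = 0 := by
  have h := mulXi_mulXi_apply i i v
  have h2 : (2 : ℂ) • mulXi i (mulXi i v) = 0 := by
    rw [two_smul]
    nth_rewrite 1 [h]
    exact neg_add_cancel _
  exact (smul_eq_zero.1 h2).resolve_left two_ne_zero

open Classical in
theorem xiProj_mulXi (i j : XiIdx s r) (v : CSpace s r) :
    xiProj i (mulXi j v) = if i = j then 0 else mulXi j (xiProj i v) := by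
  rw [xiProj_apply]
  split_ifs with h
  · subst h
    rw [mulXi_self, map_zero]
  · rw [mulXi_mulXi_apply, map_neg, dXi_mulXi_apply, if_neg h, zero_smul, zero_sub, neg_neg]
    rfl

theorem xiProj_of_dXi {i : XiIdx s r} {v : CSpace s r} (h : dXi i v = 0) : xiProj i v = v := by
  classical
  rw [xiProj_apply, dXi_mulXi_apply, if_pos rfl, one_smul, h, map_zero, sub_zero]

/-- A vector involves finitely many Grassmann variables; projecting all of them away leaves a
polynomial in the times. -/
theorem exists_xiProj (v : CSpace s r) : ∃ F : Finset (XiIdx s r), ∀ l : List (XiIdx s r),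
    (∀ i ∈ F, i ∈ l) → ∃ p, (l.map xiProj).prod v = p ⊗ₜ 1 := by
  classical
  let W : Submodule ℂ (CSpace s r) :=
    { carrier := {v | ∃ F : Finset (XiIdx s r), ∀ l : List (XiIdx s r),
        (∀ i ∈ F, i ∈ l) → ∃ p, (l.map xiProj).prod v = p ⊗ₜ 1}
      zero_mem' := ⟨∅, fun l _ => ⟨0, by rw [map_zero, TensorProduct.zero_tmul]⟩⟩
      add_mem' := by
        rintro a b ⟨F, hF⟩ ⟨G, hG⟩
        refine ⟨F ∪ G, fun l hl => ?_⟩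
        obtain ⟨p, hp⟩ := hF l fun i hi => hl i (Finset.mem_union_left _ hi)
        obtain ⟨q, hq⟩ := hG l fun i hi => hl i (Finset.mem_union_right _ hi)
        exact ⟨p + q, by rw [map_add, hp, hq, TensorProduct.add_tmul]⟩
      smul_mem' := by
        rintro c a ⟨F, hF⟩
        refine ⟨F, fun l hl => ?_⟩
        obtain ⟨p, hp⟩ := hF l hl
        exact ⟨c • p, by rw [map_smul, hp, TensorProduct.smul_tmul']⟩ }
  have key : ∀ (l : List (XiIdx s r)) (j : XiIdx s r) (v : CSpace s r),
      (l.map xiProj).prod (mulXi j v) = if j ∈ l then 0 else mulXi j ((l.map xiProj).prod v) := by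
    intro l j v
    induction l with
    | nil => exact (if_neg List.not_mem_nil).symm
    | cons i l ih =>
      rw [List.map_cons, List.prod_cons, Module.End.mul_apply, Module.End.mul_apply, ih]
      by_cases hj : j ∈ l
      · rw [if_pos hj, if_pos (List.mem_cons_of_mem _ hj), map_zero]
      · rw [if_neg hj, xiProj_mulXi]
        by_cases hij : i = j
        · rw [if_pos hij, if_pos (by rw [hij]; exact List.mem_cons_self)]
        · rw [if_neg hij, if_neg]
          rw [List.mem_cons, not_or]
          exact ⟨Ne.symm hij, hj⟩
  have hW : W = ⊤ := by
    refine cSpace_induction ?_ (fun i v hv => ?_) fun i v hv => ?_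
    · refine ⟨∅, fun l _ => ⟨1, ?_⟩⟩
      induction l with
      | nil => rfl
      | cons i l ih =>
        rw [List.map_cons, List.prod_cons, Module.End.mul_apply, ih fun j hj => by simp at hj,
          xiProj_of_dXi (dXi_one i)]
    · obtain ⟨F, hF⟩ := hv
      refine ⟨F, fun l hl => ?_⟩
      obtain ⟨p, hp⟩ := hF l hl
      refine ⟨MvPolynomial.X i * p, ?_⟩
      have : (l.map xiProj).prod (mulT i v) = mulT i ((l.map xiProj).prod v) := by
        clear hl hp
        induction l with
        | nil => rfl
        | cons j l ih =>
          rw [List.map_cons, List.prod_cons, Module.End.mul_apply, Module.End.mul_apply, ih]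
          exact LinearMap.congr_fun ((mulT_dXi i j).mul_right (mulT_mulXi i j)).symm.eq _
      rw [this, hp]
      rfl
    · refine ⟨{i}, fun l hl => ⟨0, ?_⟩⟩
      rw [key, if_pos (hl i (Finset.mem_singleton_self i)), TensorProduct.zero_tmul]
  have hv : v ∈ W := hW ▸ Submodule.mem_top
  exact hv

/-- A vector killed by all derivatives is a multiple of `1`. -/
theorem eq_smul_one_of_killed {v : CSpace s r} (hT : ∀ i, dT i v = 0) (hX : ∀ i, dXi i v = 0) :
    ∃ c : ℂ, v = c • (1 ⊗ₜ 1) := by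
  obtain ⟨F, hF⟩ := exists_xiProj v
  obtain ⟨p, hp⟩ := hF F.toList fun i hi => Finset.mem_toList.2 hi
  have h1 : ∀ l : List (XiIdx s r), (l.map xiProj).prod v = v := by
    intro l
    induction l with
    | nil => rfl
    | cons i l ih => rw [List.map_cons, List.prod_cons, Module.End.mul_apply, ih,
        xiProj_of_dXi (hX i)]
  rw [h1] at hp
  let c : ℂ := MvPolynomial.aeval (fun _ => (0 : ℂ)) p
  have hd : ∀ i, dT i (v - c • (1 ⊗ₜ 1)) = 0 := fun i => by
    rw [map_sub, map_smul, hT, dT_one, smul_zero, sub_zero]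
  have hW := eq_bot_of_atZero (W := Submodule.span ℂ {v - c • (1 ⊗ₜ 1)}) (fun i w hw => by
    obtain ⟨a, rfl⟩ := Submodule.mem_span_singleton.1 hw
    rw [map_smul, hd, smul_zero]
    exact Submodule.zero_mem _) fun f w hw => by
    obtain ⟨a, rfl⟩ := Submodule.mem_span_singleton.1 hw
    rw [map_smul, map_sub, map_smul, hp]
    have : ∀ q : MvPolynomial (TIdx s r) ℂ, atZero f (q ⊗ₜ 1) =
        f 1 * MvPolynomial.aeval (fun _ => (0 : ℂ)) q := fun q => by
      rw [atZero, LinearMap.comp_apply, timeCoeff_tmul, AlgHom.toLinearMap_apply, map_smul,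
        smul_eq_mul]
    have e1 : MvPolynomial.aeval (fun _ => (0 : ℂ)) (1 : MvPolynomial (TIdx s r) ℂ) = 1 := map_one _
    rw [this, this, e1]
    show a • (f 1 * c - c * (f 1 * 1)) = 0
    rw [smul_eq_mul]
    ring
  refine ⟨c, ?_⟩
  rw [← sub_eq_zero]
  exact (Submodule.eq_bot_iff _).1 hW _ (Submodule.mem_span_singleton_self _)

/-- The dual vacuum: the constant term of a vector. -/
def constTerm : CSpace s r →ₗ[ℂ] ℂ := atZero ExteriorAlgebra.algebraMapInv.toLinearMap

theorem constTerm_one : constTerm (1 ⊗ₜ 1 : CSpace s r) = 1 := by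
  rw [constTerm, atZero, LinearMap.comp_apply, timeCoeff_tmul, AlgHom.toLinearMap_apply,
    AlgHom.toLinearMap_apply, map_one, one_smul, map_one]

theorem constTerm_mulXi (i : XiIdx s r) (v : CSpace s r) : constTerm (mulXi i v) = 0 := by
  induction v using TensorProduct.induction_on with
  | zero => rw [map_zero, map_zero]
  | add v w hv hw => rw [map_add, map_add, hv, hw, add_zero]
  | tmul p g =>
    have e : (ExteriorAlgebra.algebraMapInv : Grass s r →ₐ[ℂ] ℂ).toLinearMap
        (ExteriorAlgebra.ι ℂ (Finsupp.single i 1) * g) = 0 := by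
      rw [AlgHom.toLinearMap_apply]
      refine (map_mul _ _ _).trans ?_
      rw [ExteriorAlgebra.algebraMapInv, ExteriorAlgebra.lift_ι_apply, LinearMap.zero_apply,
        zero_mul]
    rw [mulXi, LinearMap.lTensor_tmul, LinearMap.mulLeft_apply, constTerm, atZero,
      LinearMap.comp_apply, timeCoeff_tmul, e, zero_smul, map_zero]

end Vertex

/-! ### Linear forms that vanish on the image of `T` -/

section General

variable {M : Type*} [AddCommGroup M] [Module ℂ M]

theorem add_smul_eq_sub {a b : ℂ} (h : a = -b) (u w : M) : u + a • w = u - b • w := by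
  rw [h, neg_smul, sub_eq_add_neg]

theorem map_IsZPow_eq_zero {T : Module.End ℂ M} {P : FDist ℤ M} (h : IsZPow T P) {lam : M →ₗ[ℂ] ℂ}
    (hT : ∀ v, lam (T v) = 0) {n : ℤ} (hn : n ≠ 0) (v : M) : lam (P n v) = 0 := by
  have h1 := hT (P n v)
  have h2 := LinearMap.congr_fun (h.2.2 n) v
  rw [Module.End.mul_apply, LinearMap.smul_apply] at h2
  rw [h2, map_smul] at h1
  exact (smul_eq_zero.1 h1).resolve_left (Int.cast_ne_zero.2 hn)

end General

/-! ### Heisenberg operators on `C_{s,r}` and the dual vacuum -/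

section Heisenberg

variable {s r : ℕ}

/-- The zero mode of the Heisenberg operators on `C_{s,r}`. -/
def heisZero : Fin s ⊕ Fin r → Module.End ℂ (CSpace s r)
  | .inl a => TOp a
  | .inr _ => 0

/-- The Heisenberg operators on `C_{s,r}`. -/
def heis (c : Fin s ⊕ Fin r) (k : ℤ) : Module.End ℂ (CSpace s r) :=
  if 0 < k then -compD c k.toNat
  else if k < 0 then (((-k : ℤ) : ℂ) / compLevel c) • compT c (-k).toNat
  else heisZero c

theorem heis_pos (c : Fin s ⊕ Fin r) {j : ℕ} (hj : 0 < j) : heis c (j : ℤ) = -compD c j := by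
  rw [heis, if_pos (by omega), Int.toNat_natCast]

theorem heis_neg (c : Fin s ⊕ Fin r) {j : ℕ} (hj : 0 < j) :
    heis c (-(j : ℤ)) = ((j : ℂ) / compLevel c) • compT c j := by
  rw [heis, if_neg (by omega), if_pos (by omega), neg_neg, Int.toNat_natCast, Int.cast_natCast]

theorem heis_zero (a : Fin s) : heis (.inl a : Fin s ⊕ Fin r) 0 = TOp a := by
  rw [heis, if_neg (by omega), if_neg (by omega), heisZero]

theorem compLevel_ne_zero (c : Fin s ⊕ Fin r) : compLevel c ≠ 0 := by
  rcases c with a | c <;> simp [compLevel]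

theorem timeMode_of_curMode {c : Fin s ⊕ Fin r} {k : ℤ} {j : ℕ} (h : curMode c k) (hj : 0 < j)
    (hk : k = j ∨ k = -j) : timeMode c j := by
  rcases c with a | c
  · exact hj
  · have h' : Odd k := h
    have : Odd (j : ℤ) := by
      rcases hk with rfl | rfl
      · exact h'
      · exact neg_neg (j : ℤ) ▸ h'.neg
    exact_mod_cast this

theorem exists_inl_of_curMode_zero {c : Fin s ⊕ Fin r} (h : curMode c 0) : ∃ a, c = .inl a := by
  rcases c with a | c
  · exact ⟨a, rfl⟩
  · exact absurd h (by simp [curMode])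

/-- The brackets coincide with those of the currents with the modes of the fields. This is the link
by which currents and Heisenberg operators are identified. -/
theorem heis_vF (c : Fin s ⊕ Fin r) {k : ℤ} (hk : curMode c k) (x : FieldIdx s r) (n : ℤ)
    (v : CSpace s r) :
    heis c k (vF x n v) = vF x n (heis c k v) - wt c x • vF x (n - k) v := by
  rcases lt_trichotomy k 0 with h | rfl | h
  · obtain ⟨j, rfl⟩ : ∃ j : ℕ, k = -j := ⟨(-k).toNat, by omega⟩
    have hj : 0 < j := by omega
    have := LinearMap.congr_fun (compT_vF' c (timeMode_of_curMode hk hj (.inr rfl)) x n) v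
    simp only [Module.End.mul_apply, LinearMap.add_apply, LinearMap.smul_apply] at this
    rw [heis_neg c hj, LinearMap.smul_apply, LinearMap.smul_apply, this, smul_add, map_smul,
      smul_smul, sub_neg_eq_add]
    refine add_smul_eq_sub ?_ _ _
    have := compLevel_ne_zero c
    have : (j : ℂ) ≠ 0 := Nat.cast_ne_zero.2 hj.ne'
    field_simp
  · obtain ⟨a, rfl⟩ := exists_inl_of_curMode_zero hk
    have := LinearMap.congr_fun (TOp_vF a x n) v
    simp only [Module.End.mul_apply, LinearMap.add_apply, LinearMap.smul_apply] at this
    rw [heis_zero, this, sub_zero]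
    refine add_smul_eq_sub ?_ _ _
    rcases x with ⟨b, ε⟩ | d
    · simp only [wtZ, wt, sg]
      split_ifs <;> simp
    · simp [wtZ, wt]
  · obtain ⟨j, rfl⟩ : ∃ j : ℕ, k = j := ⟨k.toNat, by omega⟩
    have hj : 0 < j := by omega
    have := LinearMap.congr_fun (compD_vF' c (timeMode_of_curMode hk hj (.inl rfl)) x n) v
    simp only [Module.End.mul_apply, LinearMap.add_apply, LinearMap.smul_apply] at this
    rw [heis_pos c hj, LinearMap.neg_apply, LinearMap.neg_apply, this, map_neg]
    exact neg_add' _ _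

theorem heis_one (c : Fin s ⊕ Fin r) {k : ℤ} (hk : 0 ≤ k) (hc : curMode c k) :
    heis c k (1 ⊗ₜ 1 : CSpace s r) = 0 := by
  rcases hk.eq_or_lt with rfl | h
  · obtain ⟨a, rfl⟩ := exists_inl_of_curMode_zero hc
    rw [heis_zero, TOp_one]
  · obtain ⟨j, rfl⟩ : ∃ j : ℕ, k = j := ⟨k.toNat, by omega⟩
    rw [heis_pos c (by omega), LinearMap.neg_apply, compD_one, neg_zero]

open Classical in
theorem heis_heis_one (c d : Fin s ⊕ Fin r) {k : ℤ} {j : ℕ} (hk : 0 ≤ k) (hj : 0 < j)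
    (hc : curMode c k) :
    heis c k (heis d (-(j : ℤ)) (1 ⊗ₜ 1 : CSpace s r)) =
      (if c = d ∧ k = j then -curLevel c k else 0) • (1 ⊗ₜ 1) := by
  rw [heis_neg d hj, LinearMap.smul_apply, map_smul]
  rcases hk.eq_or_lt with rfl | h
  · obtain ⟨a, rfl⟩ := exists_inl_of_curMode_zero hc
    have hT : TOp a (compT d j (1 ⊗ₜ 1 : CSpace s r)) = 0 := by
      have := LinearMap.congr_fun (commute_compT (TOp_mulT a) d j).eq (1 ⊗ₜ 1 : CSpace s r)
      simp only [Module.End.mul_apply] at this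
      rw [this, TOp_one, map_zero]
    rw [heis_zero, hT, smul_zero, if_neg (by omega), zero_smul]
  · obtain ⟨i, rfl⟩ : ∃ i : ℕ, k = i := ⟨k.toNat, by omega⟩
    have hi : 0 < i := by omega
    have := LinearMap.congr_fun (compD_compT c d i j) (1 ⊗ₜ 1 : CSpace s r)
    simp only [Module.End.mul_apply, LinearMap.add_apply, LinearMap.smul_apply,
      Module.End.one_apply] at this
    rw [heis_pos c hi, LinearMap.neg_apply, this, compD_one, map_zero, zero_add, smul_neg,
      smul_smul, ← neg_smul]
    congr 1
    have htm := timeMode_of_curMode hc hi (.inl rfl)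
    by_cases h1 : c = d ∧ i = j
    · rw [if_pos ⟨htm, h1⟩, if_pos ⟨h1.1, by rw [h1.2]⟩, ← h1.1, h1.2]
      rcases c with a | c <;> simp [compLevel, curLevel]
    · rw [if_neg (fun h' => h1 h'.2), if_neg (fun h' => h1 ⟨h'.1, by omega⟩), mul_zero, neg_zero]

theorem constTerm_compT (c : Fin s ⊕ Fin r) (j : ℕ) (v : CSpace s r) :
    constTerm (compT c j v) = 0 := by
  by_cases hj : timeMode c j
  · rw [compT_of hj]
    exact atZero_mulT _ _ _
  · rw [compT_of_not hj, LinearMap.zero_apply, map_zero]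

/-- The condition on the exponent leaves only multiples of Grassmann variables, or zero at the
charged exponent `-1`; neither has a constant term. -/
theorem constTerm_psi (x : FieldIdx s r) {n : ℤ} (hn : 0 ≤ n - zShift x x) (v : CSpace s r) :
    constTerm (psi x n v) = 0 := by
  have key : ∃ (c : ℂ) (i : XiIdx s r), xiF x n = c • mulXi i ∨ xiF x n = 0 := by
    rcases x with ⟨a, ε⟩ | c
    · have h1 : zShift (.ch a ε : FieldIdx s r) (.ch a ε) = -1 := by
        rcases Int.units_eq_one_or ε with rfl | rfl <;> simp [zShift, wtZ]
      rw [h1] at hn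
      rcases (show 0 ≤ n + 1 by omega).eq_or_lt with h0 | h0
      · refine ⟨0, .inl (a, ⟨1, one_ne_zero⟩), .inr ?_⟩
        rw [xiF, XiCh_of_nonpos a ε (by omega), ← h0, mul_zero, dXiCh_zero, smul_zero]
      · have h : (ε : ℤ) * (n + 1) ≠ 0 := mul_ne_zero (by simp) h0.ne'
        exact ⟨_, _, .inl (by rw [xiF, XiCh_of_pos a ε h0, mulXiCh_of_ne a h])⟩
    · exact ⟨_, _, .inl (by rw [xiF, XiNe, if_pos (by simpa [zShift] using hn)])⟩
  obtain ⟨c, i, h | h⟩ := key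
  · rw [psi, Module.End.mul_apply, h, LinearMap.smul_apply, map_smul, constTerm_mulXi, smul_zero]
  · rw [psi, Module.End.mul_apply, h, LinearMap.zero_apply, map_zero]

theorem constTerm_TOp (a : Fin s) (v : CSpace s r) : constTerm (TOp a v) = 0 := by
  rw [TOp_apply]
  have e0 := map_finsum (constTerm (s := s) (r := r)) (locFin_TTerm a v)
  refine e0.trans (finsum_eq_zero_of_forall_eq_zero fun k => ?_)
  rw [TTerm, LinearMap.smul_apply, map_smul, Module.End.mul_apply]
  by_cases hk : k = 0
  · rw [hk, mulXiCh_zero, LinearMap.zero_apply, map_zero, smul_zero]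
  · rw [mulXiCh_of_ne a hk, constTerm_mulXi, smul_zero]

theorem constTerm_zT (x : FieldIdx s r) {n : ℤ} (hn : n ≠ 0) (v : CSpace s r) :
    constTerm (zT x n v) = 0 := by
  rcases x with ⟨a, ε⟩ | c
  · refine map_IsZPow_eq_zero (isZPow_zT a ε) (fun v => ?_) hn v
    rw [LinearMap.smul_apply, map_smul, constTerm_TOp, smul_zero]
  · rw [zT, constF, if_neg hn, LinearMap.zero_apply, map_zero]

/-- Either `Ξ` creates a variable, or `z^T`, moved to the left with its shift, projects to a nonzero
charge; the constant term sees neither. -/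
theorem constTerm_gF (x : FieldIdx s r) {n : ℤ} (hn : 0 ≤ n) (v : CSpace s r) :
    constTerm (gF x n v) = 0 := by
  rw [gF, fmul_apply (mulOK_psi_zT x)]
  have e0 := map_finsum (constTerm (s := s) (r := r)) (mulOK_psi_zT x n v)
  refine e0.trans (finsum_eq_zero_of_forall_eq_zero fun i => ?_)
  rcases le_or_gt 0 (i - zShift x x) with hi | hi
  · exact constTerm_psi x hi _
  · show constTerm ((psi x i * zT x (n - i)) v) = 0
    have := zT_psi x x (n - i + zShift x x) i
    rw [add_sub_cancel_right] at this
    rw [← this, Module.End.mul_apply]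
    exact constTerm_zT x (by omega) _

/-- The dual vacuum is killed by creation modes: the raising exponential is invisible to it, and the
lowering one only raises the exponent left for the Grassmann part. -/
theorem constTerm_vF (x : FieldIdx s r) {n : ℤ} (hn : 0 ≤ n) (v : CSpace s r) :
    constTerm (vF x n v) = 0 := by
  have hK : KillsTimes (constTerm (s := s) (r := r)) := atZero_mulT _
  rw [vF, map_fmul (mulOK_expT x) (hK.expT x), fmul_apply (mulOK_gF_expD x)]
  have e0 := map_finsum (constTerm (s := s) (r := r)) (mulOK_gF_expD x n v)
  refine e0.trans (finsum_eq_zero_of_forall_eq_zero fun i => ?_)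
  rw [Module.End.mul_apply]
  rcases lt_or_ge i n with hi | hi
  · rw [expD_eq, expDs_pos _ _ (by omega), LinearMap.zero_apply, map_zero, map_zero]
  · exact constTerm_gF x (by omega) _

/-- A vector without times and charges which is killed by the positive modes of all vertex operators
is a multiple of `1`. -/
theorem eq_smul_one_of_vF {u : CSpace s r} (hT : TimeFree u) (h0 : ∀ a, TOp a u = 0)
    (hv : ∀ x, ∀ n < 0, vF x n u = 0) : ∃ c : ℂ, u = c • (1 ⊗ₜ 1) := by
  have hz : ∀ x n, zT x n u = if n = 0 then u else 0 := by
    rintro (⟨a, ε⟩ | c) n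
    · refine (isZPow_zT a ε).apply_eigen ?_ n
      rw [LinearMap.smul_apply, h0, smul_zero, Int.cast_zero, zero_smul]
    · rw [zT, constF]
      split_ifs <;> rfl
  have hg : ∀ x n, gF x n u = psi x n u := fun x n => by
    rw [gF, fmul_apply_of_delta (mulOK_psi_zT x) (hz x), sub_zero]
  have hpsi : ∀ x, ∀ n < 0, psi x n u = 0 := by
    intro x
    obtain ⟨N, hN⟩ := laurF_psi x u
    have key : ∀ k : ℕ, ∀ n : ℤ, n < 0 → n < N + k → psi x n u = 0 := by
      intro k
      induction k with
      | zero => exact fun n _ hn => hN n (by omega)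
      | succ k ih =>
        intro n hn hk
        have h1 := hv x n hn
        rw [hT.vF, fmul_apply (mulOK_expT_gF x), finsum_eq_single _ 0] at h1
        · rw [expT_eq, expTs, expUp_zero, sub_zero, hg, Module.End.one_apply] at h1
          exact h1
        · intro i hi
          rcases lt_or_gt_of_ne hi with h | h
          · rw [upF_expT x i h, LinearMap.zero_apply]
          · rw [hg, ih _ (by omega) (by omega), map_zero]
    exact fun n hn => key (n - N + 1).toNat n hn (by omega)
  refine eq_smul_one_of_killed hT fun i => ?_
  obtain ⟨x, n, hn, hi⟩ := dXi_eq_xiF i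
  have h1 := hpsi x n hn
  rw [psi, Module.End.mul_apply, hi] at h1
  have h2 := LinearMap.congr_fun (SOp_dXi (compPos x.comp) i) u
  simp only [Module.End.mul_apply, LinearMap.smul_apply] at h2
  have h3 : sSign (compPos x.comp) (compXi i) • dXi i (SOp (compPos x.comp) u) = 0 := by
    rw [show SOp (compPos x.comp) u = sF x u from rfl, h1, smul_zero]
  rw [h3] at h2
  have h4 := LinearMap.congr_fun (SOp_mul_self (compPos x.comp)) (dXi i u)
  rw [Module.End.mul_apply, h2, map_zero, Module.End.one_apply] at h4
  exact h4.symm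

end Heisenberg

/-! ### Identification of the currents; surjectivity -/

section Intertwiner

variable {s r : ℕ} {M : Type*} [AddCommGroup M] [Module ℂ M]
  {o : FieldIdx s r → ℤ → Module.End ℂ M} {v₀ : M}

/-- A map to `C_{s,r}` that carries the modes of the symplectic bosons to vertex operators. -/
structure IsVertexMap (o : FieldIdx s r → ℤ → Module.End ℂ M) (v₀ : M) (φ : M →ₗ[ℂ] CSpace s r) :
    Prop where
  vac : φ v₀ = 1 ⊗ₜ 1
  modes : ∀ x i v, φ (o x i v) = vF x (-i - 1) (φ v)

/-- Both operators have the same brackets with the modes, so the set where they correspond is stable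
under the modes; the vacuum is cyclic. -/
theorem IsVertexMap.cur_of_vac {φ : M →ₗ[ℂ] CSpace s r} (hφ : IsVertexMap o v₀ φ)
    (h : IsBosonFock o v₀) {c : Fin s ⊕ Fin r} {k : ℤ} (hk : curMode c k)
    (h0 : φ (cur o c k v₀) = heis c k (1 ⊗ₜ 1)) (v : M) : φ (cur o c k v) = heis c k (φ v) := by
  let W : Submodule ℂ M := LinearMap.eqLocus (φ ∘ₗ cur o c k) (heis c k ∘ₗ φ)
  have hW : ∀ v, v ∈ W ↔ φ (cur o c k v) = heis c k (φ v) := fun v => Iff.rfl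
  have : W = ⊤ := by
    refine h.cyc W ?_ fun x i v hv => ?_
    · rw [hW, h0, hφ.vac]
    · rw [hW] at hv ⊢
      rw [h.cur_bracket c hk, map_sub, map_smul, hφ.modes, hφ.modes, hφ.modes, hv, heis_vF c hk,
        show -(k + i) - 1 = -i - 1 - k by ring]
  exact (hW v).1 (this ▸ Submodule.mem_top)

theorem IsVertexMap.cur_nonneg {φ : M →ₗ[ℂ] CSpace s r} (hφ : IsVertexMap o v₀ φ)
    (h : IsBosonFock o v₀) {c : Fin s ⊕ Fin r} {k : ℤ} (hk : curMode c k) (h0 : 0 ≤ k) (v : M) :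
    φ (cur o c k v) = heis c k (φ v) :=
  hφ.cur_of_vac h hk (by rw [h.cur_kill c h0, map_zero, heis_one c h0 hk]) v

/-- The currents are carried to the Heisenberg operators. -/
theorem IsVertexMap.cur {φ : M →ₗ[ℂ] CSpace s r} (hφ : IsVertexMap o v₀ φ)
    (h : IsBosonFock o v₀) {c : Fin s ⊕ Fin r} {k : ℤ} (hk : curMode c k) (v : M) :
    φ (cur o c k v) = heis c k (φ v) := by
  classical
  rcases le_or_gt 0 k with h0 | h0
  · exact hφ.cur_nonneg h hk h0 v
  obtain ⟨j, rfl⟩ : ∃ j : ℕ, k = -j := ⟨(-k).toNat, by omega⟩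
  have hj : 0 < j := by omega
  refine hφ.cur_of_vac h hk ?_ v
  -- The Heisenberg relations are known on the two vacua, so all nonnegative Heisenberg modes kill
  -- this difference; in particular it is time-free and of charge zero.
  set u := φ (SympBoson.cur o c (-(j : ℤ)) v₀) - heis c (-(j : ℤ)) (1 ⊗ₜ 1) with hu
  have h1 : ∀ (d : Fin s ⊕ Fin r) (l : ℤ), 0 ≤ l → curMode d l → heis d l u = 0 := by
    intro d l hl hdl
    rw [hu, map_sub, ← hφ.cur_nonneg h hdl hl, h.cur_cur_vac d c hl (by omega) hdl, map_smul, hφ.vac,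
      heis_heis_one d c hl hj hdl, sub_self]
  have hT : TimeFree u := fun i => by
    obtain ⟨d, l, hl, rfl⟩ := exists_timeIdx i
    have hl0 : 0 < l := by
      rcases d with a | d
      · exact hl
      · exact (show Odd l from hl).pos
    have h2 := h1 d l (by omega) (by
      rcases d with a | d
      · trivial
      · exact timeMode_odd hl d rfl)
    rw [heis_pos d hl0, LinearMap.neg_apply, neg_eq_zero, compD_of hl] at h2
    exact h2
  have h0 : ∀ a, TOp a u = 0 := fun a => by
    have := h1 (.inl a) 0 le_rfl trivial
    rwa [heis_zero] at this
  -- A positive mode of a field acts on either vector through its bracket with the current alone,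
  -- and the brackets agree.
  have hv : ∀ x, ∀ n < 0, vF x n u = 0 := by
    intro x n hn
    have e1 := h.cur_bracket c hk x (-n - 1) v₀
    rw [h.kill x _ (by omega), map_zero] at e1
    have e2 := congrArg φ (sub_eq_zero.1 e1.symm)
    rw [hφ.modes, map_smul, hφ.modes, hφ.vac] at e2
    have e3 := heis_vF c hk x n (1 ⊗ₜ 1)
    rw [vF_one x hn, map_zero] at e3
    have e4 := sub_eq_zero.1 e3.symm
    rw [hu, map_sub, e4, sub_eq_zero, ← show -(-n - 1) - 1 = n by ring, e2]
    congr 3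
    ring
  obtain ⟨a, ha⟩ := eq_smul_one_of_vF hT h0 hv
  -- One vector is a sum of vectors beginning with a creation mode, the other a multiple of a time.
  have hc : constTerm u = 0 := by
    rw [hu, map_sub, h.cur_neg_vac, map_sum, map_sum, heis_neg c hj, LinearMap.smul_apply, map_smul,
      constTerm_compT, smul_zero, sub_zero]
    refine Finset.sum_eq_zero fun i hi => ?_
    have := Finset.mem_Ico.1 hi
    rw [map_smul, map_smul, hφ.modes, constTerm_vF _ (by omega), smul_zero]
  rw [ha, map_smul, constTerm_one, smul_eq_mul, mul_one] at hc
  rw [hc, zero_smul] at ha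
  exact sub_eq_zero.1 ha

/-- The range contains `1` and is stable under Heisenberg operators and vertex operators, hence
under every factor needed to solve for `Ξ S`. -/
theorem IsVertexMap.surjective {φ : M →ₗ[ℂ] CSpace s r} (hφ : IsVertexMap o v₀ φ)
    (h : IsBosonFock o v₀) : Function.Surjective φ := by
  rw [← LinearMap.range_eq_top]
  set W := LinearMap.range φ
  have hcur : ∀ (c : Fin s ⊕ Fin r) (k : ℤ), curMode c k → ∀ v ∈ W, heis c k v ∈ W := by
    rintro c k hk _ ⟨v, rfl⟩
    exact ⟨_, hφ.cur h hk v⟩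
  have hmode : ∀ (c : Fin s ⊕ Fin r) (j : ℕ), timeMode c j → 0 < j ∧ curMode c j ∧ curMode c (-j) := by
    rintro (a | c) j hj
    · exact ⟨hj, trivial, trivial⟩
    · exact ⟨(show Odd j from hj).pos, timeMode_odd hj c rfl, (timeMode_odd hj c rfl).neg⟩
  have hT : ∀ c j, ∀ v ∈ W, compT c j v ∈ W := by
    intro c j v hv
    by_cases hj : timeMode c j
    · obtain ⟨h1, h2, h3⟩ := hmode c j hj
      have := hcur c _ h3 v hv
      rw [heis_neg c h1, LinearMap.smul_apply] at this
      have hne : (j : ℂ) / compLevel c ≠ 0 :=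
        div_ne_zero (Nat.cast_ne_zero.2 h1.ne') (compLevel_ne_zero c)
      have h4 := W.smul_mem ((j : ℂ) / compLevel c)⁻¹ this
      rwa [inv_smul_smul₀ hne] at h4
    · rw [compT_of_not hj]
      exact W.zero_mem
  have hD : ∀ c j, ∀ v ∈ W, compD c j v ∈ W := by
    intro c j v hv
    by_cases hj : timeMode c j
    · obtain ⟨h1, h2, h3⟩ := hmode c j hj
      have := hcur c _ h2 v hv
      rw [heis_pos c h1, LinearMap.neg_apply] at this
      exact (Submodule.neg_mem_iff W).1 this
    · rw [compD_of_not hj]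
      exact W.zero_mem
  have hTO : ∀ a, ∀ v ∈ W, TOp a v ∈ W := fun a v hv => by
    have := hcur (.inl a) 0 trivial v hv
    rwa [heis_zero] at this
  have hexpT : ∀ c δ n, ∀ v ∈ W, expTs c δ n v ∈ W := fun c δ =>
    expUp_mem (compT_smul_comm c δ) fun j v hv => W.smul_mem _ (hT c j v hv)
  have hexpD : ∀ c δ n, ∀ v ∈ W, expDs c δ n v ∈ W := fun c δ n => by
    rw [expDs, expDown_eq]
    exact expUp_mem (compD_smul_comm c _) (fun j v hv => W.smul_mem _ (hD c j v hv)) _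
  have hzT : ∀ x n, ∀ v ∈ W, zT x n v ∈ W := by
    rintro (⟨a, ε⟩ | c) n
    · exact (isZPow_zT a ε).mem (fun v hv => W.smul_mem _ (hTO a v hv)) n
    · intro v hv
      rw [zT, constF]
      split_ifs
      · exact hv
      · exact W.zero_mem
  have hvF : ∀ x n, ∀ v ∈ W, vF x n v ∈ W := by
    rintro x n _ ⟨v, rfl⟩
    exact ⟨_, (hφ.modes x (-n - 1) v).trans (by rw [show -(-n - 1) - 1 = n by ring])⟩
  refine eq_top_of_psi ⟨v₀, hφ.vac⟩ (fun i v hv => ?_) fun x n v hv => ?_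
  · obtain ⟨c, j, hj, rfl⟩ := exists_timeIdx i
    rw [← compT_of hj]
    exact hT c j v hv
  · rw [← (isFieldProd_psi x).2]
    refine prodF_mem (fun A hA => ?_) n v hv
    simp only [List.mem_cons, List.not_mem_nil, or_false] at hA
    rcases hA with rfl | rfl | rfl | rfl
    · exact hexpT _ _
    · exact hvF x
    · exact hzT _
    · exact hexpD _ _

end Intertwiner

/-! ### Relations transported by conjugation -/

section General

variable {M N : Type*} [AddCommGroup M] [Module ℂ M] [AddCommGroup N] [Module ℂ N]

theorem relation_of_conj (e : M ≃ₗ[ℂ] N) {A B C : Module.End ℂ M} {a c : ℂ}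
    (h : e.conj A * e.conj B - a • (e.conj B * e.conj A) = c • e.conj C) :
    A * B - a • (B * A) = c • C := by
  refine e.conj.injective ?_
  rw [map_sub, map_smul, map_smul, conj_mul', conj_mul', h]

theorem commute_of_conj (e : M ≃ₗ[ℂ] N) {A B : Module.End ℂ M}
    (h : Commute (e.conj A) (e.conj B)) : Commute A B :=
  e.conj.injective (by rw [conj_mul', conj_mul', h.eq])

theorem exists_isZPow_of_conj (e : M ≃ₗ[ℂ] N) {T : Module.End ℂ M}
    (h : ∃ P, IsZPow (e.conj T) P) : ∃ P, IsZPow T P := by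
  obtain ⟨P, hP⟩ := h
  refine ⟨conjF e.symm P, ?_⟩
  have := hP.conj e.symm
  rwa [show e.symm.conj (e.conj T) = T from LinearMap.ext fun v => by
    simp [LinearEquiv.conj_apply]] at this

theorem neg_smul_neg_end (c : ℂ) (A : Module.End ℂ M) : -c • -A = c • A := neg_smul_neg c A

theorem commute_neg_left {A C : Module.End ℂ M} (h : Commute A C) : Commute (-A) C := h.neg_left

theorem sub_one_smul_eq {A B C : Module.End ℂ M} {c : ℂ} (h : A * B - (1 : ℂ) • (B * A) = c • C) :
    A * B - B * A = c • C := by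
  rwa [one_smul] at h

theorem sub_one_smul_of {A B C : Module.End ℂ M} {c : ℂ} (h : A * B = B * A + c • C) :
    A * B - (1 : ℂ) • (B * A) = c • C := by
  rw [one_smul, h, add_sub_cancel_left]

theorem sub_neg_one_smul_of {A B C : Module.End ℂ M} {c : ℂ} (h : A * B + B * A = c • C) :
    A * B - (-1 : ℂ) • (B * A) = c • C := by
  rw [neg_one_smul, sub_neg_eq_add, h]

end General

/-! ### The isomorphism and the fields `Θ` -/

section Transport

variable {s r : ℕ} {B : FieldIdx s r → ℤ → ClC}

/-- A linear isomorphism that carries the symplectic bosons to vertex operators. -/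
structure IsVertexEquiv (B : FieldIdx s r → ℤ → ClC) (σ : Fc ≃ₗ[ℂ] CSpace s r) : Prop where
  vac : σ vac = 1 ⊗ₜ 1
  field : ∀ x, conjF σ (bField B x) = vF x
  cur : ∀ c k, curMode c k → σ.conj (cur (op B) c k) = heis c k

/-- The commutation relations and the vacuum condition produce the map, irreducibility makes it
injective, and the identified currents make it surjective. -/
theorem exists_vertexEquiv (hB : IsMulticomponent s r B) : ∃ σ, IsVertexEquiv B σ := by
  have hne : (1 ⊗ₜ 1 : CSpace s r) ≠ 0 := fun h => by
    have := constTerm_one (s := s) (r := r)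
    rw [h, map_zero] at this
    exact zero_ne_one this
  obtain ⟨φ, h1, h2, h3⟩ := exists_fc_map hB (o := fun x i => vF x (-i - 1)) hne
    (fun x y i j => by
      have := vF_comm x y (-i - 1) (-j - 1)
      rwa [show -(-i - 1) - 1 = i by ring, show -(-j - 1) - 1 = j by ring] at this)
    fun x i hi => vF_one x (by omega)
  have hφ : IsVertexMap (op B) vac φ := ⟨h1, h2⟩
  have hfock := isBosonFock_op hB
  let σ := LinearEquiv.ofBijective φ ⟨h3, hφ.surjective hfock⟩
  have hσ : ∀ v, σ v = φ v := fun v => rfl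
  refine ⟨σ, h1, fun x => funext fun n => LinearMap.ext fun v => ?_,
    fun c k hk => LinearMap.ext fun v => ?_⟩
  · rw [conjF, LinearEquiv.conj_apply_apply, hσ, bField, h2, ← hσ, LinearEquiv.apply_symm_apply,
      show -(-n - 1) - 1 = n by ring]
  · rw [LinearEquiv.conj_apply_apply, hσ, hφ.cur hfock hk, ← hσ, LinearEquiv.apply_symm_apply]

namespace IsVertexEquiv

variable {σ : Fc ≃ₗ[ℂ] CSpace s r}

theorem alphaCh_neg (h : IsVertexEquiv B σ) (a : Fin s) {j : ℕ} (hj : 0 < j) :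
    σ.conj (alphaCh B a (-(j : ℤ))) = (j : ℂ) • mulTCh a j := by
  rw [alphaCh_eq_cur, h.cur (.inl a) _ trivial, heis_neg _ hj, compLevel, div_one]; rfl

theorem alphaCh_pos (h : IsVertexEquiv B σ) (a : Fin s) {j : ℕ} (hj : 0 < j) :
    σ.conj (alphaCh B a (j : ℤ)) = -dTCh a j := by
  rw [alphaCh_eq_cur, h.cur (.inl a) _ trivial, heis_pos _ hj]; rfl

theorem alphaCh_zero (h : IsVertexEquiv B σ) (a : Fin s) : σ.conj (alphaCh B a 0) = TOp a := by
  rw [alphaCh_eq_cur, h.cur (.inl a) _ trivial, heis_zero]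

theorem alphaNe_neg (h : IsVertexEquiv B σ) (c : Fin r) {j : ℕ} (hj : Odd j) :
    σ.conj (alphaNe B c (-(j : ℤ))) = ((j : ℂ) / 2) • mulTNe c j := by
  have hj' : Odd (-(j : ℤ)) := (by exact_mod_cast hj : Odd (j : ℤ)).neg
  rw [alphaNe_eq_cur, h.cur (.inr c) _ hj', heis_neg _ hj.pos]; rfl

theorem alphaNe_pos (h : IsVertexEquiv B σ) (c : Fin r) {j : ℕ} (hj : Odd j) :
    σ.conj (alphaNe B c (j : ℤ)) = -dTNe c j := by
  have hj' : Odd (j : ℤ) := by exact_mod_cast hj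
  rw [alphaNe_eq_cur, h.cur (.inr c) _ hj', heis_pos _ hj.pos]; rfl

theorem eMinus (h : IsVertexEquiv B σ) (a : Fin s) (δ : ℂ) :
    conjF σ (EMinus (alphaCh B a) δ) = expTs (.inl a) δ := by
  rw [EMinus, conjF_expUp, expTs]
  refine expUp_congr fun j hj => ?_
  have : (j : ℂ) ≠ 0 := Nat.cast_ne_zero.2 hj
  rw [map_smul, h.alphaCh_neg a (Nat.pos_of_ne_zero hj), smul_smul]
  congr 1
  field_simp

theorem ePlus (h : IsVertexEquiv B σ) (a : Fin s) (δ : ℂ) :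
    conjF σ (EPlus (alphaCh B a) δ) = expDs (.inl a) δ := by
  rw [EPlus, conjF_expDown, expDs]
  refine expDown_congr fun j hj => ?_
  rw [map_smul, h.alphaCh_pos a (Nat.pos_of_ne_zero hj), compLevel, mul_one]
  exact neg_smul_neg_end _ _

theorem vMinus (h : IsVertexEquiv B σ) (c : Fin r) (δ : ℂ) :
    conjF σ (VMinus (alphaNe B c) δ) = expTs (.inr c) δ := by
  rw [VMinus, conjF_expUp, expTs]
  refine expUp_congr fun j hj => ?_
  have : (j : ℂ) ≠ 0 := Nat.cast_ne_zero.2 hj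
  by_cases hodd : Odd j
  · rw [if_pos hodd, map_smul, h.alphaNe_neg c hodd, smul_smul]
    congr 1
    field_simp
  · rw [if_neg hodd, map_zero, compT_of_not (c := .inr c) hodd, smul_zero]

theorem vPlus (h : IsVertexEquiv B σ) (c : Fin r) (δ : ℂ) :
    conjF σ (VPlus (alphaNe B c) δ) = expDs (.inr c) δ := by
  rw [VPlus, conjF_expDown, expDs]
  refine expDown_congr fun j hj => ?_
  by_cases hodd : Odd j
  · rw [if_pos hodd, map_smul, h.alphaNe_pos c hodd, compLevel, mul_comm δ]
    exact neg_smul_neg_end _ _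
  · rw [if_neg hodd, map_zero, compD_of_not (c := .inr c) hodd, smul_zero]

theorem exists_isZPow (h : IsVertexEquiv B σ) (a : Fin s) (ε : ℤˣ) :
    ∃ P, IsZPow (sg ε • alphaCh B a 0) P :=
  exists_isZPow_of_conj σ (by rw [map_smul, h.alphaCh_zero]; exact exists_isZPow_TOp a ε)

theorem zPow (h : IsVertexEquiv B σ) (a : Fin s) (ε : ℤˣ) :
    conjF σ (SympBoson.zPow (sg ε • alphaCh B a 0)) = zT (.ch a ε) := by
  rw [← zPow_conj σ (h.exists_isZPow a ε), map_smul, h.alphaCh_zero]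
  rfl

theorem isFieldProd_thetaCh (h : IsVertexEquiv B σ) (a : Fin s) (ε : ℤˣ) :
    IsFieldProd ((thetaChFactors B a ε).map (conjF σ)) (psi (.ch a ε)) := by
  rw [thetaChFactors, List.map_cons, List.map_cons, List.map_cons, List.map_cons, List.map_nil,
    h.eMinus, h.field, ← sg_neg, h.zPow, h.ePlus, sg_neg]
  exact isFieldProd_psi (.ch a ε)

theorem prodOK_thetaCh (h : IsVertexEquiv B σ) (a : Fin s) (ε : ℤˣ) :
    ProdOK (thetaChFactors B a ε) := (prodOK_conjF σ).1 (h.isFieldProd_thetaCh a ε).1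

theorem thetaCh (h : IsVertexEquiv B σ) (a : Fin s) (ε : ℤˣ) :
    conjF σ (SympBoson.thetaCh B a ε) = psi (.ch a ε) := by
  rw [SympBoson.thetaCh, ← prodF_conjF]
  exact (h.isFieldProd_thetaCh a ε).2

theorem isFieldProd_thetaNe (h : IsVertexEquiv B σ) (c : Fin r) :
    IsFieldProd ((thetaNeFactors B c).map (conjF σ)) (psi (.ne c)) := by
  rw [thetaNeFactors, List.map_cons, List.map_cons, List.map_cons, List.map_nil,
    h.vMinus, h.field, h.vPlus]
  exact (isFieldProd_psi (s := s) (.ne c)).drop_one [_, _]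

theorem prodOK_thetaNe (h : IsVertexEquiv B σ) (c : Fin r) :
    ProdOK (thetaNeFactors B c) := (prodOK_conjF σ).1 (h.isFieldProd_thetaNe c).1

theorem thetaNe (h : IsVertexEquiv B σ) (c : Fin r) :
    conjF σ (SympBoson.thetaNe B c) = psi (.ne c) := by
  rw [SympBoson.thetaNe, ← prodF_conjF]
  exact (h.isFieldProd_thetaNe c).2

theorem isFieldProd_bField_ch (h : IsVertexEquiv B σ) (a : Fin s) (ε : ℤˣ) : IsFieldProd
    [EMinus (alphaCh B a) (sg ε), SympBoson.thetaCh B a ε, EPlus (alphaCh B a) (sg ε),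
      SympBoson.zPow (sg ε • alphaCh B a 0)] (bField B (.ch a ε)) := by
  rw [← isFieldProd_conjF σ, List.map_cons, List.map_cons, List.map_cons, List.map_cons,
    List.map_nil, h.eMinus, h.thetaCh, h.ePlus, h.zPow, h.field]
  have := isFieldProd_vF_psi (r := r) (.ch a ε)
  rwa [expT_eq, expD_eq] at this

theorem isFieldProd_bField_ne (h : IsVertexEquiv B σ) (c : Fin r) : IsFieldProd
    [VMinus (alphaNe B c) 1, SympBoson.thetaNe B c, VPlus (alphaNe B c) 1] (bField B (.ne c)) := by
  rw [← isFieldProd_conjF σ, List.map_cons, List.map_cons, List.map_cons,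
    List.map_nil, h.vMinus, h.thetaNe, h.vPlus, h.field]
  have := isFieldProd_vF_psi (s := s) (.ne c)
  rw [expT_eq, expD_eq] at this
  exact this.drop_one [_, _, _]

end IsVertexEquiv

/-- `Ξ S` contains no times, so only the charge fails to commute with it. -/
theorem heis_psi (c : Fin s ⊕ Fin r) {k : ℤ} (hk : curMode c k) (x : FieldIdx s r) (n : ℤ) :
    heis c k * psi x n = psi x n * heis c k + (if k = 0 then -wt c x else 0) • psi x n := by
  rcases lt_trichotomy k 0 with h | rfl | h
  · obtain ⟨j, rfl⟩ : ∃ j : ℕ, k = -j := ⟨(-k).toNat, by omega⟩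
    rw [heis_neg c (by omega), if_neg h.ne, zero_smul, add_zero]
    exact ((commute_compT (fun i => (mulT_psi i x n).symm) c j).symm.smul_left _).eq
  · obtain ⟨a, rfl⟩ := exists_inl_of_curMode_zero hk
    rw [heis_zero, TOp_psi, if_pos rfl]
    congr 2
    rcases x with ⟨b, ε⟩ | d
    · simp only [wtZ, wt, sg]
      split_ifs <;> simp
    · simp [wtZ, wt]
  · obtain ⟨j, rfl⟩ : ∃ j : ℕ, k = j := ⟨k.toNat, by omega⟩
    rw [heis_pos c (by omega), if_neg h.ne', zero_smul, add_zero]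
    exact (commute_neg_left (commute_compD (fun i => (dT_psi i x n).symm) c j).symm).eq

open Classical in
theorem psi_relation (x y : FieldIdx s r) (m n : ℤ) :
    psi x m * psi y n - (if x.comp = y.comp then -1 else 1 : ℂ) • (psi y n * psi x m) =
      xiForm x y m n • 1 := by
  split_ifs with h
  · exact sub_neg_one_smul_of (psi_anticomm h m n)
  · have h0 : xiForm x y m n = 0 := by
      rcases x with ⟨a, ε⟩ | c <;> rcases y with ⟨b, η⟩ | d <;>
        simp only [FieldIdx.comp, Sum.inl.injEq, Sum.inr.injEq] at h <;> simp [xiForm, h]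
    refine sub_one_smul_of ?_
    rw [h0, zero_smul, add_zero]
    exact (psi_comm h m n).eq

end Transport

section General

variable {M N : Type*} [AddCommGroup M] [Module ℂ M] [AddCommGroup N] [Module ℂ N]

theorem apply_symm_of_conj_eq {σ σ' : M ≃ₗ[ℂ] N} {A : Module.End ℂ M} {X : Module.End ℂ N}
    (h : σ.conj A = X) (h' : σ'.conj A = X) {v : N} (hv : σ' (σ.symm v) = v) :
    σ' (σ.symm (X v)) = X v := by
  have h1 : σ.symm (X v) = A (σ.symm v) := by
    rw [← h, LinearEquiv.conj_apply_apply, LinearEquiv.symm_apply_apply]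
  have h2 := LinearMap.congr_fun h' v
  rw [LinearEquiv.conj_apply_apply] at h2
  rw [h1, ← h2]
  congr 2
  rw [LinearEquiv.eq_symm_apply, hv]

theorem apply_symm_of_smul {σ σ' : M ≃ₗ[ℂ] N} {c : ℂ} (hc : c ≠ 0) {X : Module.End ℂ N} {v : N}
    (h : σ' (σ.symm ((c • X) v)) = (c • X) v) : σ' (σ.symm (X v)) = X v := by
  rw [LinearMap.smul_apply, map_smul, map_smul] at h
  exact smul_right_injective N hc h

theorem normal_add {X Y : Module.End ℂ M} {c : ℂ} (h : X * Y - Y * X = c • 1) :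
    Y * X + c • 1 = X * Y := by
  rw [← h, add_sub_cancel]

end General

/-! ### Uniqueness, vertex operators and normally ordered products -/

section Bosonization

variable {s r : ℕ} {B : FieldIdx s r → ℤ → ClC} {σ : Fc ≃ₗ[ℂ] CSpace s r}

theorem IsVertexEquiv.isBosonization (h : IsVertexEquiv B σ) : IsBosonization B σ where
  vac := h.vac
  alphaCh_neg a _ hj := h.alphaCh_neg a hj
  alphaCh_pos a _ hj := h.alphaCh_pos a hj
  alphaCh_zero := h.alphaCh_zero
  alphaNe_neg c _ hj := h.alphaNe_neg c hj
  alphaNe_pos c _ hj := h.alphaNe_pos c hj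
  thetaCh a ε n := congrFun (h.thetaCh a ε) n
  thetaNe c n := congrFun (h.thetaNe c) n

/-- The vectors fixed by `σ' σ⁻¹` contain `1` and are stable under the times and `Ξ S`, since both
maps carry the same operators to these; they exhaust the space. -/
theorem IsBosonization.unique {σ' : Fc ≃ₗ[ℂ] CSpace s r} (h : IsBosonization B σ)
    (h' : IsBosonization B σ') : σ' = σ := by
  let W : Submodule ℂ (CSpace s r) :=
    LinearMap.eqLocus (σ'.toLinearMap ∘ₗ σ.symm.toLinearMap) LinearMap.id
  have hW : ∀ v, v ∈ W ↔ σ' (σ.symm v) = v := fun v => Iff.rfl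
  have : W = ⊤ := by
    refine eq_top_of_psi ?_ (fun i v hv => ?_) fun x n v hv => ?_
    · rw [hW, ← h.vac, LinearEquiv.symm_apply_apply, h'.vac, h.vac]
    · rw [hW] at hv ⊢
      obtain ⟨c, j, hj, rfl⟩ := exists_timeIdx i
      rw [← compT_of hj]
      rcases c with a | c
      · have hj' : 0 < j := hj
        exact apply_symm_of_smul (Nat.cast_ne_zero.2 hj'.ne')
          (apply_symm_of_conj_eq (h.alphaCh_neg a j hj') (h'.alphaCh_neg a j hj') hv)
      · have hj' : Odd j := hj
        exact apply_symm_of_smul (div_ne_zero (Nat.cast_ne_zero.2 hj'.pos.ne') two_ne_zero)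
          (apply_symm_of_conj_eq (h.alphaNe_neg c j hj') (h'.alphaNe_neg c j hj') hv)
    · rw [hW] at hv ⊢
      rcases x with ⟨a, ε⟩ | c
      · exact apply_symm_of_conj_eq (h.thetaCh a ε n) (h'.thetaCh a ε n) hv
      · exact apply_symm_of_conj_eq (h.thetaNe c n) (h'.thetaNe c n) hv
  refine LinearEquiv.ext fun w => ?_
  have h1 : σ w ∈ W := this ▸ Submodule.mem_top
  rw [hW, LinearEquiv.symm_apply_apply] at h1
  exact h1

namespace IsVertexEquiv

theorem conj_bField (h : IsVertexEquiv B σ) (x : FieldIdx s r) :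
    (fun n => σ.conj (bField B x n)) = vF x := h.field x

theorem isFieldProd_ch (h : IsVertexEquiv B σ) (a : Fin s) (ε : ℤˣ) : IsFieldProd
    [expT (.ch a ε), XiCh a ε, SympBoson.zPow (sg ε • TOp a), expD (.ch a ε), constF (SOp (a : ℕ))]
    (fun n => σ.conj (bField B (.ch a ε) n)) := by
  rw [h.conj_bField]
  exact isFieldProd_vF (.ch a ε)

theorem isFieldProd_ne (h : IsVertexEquiv B σ) (c : Fin r) : IsFieldProd
    [expT (.ne c), XiNe c, expD (.ne c), constF (SOp (s + (c : ℕ)))]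
    (fun n => σ.conj (bField B (.ne c) n)) := by
  rw [h.conj_bField]
  exact (isFieldProd_vF (s := s) (.ne c)).drop_one [_, _]

theorem conj_op (h : IsVertexEquiv B σ) (x : FieldIdx s r) (i : ℤ) :
    σ.conj (op B x (-i - 1)) = vF x i := congrFun (h.field x) i

/-- A normally ordered product and its contraction. -/
theorem cField_add_scalF (h : IsVertexEquiv B σ) (x y : FieldIdx s r) {R : ℤ × ℤ → ℂ}
    (hR : ∀ m n, R (m, n) = if m < 0 then commForm x y (-m - 1) (-n - 1) else 0) :
    cField B σ x y + scalF R = sepF (vF x) (vF y) := by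
  funext ⟨m, n⟩
  show σ.conj (normalOp B x (-m - 1) y (-n - 1)) + R (m, n) • 1 = vF x m * vF y n
  rw [hR, normalOp]
  by_cases hm : m < 0
  · rw [if_pos hm, if_pos (by omega), conj_mul', h.conj_op, h.conj_op]
    exact normal_add (vF_comm x y m n)
  · rw [if_neg hm, if_neg (by omega), conj_mul', h.conj_op, h.conj_op, zero_smul, add_zero]

theorem isFieldProd_cField_ch_ch (h : IsVertexEquiv B σ) {a d : Fin s} (had : a ≤ d) (ε η : ℤˣ) :
    IsFieldProd
      [scalF (zSubW (if a = d then -((ε : ℤ) * (η : ℤ)) else 0)),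
        inZ (expT (.ch a ε)), inW (expT (.ch d η)), inZ (XiCh a ε), inW (XiCh d η),
        inZ (SympBoson.zPow (sg ε • TOp a)), inW (SympBoson.zPow (sg η • TOp d)),
        inZ (expD (.ch a ε)), inW (expD (.ch d η)),
        constF (SOp (a : ℕ)), constF (SOp (d : ℕ))]
      (cField B σ (.ch a ε) (.ch d η) +
        scalF ((if a = d ∧ η = -ε then sg ε else 0) • zSubW (-1))) := by
  rw [h.cField_add_scalF]
  · exact isFieldProd_ch_ch had ε η
  · intro m n
    rw [Pi.smul_apply, smul_eq_mul, zSubW, commForm]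
    by_cases h1 : a = d ∧ η = -ε
    · rw [if_pos h1]
      by_cases h2 : 0 ≤ n ∧ m = -1 - n
      · rw [if_pos h2, if_pos (by omega), if_pos ⟨h1.1, h1.2, by omega⟩, neg_one_pow_mul_choose,
          mul_one]
      · rw [if_neg h2, mul_zero]
        split_ifs with h3 h4
        · omega
        · rfl
        · rfl
    · rw [if_neg h1, zero_mul]
      split_ifs with h3 h4
      · exact absurd ⟨h4.1, h4.2.1⟩ h1
      · rfl
      · rfl

theorem isFieldProd_cField_ne_ne (h : IsVertexEquiv B σ) {c d : Fin r} (hcd : c ≤ d) :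
    IsFieldProd
      [(if c = d then scalF zAddWDivZSubW else constF 1),
        inZ (expT (.ne c)), inW (expT (.ne d)), inZ (XiNe c), inW (XiNe d),
        inZ (expD (.ne c)), inW (expD (.ne d)),
        constF (SOp (s + (c : ℕ))), constF (SOp (s + (d : ℕ)))]
      (cField B σ (.ne c) (.ne d) + scalF ((if c = d then 1 else 0 : ℂ) • invZAddW)) := by
  rw [h.cField_add_scalF]
  · exact isFieldProd_ne_ne hcd
  · intro m n
    rw [Pi.smul_apply, smul_eq_mul, invZAddW, commForm]
    by_cases h1 : c = d
    · rw [if_pos h1, one_mul]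
      by_cases h2 : 0 ≤ n ∧ m = -1 - n
      · rw [if_pos h2, if_pos (by omega), if_pos ⟨h1, by omega⟩, ← zpow_natCast]
        congr 1
        simp only
        omega
      · rw [if_neg h2]
        split_ifs with h3 h4
        · omega
        · rfl
        · rfl
    · rw [if_neg h1, zero_mul]
      split_ifs with h3 h4
      · exact absurd h4.1 h1
      · rfl
      · rfl

theorem isFieldProd_cField_ch_ne (h : IsVertexEquiv B σ) (a : Fin s) (ε : ℤˣ) (c : Fin r) :
    IsFieldProd
      [inZ (expT (.ch a ε)), inW (expT (.ne c)), inZ (XiCh a ε), inW (XiNe c),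
        inZ (SympBoson.zPow (sg ε • TOp a)), inZ (expD (.ch a ε)), inW (expD (.ne c)),
        constF (SOp (a : ℕ)), constF (SOp (s + (c : ℕ)))]
      (cField B σ (.ch a ε) (.ne c)) := by
  have := h.cField_add_scalF (.ch a ε) (.ne c) (R := 0) fun m n => by
    rw [Pi.zero_apply, commForm, ite_self]
  rw [show scalF (M := CSpace s r) 0 = 0 from funext fun p => zero_smul ℂ _, add_zero] at this
  rw [this]
  exact isFieldProd_ch_ne a ε c

theorem conj_alphaCh (h : IsVertexEquiv B σ) (a : Fin s) (k : ℤ) :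
    σ.conj (alphaCh B a k) = heis (.inl a) k := by
  rw [alphaCh_eq_cur, h.cur (.inl a) _ trivial]

theorem conj_alphaNe (h : IsVertexEquiv B σ) (c : Fin r) {k : ℤ} (hk : Odd k) :
    σ.conj (alphaNe B c k) = heis (.inr c) k := h.cur (.inr c) k hk

theorem conj_mode_thetaCh (h : IsVertexEquiv B σ) (a : Fin s) (ε : ℤˣ) (k : ℤ) :
    σ.conj (mode (SympBoson.thetaCh B a ε) k) = psi (.ch a ε) (-k - 1) :=
  congrFun (h.thetaCh a ε) _

theorem conj_mode_thetaNe (h : IsVertexEquiv B σ) (c : Fin r) (k : ℤ) :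
    σ.conj (mode (SympBoson.thetaNe B c) k) = psi (.ne c) (-k - 1) :=
  congrFun (h.thetaNe c) _

theorem alphaCh_thetaCh (h : IsVertexEquiv B σ) (a b : Fin s) (ε : ℤˣ) (k l : ℤ) :
    alphaCh B a k * mode (SympBoson.thetaCh B b ε) l - mode (SympBoson.thetaCh B b ε) l * alphaCh B a k =
      (if a = b ∧ k = 0 then -sg ε else 0) • mode (SympBoson.thetaCh B b ε) l := by
  refine sub_one_smul_eq (relation_of_conj σ ?_)
  rw [h.conj_alphaCh, h.conj_mode_thetaCh]
  refine sub_one_smul_of ((heis_psi (.inl a) trivial _ _).trans ?_)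
  congr 2
  simp only [wt]
  by_cases hk : k = 0 <;> by_cases hab : a = b <;> simp [hk, hab]

theorem alphaCh_thetaNe (h : IsVertexEquiv B σ) (a : Fin s) (c : Fin r) (k l : ℤ) :
    Commute (alphaCh B a k) (mode (SympBoson.thetaNe B c) l) := by
  refine commute_of_conj σ ?_
  rw [h.conj_alphaCh, h.conj_mode_thetaNe]
  refine (heis_psi (.inl a) trivial _ _).trans ?_
  rw [wt, neg_zero, ite_self, zero_smul, add_zero]

theorem alphaNe_thetaCh (h : IsVertexEquiv B σ) (c : Fin r) (b : Fin s) (ε : ℤˣ) {k : ℤ} (l : ℤ)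
    (hk : Odd k) : Commute (alphaNe B c k) (mode (SympBoson.thetaCh B b ε) l) := by
  refine commute_of_conj σ ?_
  rw [h.conj_alphaNe c hk, h.conj_mode_thetaCh]
  refine (heis_psi (.inr c) hk _ _).trans ?_
  rw [if_neg (by rintro rfl; simp at hk), zero_smul, add_zero]

theorem alphaNe_thetaNe (h : IsVertexEquiv B σ) (c d : Fin r) {k : ℤ} (l : ℤ)
    (hk : Odd k) : Commute (alphaNe B c k) (mode (SympBoson.thetaNe B d) l) := by
  refine commute_of_conj σ ?_
  rw [h.conj_alphaNe c hk, h.conj_mode_thetaNe]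
  refine (heis_psi (.inr c) hk _ _).trans ?_
  rw [if_neg (by rintro rfl; simp at hk), zero_smul, add_zero]

theorem thetaCh_thetaCh (h : IsVertexEquiv B σ) (a b : Fin s) (ε η : ℤˣ) (k l : ℤ) :
    mode (SympBoson.thetaCh B a ε) k * mode (SympBoson.thetaCh B b η) l -
      (if a = b then -1 else 1 : ℂ) •
        (mode (SympBoson.thetaCh B b η) l * mode (SympBoson.thetaCh B a ε) k) =
      (if a = b ∧ η = -ε ∧ k = -l then sg ε * (k : ℂ) else 0) • 1 := by
  refine relation_of_conj σ ?_
  rw [h.conj_mode_thetaCh, h.conj_mode_thetaCh, conj_one']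
  have := psi_relation (r := r) (.ch a ε) (.ch b η) (-k - 1) (-l - 1)
  simp only [FieldIdx.comp, Sum.inl.injEq] at this
  refine Eq.trans ?_ (this.trans ?_)
  · congr
  · congr 1
    rw [xiForm]
    by_cases h1 : a = b ∧ η = -ε ∧ k = -l
    · rw [if_pos h1, if_pos ⟨h1.1, h1.2.1, by omega⟩]
      push_cast; ring
    · rw [if_neg h1, if_neg fun h' => h1 ⟨h'.1, h'.2.1, by omega⟩]

theorem thetaCh_thetaNe (h : IsVertexEquiv B σ) (a : Fin s) (ε : ℤˣ) (c : Fin r) (k l : ℤ) :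
    Commute (mode (SympBoson.thetaCh B a ε) k) (mode (SympBoson.thetaNe B c) l) := by
  refine commute_of_conj σ ?_
  rw [h.conj_mode_thetaCh, h.conj_mode_thetaNe]
  exact psi_comm (by simp [FieldIdx.comp]) _ _

theorem thetaNe_thetaNe (h : IsVertexEquiv B σ) (c d : Fin r) (k l : ℤ) :
    mode (SympBoson.thetaNe B c) k * mode (SympBoson.thetaNe B d) l -
      (if c = d then -1 else 1 : ℂ) •
        (mode (SympBoson.thetaNe B d) l * mode (SympBoson.thetaNe B c) k) =
      (if c = d ∧ k + l + 1 = 0 then (-1) ^ k * (2 * (k : ℂ) + 1) else 0) • 1 := by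
  refine relation_of_conj σ ?_
  rw [h.conj_mode_thetaNe, h.conj_mode_thetaNe, conj_one']
  have := psi_relation (s := s) (.ne c) (.ne d) (-k - 1) (-l - 1)
  simp only [FieldIdx.comp, Sum.inr.injEq] at this
  refine Eq.trans ?_ (this.trans ?_)
  · congr
  · congr 1
    rw [xiForm]
    by_cases h1 : c = d ∧ k + l + 1 = 0
    · rw [if_pos h1, if_pos ⟨h1.1, by omega⟩,
        neg_one_zpow_reflect (show k + (-k - 1) + 1 = 0 by ring)]
      push_cast; ring
    · rw [if_neg h1, if_neg fun h' => h1 ⟨h'.1, by omega⟩]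

end IsVertexEquiv

end Bosonization

section General

variable {M : Type*} [AddCommGroup M] [Module ℂ M]

theorem smul_apply_eigen {T : Module.End ℂ M} {v : M} {m : ℤ} (h : T v = (m : ℂ) • v) (ε : ℤˣ) :
    (sg ε • T) v = ((ε * m : ℤ) : ℂ) • v := by
  rw [LinearMap.smul_apply, h, smul_smul, sg, ← Int.cast_mul]

theorem sub_smul_of_eq {a b c : ℂ} (h : a - b = c) (v : M) : a • v - b • v = c • v := by
  rw [← sub_smul, h]

theorem zPow_of_sg_one {T : Module.End ℂ M} (h : ∃ P, IsZPow (sg 1 • T) P) :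
    IsZPow T (zPow T) := by
  rw [sg_one, one_smul] at h
  exact zPow_spec h

theorem sub_eq_zero_smul {T A : Module.End ℂ M} (h : Commute T A) :
    T * A - A * T = ((0 : ℤ) : ℂ) • A := by
  rw [Int.cast_zero, zero_smul, h.eq, sub_self]

theorem eq_zero_smul {c : ℂ} (hc : c = 0) {v w : M} (h : v = 0) : v = c • w := by
  rw [h, hc, zero_smul]

theorem eq_zero_of_eq_smul {c : ℂ} {v w : M} (hc : c = 0) (h : v = c • w) : v = 0 := by
  rw [h, hc, zero_smul]

theorem commute_of_zero_smul {T A : Module.End ℂ M} {c : ℂ} (hc : c = 0)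
    (h : T * A - A * T = c • A) : Commute T A := by
  rw [hc, zero_smul] at h
  exact sub_eq_zero.1 h

theorem upF_eMinus (α : ℤ → Module.End ℂ M) (δ : ℂ) : UpF (EMinus α δ) := upF_expUp _

theorem units_ne_neg (ε : ℤˣ) : ε ≠ -ε := by decide +revert

end General

/-! ### The extension by the operators `Q_a` -/

section Ext

variable {s : ℕ}

theorem ext_single (f : Module.End ℂ Fc) (m : Fin s → ℤ) (v : Fc) :
    ext f (Finsupp.single m v) = Finsupp.single m (f v) :=
  Finsupp.mapRange_single (hf := map_zero f)

theorem fhat_hom_ext {N : Type*} [AddCommGroup N] [Module ℂ N] {f g : Fhat s →ₗ[ℂ] N}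
    (h : ∀ m v, f (Finsupp.single m v) = g (Finsupp.single m v)) : f = g :=
  Finsupp.lhom_ext h

theorem fhat_span : Submodule.span ℂ
    (Set.range fun p : (Fin s → ℤ) × Fc => (Finsupp.single p.1 p.2 : Fhat s)) = ⊤ := by
  refine eq_top_iff.2 fun x _ => ?_
  induction x using Finsupp.induction_linear with
  | zero => exact zero_mem _
  | add x y hx hy => exact add_mem (hx trivial) (hy trivial)
  | single m v => exact Submodule.subset_span ⟨(m, v), rfl⟩

theorem locFin_of_single {ι : Type*} {f : ι → Module.End ℂ (Fhat s)}
    (h : ∀ m v, (Function.support fun i => f i (Finsupp.single m v)).Finite) : LocFin f :=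
  locFin_of_span fhat_span (by rintro _ ⟨p, rfl⟩; exact h p.1 p.2)

theorem ext_one : (ext 1 : Module.End ℂ (Fhat s)) = 1 :=
  fhat_hom_ext fun m v => ext_single 1 m v

theorem ext_mul (A B : Module.End ℂ Fc) : (ext (A * B) : Module.End ℂ (Fhat s)) = ext A * ext B :=
  fhat_hom_ext fun m v => by
    rw [Module.End.mul_apply, ext_single, ext_single, ext_single, Module.End.mul_apply]

/-- The map `f ↦ f ⊗ 1` as a linear map. -/
def extHom : Module.End ℂ Fc →ₗ[ℂ] Module.End ℂ (Fhat s) where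
  toFun := ext
  map_add' A B := fhat_hom_ext fun m v => by
    rw [LinearMap.add_apply, ext_single, ext_single, ext_single, LinearMap.add_apply,
      Finsupp.single_add]
  map_smul' c A := fhat_hom_ext fun m v => by
    rw [LinearMap.smul_apply, ext_single, ext_single, LinearMap.smul_apply, Finsupp.smul_single]
    rfl

theorem ext_relation {A B C : Module.End ℂ Fc} {a c : ℂ} (h : A * B - a • (B * A) = c • C) :
    (ext A * ext B - a • (ext B * ext A) : Module.End ℂ (Fhat s)) = c • ext C := by
  have := congrArg (extHom (s := s)) h
  rw [map_sub, map_smul, map_smul] at this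
  exact (congrArg₂ (fun X Y => X - a • Y) (ext_mul A B) (ext_mul B A)).symm.trans this

theorem ext_relation_one {A B : Module.End ℂ Fc} {a c : ℂ} (h : A * B - a • (B * A) = c • 1) :
    (ext A * ext B - a • (ext B * ext A) : Module.End ℂ (Fhat s)) = c • 1 :=
  (ext_relation h).trans (congrArg (c • ·) ext_one)

theorem ext_relation_zero {A B : Module.End ℂ Fc} {a : ℂ} (h : A * B - a • (B * A) = 0) :
    (ext A * ext B - a • (ext B * ext A) : Module.End ℂ (Fhat s)) = 0 := by
  have := congrArg (extHom (s := s)) h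
  rw [map_sub, map_smul, map_zero] at this
  exact (congrArg₂ (fun X Y => X - a • Y) (ext_mul A B) (ext_mul B A)).symm.trans this

theorem ext_commute {A B : Module.End ℂ Fc} (h : Commute A B) :
    Commute (ext A : Module.End ℂ (Fhat s)) (ext B) :=
  (ext_mul A B).symm.trans ((congrArg ext h.eq).trans (ext_mul B A))

theorem locFin_ext {ι : Type*} {f : ι → Module.End ℂ Fc} (h : LocFin f) :
    LocFin fun i => (ext (f i) : Module.End ℂ (Fhat s)) :=
  locFin_of_single fun m v => (h v).subset fun i hi hv => hi (by
    show ext (f i) (Finsupp.single m v) = 0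
    rw [ext_single, show f i v = 0 from hv, Finsupp.single_zero])

/-- Extension by the identity commutes with locally finite sums, so well-defined products on the
Weyl module extend factor by factor. -/
theorem locSum_ext {ι : Type*} {f : ι → Module.End ℂ Fc} (h : LocFin f) :
    locSum (fun i => (ext (f i) : Module.End ℂ (Fhat s))) = ext (locSum f) :=
  fhat_hom_ext fun m v => by
    rw [locSum_apply (locFin_ext h), ext_single, locSum_apply h]
    exact ((finsum_congr fun i => ext_single (f i) m v).trans
      ((Finsupp.lsingle (R := ℂ) m : Fc →ₗ[ℂ] Fhat s).toAddMonoidHom.map_finsum (h v)).symm)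

/-- The field `A ⊗ 1`. -/
def extF {G : Type*} (A : FDist G Fc) : FDist G (Fhat s) := fun n => ext (A n)

theorem mulOK_extF {G : Type*} [AddCommGroup G] {A B : FDist G Fc} (h : MulOK A B) :
    MulOK (extF A : FDist G (Fhat s)) (extF B) := fun n => by
  have := locFin_ext (s := s) (h n)
  simp only [ext_mul] at this
  exact this

theorem fmul_extF {G : Type*} [AddCommGroup G] {A B : FDist G Fc} (h : MulOK A B) :
    fmul (extF A : FDist G (Fhat s)) (extF B) = extF (fmul A B) := funext fun n => by
  have := locSum_ext (s := s) (h n)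
  simp only [ext_mul] at this
  exact this

theorem extF_expUp (A : ℕ → Module.End ℂ Fc) :
    (extF (expUp A) : FDist ℤ (Fhat s)) = expUp fun j => ext (A j) :=
  funext fun n => expUp_map (extHom (s := s)) ext_one ext_mul A n

theorem extF_expDown (A : ℕ → Module.End ℂ Fc) :
    (extF (expDown A) : FDist ℤ (Fhat s)) = expDown fun j => ext (A j) :=
  funext fun n => by
    rw [extF, expDown_eq, expDown_eq]
    exact expUp_map (extHom (s := s)) ext_one ext_mul A (-n)

theorem QPow_single (a : Fin s) (n : ℤ) (m : Fin s → ℤ) (v : Fc) :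
    QPow a n (Finsupp.single m v) = Finsupp.single (m + Pi.single a n) v :=
  Finsupp.mapDomain_single

theorem QPow_ext (a : Fin s) (n : ℤ) (f : Module.End ℂ Fc) (m : Fin s → ℤ) (v : Fc) :
    (QPow a n * ext f : Module.End ℂ (Fhat s)) (Finsupp.single m v) = Finsupp.single (m + Pi.single a n) (f v) := by
  rw [Module.End.mul_apply, ext_single, QPow_single]

variable {r : ℕ} (B : FieldIdx s r → ℤ → ClC)

theorem alphaHat_zero_single (a : Fin s) (m : Fin s → ℤ) (v : Fc) :
    alphaHat B a 0 (Finsupp.single m v) = ((m a : ℤ) : ℂ) • Finsupp.single m v := by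
  rw [alphaHat, if_pos rfl, Finsupp.lsum_single]
  rfl

theorem alphaHat_of_ne (a : Fin s) {k : ℤ} (hk : k ≠ 0) : alphaHat B a k = ext (alphaCh B a k) := by
  rw [alphaHat, if_neg hk]

theorem exists_isZPow_alphaHat (a : Fin s) (ε : ℤˣ) :
    ∃ P, IsZPow (sg ε • alphaHat B a 0) P :=
  exists_isZPow_of_span fhat_span (by
    rintro _ ⟨p, rfl⟩
    exact ⟨ε * p.1 a, smul_apply_eigen (alphaHat_zero_single B a p.1 p.2) ε⟩)

theorem zPow_alphaHat_single (a : Fin s) (ε : ℤˣ) (n : ℤ) (m : Fin s → ℤ) (v : Fc) :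
    zPow (sg ε • alphaHat B a 0) n (Finsupp.single m v) =
      if n = ε * m a then Finsupp.single m v else 0 :=
  (zPow_spec (exists_isZPow_alphaHat B a ε)).apply_eigen
    (smul_apply_eigen (alphaHat_zero_single B a m v) ε) n

theorem alphaHat_QPow (a b : Fin s) : alphaHat B a 0 * QPow b 1 - QPow b 1 * alphaHat B a 0 =
    (if a = b then 1 else 0 : ℂ) • QPow b 1 := fhat_hom_ext fun m v => by
  rw [LinearMap.sub_apply, LinearMap.smul_apply, Module.End.mul_apply, Module.End.mul_apply,
    QPow_single, alphaHat_zero_single, alphaHat_zero_single, map_smul, QPow_single]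
  refine sub_smul_of_eq (M := Fhat s) ?_ _
  rw [Pi.add_apply, Int.cast_add, add_sub_cancel_left]
  by_cases h : a = b
  · subst h; simp
  · simp [h]

theorem alphaHat_zero_ext (a : Fin s) (f : Module.End ℂ Fc) :
    alphaHat B a 0 * ext f = ext f * alphaHat B a 0 := fhat_hom_ext fun m v => by
  rw [Module.End.mul_apply, Module.End.mul_apply, ext_single, alphaHat_zero_single,
    alphaHat_zero_single, map_smul, ext_single]

theorem eMinus_alphaHat (a : Fin s) (δ : ℂ) :
    EMinus (alphaHat B a) δ = extF (EMinus (alphaCh B a) δ) := by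
  rw [EMinus, EMinus, extF_expUp]
  refine expUp_congr fun j hj => ?_
  rw [alphaHat_of_ne B a (by omega : -(j : ℤ) ≠ 0)]
  exact (map_smul (extHom (s := s)) _ _).symm

theorem ePlus_alphaHat (a : Fin s) (δ : ℂ) :
    EPlus (alphaHat B a) δ = extF (EPlus (alphaCh B a) δ) := by
  rw [EPlus, EPlus, extF_expDown]
  refine expDown_congr fun j hj => ?_
  rw [alphaHat_of_ne B a (by omega : (j : ℤ) ≠ 0)]
  exact (map_smul (extHom (s := s)) _ _).symm

end Ext

/-! ### Charge decomposition of the Weyl module and its embedding -/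

section Charge

variable {s r : ℕ} {B : FieldIdx s r → ℤ → ClC}

/-- The vector `v` has the charges `m`. -/
def HasCharge (B : FieldIdx s r → ℤ → ClC) (m : Fin s → ℤ) (v : Fc) : Prop :=
  ∀ a, alphaCh B a 0 v = ((m a : ℤ) : ℂ) • v

/-- The charge of the operator `A` is `d`. -/
def ShiftsCharge (B : FieldIdx s r → ℤ → ClC) (d : Fin s → ℤ) (A : Module.End ℂ Fc) : Prop :=
  ∀ a, alphaCh B a 0 * A - A * alphaCh B a 0 = ((d a : ℤ) : ℂ) • A

theorem shift_eigen {M : Type*} [AddCommGroup M] [Module ℂ M] {T A : Module.End ℂ M} {c d : ℂ}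
    (h : T * A - A * T = d • A) {v : M} (hv : T v = c • v) : T (A v) = (c + d) • A v := by
  have := LinearMap.congr_fun h v
  rw [LinearMap.sub_apply, Module.End.mul_apply, Module.End.mul_apply, hv, map_smul,
    LinearMap.smul_apply] at this
  rw [add_smul, ← this, add_sub_cancel]

theorem ShiftsCharge.apply {d : Fin s → ℤ} {A : Module.End ℂ Fc} (h : ShiftsCharge B d A)
    {m : Fin s → ℤ} {v : Fc} (hv : HasCharge B m v) : HasCharge B (m + d) (A v) := fun a => by
  rw [Pi.add_apply, Int.cast_add]
  exact shift_eigen (h a) (hv a)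

theorem single_units (b a : Fin s) (ε : ℤˣ) :
    (((Pi.single b (-(ε : ℤ)) : Fin s → ℤ) a : ℤ) : ℂ) = if a = b then -sg ε else 0 := by
  by_cases h : a = b
  · subst h; simp [sg]
  · simp [h]

/-- The charge of a field. -/
def fieldCharge : FieldIdx s r → Fin s → ℤ
  | .ch b ε => Pi.single b (-(ε : ℤ))
  | .ne _ => 0

theorem shift_of_bracket {M : Type*} [AddCommGroup M] [Module ℂ M] {T A : Module.End ℂ M} {c : ℂ}
    (h : ∀ v, T (A v) = A (T v) - c • A v) : T * A - A * T = -c • A := LinearMap.ext fun v => by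
  rw [LinearMap.sub_apply, Module.End.mul_apply, Module.End.mul_apply, h, LinearMap.smul_apply,
    neg_smul, sub_sub_cancel_left]

theorem shiftsCharge_op (hB : IsMulticomponent s r B) (x : FieldIdx s r) (i : ℤ) :
    ShiftsCharge B (fieldCharge x) (op B x i) := fun a => by
  have h0 : ((fieldCharge x a : ℤ) : ℂ) = -wt (.inl a) x := by
    rcases x with ⟨b, ε⟩ | c
    · rw [fieldCharge, single_units, wt]; split_ifs <;> simp
    · simp [fieldCharge, wt]
  rw [h0, alphaCh_eq_cur]
  refine shift_of_bracket fun v => ?_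
  have := IsBosonFock.cur_bracket (isBosonFock_op hB) (.inl a) (k := 0) trivial x i v
  rwa [zero_add] at this

/-- The vacuum has charge zero and each mode changes the charges by integers, so the joint
eigenvectors span. -/
theorem span_hasCharge (hB : IsMulticomponent s r B) :
    Submodule.span ℂ {v : Fc | ∃ m, HasCharge B m v} = ⊤ := by
  refine (isBosonFock_op hB).cyc _ (Submodule.subset_span ⟨0, fun a =>
    eq_zero_smul Int.cast_zero ((LinearMap.congr_fun (alphaCh_eq_cur a 0) vac).trans
      (IsBosonFock.cur_kill (isBosonFock_op hB) _ le_rfl))⟩)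
    fun x i => ?_
  have : Submodule.span ℂ {v : Fc | ∃ m, HasCharge B m v} ≤
      (Submodule.span ℂ {v : Fc | ∃ m, HasCharge B m v}).comap (op B x i) :=
    Submodule.span_le.2 fun v ⟨m, hm⟩ =>
      Submodule.subset_span ⟨_, (shiftsCharge_op hB x i).apply hm⟩
  exact fun v hv => this hv

theorem hom_ext_of_charge (hB : IsMulticomponent s r B) {N : Type*} [AddCommGroup N] [Module ℂ N]
    {f g : Fc →ₗ[ℂ] N} (h : ∀ m v, HasCharge B m v → f v = g v) : f = g :=
  LinearMap.ext_on (span_hasCharge hB) fun v ⟨m, hm⟩ => h m v hm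

/-- The projection to the vectors of charges `m`. -/
def chargeProj (B : FieldIdx s r → ℤ → ClC) (m : Fin s → ℤ) : Module.End ℂ Fc :=
  ((List.finRange s).map fun a => zPow (alphaCh B a 0) (m a)).prod

theorem chargeProj_apply (hz : ∀ a, IsZPow (alphaCh B a 0) (zPow (alphaCh B a 0)))
    {m : Fin s → ℤ} {v : Fc} (hv : HasCharge B m v) (m' : Fin s → ℤ) :
    chargeProj B m' v = if m' = m then v else 0 := by
  have key : ∀ l : List (Fin s), (l.map fun a => zPow (alphaCh B a 0) (m' a)).prod v =
      if ∀ a ∈ l, m' a = m a then v else 0 := by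
    intro l
    induction l with
    | nil => simp
    | cons a l ih =>
      rw [List.map_cons, List.prod_cons, Module.End.mul_apply, ih]
      by_cases hl : ∀ a ∈ l, m' a = m a
      · rw [if_pos hl, (hz a).apply_eigen (hv a)]
        exact if_congr ⟨fun h => by simpa [h] using hl, fun h => h a (by simp)⟩ rfl rfl
      · rw [if_neg hl, map_zero, if_neg fun h => hl fun b hb => h b (by simp [hb])]
  rw [chargeProj, key]
  exact if_congr ⟨fun h => funext fun a => h a (List.mem_finRange a), fun h a _ => congrFun h a⟩
    rfl rfl

theorem locFin_chargeProj (hB : IsMulticomponent s r B)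
    (hz : ∀ a, IsZPow (alphaCh B a 0) (zPow (alphaCh B a 0))) : LocFin (chargeProj B) :=
  locFin_of_span (span_hasCharge hB) fun v ⟨m, hm⟩ =>
    (Set.finite_singleton m).subset fun m' h => by
      by_contra hne
      exact h ((chargeProj_apply hz hm m').trans (if_neg hne))

/-- A vector is recorded through its components of all charges, of which finitely many are nonzero.
-/
theorem exists_chargeEmbedding (hB : IsMulticomponent s r B)
    (hz : ∀ a, IsZPow (alphaCh B a 0) (zPow (alphaCh B a 0))) :
    ∃ ι : Fc →ₗ[ℂ] Fhat s, IsChargeEmbedding B ι ∧ Function.Injective ι := by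
  let ι : Fc →ₗ[ℂ] Fhat s :=
    { toFun := fun v => Finsupp.ofSupportFinite (fun m => chargeProj B m v)
        (locFin_chargeProj hB hz v)
      map_add' := fun v w => Finsupp.ext fun m => map_add (chargeProj B m) v w
      map_smul' := fun c v => Finsupp.ext fun m => map_smul (chargeProj B m) c v }
  have hι : ∀ m v, HasCharge B m v → ι v = Finsupp.single m v := fun m v hv =>
    Finsupp.ext fun m' => (chargeProj_apply hz hv m').trans (by
      rw [Finsupp.single_apply]; exact if_congr eq_comm rfl rfl)
  refine ⟨ι, hι, ?_⟩
  -- Setting all `q_a` equal to `1` adds the components up again and provides a left inverse.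
  have : (Finsupp.lsum ℂ fun _ : Fin s → ℤ => (LinearMap.id : Fc →ₗ[ℂ] Fc)) ∘ₗ ι = LinearMap.id :=
    hom_ext_of_charge hB fun m v hv => by
      rw [LinearMap.comp_apply, hι m v hv, Finsupp.lsum_single]
  exact fun v w hvw => (LinearMap.congr_fun this v).symm.trans
    ((congrArg (Finsupp.lsum ℂ fun _ : Fin s → ℤ => (LinearMap.id : Fc →ₗ[ℂ] Fc)) hvw).trans
      (LinearMap.congr_fun this w))

theorem comp_chargeEmbedding (hB : IsMulticomponent s r B) {ι : Fc →ₗ[ℂ] Fhat s}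
    (hι : IsChargeEmbedding B ι) {A : Module.End ℂ Fc} {d : Fin s → ℤ} (hA : ShiftsCharge B d A)
    {A' : Module.End ℂ (Fhat s)}
    (h : ∀ m v, HasCharge B m v → A' (Finsupp.single m v) = Finsupp.single (m + d) (A v)) :
    A' ∘ₗ ι = ι ∘ₗ A := hom_ext_of_charge hB fun m v hv => by
  rw [LinearMap.comp_apply, LinearMap.comp_apply, hι m v hv, hι _ _ (hA.apply hv), h m v hv]

end Charge

/-! ### The vertex operators with `Q_a` and `z ^ α_0` -/

namespace IsVertexEquiv

variable {s r : ℕ} {B : FieldIdx s r → ℤ → ClC} {σ : Fc ≃ₗ[ℂ] CSpace s r}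

theorem isZPow_alphaCh (h : IsVertexEquiv B σ) (a : Fin s) :
    IsZPow (alphaCh B a 0) (SympBoson.zPow (alphaCh B a 0)) :=
  zPow_of_sg_one (h.exists_isZPow a 1)

theorem alphaCh_commute (h : IsVertexEquiv B σ) (a b : Fin s) (k : ℤ) :
    Commute (alphaCh B b 0) (alphaCh B a k) := by
  refine commute_of_conj σ ?_
  rw [h.conj_alphaCh, h.conj_alphaCh, heis_zero]
  rcases lt_trichotomy k 0 with hk | rfl | hk
  · obtain ⟨j, rfl⟩ : ∃ j : ℕ, k = -j := ⟨(-k).toNat, by omega⟩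
    rw [heis_neg _ (by omega)]
    exact (commute_compT (TOp_mulT b) _ j).smul_right _
  · rw [heis_zero]; exact TOp_comm b a
  · obtain ⟨j, rfl⟩ : ∃ j : ℕ, k = j := ⟨k.toNat, by omega⟩
    rw [heis_pos _ (by omega)]
    exact (commute_neg_left (commute_compD (TOp_dT b) _ j).symm).symm

theorem shiftsCharge_alphaCh (h : IsVertexEquiv B σ) (a : Fin s) (k : ℤ) :
    ShiftsCharge B 0 (alphaCh B a k) := fun b =>
  sub_eq_zero_smul (h.alphaCh_commute a b k)

theorem shiftsCharge_thetaCh (h : IsVertexEquiv B σ) (a : Fin s) (ε : ℤˣ) (n : ℤ) :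
    ShiftsCharge B (Pi.single a (-(ε : ℤ))) (SympBoson.thetaCh B a ε n) := fun b => by
  have := h.alphaCh_thetaCh b a ε 0 (-n - 1)
  rw [mode, show -(-n - 1) - 1 = n by ring] at this
  rw [this, single_units]
  congr 1
  exact if_congr (and_iff_left rfl) rfl rfl

theorem locFin_ePlus (h : IsVertexEquiv B σ) (a : Fin s) (δ : ℂ) :
    LocFin (EPlus (alphaCh B a) δ) := by
  rw [← locFin_conj σ]
  have := locFin_expDs (r := r) (.inl a) δ
  rwa [← h.ePlus] at this

theorem laurF_thetaCh (h : IsVertexEquiv B σ) (a : Fin s) (ε : ℤˣ) :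
    LaurF (SympBoson.thetaCh B a ε) := fun v => by
  obtain ⟨N, hN⟩ := laurF_psi (.ch a ε : FieldIdx s r) (σ v)
  refine ⟨N, fun n hn => σ.injective ?_⟩
  have := hN n hn
  rwa [← h.thetaCh, conjF, LinearEquiv.conj_apply_apply, LinearEquiv.symm_apply_apply,
    ← σ.map_zero] at this

theorem prodOK_vertexCh (h : IsVertexEquiv B σ) (a : Fin s) (ε : ℤˣ) :
    MulOK (SympBoson.thetaCh B a ε) (EPlus (alphaCh B a) (sg ε)) ∧
      MulOK (EMinus (alphaCh B a) (sg ε))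
        (fmul (SympBoson.thetaCh B a ε) (EPlus (alphaCh B a) (sg ε))) :=
  ⟨mulOK_of_locFin _ (h.locFin_ePlus a _),
    mulOK_up_laur (upF_eMinus _ _) (laurF_fmul_locFin (h.laurF_thetaCh a ε) (h.locFin_ePlus a _))⟩

/-- On a vector of definite charge the factor `z^{α_0}` on the right is a power of `z` fixed by the
charge before `b` acts. -/
theorem bField_apply (h : IsVertexEquiv B σ) (a : Fin s) (ε : ℤˣ) (n : ℤ) {m : Fin s → ℤ} {v : Fc}
    (hv : HasCharge B m v) : bField B (.ch a ε) n v =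
      fmul (EMinus (alphaCh B a) (sg ε))
        (fmul (SympBoson.thetaCh B a ε) (EPlus (alphaCh B a) (sg ε))) (n - ε * m a) v := by
  have hz := zPow_spec (h.exists_isZPow a ε)
  have hE := h.locFin_ePlus a (sg ε)
  rw [← (h.isFieldProd_bField_ch a ε).2, prodF_cons, prodF_cons, prodF_cons, prodF_singleton,
    ← fmul_assoc_locFin _ hE hz.1,
    ← fmul_assoc_up_locFin (upF_eMinus _ _) (laurF_fmul_locFin (h.laurF_thetaCh a ε) hE) hz.1]
  refine fmul_apply_of_delta (mulOK_of_locFin _ hz.1) (fun n => ?_) n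
  exact hz.apply_eigen (smul_apply_eigen (hv a) ε) n

theorem prodF_vertexHat (h : IsVertexEquiv B σ) (a : Fin s) (ε : ℤˣ) :
    IsFieldProd [EMinus (alphaHat B a) (sg ε), thetaHat B a ε, EPlus (alphaHat B a) (sg ε)]
      (extF (fmul (EMinus (alphaCh B a) (sg ε))
        (fmul (SympBoson.thetaCh B a ε) (EPlus (alphaCh B a) (sg ε))))) := by
  obtain ⟨h1, h2⟩ := h.prodOK_vertexCh a ε
  rw [eMinus_alphaHat, ePlus_alphaHat]
  exact ((IsFieldProd.singleton _).cons (mulOK_extF h1) (fmul_extF h1)).cons (mulOK_extF h2)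
    (fmul_extF h2)

theorem zPowHat_apply (a : Fin s) (ε : ℤˣ) (G : FDist ℤ Fc) (n i : ℤ) (m : Fin s → ℤ) (v : Fc) :
    (SympBoson.zPow (sg ε • alphaHat B a 0) i * extF G (n - i) : Module.End ℂ (Fhat s)) (Finsupp.single m v) =
      if i = ε * m a then Finsupp.single m (G (n - i) v) else 0 := by
  rw [Module.End.mul_apply, extF, ext_single, zPow_alphaHat_single]

theorem mulOK_zPowHat (a : Fin s) (ε : ℤˣ) (G : FDist ℤ Fc) :
    MulOK (SympBoson.zPow (sg ε • alphaHat B a 0)) (extF G) := fun n =>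
  locFin_of_single fun m v => (Set.finite_singleton ((ε : ℤ) * m a)).subset fun i hi => by
    by_contra hne
    exact hi ((zPowHat_apply a ε G n i m v).trans (if_neg hne))

/-- The extended factors leave the exponent of `q` untouched, so `z^{α_0}` on their left still reads
off the original charge. This explains its place in the extended formula, where only `Q_a` changes
that exponent. -/
theorem fmul_zPowHat (a : Fin s) (ε : ℤˣ) (G : FDist ℤ Fc) (n : ℤ) (m : Fin s → ℤ) (v : Fc) :
    fmul (SympBoson.zPow (sg ε • alphaHat B a 0)) (extF G) n (Finsupp.single m v) =
      Finsupp.single m (G (n - ε * m a) v) := by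
  rw [fmul_apply (mulOK_zPowHat a ε G)]
  refine (finsum_eq_single _ ((ε : ℤ) * m a) fun i hi => ?_).trans ?_
  · exact (zPowHat_apply a ε G n i m v).trans (if_neg hi)
  · exact (zPowHat_apply a ε G n _ m v).trans (if_pos rfl)

theorem prodOK_bHat (h : IsVertexEquiv B σ) (a : Fin s) (ε : ℤˣ) : ProdOK
    [constF (QPow a (-(ε : ℤ))), SympBoson.zPow (sg ε • alphaHat B a 0), EMinus (alphaHat B a) (sg ε),
      thetaHat B a ε, EPlus (alphaHat B a) (sg ε)] := by
  have h1 := h.prodF_vertexHat a ε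
  refine prodOK_cons.2 ⟨mulOK_constF_left _ _, prodOK_cons.2 ⟨?_, h1.1⟩⟩
  rw [h1.2]
  exact mulOK_zPowHat a ε _

theorem prodF_bHat (h : IsVertexEquiv B σ) (hB : IsMulticomponent s r B) {ι : Fc →ₗ[ℂ] Fhat s}
    (hι : IsChargeEmbedding B ι) (a : Fin s) (ε : ℤˣ) (n : ℤ) : prodF
    [constF (QPow a (-(ε : ℤ))), SympBoson.zPow (sg ε • alphaHat B a 0), EMinus (alphaHat B a) (sg ε),
      thetaHat B a ε, EPlus (alphaHat B a) (sg ε)] n ∘ₗ ι = ι ∘ₗ bField B (.ch a ε) n := by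
  refine comp_chargeEmbedding hB hι (shiftsCharge_op hB (.ch a ε) (-n - 1)) fun m v hv => ?_
  rw [prodF_cons, prodF_cons, (h.prodF_vertexHat a ε).2, fmul_constF_left, Module.End.mul_apply,
    fmul_zPowHat, QPow_single]
  exact congrArg _ (h.bField_apply a ε n hv).symm

theorem alphaHat_chargeEmbedding (h : IsVertexEquiv B σ) (hB : IsMulticomponent s r B)
    {ι : Fc →ₗ[ℂ] Fhat s} (hι : IsChargeEmbedding B ι) (a : Fin s) (k : ℤ) :
    alphaHat B a k ∘ₗ ι = ι ∘ₗ alphaCh B a k := by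
  refine comp_chargeEmbedding hB hι (h.shiftsCharge_alphaCh a k) fun m v hv => ?_
  rw [add_zero]
  by_cases hk : k = 0
  · subst hk
    rw [alphaHat_zero_single, hv a, Finsupp.smul_single]
  · rw [alphaHat_of_ne B a hk, ext_single]

theorem thetaHat_chargeEmbedding (h : IsVertexEquiv B σ) (hB : IsMulticomponent s r B)
    {ι : Fc →ₗ[ℂ] Fhat s} (hι : IsChargeEmbedding B ι) (a : Fin s) (ε : ℤˣ) (n : ℤ) :
    (QPow a (-(ε : ℤ)) * thetaHat B a ε n) ∘ₗ ι = ι ∘ₗ SympBoson.thetaCh B a ε n :=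
  comp_chargeEmbedding hB hι (h.shiftsCharge_thetaCh a ε n) fun m v _ => QPow_ext a _ _ m v

theorem alphaHat_thetaHat (h : IsVertexEquiv B σ) (a b : Fin s) (ε : ℤˣ) (k l : ℤ) :
    alphaHat B a k * mode (thetaHat B b ε) l = mode (thetaHat B b ε) l * alphaHat B a k := by
  by_cases hk : k = 0
  · subst hk
    exact alphaHat_zero_ext B a _
  · rw [alphaHat_of_ne B a hk]
    exact ext_commute (commute_of_zero_smul (if_neg fun h => hk h.2) (h.alphaCh_thetaCh a b ε k l))

theorem thetaCh_thetaCh_self (h : IsVertexEquiv B σ) (a b : Fin s) (ε : ℤˣ) (k l : ℤ) :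
    mode (SympBoson.thetaCh B a ε) k * mode (SympBoson.thetaCh B b ε) l -
      (if a = b then -1 else 1 : ℂ) •
        (mode (SympBoson.thetaCh B b ε) l * mode (SympBoson.thetaCh B a ε) k) = 0 :=
  eq_zero_of_eq_smul (if_neg fun h' => units_ne_neg ε h'.2.1)
    (h.thetaCh_thetaCh a b ε ε k l)

theorem thetaCh_thetaCh_dual (h : IsVertexEquiv B σ) (a b : Fin s) (k l : ℤ) :
    mode (SympBoson.thetaCh B a 1) k * mode (SympBoson.thetaCh B b (-1)) l -
      (if a = b then -1 else 1 : ℂ) •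
        (mode (SympBoson.thetaCh B b (-1)) l * mode (SympBoson.thetaCh B a 1) k) =
      (if a = b ∧ k = -l then (k : ℂ) else 0) • 1 := by
  refine (h.thetaCh_thetaCh a b 1 (-1) k l).trans (congrArg (· • _) ?_)
  rw [sg_one, one_mul]
  exact if_congr (by simp) rfl rfl

end IsVertexEquiv

end

end SympBoson

/-! ### Assembly of all statements from one isomorphism -/

theorem mainTheorem2 (s r : ℕ) (hsr : 0 < s + r) :
    -- the Weyl module is irreducible, and it has an `(s, r)`-component relabeling
    IsSimpleModule ClC Fc ∧
    (∃ B : FieldIdx s r → ℤ → ClC, IsMulticomponent s r B) ∧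
    ∀ B : FieldIdx s r → ℤ → ClC, IsMulticomponent s r B →
      -- the modes `α_k` and the powers `z ^ α_0` are well defined
      (∀ a k, LocFin (alphaChTerm B a k)) ∧
      (∀ c k, LocFin (alphaNeTerm B c k)) ∧
      (∀ a, IsZPow (alphaCh B a 0) (zPow (alphaCh B a 0))) ∧
      -- the fields `Θ` are well defined, and the `b` are expressed through them
      (∀ a ε, ProdOK (thetaChFactors B a ε)) ∧
      (∀ c, ProdOK (thetaNeFactors B c)) ∧
      (∀ a ε, IsFieldProd
        [EMinus (alphaCh B a) (sg ε), thetaCh B a ε, EPlus (alphaCh B a) (sg ε),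
          zPow (sg ε • alphaCh B a 0)] (bField B (.ch a ε))) ∧
      (∀ c, IsFieldProd [VMinus (alphaNe B c) 1, thetaNe B c, VPlus (alphaNe B c) 1]
        (bField B (.ne c))) ∧
      -- commutators of the Heisenberg modes with the modes of `Θ`
      (∀ a b ε k l, alphaCh B a k * mode (thetaCh B b ε) l - mode (thetaCh B b ε) l * alphaCh B a k =
        (if a = b ∧ k = 0 then -sg ε else 0) • mode (thetaCh B b ε) l) ∧
      (∀ a c k l, alphaCh B a k * mode (thetaNe B c) l = mode (thetaNe B c) l * alphaCh B a k) ∧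
      (∀ c b ε k l, Odd k →
        alphaNe B c k * mode (thetaCh B b ε) l = mode (thetaCh B b ε) l * alphaNe B c k) ∧
      (∀ c d k l, Odd k →
        alphaNe B c k * mode (thetaNe B d) l = mode (thetaNe B d) l * alphaNe B c k) ∧
      -- (anti)commutation relations of the modes of `Θ`
      (∀ a b ε k l, mode (thetaCh B a ε) k * mode (thetaCh B b ε) l -
        (if a = b then -1 else 1 : ℂ) • (mode (thetaCh B b ε) l * mode (thetaCh B a ε) k) = 0) ∧
      (∀ a b k l, mode (thetaCh B a 1) k * mode (thetaCh B b (-1)) l -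
        (if a = b then -1 else 1 : ℂ) • (mode (thetaCh B b (-1)) l * mode (thetaCh B a 1) k) =
          (if a = b ∧ k = -l then (k : ℂ) else 0) • 1) ∧
      (∀ a ε c k l, mode (thetaCh B a ε) k * mode (thetaNe B c) l -
        mode (thetaNe B c) l * mode (thetaCh B a ε) k = 0) ∧
      (∀ c d k l, mode (thetaNe B c) k * mode (thetaNe B d) l -
        (if c = d then -1 else 1 : ℂ) • (mode (thetaNe B d) l * mode (thetaNe B c) k) =
          (if c = d ∧ k + l + 1 = 0 then (-1) ^ k * (2 * (k : ℂ) + 1) else 0) • 1) ∧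
      -- the form with the operators `Q_a`, on the extension of the Weyl module
      (∃ ι : Fc →ₗ[ℂ] Fhat s, IsChargeEmbedding B ι ∧ Function.Injective ι ∧
        (∀ a k, alphaHat B a k ∘ₗ ι = ι ∘ₗ alphaCh B a k) ∧
        (∀ (a : Fin s) (ε : ℤˣ) (n : ℤ), (QPow a (-(ε : ℤ)) * thetaHat B a ε n) ∘ₗ ι = ι ∘ₗ thetaCh B a ε n) ∧
        (∀ (a : Fin s) (ε : ℤˣ), ProdOK
          [constF (QPow a (-(ε : ℤ))), zPow (sg ε • alphaHat B a 0), EMinus (alphaHat B a) (sg ε),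
            thetaHat B a ε, EPlus (alphaHat B a) (sg ε)]) ∧
        (∀ (a : Fin s) (ε : ℤˣ) (n : ℤ), prodF
          [constF (QPow a (-(ε : ℤ))), zPow (sg ε • alphaHat B a 0), EMinus (alphaHat B a) (sg ε),
            thetaHat B a ε, EPlus (alphaHat B a) (sg ε)] n ∘ₗ ι = ι ∘ₗ bField B (.ch a ε) n)) ∧
      (∀ a b : Fin s, alphaHat B a 0 * QPow b 1 - QPow b 1 * alphaHat B a 0 =
        (if a = b then 1 else 0 : ℂ) • QPow b 1) ∧
      (∀ a, IsZPow (alphaHat B a 0) (zPow (alphaHat B a 0))) ∧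
      (∀ a b ε k l, alphaHat B a k * mode (thetaHat B b ε) l =
        mode (thetaHat B b ε) l * alphaHat B a k) ∧
      (∀ a b ε k l, mode (thetaHat B a ε) k * mode (thetaHat B b ε) l -
        (if a = b then -1 else 1 : ℂ) • (mode (thetaHat B b ε) l * mode (thetaHat B a ε) k) = 0) ∧
      (∀ a b k l, mode (thetaHat B a 1) k * mode (thetaHat B b (-1)) l -
        (if a = b then -1 else 1 : ℂ) • (mode (thetaHat B b (-1)) l * mode (thetaHat B a 1) k) =
          (if a = b ∧ k = -l then (k : ℂ) else 0) • 1) ∧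
      (∀ a ε c k l, mode (thetaHat B a ε) k * ext (mode (thetaNe B c) l) -
        ext (mode (thetaNe B c) l) * mode (thetaHat B a ε) k = 0) ∧
      -- the bosonization: `T_a` and `z ^ T_a` are well defined, `σ` exists and is unique
      (∀ a : Fin s, LocFin (TTerm (r := r) a)) ∧
      (∀ a : Fin s, IsZPow (TOp (r := r) a) (zPow (TOp (r := r) a))) ∧
      ∃ σ : Fc ≃ₗ[ℂ] CSpace s r, IsBosonization B σ ∧
        (∀ σ' : Fc ≃ₗ[ℂ] CSpace s r, IsBosonization B σ' → σ' = σ) ∧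
        -- the vertex operators for `b^{±a}(z)` and `b^c(z)`
        (∀ a ε, IsFieldProd
          [expT (.ch a ε), XiCh a ε, zPow (sg ε • TOp a), expD (.ch a ε), constF (SOp (a : ℕ))]
          (fun n => σ.conj (bField B (.ch a ε) n))) ∧
        (∀ c, IsFieldProd [expT (.ne c), XiNe c, expD (.ne c), constF (SOp (s + (c : ℕ)))]
          (fun n => σ.conj (bField B (.ne c) n))) ∧
        -- the vertex operators for the generating fields of `c_∞`
        (∀ (a d : Fin s) (ε η : ℤˣ), a ≤ d → IsFieldProd
          [scalF (zSubW (if a = d then -((ε : ℤ) * (η : ℤ)) else 0)),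
            inZ (expT (.ch a ε)), inW (expT (.ch d η)), inZ (XiCh a ε), inW (XiCh d η),
            inZ (zPow (sg ε • TOp a)), inW (zPow (sg η • TOp d)),
            inZ (expD (.ch a ε)), inW (expD (.ch d η)),
            constF (SOp (a : ℕ)), constF (SOp (d : ℕ))]
          (cField B σ (.ch a ε) (.ch d η) +
            scalF ((if a = d ∧ η = -ε then sg ε else 0) • zSubW (-1)))) ∧
        (∀ c d, c ≤ d → IsFieldProd
          [(if c = d then scalF zAddWDivZSubW else constF 1),
            inZ (expT (.ne c)), inW (expT (.ne d)), inZ (XiNe c), inW (XiNe d),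
            inZ (expD (.ne c)), inW (expD (.ne d)),
            constF (SOp (s + (c : ℕ))), constF (SOp (s + (d : ℕ)))]
          (cField B σ (.ne c) (.ne d) +
            scalF ((if c = d then 1 else 0 : ℂ) • invZAddW))) ∧
        (∀ a ε c, IsFieldProd
          [inZ (expT (.ch a ε)), inW (expT (.ne c)), inZ (XiCh a ε), inW (XiNe c),
            inZ (zPow (sg ε • TOp a)), inZ (expD (.ch a ε)), inW (expD (.ne c)),
            constF (SOp (a : ℕ)), constF (SOp (s + (c : ℕ)))]
          (cField B σ (.ch a ε) (.ne c))) := by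
  refine ⟨fc_simple, exists_multicomponent hsr, fun B hB => ?_⟩
  obtain ⟨σ, h⟩ := exists_vertexEquiv hB
  have hfock := isBosonFock_op hB
  obtain ⟨ι, hι, hinj⟩ := exists_chargeEmbedding hB h.isZPow_alphaCh
  refine ⟨fun a k => ?_, fun c k => hfock.locFin_curTerm (.inr c) k, h.isZPow_alphaCh,
    h.prodOK_thetaCh, h.prodOK_thetaNe, h.isFieldProd_bField_ch, h.isFieldProd_bField_ne,
    h.alphaCh_thetaCh, fun a c k l => (h.alphaCh_thetaNe a c k l).eq,
    fun c b ε k l hk => (h.alphaNe_thetaCh c b ε l hk).eq,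
    fun c d k l hk => (h.alphaNe_thetaNe c d l hk).eq, h.thetaCh_thetaCh_self,
    h.thetaCh_thetaCh_dual, fun a ε c k l => sub_eq_zero.2 (h.thetaCh_thetaNe a ε c k l).eq,
    h.thetaNe_thetaNe,
    ⟨ι, hι, hinj, h.alphaHat_chargeEmbedding hB hι, h.thetaHat_chargeEmbedding hB hι,
      h.prodOK_bHat, h.prodF_bHat hB hι⟩,
    alphaHat_QPow B, fun a => zPow_of_sg_one (exists_isZPow_alphaHat B a 1), h.alphaHat_thetaHat,
    fun a b ε k l => ext_relation_zero (h.thetaCh_thetaCh_self a b ε k l),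
    fun a b k l => ext_relation_one (h.thetaCh_thetaCh_dual a b k l),
    fun a ε c k l => sub_eq_zero.2 (ext_commute (h.thetaCh_thetaNe a ε c k l)).eq,
    locFin_TTerm, fun a => zPow_of_sg_one (exists_isZPow_TOp a 1), σ, h.isBosonization,
    fun σ' h' => h.isBosonization.unique h', h.isFieldProd_ch, h.isFieldProd_ne,
    fun a d ε η had => h.isFieldProd_cField_ch_ch had ε η,
    fun c d hcd => h.isFieldProd_cField_ne_ne hcd, h.isFieldProd_cField_ch_ne⟩
  have e : curTerm (op B) (.inl a) k = alphaChTerm B a k :=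
    funext fun i => curTerm_inl (op B) a k i
  exact e ▸ hfock.locFin_curTerm (.inl a) k
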